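/- Let $\mathbb{R}_+=(0,\infty)$ and let $L_0y=-y''$ in $L^2(\mathbb{R}_+)$ with domain $\{y\in W_2^2(\mathbb{R}_+):y(0)=0\}$. Let $\{E_t\}_{t\in\mathbb{R}}$ be its resolution of identity. Let $n\in\mathbb{N}$. Let $\alpha_1,\dots,\alpha_n$ be non-zero real numbers, and let $v_1,\dots,v_n\in L^2(\mathbb{R}_+)$ be linearly independent with $\int_{\mathbb{R}_+}(1+x^2)|v_k(x)|^2dx<\infty$. For $0\le k\le n$ put $L_k=L_0+\sum_{s\le k}\alpha_s\langle\cdot,v_s\rangle v_s$ and $R_k(z)=(L_k-z)^{-1}$. Assume that the kernel $K_n(x,t)=\sum_k\alpha_kv_k(x)\overline{v_k(t)}$ is $L_0$-orthogonal, that is, $v_k\perp\mathrm{span}\{E_tv_s:t\in\mathbb{R}\}$ for all $1\le s<k\le n$. *Notation.* For $\lambda\in\mathbb{R}$ let $\tilde v_k(\lambda)=\int_{\mathbb{R}_+}e^{-i\lambda x}v_k(x)dx$ and $W_k(\lambda)=\tilde v_k(\lambda)-\tilde v_k(-\lambda)$. For real $\lambda\neq0$ let $\psi_k(\lambda,x)=\int_x^\infty\frac{\sin\lambda(t-x)}{\lambda}v_k(t)dt$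 and $\varphi_{s,k}(\lambda)=\int_{\mathbb{R}_+}\psi_s(\lambda,x)\overline{v_k(x)}dx$. Let $M(\lambda)$ be the matrix with entries $\alpha_s\varphi_{s,k}(\lambda)-\delta_{s,k}$ in row $k$ and column $s$. Put $e_0(\lambda)=\det M(\lambda)$, and let $-e_j(\lambda)$ be the determinant of $M(\lambda)$ with column $j$ replaced by $(\overline{\tilde v_k(\lambda)})_k$. Let $e(\lambda,x)=e^{i\lambda x}e_0(\lambda)+\sum_k\alpha_ke_k(\lambda)\psi_k(\lambda,x)$ be the Jost solution, and $S(\lambda)=e(-\lambda,0)/e(\lambda,0)$ the scattering function of the pair $\{L_n,L_0\}$. For $1\le k\le n$ and $z\in\mathbb{C}\setminus\mathbb{R}$ let $b_k(z)=1+\alpha_k\langle R_{k-1}(z)v_k,v_k\rangle$. Let $B_k^{\pm}(\lambda)$, $\lambda\in\mathbb{R}$, be the limits of $b_k(w^2)$ as $w\to\lambda$ with $\pm\operatorname{Im}w>0$ and $w^2\notin\mathbb{R}$. The continuous extension of $b_k(w^2)$ to points $w=i\varkappa$, $\varkappa>0$, is denoted in the same way, $B_k^+(i\varkappa)$. Let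 $r_k(\lambda)=-\frac{2i\lambda}{\alpha_k}B_k^+(\lambda)$ and $S_k(\lambda)=-r_k(-\lambda)/r_k(\lambda)$. A quotient with zero denominator is read as $0$. *Scattering data of $S_k$.* This is a triple $\{\zeta_k,\{\lambda_p\}_{p=1}^{q},\{\varkappa_j\}_{j=1}^m\}$ as follows. The $\lambda_p$ are the (finitely many) positive zeros of $r_k$, and $\{\varkappa_j\}$ is the (finite) set of $\varkappa>0$ with $r_k(i\varkappa)=0$. The phase $\zeta_k:\mathbb{R}\to\mathbb{R}$ is odd, is continuous on $(0,\infty)$, tends to $0$ at $+\infty$, and satisfies $S_k(\lambda)=e^{-2i\zeta_k(\lambda)}$ for all real $\lambda$ with $r_k(\lambda)\ne0$. For such a triple put $$D_k(\lambda)=\psi(\lambda)^{q+m}\prod_{j}(\lambda^2+\varkappa_j^2)\prod_{p}(\lambda^2-\lambda_p^2)\,\sin\zeta_k(\lambda)\,\exp\Big\{\frac1\pi\,\mathrm{p.v.}\!\!\int_{\mathbb{R}}\frac{\zeta_k(t)}{t-\lambda}dt\Big\},$$ $$\psi(\lambda)=\frac1{\lambda^2+1}\exp\Big\{\frac2\pi\,\mathrm{p.v.}\!\!\int_{\mathbb{R}}\frac{\arctan(1/t)}{t-\lambda}dt\Big\}.$$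 **Theorem.** The inverse scattering problem is solvable in the following sense. 1. For all $k$ and $z\in\mathbb{C}\setminus\mathbb{R}$, $b_k(z)=1+\alpha_k\langle R_0(z)v_k,v_k\rangle$. The boundary values $B_k^\pm(\lambda)$ exist for all $\lambda\in\mathbb{R}$. For real $\lambda\ne0$, $S_k(\lambda)B_k^+(\lambda)=B_k^-(\lambda)$ and $S(\lambda)=S_1(\lambda)\cdots S_n(\lambda)$. 2. If $\alpha_k>0$ or $B_k^+(0)\neq0$, then $S_k$ has exactly one triple of scattering data. 3. For every triple of scattering data of $S_k$ one has $m\le1$, and $m=0$ if $\alpha_k>0$. The principal values above exist for every real $\lambda\neq0$, and $$|W_k(\lambda)|^2=\frac{4\lambda}{\alpha_k}D_k(\lambda)\quad(\lambda\in\mathbb{R}\setminus\{0\}).$$ The function $\lambda D_k(\lambda)$ is integrable on $\mathbb{R}_+$, and if $\|v_k\|_{L^2}=1$, then $$\alpha_k=\frac2\pi\int_{\mathbb{R}_+}\lambda D_k(\lambda)\,d\lambda.$$ Thus, under the normalization $\|v_k\|_{L^2}=1$, the scattering data determine $\alpha_k$ and $|W_k|^2$. 4. Suppose $\|v_k\|_{L^2}=1$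 for all $k$, and let scattering data be given for each $S_k$. Let $\beta_k,u_k$ $(1\le k\le n)$ be another system satisfying all the assumptions made on $\alpha_k,v_k$, with $\|u_k\|_{L^2}=1$. Then the factors of $\{\beta_k,u_k\}$ have the same scattering data for every $k$ if and only if, for every $k$, $\beta_k=\alpha_k$ and $|W_{u_k}(\lambda)|=|W_k(\lambda)|$ for all $\lambda\in\mathbb{R}$, where $W_{u_k}$ is formed from $u_k$ as $W_k$ is from $v_k$. -/

import Mathlib

open MeasureTheory Filter Topology Set

noncomputable section

namespace NonlocalScattering

/-! ### Spectral families of an operator in a Hilbert space -/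

section Abstract

variable {H : Type*} [NormedAddCommGroup H] [InnerProductSpace ℂ H] [CompleteSpace H]

/-- `E` is the resolution of identity of the (unbounded) operator `L`: a right-continuous monotone
family of orthogonal projections going from `0` to `1`, with `L = ∫ t dE_t`.  Here `μ f` is the
measure `d‖E_t f‖² = d⟨E_t f, f⟩`; the last two clauses say that
`dom L = {f : ∫ t² d⟨E_t f, f⟩ < ∞}` and `⟨L f, f⟩ = ∫ t d⟨E_t f, f⟩` on `dom L`. -/
structure IsResolutionOfIdentity (L : H →ₗ.[ℂ] H) (E : ℝ → H →L[ℂ] H) : Prop where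
  isStarProjection : ∀ t, IsStarProjection (E t)
  mul_eq : ∀ s t, E s * E t = E (min s t)
  rightContinuous : ∀ f t, ContinuousWithinAt (fun s => E s f) (Ici t) t
  tendsto_atBot : ∀ f, Tendsto (fun t => E t f) atBot (𝓝 0)
  tendsto_atTop : ∀ f, Tendsto (fun t => E t f) atTop (𝓝 f)
  generates : ∃ μ : H → Measure ℝ,
    (∀ f t, μ f (Iic t) = ENNReal.ofReal (‖E t f‖ ^ 2)) ∧
    (∀ f, f ∈ L.domain ↔ Integrable (fun t : ℝ => t ^ 2) (μ f)) ∧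
    (∀ f : L.domain, inner ℂ (f : H) (L f) = ((∫ t, t ∂(μ f) : ℝ) : ℂ))

/-- The subspace `G(h) = span {E_t h : t ∈ ℝ}`. -/
def cyclicSpan (E : ℝ → H →L[ℂ] H) (h : H) : Submodule ℂ H :=
  Submodule.span ℂ (Set.range fun t => E t h)

/-- Each `v k` is orthogonal to the subspaces `G(v s)`, `s < k`. -/
def IsOrthogonalFamily (E : ℝ → H →L[ℂ] H) {n : ℕ} (v : Fin n → H) : Prop :=
  ∀ k s : Fin n, s < k → v k ∈ (cyclicSpan E (v s))ᗮ

open Classical in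
/-- `(L - z)⁻¹ f` (the value is irrelevant if `(L - z) u = f` is not uniquely solvable). -/
def resolventApply (L : H →ₗ.[ℂ] H) (z : ℂ) (f : H) : H :=
  if h : ∃! u : L.domain, L u - z • (u : H) = f then (h.choose : H) else 0

end Abstract

/-! ### The operators on the half-axis -/

/-- Lebesgue measure on `ℝ₊`. -/
abbrev halfLine : Measure ℝ := volume.restrict (Ioi (0 : ℝ))

/-- `L²(ℝ₊)`. -/
abbrev L2 : Type := Lp ℂ 2 halfLine

/-- `(y, w)` belongs to the graph of `y ↦ -y''` on `{y ∈ W₂²(ℝ₊) : y(0) = 0}`: `y` has a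
representative `u` with `u(0) = 0` which is an antiderivative of `u' ∈ L²`, and `u'` is
absolutely continuous with derivative `-w ∈ L²`. -/
def IsDirichletPair (y w : L2) : Prop :=
  ∃ u u' : ℝ → ℂ, y =ᵐ[halfLine] u ∧ MemLp u' 2 halfLine ∧
    (∀ x, 0 ≤ x → u x = ∫ t in (0 : ℝ)..x, u' t) ∧
    (∀ x, 0 ≤ x → u' x = u' 0 - ∫ t in (0 : ℝ)..x, w t)

theorem intervalIntegrable_of_memLp {f : ℝ → ℂ} (hf : MemLp f 2 halfLine) {x : ℝ} (hx : 0 ≤ x) :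
    IntervalIntegrable f volume 0 x := by
  rw [intervalIntegrable_iff_integrableOn_Ioc_of_le hx]
  have h1 : MemLp f 2 (volume.restrict (Ioc 0 x)) :=
    hf.mono_measure (Measure.restrict_mono Ioc_subset_Ioi_self le_rfl)
  exact h1.integrable (by norm_num)

theorem intervalIntegral_congr_half {f g : ℝ → ℂ} (h : f =ᵐ[halfLine] g) {x : ℝ} (hx : 0 ≤ x) :
    ∫ t in (0 : ℝ)..x, f t = ∫ t in (0 : ℝ)..x, g t := by
  rw [intervalIntegral.integral_of_le hx, intervalIntegral.integral_of_le hx]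
  exact integral_congr_ae
    (ae_mono (Measure.restrict_mono Ioc_subset_Ioi_self le_rfl) h)

/-- The graph of the operator of second derivative with Dirichlet condition. -/
def dirichletGraph : Submodule ℂ (L2 × L2) where
  carrier := {p | IsDirichletPair p.1 p.2}
  zero_mem' := by
    refine ⟨0, 0, Lp.coeFn_zero _ _ _, MemLp.zero, ?_, ?_⟩
    · intro x _
      simp
    · intro x hx
      have h := intervalIntegral_congr_half (Lp.coeFn_zero ℂ 2 halfLine) hx
      simp only [Prod.snd_zero]
      rw [h]
      simp
  add_mem' := by
    rintro ⟨y, w⟩ ⟨y₂, w₂⟩ ⟨u, u', h1, h2, h3, h4⟩ ⟨q, q', k1, k2, k3, k4⟩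
    refine ⟨u + q, u' + q', (Lp.coeFn_add y y₂).trans (h1.add k1), h2.add k2, ?_, ?_⟩
    · intro x hx
      simp only [Pi.add_apply]
      rw [h3 x hx, k3 x hx, intervalIntegral.integral_add (intervalIntegrable_of_memLp h2 hx)
        (intervalIntegrable_of_memLp k2 hx)]
    · intro x hx
      have h := intervalIntegral_congr_half (Lp.coeFn_add w w₂) hx
      simp only [Pi.add_apply, Prod.mk_add_mk] at h ⊢
      rw [h, intervalIntegral.integral_add (intervalIntegrable_of_memLp (Lp.memLp w) hx)
        (intervalIntegrable_of_memLp (Lp.memLp w₂) hx), h4 x hx, k4 x hx]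
      simp only at *
      ring
  smul_mem' := by
    rintro c ⟨y, w⟩ ⟨u, u', h1, h2, h3, h4⟩
    refine ⟨c • u, c • u', (Lp.coeFn_smul c y).trans (h1.const_smul c), h2.const_smul c, ?_, ?_⟩
    · intro x hx
      simp only [Pi.smul_apply, smul_eq_mul]
      rw [h3 x hx, intervalIntegral.integral_const_mul]
    · intro x hx
      have h := intervalIntegral_congr_half (Lp.coeFn_smul c w) hx
      simp only [Pi.smul_apply, Prod.smul_mk, smul_eq_mul] at h ⊢
      rw [h, intervalIntegral.integral_const_mul, h4 x hx]
      simp only at *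
      ring

theorem ae_zero_of_intervalIntegral_zero {f : ℝ → ℂ} (hf : MemLp f 2 halfLine)
    (h : ∀ x, 0 ≤ x → ∫ t in (0 : ℝ)..x, f t = 0) : f =ᵐ[halfLine] 0 := by
  have key : ∀ m : ℕ, ∀ᵐ x : ℝ, x ∈ Ioo (0 : ℝ) m → f x = 0 := by
    intro m
    have hi := intervalIntegrable_of_memLp hf (Nat.cast_nonneg (α := ℝ) m)
    filter_upwards [hi.ae_hasDerivAt_integral] with x hx hxm
    have hm : (0 : ℝ) ≤ m := Nat.cast_nonneg m
    have hd := hx (by rw [uIcc_of_le hm]; exact ⟨hxm.1.le, hxm.2.le⟩) 0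
      (by rw [uIcc_of_le hm]; exact ⟨le_rfl, hm⟩)
    have hz : HasDerivAt (fun y => ∫ t in (0 : ℝ)..y, f t) 0 x := by
      refine (hasDerivAt_const x (0 : ℂ)).congr_of_eventuallyEq ?_
      filter_upwards [Ioi_mem_nhds hxm.1] with y hy
      exact h y (le_of_lt hy)
    exact hd.unique hz
  rw [Filter.EventuallyEq, ae_restrict_iff' measurableSet_Ioi]
  filter_upwards [ae_all_iff.2 key] with x hx hx0
  obtain ⟨m, hm⟩ := exists_nat_gt x
  exact hx m ⟨hx0, hm⟩

theorem dirichletGraph_functional (p : L2 × L2) (hp : p ∈ dirichletGraph) (h0 : p.1 = 0) :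
    p.2 = 0 := by
  obtain ⟨u, u', h1, h2, h3, h4⟩ := hp
  have hII : ∀ x, 0 ≤ x → IntervalIntegrable u' volume 0 x := fun x hx =>
    intervalIntegrable_of_memLp h2 hx
  have hu0 : u =ᵐ[halfLine] 0 := by
    rw [h0] at h1
    exact h1.symm.trans (Lp.coeFn_zero _ _ _)
  -- the continuous representative vanishes identically
  have hcont : ContinuousOn (fun x => ∫ t in (0 : ℝ)..x, u' t) (Ici 0) := by
    intro x hx
    have hx1 : (0 : ℝ) ≤ x + 1 := by linarith [mem_Ici.1 hx]
    have hc := intervalIntegral.continuousOn_primitive_interval (μ := volume) (f := u')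
      (a := 0) (b := x + 1)
      (by rw [uIcc_of_le hx1, integrableOn_Icc_iff_integrableOn_Ioc,
            ← intervalIntegrable_iff_integrableOn_Ioc_of_le hx1]
          exact hII _ hx1)
    rw [uIcc_of_le hx1] at hc
    refine (hc x ⟨hx, by linarith⟩).mono_of_mem_nhdsWithin ?_
    refine mem_nhdsWithin.2 ⟨Iio (x + 1), isOpen_Iio, by simp, ?_⟩
    rintro y ⟨hy1, hy2⟩
    exact ⟨hy2, le_of_lt hy1⟩
  have hu'0 : ∀ x, 0 ≤ x → ∫ t in (0 : ℝ)..x, u' t = 0 := by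
    have hae : (fun x => ∫ t in (0 : ℝ)..x, u' t) =ᵐ[halfLine] fun _ => 0 := by
      filter_upwards [hu0, ae_restrict_mem measurableSet_Ioi] with x hx hx0
      rw [← h3 x (le_of_lt hx0), hx]
      rfl
    have hEq := Measure.eqOn_open_of_ae_eq hae isOpen_Ioi
      (hcont.mono Ioi_subset_Ici_self) continuousOn_const
    intro x hx
    rcases hx.eq_or_lt with rfl | hx
    · simp
    · exact hEq hx
  have hu'ae := ae_zero_of_intervalIntegral_zero h2 hu'0
  have hwII : ∀ x, 0 ≤ x → IntervalIntegrable p.2 volume 0 x := fun x hx =>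
    intervalIntegrable_of_memLp (Lp.memLp p.2) hx
  have hcontw : ContinuousOn (fun x => u' 0 - ∫ t in (0 : ℝ)..x, p.2 t) (Ici 0) := by
    refine continuousOn_const.sub ?_
    intro x hx
    have hx1 : (0 : ℝ) ≤ x + 1 := by linarith [mem_Ici.1 hx]
    have hc := intervalIntegral.continuousOn_primitive_interval (μ := volume) (f := p.2)
      (a := 0) (b := x + 1)
      (by rw [uIcc_of_le hx1, integrableOn_Icc_iff_integrableOn_Ioc,
            ← intervalIntegrable_iff_integrableOn_Ioc_of_le hx1]
          exact hwII _ hx1)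
    rw [uIcc_of_le hx1] at hc
    refine (hc x ⟨hx, by linarith⟩).mono_of_mem_nhdsWithin ?_
    refine mem_nhdsWithin.2 ⟨Iio (x + 1), isOpen_Iio, by simp, ?_⟩
    rintro y ⟨hy1, hy2⟩
    exact ⟨hy2, le_of_lt hy1⟩
  have hEq : EqOn (fun x => u' 0 - ∫ t in (0 : ℝ)..x, p.2 t) (fun _ => 0) (Ioi 0) := by
    refine Measure.eqOn_open_of_ae_eq (μ := volume) ?_ isOpen_Ioi
      (hcontw.mono Ioi_subset_Ici_self) continuousOn_const
    filter_upwards [hu'ae, ae_restrict_mem measurableSet_Ioi] with x hx hx0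
    rw [← h4 x (le_of_lt hx0), hx]
    rfl
  have hEq' : EqOn (fun x => u' 0 - ∫ t in (0 : ℝ)..x, p.2 t) (fun _ => 0) (Ici 0) := by
    have hcl : closure (Ioi (0 : ℝ)) = Ici 0 := closure_Ioi 0
    exact hEq.of_subset_closure hcontw continuousOn_const Ioi_subset_Ici_self hcl.ge
  have hzero : u' 0 = 0 := by
    have := hEq' (mem_Ici.2 le_rfl)
    simpa using this
  have hw : ∀ x, 0 ≤ x → ∫ t in (0 : ℝ)..x, p.2 t = 0 := by
    intro x hx
    have := hEq' (mem_Ici.2 hx)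
    simp only [hzero, zero_sub, neg_eq_zero] at this
    exact this
  have := ae_zero_of_intervalIntegral_zero (Lp.memLp p.2) hw
  exact Lp.eq_zero_iff_ae_eq_zero.2 this

/-- The operator `L₀ y = -y''` with domain `{y ∈ W₂²(ℝ₊) : y(0) = 0}`. -/
def L0 : L2 →ₗ.[ℂ] L2 := dirichletGraph.toLinearPMap

theorem L0_graph : L0.graph = dirichletGraph :=
  Submodule.toLinearPMap_graph_eq _ dirichletGraph_functional

variable {n : ℕ}

/-- `L_k = L₀ + ∑ α_s ⟨·, v_s⟩ v_s`, the sum being over the first `k` indices. -/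
def partialOp (α : Fin n → ℝ) (v : Fin n → L2) (k : ℕ) : L2 →ₗ.[ℂ] L2 :=
  ((∑ s : Fin n, if (s : ℕ) < k then (α s : ℂ) • InnerProductSpace.rankOne ℂ (v s) (v s) else 0 :
    L2 →L[ℂ] L2) : L2 →ₗ[ℂ] L2) +ᵥ L0

/-- The standing assumptions on `α_k`, `v_k`: the `α_k` are non-zero reals, `∫ (1+x²)|v_k|² < ∞`,
and the `v_k` are linearly independent. -/
structure IsAdmissible (α : Fin n → ℝ) (v : Fin n → L2) : Prop where
  ne_zero : ∀ k, α k ≠ 0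
  decay : ∀ k, Integrable (fun x : ℝ => (1 + x ^ 2) * ‖v k x‖ ^ 2) halfLine
  linearIndependent : LinearIndependent ℂ v

/-! ### Jost solution and scattering function of the pair `{L_n, L₀}` -/

/-- `ṽ(λ) = ∫ e^{-iλx} v(x) dx` for real `λ`. -/
def fourier (v : L2) (l : ℝ) : ℂ :=
  ∫ x in Ioi (0 : ℝ), Complex.exp (-(Complex.I * l * x)) * v x

/-- `W(λ) = ṽ(λ) - ṽ(-λ)`. -/
def W (v : L2) (l : ℝ) : ℂ := fourier v l - fourier v (-l)

/-- `ψ(λ,x) = ∫_x^∞ (sin λ(t-x)/λ) v(t) dt`. -/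
def psiTail (v : L2) (l x : ℝ) : ℂ :=
  ∫ t in Ioi x, ((Real.sin (l * (t - x)) / l : ℝ) : ℂ) * v t

/-- `φ_{s,k}(λ) = ∫ ψ_s(λ,x) \overline{v_k(x)} dx`. -/
def phiEntry (v : Fin n → L2) (s k : Fin n) (l : ℝ) : ℂ :=
  ∫ x in Ioi (0 : ℝ), psiTail (v s) l x * (starRingEnd ℂ) (v k x)

/-- The matrix `[α_s φ_{s,k}(λ) - δ_{s,k}]`, with row index `k` and column index `s`. -/
def jostMatrix (α : Fin n → ℝ) (v : Fin n → L2) (l : ℝ) : Matrix (Fin n) (Fin n) ℂ :=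
  Matrix.of fun k s => (α s : ℂ) * phiEntry v s k l - if s = k then 1 else 0

/-- `e_0(λ)`, the determinant of the linear system. -/
def jostDet (α : Fin n → ℝ) (v : Fin n → L2) (l : ℝ) : ℂ := (jostMatrix α v l).det

/-- `e_j(λ) = ⟨e(λ,·), v_j⟩`, given by Cramer's rule. -/
def jostCoeff (α : Fin n → ℝ) (v : Fin n → L2) (j : Fin n) (l : ℝ) : ℂ :=
  -((jostMatrix α v l).updateCol j fun k => (starRingEnd ℂ) (fourier (v k) l)).det

/-- The Jost solution `e(λ,x) = e^{iλx} e_0(λ) + ∑ α_k e_k(λ) ψ_k(λ,x)`. -/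
def jost (α : Fin n → ℝ) (v : Fin n → L2) (l x : ℝ) : ℂ :=
  Complex.exp (Complex.I * l * x) * jostDet α v l +
    ∑ k, (α k : ℂ) * jostCoeff α v k l * psiTail (v k) l x

/-- The scattering function `S(λ) = e(-λ,0)/e(λ,0)` of the pair `{L_n, L₀}`. -/
def scattering (α : Fin n → ℝ) (v : Fin n → L2) (l : ℝ) : ℂ := jost α v (-l) 0 / jost α v l 0

/-! ### The factors of the scattering function -/

/-- `b_k(z) = 1 + α_k ⟨R_{k-1}(z) v_k, v_k⟩`, `R_{k-1}(z) = (L_{k-1} - z)⁻¹`.  In the 0-based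
indexing used here, `L_{k-1}` contains the terms with index `s < k`. -/
def bFactor (α : Fin n → ℝ) (v : Fin n → L2) (k : Fin n) (z : ℂ) : ℂ :=
  1 + (α k : ℂ) * inner ℂ (v k) (resolventApply (partialOp α v k) z (v k))

/-- Non-real spectral parameters `w²` with `w` in the upper half-plane. -/
def upperSet : Set ℂ := {w | 0 < w.im ∧ (w ^ 2).im ≠ 0}

/-- Non-real spectral parameters `w²` with `w` in the lower half-plane. -/
def lowerSet : Set ℂ := {w | w.im < 0 ∧ (w ^ 2).im ≠ 0}

/-- The value at `w` (`Im w ≥ 0`) of the continuous extension of `w ↦ b_k(w²)` from the upper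
half-plane; for real `w` it is the boundary value `B_k^+(w)`. -/
def bUpper (α : Fin n → ℝ) (v : Fin n → L2) (k : Fin n) (w : ℂ) : ℂ :=
  limUnder (𝓝[upperSet] w) fun ω => bFactor α v k (ω ^ 2)

/-- The value at `w` (`Im w ≤ 0`) of the continuous extension of `w ↦ b_k(w²)` from the lower
half-plane; for real `w` it is the boundary value `B_k^-(w)`. -/
def bLower (α : Fin n → ℝ) (v : Fin n → L2) (k : Fin n) (w : ℂ) : ℂ :=
  limUnder (𝓝[lowerSet] w) fun ω => bFactor α v k (ω ^ 2)

/-- `r_k(λ) = -(2iλ/α_k) b_k(λ²)` (boundary value from the upper half-plane). -/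
def rFactor (α : Fin n → ℝ) (v : Fin n → L2) (k : Fin n) (w : ℂ) : ℂ :=
  -(2 * Complex.I * w / (α k : ℂ)) * bUpper α v k w

/-- `S_k(λ) = -r_k(-λ)/r_k(λ)`. -/
def sFactor (α : Fin n → ℝ) (v : Fin n → L2) (k : Fin n) (l : ℝ) : ℂ :=
  -rFactor α v k (-l) / rFactor α v k l

/-- Scattering data of one factor: the phase `ζ`, the positive zeros `{λ_p}` and the
bound states `{ϰ}`. -/
structure ScatteringData where
  phase : ℝ → ℝ
  realZeros : Finset ℝ
  boundStates : Finset ℝ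

/-- `d` is the scattering data of the factor `S_k`.  The phase is the odd function with
`S_k = e^{-2iζ}` off the zeros of `r_k` that is continuous on the positive half-axis and vanishes at
infinity; the `λ_p` are the positive zeros of `r_k`, and the points `iϰ` are its zeros on the
positive imaginary axis. -/
structure IsScatteringData (α : Fin n → ℝ) (v : Fin n → L2) (k : Fin n) (d : ScatteringData) :
    Prop where
  odd : ∀ l, d.phase (-l) = -d.phase l
  continuousOn : ContinuousOn d.phase (Ioi 0)
  tendsto : Tendsto d.phase atTop (𝓝 0)
  factor_eq : ∀ l : ℝ, rFactor α v k l ≠ 0 →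
    sFactor α v k l = Complex.exp (-2 * Complex.I * d.phase l)
  mem_realZeros : ∀ l : ℝ, l ∈ d.realZeros ↔ 0 < l ∧ rFactor α v k l = 0
  mem_boundStates : ∀ κ : ℝ, κ ∈ d.boundStates ↔ 0 < κ ∧ rFactor α v k (Complex.I * κ) = 0

/-! ### Principal values and the reconstruction formulas -/

/-- `L` is the principal value of `∫ f(t)/(t-x) dt`. -/
def HasPV (f : ℝ → ℝ) (x L : ℝ) : Prop :=
  (∀ ε > 0, IntegrableOn (fun t => f t / (t - x)) {t | ε < |t - x|}) ∧
    Tendsto (fun ε : ℝ => ∫ t in {t | ε < |t - x|}, f t / (t - x)) (𝓝[>] 0) (𝓝 L)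

/-- The principal value of `∫ f(t)/(t-x) dt`. -/
def pv (f : ℝ → ℝ) (x : ℝ) : ℝ :=
  limUnder (𝓝[>] 0) fun ε : ℝ => ∫ t in {t | ε < |t - x|}, f t / (t - x)

/-- `ψ(λ) = (λ²+1)⁻¹ exp((2/π) pv∫ arctan(1/t)/(t-λ) dt)`. -/
def psi (l : ℝ) : ℝ :=
  1 / (l ^ 2 + 1) * Real.exp (2 / Real.pi * pv (fun t => Real.arctan (1 / t)) l)

/-- `ψ^{q+m}(λ) ∏(λ²+ϰ²) ∏(λ²-λ_p²) sin ζ(λ) exp((1/π) pv∫ ζ(t)/(t-λ) dt)`, where `q` and `m` are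
the numbers of the `λ_p` and of the `ϰ`. -/
def dataDensity (d : ScatteringData) (l : ℝ) : ℝ :=
  psi l ^ (d.realZeros.card + d.boundStates.card) * (∏ κ ∈ d.boundStates, (l ^ 2 + κ ^ 2)) *
    (∏ p ∈ d.realZeros, (l ^ 2 - p ^ 2)) * Real.sin (d.phase l) *
    Real.exp (1 / Real.pi * pv d.phase l)

end NonlocalScattering

end

open NonlocalScattering

open MeasureTheory Filter Topology Set

noncomputable section

namespace NonlocalScattering

/-! ### Plancherel's theorem for integrable square-integrable functions on the line -/

section Plancherel

open FourierTransform SchwartzMap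

/-! One factor is governed by the density ρ(s) = |∫ sin(sx) f(x) dx|² (`specDensity`). In the
variable w = √z the factor is b(w) = 1 + (a/π) ∫ ρ(s)/(s² - w²) ds (`greenForm_eq_integral`); on the
real axis Im b(λ) = aρ(λ)/λ (`bVal_im`), and |W|² = 4ρ (`norm_W_sq`).

Direct part. The closed subspace orthogonal to all E_t v_k reduces L₀, so the orthogonality
hypothesis passes from the spectral family to the resolvent: ⟨R₀(z)v_s, v_k⟩ = 0 for s ≠ k
(`IsResolutionOfIdentity.inner_resolvent_eq_zero`). The finite-rank terms of L_{k-1} therefore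
annihilate R₀(z)v_k, and b_k only involves the free resolvent. By Cramer's rule e(λ,0) is the
determinant of a rank-one update of M(λ), and that update is the diagonal matrix of the -b_k
(`jost_zero`); this is the product formula.

Inverse part. S_k = b(-λ)/b(λ) determines the argument of b modulo π, and the modulus is recovered
from the argument. As a function of z = w², b or -b maps the upper half-plane into itself, so log b
is analytic there, has bounded imaginary part and is O(|z|^(-1/2)); hence it is the Cauchy integral
of its boundary argument (`cauchy_integral_boundary`). That argument is the phase plus steps of
height π ending at the positive zeros and at the bound state. The steps integrate to the products in
D, and the odd phase yields, on the real axis, the principal value (`norm_bVal_eq`). Now Im b = |b|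
sin(arg b) reads aρ(λ) = λD(λ) (`dataDensity_oddPhase`), and Plancherel, ∫ρ = π‖f‖², separates a
from ρ. Conversely b depends on a and ρ alone, so equal couplings and equal |W| give equal data.

Regularity is the delicate point. The weight 1 + x² gives the Fourier transform one derivative in
L²: it is Hölder of order 1/2 with arbitrarily small local constant (`sineTransform_modulus`), and
its difference quotients are square-integrable (`integrable_hardy`). At a positive zero λ of b the
density vanishes, so ρ(s)/(s - λ)² is integrable. From this the difference quotient of Re b, up to
the sign of a, stays bounded below near λ (`greenForm_simple_zero`). Thus the zeros are simple, they
are finite in number if b(0) ≠ 0, the argument jumps by exactly π at each of them, and the principal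
values of the corrected phase exist. -/

theorem fourier_toLp_ae_eq {f : ℝ → ℂ} (h1 : Integrable f) (h2 : MemLp f 2) :
    ((𝓕 (h2.toLp f) : Lp ℂ 2 (volume : Measure ℝ)) : ℝ → ℂ) =ᵐ[volume] 𝓕 f := by
  have hcont : Continuous (𝓕 f) :=
    VectorFourier.fourierIntegral_continuous Real.continuous_fourierChar
      (L := innerₗ ℝ) (by fun_prop) h1
  have hloc : LocallyIntegrable
      ((𝓕 (h2.toLp f) : Lp ℂ 2 (volume : Measure ℝ)) : ℝ → ℂ) volume :=
    (Lp.memLp _).locallyIntegrable (by norm_num)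
  -- Both transforms are tested against smooth compactly supported functions: on the L² side the
  -- transform is the distributional one, on the L¹ side Fubini moves it onto the test function.
  refine ae_eq_of_integral_contDiff_smul_eq hloc hcont.locallyIntegrable ?_
  intro g hg hc
  have hgc : HasCompactSupport (fun x => (g x : ℂ)) := hc.comp_left (g := fun x : ℝ => (x : ℂ)) (by simp)
  have hgd : ContDiff ℝ (⊤ : ℕ∞) (fun x => (g x : ℂ)) := Complex.ofRealCLM.contDiff.comp hg
  let G : 𝓢(ℝ, ℂ) := hgc.toSchwartzMap hgd
  have hG : ∀ x, G x = (g x : ℂ) := fun x => rfl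
  have key := congrArg (fun T => T G)
    (MeasureTheory.Lp.fourier_toTemperedDistribution_eq (h2.toLp f))
  simp only [TemperedDistribution.fourier_apply, Lp.toTemperedDistribution_apply] at key
  have e1 : ∫ x, (𝓕 G) x • (h2.toLp f) x = ∫ x, (𝓕 (G : ℝ → ℂ)) x • f x := by
    refine integral_congr_ae ?_
    filter_upwards [h2.coeFn_toLp] with x hx
    rw [hx, SchwartzMap.fourier_coe]
  have e2 : ∫ x, (𝓕 (G : ℝ → ℂ)) x • f x = ∫ x, G x • 𝓕 f x :=
by
    simpa using! VectorFourier.integral_fourierIntegral_smul_eq_flip (μ := volume) (ν := volume)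
      (L := innerₗ ℝ) Real.continuous_fourierChar (by fun_prop) G.integrable h1
  rw [e1, e2] at key
  simpa [hG] using key.symm

theorem memLp_fourier {f : ℝ → ℂ} (h1 : Integrable f) (h2 : MemLp f 2) : MemLp (𝓕 f) 2 :=
  (memLp_congr_ae (fourier_toLp_ae_eq h1 h2)).1 (Lp.memLp _)

theorem norm_sq_toLp {μ : Measure ℝ} {f : ℝ → ℂ} (h : MemLp f 2 μ) :
    ‖h.toLp f‖ ^ 2 = ∫ x, ‖f x‖ ^ 2 ∂μ := by
  have e : (((‖h.toLp f‖ ^ 2 : ℝ)) : ℂ) = ((∫ x, ‖f x‖ ^ 2 ∂μ : ℝ) : ℂ) := by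
    rw [Complex.ofReal_pow, ← Complex.coe_algebraMap, ← inner_self_eq_norm_sq_to_K (𝕜 := ℂ), MeasureTheory.L2.inner_def, Complex.coe_algebraMap,
      ← integral_complex_ofReal]
    refine integral_congr_ae ?_
    filter_upwards [h.coeFn_toLp] with x hx
    rw [hx, inner_self_eq_norm_sq_to_K]
    simp
  exact_mod_cast e

theorem integral_norm_sq_fourier {f : ℝ → ℂ} (h1 : Integrable f) (h2 : MemLp f 2) :
    ∫ x, ‖𝓕 f x‖ ^ 2 = ∫ x, ‖f x‖ ^ 2 := by
  rw [← norm_sq_toLp (memLp_fourier h1 h2), ← norm_sq_toLp h2, ← Lp.norm_fourier_eq (h2.toLp f)]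
  congr 2
  apply Lp.ext
  exact (memLp_fourier h1 h2).coeFn_toLp.trans (fourier_toLp_ae_eq h1 h2).symm

end Plancherel

/-! ### Cauchy's theorem and Cauchy integrals in the upper half-plane -/

section HalfPlane

theorem integrable_of_continuous_of_decay {f : ℝ → ℂ} (hf : Continuous f) {K R : ℝ}
    (hb : ∀ x : ℝ, R ≤ |x| → ‖f x‖ ≤ K * |x| ^ (-(3 / 2) : ℝ)) : Integrable f := by
  have hint : Integrable (fun x : ℝ => (1 + ‖x‖ ^ 2) ^ (-(3 / 2) / 2 : ℝ)) :=
    integrable_rpow_neg_one_add_norm_sq (by norm_num)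
  have hK : 0 ≤ max K 0 := le_max_right _ _
  have hR : ∀ x : ℝ, max R 1 ≤ |x| →
      ‖f x‖ ≤ (max K 0 * 2 ^ (3 / 4 : ℝ)) * (1 + ‖x‖ ^ 2) ^ (-(3 / 2) / 2 : ℝ) := by
    intro x hx
    have h1 : 1 ≤ |x| := (le_max_right _ _).trans hx
    refine (hb x ((le_max_left _ _).trans hx)).trans ?_
    have e : |x| ^ (-(3 / 2) : ℝ) = 2 ^ (3 / 4 : ℝ) * (2 * |x| ^ 2) ^ (-(3 / 4) : ℝ) := by
      rw [Real.mul_rpow (by norm_num) (by positivity), ← mul_assoc, ← Real.rpow_add (by norm_num),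
        ← Real.rpow_natCast, ← Real.rpow_mul (by positivity)]
      norm_num
    have e2 : (2 * |x| ^ 2) ^ (-(3 / 4) : ℝ) ≤ (1 + ‖x‖ ^ 2) ^ (-(3 / 2) / 2 : ℝ) := by
      rw [show (-(3 / 2) / 2 : ℝ) = -(3 / 4) by norm_num]
      refine Real.rpow_le_rpow_of_nonpos (by positivity) ?_ (by norm_num)
      rw [Real.norm_eq_abs]; nlinarith
    rw [e, mul_assoc]
    gcongr
    exact le_max_left _ _
  obtain ⟨M, hM⟩ := (isCompact_Icc (a := -max R 1) (b := max R 1)).exists_bound_of_continuousOn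
    hf.continuousOn
  rw [← integrableOn_univ, ← union_compl_self (Icc (-max R 1) (max R 1)), integrableOn_union]
  refine ⟨hf.continuousOn.integrableOn_compact isCompact_Icc, ?_⟩
  refine Integrable.mono' ((hint.const_mul (max K 0 * 2 ^ (3 / 4 : ℝ))).integrableOn)
    hf.aestronglyMeasurable ?_
  refine (ae_restrict_iff' measurableSet_Icc.compl).2 (ae_of_all _ fun x hx => hR x ?_)
  by_contra hcon
  exact hx (abs_le.1 (not_le.1 hcon).le)

/-- Cauchy's theorem for a half-plane. -/
theorem integral_real_line_eq_zero {f : ℂ → ℂ} (hf : ∀ z : ℂ, 0 ≤ z.im → DifferentiableAt ℂ f z)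
    {K R : ℝ} (hb : ∀ z : ℂ, 0 ≤ z.im → R ≤ ‖z‖ → ‖f z‖ ≤ K * ‖z‖ ^ (-(3 / 2) : ℝ)) :
    Integrable (fun x : ℝ => f x) ∧ ∫ x : ℝ, f x = 0 := by
  have hcont : Continuous fun x : ℝ => f x :=
    continuous_iff_continuousAt.2 fun x =>
      ((hf x (by simp)).continuousAt).comp Complex.continuous_ofReal.continuousAt
  have hint : Integrable (fun x : ℝ => f x) :=
    integrable_of_continuous_of_decay hcont (K := K) (R := R) fun x hx => by
      simpa using hb x (by simp) (by simpa using hx)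
  refine ⟨hint, ?_⟩
  have hlim : Tendsto (fun r : ℝ => ∫ x in (-r)..r, f (x : ℂ)) atTop (𝓝 (∫ x : ℝ, f x)) :=
    intervalIntegral_tendsto_integral hint tendsto_neg_atTop_atBot tendsto_id
  refine tendsto_nhds_unique hlim ?_
  -- The three sides of the rectangle `[-r, r] × [0, r]` off the real axis have total length `4 *
  -- r`, and the integrand there is at most `max K 0 * r ^ (-(3 / 2))`.
  have hdec : Tendsto (fun r : ℝ => 4 * (max K 0) * r ^ (-(1 / 2) : ℝ)) atTop (𝓝 0) := by
    simpa using (tendsto_rpow_neg_atTop (show (0 : ℝ) < 1 / 2 by norm_num)).const_mul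
      (4 * max K 0)
  refine squeeze_zero_norm' ?_ hdec
  filter_upwards [eventually_ge_atTop (max R 1)] with r hr
  have hr1 : 1 ≤ r := (le_max_right _ _).trans hr
  have hr0 : 0 < r := by linarith
  have hbd : ∀ z : ℂ, 0 ≤ z.im → r ≤ ‖z‖ → ‖f z‖ ≤ max K 0 * r ^ (-(3 / 2) : ℝ) := by
    intro z hz hzr
    refine (hb z hz (((le_max_left _ _).trans hr).trans hzr)).trans ?_
    have : ‖z‖ ^ (-(3 / 2) : ℝ) ≤ r ^ (-(3 / 2) : ℝ) :=
      Real.rpow_le_rpow_of_nonpos hr0 hzr (by norm_num)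
    have h0 : 0 ≤ ‖z‖ ^ (-(3 / 2) : ℝ) := by positivity
    calc K * ‖z‖ ^ (-(3 / 2) : ℝ) ≤ max K 0 * ‖z‖ ^ (-(3 / 2) : ℝ) := by
          gcongr; exact le_max_left _ _
      _ ≤ _ := by gcongr
  have hrect := Complex.integral_boundary_rect_eq_zero_of_differentiableOn f
    (-r : ℂ) (r + r * Complex.I) (by
      intro z hz
      refine (hf z ?_).differentiableWithinAt
      have := hz.2
      simp [hr0.le] at this
      exact this.1)
  simp only [Complex.neg_re, Complex.ofReal_re, Complex.add_re, Complex.mul_re, Complex.I_re,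
    mul_zero, Complex.ofReal_im, Complex.I_im, mul_one, sub_self, add_zero, Complex.neg_im,
    neg_zero, Complex.ofReal_zero, zero_mul, Complex.add_im, Complex.mul_im, zero_add] at hrect
  have b1 : ‖∫ x in (-r)..r, f (x + r * Complex.I)‖ ≤ max K 0 * r ^ (-(3 / 2) : ℝ) * |r - -r| := by
    refine intervalIntegral.norm_integral_le_of_norm_le_const fun x _ => hbd _ ?_ ?_
    · simp [hr0.le]
    · refine le_trans ?_ (Complex.abs_im_le_norm _)
      simp [le_abs_self]
  have b2 : ‖∫ y in (0)..r, f (r + y * Complex.I)‖ ≤ max K 0 * r ^ (-(3 / 2) : ℝ) * |r - 0| := by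
    refine intervalIntegral.norm_integral_le_of_norm_le_const fun x hx => hbd _ ?_ ?_
    · rw [uIoc_of_le hr0.le] at hx
      simp [hx.1.le]
    · refine le_trans ?_ (Complex.abs_re_le_norm _)
      simp [le_abs_self]
  have b3 : ‖∫ y in (0)..r, f (((-r : ℝ) : ℂ) + y * Complex.I)‖ ≤
      max K 0 * r ^ (-(3 / 2) : ℝ) * |r - 0| := by
    refine intervalIntegral.norm_integral_le_of_norm_le_const fun x hx => hbd _ ?_ ?_
    · rw [uIoc_of_le hr0.le] at hx
      simp [hx.1.le]
    · refine le_trans ?_ (Complex.abs_re_le_norm _)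
      simp [le_abs_self]
  have e : ∫ x in (-r)..r, f (x : ℂ) = (∫ x in (-r)..r, f (x + r * Complex.I)) -
      Complex.I • (∫ y in (0)..r, f (r + y * Complex.I)) +
      Complex.I • (∫ y in (0)..r, f (((-r : ℝ) : ℂ) + y * Complex.I)) := by
    linear_combination hrect
  rw [e]
  refine (norm_add_le _ _).trans ((add_le_add (norm_sub_le _ _) le_rfl).trans ?_)
  rw [norm_smul, norm_smul, Complex.norm_I, one_mul, one_mul]
  refine (add_le_add (add_le_add b1 b2) b3).trans (le_of_eq ?_)
  have e4 : r ^ (-(3 / 2) : ℝ) * r = r ^ (-(1 / 2) : ℝ) := by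
    nth_rewrite 2 [← Real.rpow_one r]
    rw [← Real.rpow_add hr0]
    norm_num
  rw [show r - -r = 2 * r by ring, sub_zero, abs_of_pos hr0, abs_of_pos (by linarith), ← e4]
  ring

theorem integral_poisson_kernel {z : ℂ} (hz : 0 < z.im) :
    ∫ t : ℝ, (1 / (((t : ℂ) - (starRingEnd ℂ) z) * (t - z)) : ℂ) = (Real.pi / z.im : ℝ) := by
  have e : ∀ t : ℝ, (1 / (((t : ℂ) - (starRingEnd ℂ) z) * (t - z)) : ℂ) =
      (((z.im ^ 2)⁻¹ * (1 + ((t - z.re) / z.im) ^ 2)⁻¹ : ℝ) : ℂ) := by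
    intro t
    have h1 : (((t : ℂ) - (starRingEnd ℂ) z) * (t - z)) = ((z.im ^ 2 * (1 + ((t - z.re) / z.im) ^ 2) : ℝ) : ℂ) := by
      have : (z.im : ℝ) ^ 2 * (1 + ((t - z.re) / z.im) ^ 2) = z.im ^ 2 + (t - z.re) ^ 2 := by
        field_simp
      rw [this]
      apply Complex.ext <;> simp [pow_two] <;> ring
    rw [h1, one_div, ← Complex.ofReal_inv, mul_inv]
  simp_rw [e]
  rw [integral_complex_ofReal, integral_const_mul]
  have h2 : ∫ t : ℝ, (1 + ((t - z.re) / z.im) ^ 2)⁻¹ = |z.im| * Real.pi := by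
    rw [integral_sub_right_eq_self (fun t : ℝ => (1 + (t / z.im) ^ 2)⁻¹) z.re,
      Measure.integral_comp_div (fun t : ℝ => (1 + t ^ 2)⁻¹), integral_univ_inv_one_add_sq, smul_eq_mul]
  rw [h2, abs_of_pos hz]
  congr 1
  field_simp

/-- The Cauchy integral of the imaginary part of a function that is analytic in the closed upper
half-plane and decays at infinity. -/
theorem cauchy_integral_im {G : ℂ → ℂ} (hG : ∀ z : ℂ, 0 ≤ z.im → DifferentiableAt ℂ G z)
    {K R : ℝ} (hb : ∀ z : ℂ, 0 ≤ z.im → R ≤ ‖z‖ → ‖G z‖ ≤ K * ‖z‖ ^ (-(1 / 2) : ℝ)) {z : ℂ}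
    (hz : 0 < z.im) :
    ∫ t : ℝ, (((G t).im : ℝ) : ℂ) / (t - z) = Real.pi * G z := by
  have hrp : ∀ {x : ℝ}, 0 < x → x ^ (-(3 / 2) : ℝ) = x ^ (-(1 / 2) : ℝ) * x⁻¹ := by
    intro x hx
    rw [← Real.rpow_neg_one, ← Real.rpow_add hx]; norm_num
  have hconj : ∀ ζ : ℂ, 0 ≤ ζ.im → ζ - (starRingEnd ℂ) z ≠ 0 := by
    intro ζ hζ h
    have := congrArg Complex.im h
    simp at this
    linarith
  have hfar : ∀ (ζ a : ℂ), ‖a‖ = ‖z‖ → max R (2 * ‖z‖ + 1) ≤ ‖ζ‖ → ‖ζ - a‖⁻¹ ≤ 2 * ‖ζ‖⁻¹ := by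
    intro ζ a ha hζ
    have h1 : 2 * ‖z‖ + 1 ≤ ‖ζ‖ := (le_max_right _ _).trans hζ
    have h0 := norm_nonneg z
    have h2 : ‖ζ‖ / 2 ≤ ‖ζ - a‖ := by
      have := norm_sub_norm_le ζ a
      linarith
    calc ‖ζ - a‖⁻¹ ≤ (‖ζ‖ / 2)⁻¹ := by
          apply inv_anti₀ _ h2
          linarith
      _ = _ := by rw [inv_div]; ring
  -- the reflected pole contributes nothing
  obtain ⟨i1, z1⟩ := integral_real_line_eq_zero (f := fun ζ => G ζ / (ζ - (starRingEnd ℂ) z))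
    (fun ζ hζ => (hG ζ hζ).div (by fun_prop) (hconj ζ hζ)) (K := max K 0 * 2)
    (R := max R (2 * ‖z‖ + 1)) (by
      intro ζ hζ hR
      have hpos : 0 < ‖ζ‖ := by
        have : 2 * ‖z‖ + 1 ≤ ‖ζ‖ := (le_max_right _ _).trans hR
        have := norm_nonneg z
        linarith
      rw [norm_div, div_eq_mul_inv, hrp hpos]
      calc ‖G ζ‖ * ‖ζ - (starRingEnd ℂ) z‖⁻¹
          ≤ (max K 0 * ‖ζ‖ ^ (-(1 / 2) : ℝ)) * (2 * ‖ζ‖⁻¹) := by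
            gcongr
            · refine (hb ζ hζ ((le_max_left _ _).trans hR)).trans ?_
              gcongr; exact le_max_left _ _
            · exact hfar ζ _ (by simp) hR
        _ = _ := by ring)
  -- The subtracted term has its pole in the lower half-plane and decays, so `g` is as good as `G`
  -- but vanishes at `z`. Then `g ζ / (ζ - z)` has a removable singularity and integrates to zero;
  -- what remains of the Cauchy integral is a multiple of the Poisson kernel.
  set g : ℂ → ℂ := fun ζ => G ζ - G z * ((z - (starRingEnd ℂ) z) / (ζ - (starRingEnd ℂ) z)) with hg
  have hgz : g z = 0 := by
    simp only [hg]
    rw [div_self (hconj z hz.le)]; ring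
  have hgd : ∀ ζ : ℂ, 0 ≤ ζ.im → DifferentiableAt ℂ g ζ := fun ζ hζ => by
    have h1 : DifferentiableAt ℂ (fun ζ : ℂ => (z - (starRingEnd ℂ) z) / (ζ - (starRingEnd ℂ) z)) ζ :=
      (differentiableAt_const _).fun_div (by fun_prop) (hconj ζ hζ)
    exact (hG ζ hζ).fun_sub (h1.const_mul _)
  have hne : ∀ ζ, ζ ≠ z → dslope g z ζ = g ζ / (ζ - z) := by
    intro ζ h
    rw [dslope_of_ne _ h, slope_def_field, hgz, sub_zero]
  have hopen : IsOpen {ζ : ℂ | 0 < ζ.im} := isOpen_lt continuous_const Complex.continuous_im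
  obtain ⟨i2, z2⟩ := integral_real_line_eq_zero (f := dslope g z)
    (K := (max K 0 + 2 * ‖G z * (z - (starRingEnd ℂ) z)‖) * 2)
    (R := max R (2 * ‖z‖ + 1)) (by
      intro ζ hζ
      by_cases h : ζ = z
      · subst h
        have := (Complex.differentiableOn_dslope (f := g) (hopen.mem_nhds hz)).2
          (fun x hx => (hgd x (le_of_lt hx)).differentiableWithinAt)
        exact this.differentiableAt (hopen.mem_nhds hz)
      · have h1 : DifferentiableAt ℂ (fun ζ : ℂ => ζ - z) ζ := by fun_prop
        refine ((hgd ζ hζ).fun_div h1 (sub_ne_zero.2 h)).congr_of_eventuallyEq ?_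
        filter_upwards [isOpen_ne.mem_nhds h] with x hx
        exact hne x hx) (by
      intro ζ hζ hR
      have h1 : 2 * ‖z‖ + 1 ≤ ‖ζ‖ := (le_max_right _ _).trans hR
      have h0 := norm_nonneg z
      have hpos : 0 < ‖ζ‖ := by linarith
      have hζz : ζ ≠ z := by rintro rfl; linarith
      rw [hne ζ hζz, norm_div, div_eq_mul_inv, hrp hpos]
      have hhalf : ‖ζ‖⁻¹ ≤ ‖ζ‖ ^ (-(1 / 2) : ℝ) := by
        rw [← Real.rpow_neg_one]
        exact Real.rpow_le_rpow_of_exponent_le (by linarith) (by norm_num)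
      have hgb : ‖g ζ‖ ≤ (max K 0 + 2 * ‖G z * (z - (starRingEnd ℂ) z)‖) *
          ‖ζ‖ ^ (-(1 / 2) : ℝ) := by
        refine (norm_sub_le _ _).trans ?_
        rw [add_mul]
        refine add_le_add ?_ ?_
        · refine (hb ζ hζ ((le_max_left _ _).trans hR)).trans ?_
          gcongr; exact le_max_left _ _
        · rw [← mul_div_assoc, norm_div, div_eq_mul_inv]
          calc _ ≤ ‖G z * (z - (starRingEnd ℂ) z)‖ * (2 * ‖ζ‖⁻¹) := by
                gcongr; exact hfar ζ _ (by simp) hR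
            _ ≤ ‖G z * (z - (starRingEnd ℂ) z)‖ * (2 * ‖ζ‖ ^ (-(1 / 2) : ℝ)) := by gcongr
            _ = _ := by ring
      calc _ ≤ ((max K 0 + 2 * ‖G z * (z - (starRingEnd ℂ) z)‖) *
          ‖ζ‖ ^ (-(1 / 2) : ℝ)) * (2 * ‖ζ‖⁻¹) := by
            gcongr; exact hfar ζ _ rfl hR
        _ = _ := by ring)
  have htz : ∀ t : ℝ, (t : ℂ) - z ≠ 0 := by
    intro t h
    have := congrArg Complex.im h
    simp at this
    linarith
  have hz2 : z - (starRingEnd ℂ) z = 2 * Complex.I * z.im := by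
    apply Complex.ext <;> simp; ring
  -- conjugate of the first
  have i3 : Integrable (fun t : ℝ => (starRingEnd ℂ) (G t) / (t - z)) := by
    have := (Complex.conjCLE.toContinuousLinearMap.integrable_comp i1)
    refine this.congr (ae_of_all _ fun t => ?_)
    simp
  have z3 : ∫ t : ℝ, (starRingEnd ℂ) (G t) / (t - z) = 0 := by
    have h := integral_conj (f := fun t : ℝ => G t / ((t : ℂ) - (starRingEnd ℂ) z)) (μ := volume)
    rw [z1, map_zero] at h
    rw [← h]
    refine integral_congr_ae (ae_of_all _ fun t => ?_)
    simp
  have i4 : Integrable (fun t : ℝ =>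
      G z * (z - (starRingEnd ℂ) z) * (1 / (((t : ℂ) - (starRingEnd ℂ) z) * (t - z)))) := by
    refine Integrable.const_mul ?_ _
    have := integral_poisson_kernel hz
    -- A non-integrable function would have integral `0` by convention, whereas the value is `π /
    -- z.im`.
    by_contra hcon
    rw [integral_undef hcon] at this
    have h : Real.pi / z.im = 0 := by exact_mod_cast this.symm
    have := Real.pi_pos
    exact absurd h (by positivity)
  have z4 := integral_add i2 i4
  have e4 : ∀ t : ℝ, dslope g z t + G z * (z - (starRingEnd ℂ) z) *
      (1 / (((t : ℂ) - (starRingEnd ℂ) z) * (t - z))) = G t / (t - z) := by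
    intro t
    rw [hne t (sub_ne_zero.1 (htz t))]
    simp only [hg]
    have := hconj t (by simp)
    have := htz t
    field_simp
    ring
  have i5 : Integrable (fun t : ℝ => G t / (t - z)) :=
    (i2.add i4).congr (ae_of_all _ fun t => e4 t)
  simp_rw [e4] at z4
  rw [z2, integral_const_mul, integral_poisson_kernel hz, zero_add] at z4
  have e6 : ∀ t : ℝ, (((G t).im : ℝ) : ℂ) / (t - z) =
      (1 / (2 * Complex.I)) * (G t / (t - z) - (starRingEnd ℂ) (G t) / (t - z)) := by
    intro t
    rw [← sub_div, Complex.sub_conj]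
    have := htz t
    have := Complex.I_ne_zero
    field_simp
    push_cast; ring
  simp_rw [e6]
  rw [integral_const_mul, integral_sub i5 i3, z3, sub_zero, z4, hz2]
  have : (z.im : ℂ) ≠ 0 := by exact_mod_cast hz.ne'
  have := Complex.I_ne_zero
  push_cast
  field_simp

end HalfPlane

/-! ### Recovering an analytic function from the boundary values of its imaginary part -/

section Boundary

theorem one_add_sq_rpow_le {t : ℝ} {a : ℝ} (ha : 0 ≤ a) (ht : 1 ≤ |t|) :
    |t| ^ (-(2 * a)) ≤ 2 ^ a * (1 + t ^ 2) ^ (-a) := by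
  have h1 : 0 < |t| := by linarith
  rw [Real.rpow_neg h1.le, Real.rpow_neg (by positivity), Real.rpow_mul h1.le, Real.rpow_two, sq_abs,
    ← div_eq_mul_inv, ← Real.div_rpow (by norm_num) (by positivity), ← Real.inv_rpow (by positivity)]
  refine Real.rpow_le_rpow (by positivity) ?_ ha
  rw [inv_le_comm₀ (by nlinarith [sq_abs t]) (by positivity), inv_div]
  nlinarith [sq_abs t]

/-- An analytic function in the upper half-plane with bounded imaginary part that decays at
infinity is the Cauchy integral of the boundary values of its imaginary part. -/
theorem cauchy_integral_boundary {F : ℂ → ℂ} (hF : ∀ z : ℂ, 0 < z.im → DifferentiableAt ℂ F z)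
    {K R M : ℝ} (hb : ∀ z : ℂ, 0 < z.im → R ≤ ‖z‖ → ‖F z‖ ≤ K * ‖z‖ ^ (-(1 / 2) : ℝ))
    (hM : ∀ z : ℂ, 0 < z.im → |(F z).im| ≤ M) {θ : ℝ → ℝ}
    (hθ : ∀ᵐ t : ℝ, Tendsto (fun ε : ℝ => (F (t + ε * Complex.I)).im) (𝓝[>] 0) (𝓝 (θ t)))
    {z : ℂ} (hz : 0 < z.im) :
    ∫ t : ℝ, ((θ t : ℝ) : ℂ) / (t - z) = Real.pi * F z := by
  have hM0 : 0 ≤ M := (abs_nonneg _).trans (hM z hz)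
  -- Shifting by `ε * I` puts the function in the scope of the formula for the closed half-plane;
  -- afterwards `ε` tends to `0` under a common integrable bound.
  have hseq : ∀ ε : ℝ, 0 < ε →
      ∫ t : ℝ, (((F (t + ε * Complex.I)).im : ℝ) : ℂ) / (t - z) = Real.pi * F (z + ε * Complex.I) := by
    intro ε hε
    refine cauchy_integral_im (G := fun ζ => F (ζ + ε * Complex.I)) (K := 2 * max K 0)
      (R := |R| + 2 * ε) ?_ ?_ hz
    · intro ζ hζ
      have : DifferentiableAt ℂ F (ζ + ε * Complex.I) := hF _ (by simp; linarith)
      exact this.comp ζ (f := fun ζ => ζ + ε * Complex.I) (by fun_prop)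
    · intro ζ hζ hR
      have h1 : ‖ζ‖ ≤ ‖ζ + ε * Complex.I‖ + ε := by
        have := norm_sub_le (ζ + ε * Complex.I) (ε * Complex.I)
        simp [abs_of_pos hε] at this
        linarith
      have hR' := abs_nonneg R
      have h2 : ‖ζ‖ / 2 ≤ ‖ζ + ε * Complex.I‖ := by linarith
      have h0 : 0 < ‖ζ‖ := by linarith
      refine (hb _ (by simp; linarith) (by have := le_abs_self R; linarith)).trans ?_
      have h3 : ‖ζ + ε * Complex.I‖ ^ (-(1 / 2) : ℝ) ≤ 2 * ‖ζ‖ ^ (-(1 / 2) : ℝ) := by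
        calc _ ≤ (‖ζ‖ / 2) ^ (-(1 / 2) : ℝ) :=
              Real.rpow_le_rpow_of_nonpos (by positivity) h2 (by norm_num)
          _ = ‖ζ‖ ^ (-(1 / 2) : ℝ) * 2 ^ (1 / 2 : ℝ) := by
              rw [Real.div_rpow h0.le (by norm_num), Real.rpow_neg (x := 2) (by norm_num), div_inv_eq_mul]
          _ ≤ ‖ζ‖ ^ (-(1 / 2) : ℝ) * 2 := by
              gcongr
              calc (2 : ℝ) ^ (1 / 2 : ℝ) ≤ 2 ^ (1 : ℝ) :=
                    Real.rpow_le_rpow_of_exponent_le (by norm_num) (by norm_num)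
                _ = 2 := by simp
          _ = _ := by ring
      calc _ ≤ max K 0 * ‖ζ + ε * Complex.I‖ ^ (-(1 / 2) : ℝ) := by gcongr; exact le_max_left _ _
        _ ≤ max K 0 * (2 * ‖ζ‖ ^ (-(1 / 2) : ℝ)) := by gcongr
        _ = _ := by ring
  have htz : ∀ t : ℝ, (t : ℂ) - z ≠ 0 := by
    intro t h
    have := congrArg Complex.im h
    simp at this
    linarith
  -- bound for the Cauchy kernel
  obtain ⟨C, hC⟩ : ∃ C : ℝ, ∀ t : ℝ, ‖(t : ℂ) - z‖⁻¹ ≤ C * (1 + t ^ 2) ^ (-(1 / 2) : ℝ) := by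
    refine ⟨max (2 * 2 ^ (1 / 2 : ℝ)) (z.im⁻¹ * (1 + (2 * ‖z‖ + 1) ^ 2) ^ (1 / 2 : ℝ)), fun t => ?_⟩
    by_cases ht : 2 * ‖z‖ + 1 ≤ |t|
    · have h0 := norm_nonneg z
      have h1 := one_add_sq_rpow_le (a := 1 / 2) (by norm_num) (t := t) (by linarith)
      norm_num at h1
      have h2 : |t| / 2 ≤ ‖(t : ℂ) - z‖ := by
        have := norm_sub_norm_le (t : ℂ) z
        simp at this
        linarith
      calc _ ≤ (|t| / 2)⁻¹ := inv_anti₀ (by linarith) h2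
        _ = 2 * |t| ^ (-1 : ℝ) := by rw [inv_div, Real.rpow_neg_one]; ring
        _ ≤ 2 * (2 ^ (1 / 2 : ℝ) * (1 + t ^ 2) ^ (-(1 / 2) : ℝ)) := by gcongr
        _ ≤ _ := by rw [← mul_assoc]; gcongr; exact le_max_left _ _
    · have h2 : z.im ≤ ‖(t : ℂ) - z‖ := by
        have := Complex.abs_im_le_norm ((t : ℂ) - z)
        simp at this
        exact (le_abs_self _).trans this
      have h3 : (1 + (2 * ‖z‖ + 1) ^ 2) ^ (-(1 / 2) : ℝ) ≤ (1 + t ^ 2) ^ (-(1 / 2) : ℝ) := by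
        refine Real.rpow_le_rpow_of_nonpos (by positivity) ?_ (by norm_num)
        have := abs_nonneg t
        nlinarith [sq_abs t]
      have h4 : (1 + (2 * ‖z‖ + 1) ^ 2) ^ (1 / 2 : ℝ) * (1 + (2 * ‖z‖ + 1) ^ 2) ^ (-(1 / 2) : ℝ) = 1 := by
        rw [← Real.rpow_add (by positivity)]; norm_num
      calc _ ≤ z.im⁻¹ := inv_anti₀ hz h2
        _ = z.im⁻¹ * (1 + (2 * ‖z‖ + 1) ^ 2) ^ (1 / 2 : ℝ) * (1 + (2 * ‖z‖ + 1) ^ 2) ^ (-(1 / 2) : ℝ) := by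
            rw [mul_assoc, h4, mul_one]
        _ ≤ z.im⁻¹ * (1 + (2 * ‖z‖ + 1) ^ 2) ^ (1 / 2 : ℝ) * (1 + t ^ 2) ^ (-(1 / 2) : ℝ) := by gcongr
        _ ≤ _ := by gcongr; exact le_max_right _ _
  obtain ⟨C', hC'⟩ : ∃ C : ℝ, ∀ ε : ℝ, 0 < ε → ∀ t : ℝ,
      |(F (t + ε * Complex.I)).im| ≤ C * (1 + t ^ 2) ^ (-(1 / 4) : ℝ) := by
    refine ⟨max (max K 0 * 2 ^ (1 / 4 : ℝ)) (M * (1 + (|R| + 1) ^ 2) ^ (1 / 4 : ℝ)), fun ε hε t => ?_⟩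
    by_cases ht : |R| + 1 ≤ |t|
    · have hR' := abs_nonneg R
      have h1 := one_add_sq_rpow_le (a := 1 / 4) (by norm_num) (t := t) (by linarith)
      norm_num at h1
      have h2 : |t| ≤ ‖(t : ℂ) + ε * Complex.I‖ := by
        simpa using Complex.abs_re_le_norm ((t : ℂ) + ε * Complex.I)
      calc _ ≤ ‖F (t + ε * Complex.I)‖ := Complex.abs_im_le_norm _
        _ ≤ K * ‖(t : ℂ) + ε * Complex.I‖ ^ (-(1 / 2) : ℝ) :=
            hb _ (by simpa using hε) (by have := le_abs_self R; linarith)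
        _ ≤ max K 0 * ‖(t : ℂ) + ε * Complex.I‖ ^ (-(1 / 2) : ℝ) := by gcongr; exact le_max_left _ _
        _ ≤ max K 0 * |t| ^ (-(1 / 2) : ℝ) := by
            gcongr max K 0 * ?_
            exact Real.rpow_le_rpow_of_nonpos (by linarith) h2 (by norm_num)
        _ ≤ max K 0 * (2 ^ (1 / 4 : ℝ) * (1 + t ^ 2) ^ (-(1 / 4) : ℝ)) := by gcongr
        _ ≤ _ := by rw [← mul_assoc]; gcongr; exact le_max_left _ _
    · have h3 : (1 + (|R| + 1) ^ 2) ^ (-(1 / 4) : ℝ) ≤ (1 + t ^ 2) ^ (-(1 / 4) : ℝ) := by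
        refine Real.rpow_le_rpow_of_nonpos (by positivity) ?_ (by norm_num)
        have := abs_nonneg t
        nlinarith [sq_abs t]
      have h4 : (1 + (|R| + 1) ^ 2) ^ (1 / 4 : ℝ) * (1 + (|R| + 1) ^ 2) ^ (-(1 / 4) : ℝ) = 1 := by
        rw [← Real.rpow_add (by positivity)]; norm_num
      calc _ ≤ M := hM _ (by simpa using hε)
        _ = M * (1 + (|R| + 1) ^ 2) ^ (1 / 4 : ℝ) * (1 + (|R| + 1) ^ 2) ^ (-(1 / 4) : ℝ) := by
            rw [mul_assoc, h4, mul_one]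
        _ ≤ M * (1 + (|R| + 1) ^ 2) ^ (1 / 4 : ℝ) * (1 + t ^ 2) ^ (-(1 / 4) : ℝ) := by gcongr
        _ ≤ _ := by gcongr; exact le_max_right _ _
  have hl : Tendsto (fun ε : ℝ => z + ε * Complex.I) (𝓝[>] 0) (𝓝 z) := by
    have : Continuous fun ε : ℝ => z + ε * Complex.I := by fun_prop
    simpa using (this.tendsto 0).mono_left nhdsWithin_le_nhds
  have hr : Tendsto (fun ε : ℝ => Real.pi * F (z + ε * Complex.I)) (𝓝[>] 0) (𝓝 (Real.pi * F z)) :=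
    (((hF z hz).continuousAt.tendsto).comp hl).const_mul _
  refine tendsto_nhds_unique ?_ hr
  have hcongr : (fun ε : ℝ => Real.pi * F (z + ε * Complex.I)) =ᶠ[𝓝[>] 0]
      fun ε : ℝ => ∫ t : ℝ, (((F (t + ε * Complex.I)).im : ℝ) : ℂ) / (t - z) := by
    filter_upwards [self_mem_nhdsWithin] with ε hε
    exact (hseq ε hε).symm
  refine Tendsto.congr' hcongr.symm ?_
  -- The Cauchy kernel contributes the exponent `-1/2` and the decay of `F` the exponent `-1/4`;
  -- together they give an integrable power of `1 + t ^ 2`.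
  have hbi : Integrable (fun t : ℝ => C' * C * (1 + ‖t‖ ^ 2) ^ (-(3 / 2) / 2 : ℝ)) :=
    (integrable_rpow_neg_one_add_norm_sq (by norm_num)).const_mul _
  refine tendsto_integral_filter_of_dominated_convergence _ ?_ ?_ hbi ?_
  · filter_upwards [self_mem_nhdsWithin] with ε hε
    refine Continuous.aestronglyMeasurable ?_
    refine Continuous.div ?_ (by fun_prop) htz
    refine Complex.continuous_ofReal.comp (Complex.continuous_im.comp ?_)
    refine continuous_iff_continuousAt.2 fun t => ?_
    have hε' : (0 : ℝ) < ε := hε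
    have := (hF (t + ε * Complex.I) (by simpa using hε')).continuousAt
    exact ContinuousAt.comp (f := fun t : ℝ => (t : ℂ) + ε * Complex.I) this (by fun_prop)
  · filter_upwards [self_mem_nhdsWithin] with ε hε
    refine ae_of_all _ fun t => ?_
    rw [norm_div, div_eq_mul_inv, Complex.norm_real, Real.norm_eq_abs, Real.norm_eq_abs, sq_abs]
    have e : (1 + t ^ 2) ^ (-(3 / 2) / 2 : ℝ) =
        (1 + t ^ 2) ^ (-(1 / 4) : ℝ) * (1 + t ^ 2) ^ (-(1 / 2) : ℝ) := by
      rw [← Real.rpow_add (by positivity)]; norm_num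
    rw [e]
    calc _ ≤ (C' * (1 + t ^ 2) ^ (-(1 / 4) : ℝ)) * (C * (1 + t ^ 2) ^ (-(1 / 2) : ℝ)) :=
          mul_le_mul (hC' ε hε t) (hC t) (by positivity) ((abs_nonneg _).trans (hC' ε hε t))
      _ = _ := by ring
  · filter_upwards [hθ] with t ht
    exact ((Complex.continuous_ofReal.tendsto _).comp ht).div_const _

end Boundary

/-! ### Principal values as absolutely convergent integrals -/

section PrincipalValue

theorem HasPV.pv_eq {f : ℝ → ℝ} {x L : ℝ} (h : HasPV f x L) : pv f x = L := h.2.limUnder_eq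

/-- The integrand of a principal value at `x`, regularised by subtracting the value at `x` on a
symmetric neighbourhood. -/
def pvIntegrand (f : ℝ → ℝ) (x r s : ℝ) : ℝ :=
  (f s - (Ioo (x - r) (x + r)).indicator (fun _ => f x) s) / (s - x)

theorem integral_eq_zero_of_reflect {E : Type*} [NormedAddCommGroup E] [NormedSpace ℝ E]
    {g : ℝ → E} {x : ℝ} (h : ∀ s, g (2 * x - s) = -g s) : ∫ s, g s = 0 := by
  have h1 := integral_sub_left_eq_self g volume (2 * x)
  simp_rw [h, integral_neg] at h1
  have h2 : (2 : ℝ) • ∫ s, g s = 0 := by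
    rw [two_smul]
    nth_rewrite 1 [← h1]
    simp
  simpa using h2

theorem indicator_reflect (x r c s : ℝ) : (Ioo (x - r) (x + r)).indicator (fun _ => c) (2 * x - s) =
    (Ioo (x - r) (x + r)).indicator (fun _ => c) s := by
  have : 2 * x - s ∈ Ioo (x - r) (x + r) ↔ s ∈ Ioo (x - r) (x + r) := by
    simp only [mem_Ioo]
    constructor <;> rintro ⟨h1, h2⟩ <;> constructor <;> linarith
  by_cases h : s ∈ Ioo (x - r) (x + r)
  · rw [indicator_of_mem h, indicator_of_mem (this.2 h)]
  · rw [indicator_of_notMem h, indicator_of_notMem (fun h' => h (this.1 h'))]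

/-- The subtracted constant divided by `s - x` is odd about `x` on a symmetric set, so it
contributes nothing to any truncated integral; the remaining integrand is integrable and the
truncation is removed by dominated convergence. -/
theorem hasPV_of_integrable {f : ℝ → ℝ} {x r : ℝ} (h : Integrable (pvIntegrand f x r)) :
    HasPV f x (∫ s, pvIntegrand f x r s) := by
  have hms : ∀ ε : ℝ, MeasurableSet {t : ℝ | ε < |t - x|} := fun ε =>
    measurableSet_lt measurable_const (by fun_prop)
  have hsplit : ∀ t : ℝ, f t / (t - x) = pvIntegrand f x r t +
      (Ioo (x - r) (x + r)).indicator (fun _ => f x) t / (t - x) := by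
    intro t; simp only [pvIntegrand]; ring
  have hi2 : ∀ ε > 0, IntegrableOn (fun t =>
      (Ioo (x - r) (x + r)).indicator (fun _ => f x) t / (t - x)) {t | ε < |t - x|} := by
    intro ε hε
    have h1 : IntegrableOn (fun t => (Ioo (x - r) (x + r)).indicator (fun _ => f x) t)
        {t | ε < |t - x|} := by
      refine Integrable.integrableOn ?_
      rw [integrable_indicator_iff measurableSet_Ioo]
      exact integrableOn_const (by simp)
    refine Integrable.mono' (h1.norm.const_mul ε⁻¹) ?_ ?_
    · refine AEStronglyMeasurable.div₀ h1.aestronglyMeasurable ?_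
      fun_prop
    · refine (ae_restrict_iff' (hms ε)).2 (ae_of_all _ fun t ht => ?_)
      rw [norm_div, div_eq_inv_mul]
      have : (ε : ℝ) < ‖t - x‖ := ht
      gcongr
  have hz : ∀ ε > 0, ∫ t in {t | ε < |t - x|},
      (Ioo (x - r) (x + r)).indicator (fun _ => f x) t / (t - x) = 0 := by
    intro ε hε
    rw [← integral_indicator (hms ε)]
    refine integral_eq_zero_of_reflect (x := x) fun s => ?_
    have e : 2 * x - s - x = -(s - x) := by ring
    simp only [indicator_apply (s := {t | ε < |t - x|}), mem_ofPred_eq, e, abs_neg]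
    rw [indicator_reflect, div_neg]
    split_ifs <;> simp
  refine ⟨fun ε hε => ?_, ?_⟩
  · simp_rw [hsplit]
    exact h.integrableOn.add (hi2 ε hε)
  · have hc : (fun ε : ℝ => ∫ t in {t | ε < |t - x|}, f t / (t - x)) =ᶠ[𝓝[>] 0]
        fun ε => ∫ t, {t | ε < |t - x|}.indicator (pvIntegrand f x r) t := by
      filter_upwards [self_mem_nhdsWithin] with ε hε
      simp_rw [hsplit]
      rw [integral_add h.integrableOn (hi2 ε hε), hz ε hε, add_zero, integral_indicator (hms ε)]
    refine Tendsto.congr' hc.symm ?_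
    refine tendsto_integral_filter_of_dominated_convergence (fun t => ‖pvIntegrand f x r t‖) ?_ ?_
      h.norm ?_
    · exact Eventually.of_forall fun ε => h.aestronglyMeasurable.indicator (hms ε)
    · exact Eventually.of_forall fun ε => ae_of_all _ fun t => norm_indicator_le_norm_self _ _
    · refine ae_of_all _ fun t => ?_
      by_cases ht : t = x
      · subst ht
        have : pvIntegrand f t r t = 0 := by simp [pvIntegrand]
        rw [this]
        refine tendsto_const_nhds.congr fun ε => ?_
        by_cases hm : t ∈ {s | ε < |s - t|}
        · rw [indicator_of_mem hm, this]
        · rw [indicator_of_notMem hm]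
      · have hpos : 0 < |t - x| := abs_pos.2 (sub_ne_zero.2 ht)
        refine tendsto_const_nhds.congr' ?_
        filter_upwards [nhdsWithin_le_nhds (Iio_mem_nhds hpos)] with ε hε
        rw [indicator_of_mem (show t ∈ {s | ε < |s - x|} from hε)]

theorem integrable_cauchy_kernel {f : ℝ → ℝ} {x r η : ℝ} (h : Integrable (pvIntegrand f x r))
    (hη : 0 < η) : Integrable (fun s : ℝ => (f s : ℂ) / (s - (x + η * Complex.I))) := by
  have hne : ∀ s : ℝ, (s : ℂ) - (x + η * Complex.I) ≠ 0 := by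
    intro s hs
    have := congrArg Complex.im hs
    simp at this
    linarith
  have h2 : Integrable ((Ioo (x - r) (x + r)).indicator (fun _ : ℝ => f x)) := by
    rw [integrable_indicator_iff measurableSet_Ioo]
    exact integrableOn_const (by simp)
  have e : ∀ s : ℝ, s ≠ x → (f s : ℂ) / (s - (x + η * Complex.I)) =
      ((s - x) / (s - (x + η * Complex.I))) * (pvIntegrand f x r s : ℂ) +
      (1 / (s - (x + η * Complex.I))) * (((Ioo (x - r) (x + r)).indicator (fun _ => f x) s : ℝ) : ℂ) := by
    intro s hs
    have h1 := hne s
    have h3 : (s : ℂ) - x ≠ 0 := by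
      rw [← Complex.ofReal_sub]; exact_mod_cast sub_ne_zero.2 hs
    rw [pvIntegrand]
    push_cast
    field_simp
    ring
  have hae : ∀ᵐ s : ℝ, s ≠ x := by simp [ae_iff, measure_singleton]
  have i1 : Integrable (fun s : ℝ => (((s : ℂ) - x) / (s - (x + η * Complex.I))) *
      (pvIntegrand f x r s : ℂ)) := by
    refine h.ofReal.bdd_mul (c := 1) ?_ (ae_of_all _ fun s => ?_)
    · exact Continuous.aestronglyMeasurable (Continuous.div (by fun_prop) (by fun_prop) hne)
    · rw [norm_div]
      refine div_le_one_of_le₀ ?_ (norm_nonneg _)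
      rw [← Complex.ofReal_sub, Complex.norm_real]
      have := Complex.abs_re_le_norm ((s : ℂ) - (x + η * Complex.I))
      simpa using this
  have i2 : Integrable (fun s : ℝ => (1 / ((s : ℂ) - (x + η * Complex.I))) *
      (((Ioo (x - r) (x + r)).indicator (fun _ => f x) s : ℝ) : ℂ)) := by
    refine h2.ofReal.bdd_mul (c := 1 / η) ?_ (ae_of_all _ fun s => ?_)
    · exact Continuous.aestronglyMeasurable (Continuous.div (by fun_prop) (by fun_prop) hne)
    · rw [norm_div, norm_one]
      have := Complex.abs_im_le_norm ((s : ℂ) - (x + η * Complex.I))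
      simp [abs_of_pos hη] at this
      gcongr
  refine (i1.add i2).congr ?_
  filter_upwards [hae] with s hs
  exact (e s hs).symm

/-- The real half of the Plemelj formula. The real part of the kernel, `(s - x) / ((s - x)² + η²)`,
is odd about `x`, so the constant may again be subtracted; the integrand becomes `pvIntegrand` times
a factor in `[0, 1]` that tends to `1`. -/
theorem tendsto_re_cauchy_integral {f : ℝ → ℝ} {x r : ℝ} (h : Integrable (pvIntegrand f x r)) :
    Tendsto (fun η : ℝ => (∫ s : ℝ, (f s : ℂ) / (s - (x + η * Complex.I))).re) (𝓝[>] 0)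
      (𝓝 (∫ s, pvIntegrand f x r s)) := by
  have hae : ∀ᵐ s : ℝ, s ≠ x := by simp [ae_iff, measure_singleton]
  have hk : Continuous fun s : ℝ => s - x := by fun_prop
  have hre : ∀ s η : ℝ, ((f s : ℂ) / (s - (x + η * Complex.I))).re =
      f s * (s - x) / ((s - x) ^ 2 + η ^ 2) := by
    intro s η
    rw [Complex.div_re]
    simp [Complex.normSq_apply]
    ring
  have h2 : Integrable ((Ioo (x - r) (x + r)).indicator (fun _ : ℝ => f x)) := by
    rw [integrable_indicator_iff measurableSet_Ioo]
    exact integrableOn_const (by simp)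
  have hc : (fun η : ℝ => (∫ s : ℝ, (f s : ℂ) / (s - (x + η * Complex.I))).re) =ᶠ[𝓝[>] 0]
      fun η => ∫ s, (s - x) ^ 2 / ((s - x) ^ 2 + η ^ 2) * pvIntegrand f x r s := by
    filter_upwards [self_mem_nhdsWithin] with η hη
    have hη' : 0 < η := hη
    have e1 : (∫ s : ℝ, (f s : ℂ) / (s - (x + η * Complex.I))).re =
        ∫ s : ℝ, ((f s : ℂ) / (s - (x + η * Complex.I))).re :=
      (integral_re (integrable_cauchy_kernel h hη')).symm
    rw [e1]
    have i1 : Integrable fun s => (s - x) ^ 2 / ((s - x) ^ 2 + η ^ 2) * pvIntegrand f x r s := by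
      refine h.bdd_mul (c := 1) ?_ (ae_of_all _ fun s => ?_)
      · exact Continuous.aestronglyMeasurable
          (Continuous.div (by fun_prop) (by fun_prop) fun s => by positivity)
      · rw [Real.norm_of_nonneg (by positivity)]
        exact div_le_one_of_le₀ (by nlinarith) (by positivity)
    have i2 : Integrable fun s => (s - x) / ((s - x) ^ 2 + η ^ 2) *
        (Ioo (x - r) (x + r)).indicator (fun _ => f x) s := by
      refine h2.bdd_mul (c := 1 / η) ?_ (ae_of_all _ fun s => ?_)
      · exact Continuous.aestronglyMeasurable
          (Continuous.div (by fun_prop) (by fun_prop) fun s => by positivity)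
      · rw [norm_div, Real.norm_of_nonneg (r := (s - x) ^ 2 + η ^ 2) (by positivity),
          Real.norm_eq_abs, div_le_div_iff₀ (by positivity) hη', one_mul]
        nlinarith [sq_abs (s - x), sq_nonneg (|s - x| - η), abs_nonneg (s - x)]
    have z2 : ∫ s, (s - x) / ((s - x) ^ 2 + η ^ 2) *
        (Ioo (x - r) (x + r)).indicator (fun _ => f x) s = 0 := by
      refine integral_eq_zero_of_reflect (x := x) fun s => ?_
      rw [indicator_reflect, show 2 * x - s - x = -(s - x) by ring]
      ring
    rw [← add_zero (∫ s, _ * pvIntegrand f x r s), ← z2, ← integral_add i1 i2]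
    refine integral_congr_ae ?_
    filter_upwards [hae] with s hs
    have h3 : s - x ≠ 0 := sub_ne_zero.2 hs
    rw [hre, pvIntegrand]
    field_simp
    ring
  refine Tendsto.congr' hc.symm ?_
  refine tendsto_integral_filter_of_dominated_convergence (fun t => ‖pvIntegrand f x r t‖) ?_ ?_
    h.norm ?_
  · filter_upwards [self_mem_nhdsWithin] with η hη
    have hη' : 0 < η := hη
    refine AEStronglyMeasurable.mul ?_ h.aestronglyMeasurable
    exact Continuous.aestronglyMeasurable
      (Continuous.div (by fun_prop) (by fun_prop) fun s => by positivity)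
  · refine Eventually.of_forall fun η => ae_of_all _ fun s => ?_
    have h0 : 0 ≤ (s - x) ^ 2 / ((s - x) ^ 2 + η ^ 2) :=
      div_nonneg (sq_nonneg _) (add_nonneg (sq_nonneg _) (sq_nonneg _))
    rw [norm_mul, Real.norm_of_nonneg h0]
    refine mul_le_of_le_one_left (norm_nonneg _) ?_
    exact div_le_one_of_le₀ (by nlinarith [sq_nonneg η]) (add_nonneg (sq_nonneg _) (sq_nonneg _))
  · filter_upwards [hae] with s hs
    have h3 : s - x ≠ 0 := sub_ne_zero.2 hs
    have h4 : Continuous fun η : ℝ => (s - x) ^ 2 / ((s - x) ^ 2 + η ^ 2) * pvIntegrand f x r s := by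
      refine Continuous.mul (Continuous.div (by fun_prop) (by fun_prop) fun η => ?_) continuous_const
      positivity
    have := (h4.tendsto 0).mono_left (nhdsWithin_le_nhds (s := Ioi 0))
    simpa [h3] using this

end PrincipalValue

/-! ### The reference phase `arctan (1 / t)` and the factor `psi` -/

section ArctanPhase

/-- Outside the interval the bounds on `|f s|` and `|f s| * |s|` dominate the quotient by a multiple
of `1 / (1 + s ^ 2)`, so only the behaviour near `x` is a real condition. -/
theorem integrable_pvIntegrand {f : ℝ → ℝ} {x r C D : ℝ} (hr : 0 < r)
    (hm : AEStronglyMeasurable f) (hC : ∀ s, |f s| ≤ C) (hD : ∀ s, |f s| * |s| ≤ D)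
    (hloc : IntegrableOn (fun s => (f s - f x) / (s - x)) (Ioo (x - r) (x + r))) :
    Integrable (pvIntegrand f x r) := by
  rw [← integrableOn_univ, ← union_compl_self (Ioo (x - r) (x + r)), integrableOn_union]
  constructor
  · refine hloc.congr_fun (fun s hs => ?_) measurableSet_Ioo
    simp only [pvIntegrand, indicator_of_mem hs]
  · refine IntegrableOn.congr_fun (f := fun s => f s / (s - x)) ?_ (fun s hs => ?_)
      measurableSet_Ioo.compl
    · have hb : Integrable (fun s : ℝ => (C / r + D * (1 + |x| / r)) * (1 + s ^ 2)⁻¹) :=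
        integrable_inv_one_add_sq.const_mul _
      refine Integrable.mono' hb.integrableOn ?_ ?_
      · exact hm.restrict.div₀ (by fun_prop)
      · refine (ae_restrict_iff' measurableSet_Ioo.compl).2 (ae_of_all _ fun s hs => ?_)
        have hs' : r ≤ |s - x| := by
          by_contra hcon
          have := abs_lt.1 (not_le.1 hcon)
          exact hs ⟨by linarith [this.1], by linarith [this.2]⟩
        have h0 : 0 < |s - x| := by linarith
        rw [norm_div, Real.norm_eq_abs, Real.norm_eq_abs, ← div_eq_mul_inv,
          div_le_div_iff₀ h0 (by positivity)]
        have h1 : |s| ≤ (1 + |x| / r) * |s - x| := by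
          have : |s| ≤ |s - x| + |x| := by simpa using abs_add_le (s - x) x
          have h2 : |x| ≤ |x| / r * |s - x| := by
            rw [div_mul_eq_mul_div, le_div_iff₀ hr]
            gcongr
          linarith
        have h3 : |f s| ≤ C / r * |s - x| := by
          refine (hC s).trans ?_
          rw [div_mul_eq_mul_div, le_div_iff₀ hr]
          have := (abs_nonneg _).trans (hC s)
          gcongr
        have hD0 : 0 ≤ D := le_trans (by positivity) (hD s)
        calc |f s| * (1 + s ^ 2) = |f s| + (|f s| * |s|) * |s| := by rw [← sq_abs s]; ring
          _ ≤ C / r * |s - x| + D * ((1 + |x| / r) * |s - x|) := by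
              gcongr
              exact hD s
          _ = _ := by ring
    · simp only [pvIntegrand, indicator_of_notMem hs, sub_zero]

theorem abs_arctan_sub_le (a b : ℝ) : |Real.arctan a - Real.arctan b| ≤ |a - b| := by
  have := Convex.norm_image_sub_le_of_norm_deriv_le (f := Real.arctan) (C := 1) (s := univ)
    (x := b) (y := a) (fun x _ => Real.differentiableAt_arctan x) (fun x _ => by
      rw [Real.deriv_arctan, Real.norm_of_nonneg (by positivity)]
      exact div_le_one_of_le₀ (by nlinarith) (by positivity)) convex_univ trivial trivial
  simpa using this

theorem integrable_pvIntegrand_arctan {x : ℝ} (hx : x ≠ 0) :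
    Integrable (pvIntegrand (fun t => Real.arctan (1 / t)) x (|x| / 2)) := by
  have hx0 : 0 < |x| := abs_pos.2 hx
  have hmeas : Measurable fun t : ℝ => Real.arctan (1 / t) :=
    Real.continuous_arctan.measurable.comp (by fun_prop)
  have hd : ∀ y, |Real.arctan y| ≤ |y| := fun y => by simpa using abs_arctan_sub_le y 0
  refine integrable_pvIntegrand (C := Real.pi / 2) (D := 1) (by positivity)
    hmeas.aestronglyMeasurable (fun s => ?_) (fun s => ?_) ?_
  · exact abs_le.2 ⟨(Real.neg_pi_div_two_lt_arctan _).le, (Real.arctan_lt_pi_div_two _).le⟩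
  · by_cases hs : s = 0
    · simp [hs]
    · calc _ ≤ |1 / s| * |s| := mul_le_mul_of_nonneg_right (hd _) (abs_nonneg _)
        _ = 1 := by rw [← abs_mul, one_div_mul_cancel hs, abs_one]
  · refine Measure.integrableOn_of_bounded (M := 2 / x ^ 2) (by simp) ?_ ?_
    · exact ((hmeas.sub_const _).div (by fun_prop)).aestronglyMeasurable
    · refine (ae_restrict_iff' measurableSet_Ioo).2 (ae_of_all _ fun s hs => ?_)
      have h1 : |x| / 2 ≤ |s| := by
        have h2 : |s - x| < |x| / 2 := abs_lt.2 ⟨by linarith [hs.1], by linarith [hs.2]⟩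
        have := abs_sub_abs_le_abs_sub x s
        rw [abs_sub_comm] at this
        linarith
      have hs0 : s ≠ 0 := by
        rintro rfl; simp at h1; linarith
      have hs1 : 0 < |s| := abs_pos.2 hs0
      rw [norm_div, Real.norm_eq_abs, Real.norm_eq_abs]
      refine div_le_of_le_mul₀ (abs_nonneg _) (by positivity) ?_
      refine (abs_arctan_sub_le _ _).trans ?_
      rw [div_sub_div _ _ hs0 hx, abs_div, one_mul, mul_one, abs_sub_comm, abs_mul,
        div_le_iff₀ (by positivity), div_mul_eq_mul_div, div_mul_eq_mul_div, le_div_iff₀ (by positivity),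
        ← sq_abs x]
      have : 0 ≤ |s - x| := abs_nonneg _
      nlinarith [mul_nonneg this hx0.le]

/-- The function `arctan (1 / t)` is the boundary value of `Im log (1 + I / z)`, which is analytic
and decaying in the upper half-plane. Hence its Cauchy integral is `π log (1 + I / z)`, and the
principal value is the real part at `x`. -/
theorem hasPV_arctan {x : ℝ} (hx : x ≠ 0) :
    HasPV (fun t => Real.arctan (1 / t)) x (Real.pi / 2 * Real.log ((x ^ 2 + 1) / x ^ 2)) := by
  have hP := tendsto_re_cauchy_integral (integrable_pvIntegrand_arctan hx)
  have hPV := hasPV_of_integrable (integrable_pvIntegrand_arctan hx)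
  set F : ℂ → ℂ := fun z => Complex.log (1 + Complex.I / z) with hF
  have hz0 : ∀ {z : ℂ}, 0 < z.im → z ≠ 0 := by rintro z hz rfl; simp at hz
  have hre : ∀ {z : ℂ}, 0 < z.im → 0 < (1 + Complex.I / z).re := by
    intro z hz
    have : (Complex.I / z).re = z.im / Complex.normSq z := by simp [Complex.div_re]
    rw [Complex.add_re, this, Complex.one_re]
    have := Complex.normSq_nonneg z
    positivity
  have hC : ∀ z : ℂ, 0 < z.im → ∫ t : ℝ, ((Real.arctan (1 / t) : ℝ) : ℂ) / (t - z) = Real.pi * F z := by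
    intro z hz
    refine cauchy_integral_boundary (K := 2) (R := 2) (M := Real.pi) (fun z hz => ?_) ?_ ?_ ?_ hz
    · refine DifferentiableAt.clog ?_ (Or.inl (hre hz))
      exact (differentiableAt_const _).fun_add
        ((differentiableAt_const _).fun_div differentiableAt_id (hz0 hz))
    · intro z hz hR
      have hn : ‖Complex.I / z‖ = ‖z‖⁻¹ := by simp
      have h2 : ‖z‖⁻¹ ≤ 1 / 2 := by
        rw [inv_le_comm₀ (by linarith) (by norm_num)]; simpa using hR
      refine (Complex.norm_log_one_add_half_le_self (z := Complex.I / z) (by rw [hn]; exact h2)).trans ?_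
      rw [hn]
      have : ‖z‖⁻¹ ≤ ‖z‖ ^ (-(1 / 2) : ℝ) := by
        rw [← Real.rpow_neg_one]
        exact Real.rpow_le_rpow_of_exponent_le (by linarith) (by norm_num)
      have := inv_nonneg.2 (norm_nonneg z)
      linarith
    · intro z hz
      rw [hF]; simp only [Complex.log_im]
      exact Complex.abs_arg_le_pi _
    · have hae : ∀ᵐ s : ℝ, s ≠ 0 := by simp [ae_iff, measure_singleton]
      filter_upwards [hae] with t ht
      have ht' : (t : ℂ) ≠ 0 := by exact_mod_cast ht
      have hv : (F t).im = Real.arctan (1 / t) := by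
        rw [hF]; simp only [Complex.log_im]
        have hr1 : (1 + Complex.I / (t : ℂ)).re = 1 := by simp [Complex.div_re]
        have hi1 : (1 + Complex.I / (t : ℂ)).im = 1 / t := by
          simp [Complex.div_im, Complex.normSq_apply]
        rw [Complex.arg_of_re_nonneg (by rw [hr1]; norm_num), hi1, Real.arctan_eq_arcsin,
          Complex.norm_def, Complex.normSq_apply, hr1, hi1]
        congr 3
        ring
      rw [← hv]
      have hct : ContinuousAt F t := by
        refine ContinuousAt.clog ?_ (Or.inl (by simp [Complex.div_re]))
        exact continuousAt_const.add (continuousAt_const.div continuousAt_id ht')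
      have hl : Tendsto (fun ε : ℝ => (t : ℂ) + ε * Complex.I) (𝓝[>] 0) (𝓝 t) := by
        have : Continuous fun ε : ℝ => (t : ℂ) + ε * Complex.I := by fun_prop
        simpa using (this.tendsto 0).mono_left nhdsWithin_le_nhds
      exact (Complex.continuous_im.tendsto _).comp (hct.tendsto.comp hl)
  have hx' : (x : ℂ) ≠ 0 := by exact_mod_cast hx
  have hlim : Tendsto (fun η : ℝ => (Real.pi * F (x + η * Complex.I)).re) (𝓝[>] 0)
      (𝓝 ((Real.pi * F x).re)) := by
    have hct : ContinuousAt F x := by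
      refine ContinuousAt.clog ?_ (Or.inl (by simp [Complex.div_re]))
      exact continuousAt_const.add (continuousAt_const.div continuousAt_id hx')
    have hl : Tendsto (fun ε : ℝ => (x : ℂ) + ε * Complex.I) (𝓝[>] 0) (𝓝 x) := by
      have : Continuous fun ε : ℝ => (x : ℂ) + ε * Complex.I := by fun_prop
      simpa using (this.tendsto 0).mono_left nhdsWithin_le_nhds
    exact (Complex.continuous_re.tendsto _).comp ((hct.tendsto.comp hl).const_mul _)
  have hcg : (fun η : ℝ => (∫ s : ℝ, ((Real.arctan (1 / s) : ℝ) : ℂ) / (s - (x + η * Complex.I))).re)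
      =ᶠ[𝓝[>] 0] fun η : ℝ => (Real.pi * F (x + η * Complex.I)).re := by
    filter_upwards [self_mem_nhdsWithin] with η hη
    rw [hC _ (by simpa using hη)]
  have hval := tendsto_nhds_unique (hP.congr' hcg) hlim
  have : (Real.pi * F x).re = Real.pi / 2 * Real.log ((x ^ 2 + 1) / x ^ 2) := by
    rw [Complex.re_ofReal_mul, hF, Complex.log_re, Complex.norm_def, Real.log_sqrt
      (Complex.normSq_nonneg _)]
    have e : Complex.normSq (1 + Complex.I / x) = (x ^ 2 + 1) / x ^ 2 := by
      have hr1 : (1 + Complex.I / (x : ℂ)).re = 1 := by simp [Complex.div_re]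
      have hi1 : (1 + Complex.I / (x : ℂ)).im = 1 / x := by
        simp [Complex.div_im, Complex.normSq_apply]
      rw [Complex.normSq_apply, hr1, hi1]
      field_simp
    rw [e]; ring
  rw [← this, ← hval]
  exact hPV

/-- This makes the power of `psi` in the density the denominator `x ^ 2` attached to each zero and
each bound state in the modulus formula. -/
theorem psi_eq {x : ℝ} (hx : x ≠ 0) : psi x = 1 / x ^ 2 := by
  rw [psi, (hasPV_arctan hx).pv_eq]
  have h : 2 / Real.pi * (Real.pi / 2 * Real.log ((x ^ 2 + 1) / x ^ 2)) =
      Real.log ((x ^ 2 + 1) / x ^ 2) := by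
    have := Real.pi_ne_zero
    field_simp
  rw [h, Real.exp_log (by positivity)]
  field_simp

end ArctanPhase

/-! ### Functions square-integrable with weight 1 + x² -/

section DecayingFunctions

/-- Square-integrability on the half-axis with the weight `1 + x²`. -/
structure Decay (f : ℝ → ℂ) : Prop where
  aesm : AEStronglyMeasurable f halfLine
  int : Integrable (fun x : ℝ => (1 + x ^ 2) * ‖f x‖ ^ 2) halfLine

variable {f g : ℝ → ℂ}

/-- By the arithmetic-geometric mean inequality `‖f‖` is at most `(1 + x²)‖f‖² + 1 / (1 + x²)`. -/
theorem Decay.integrable (hf : Decay f) : Integrable f halfLine := by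
  refine Integrable.mono' (hf.int.add (integrable_inv_one_add_sq.restrict (s := Ioi 0))) hf.aesm
    (ae_of_all _ fun x => ?_)
  have h : 0 < 1 + x ^ 2 := by positivity
  simp only [Pi.add_apply]
  rw [← mul_le_mul_iff_right₀ h, mul_add, mul_inv_cancel₀ h.ne']
  nlinarith [sq_nonneg ((1 + x ^ 2) * ‖f x‖ - 1), norm_nonneg (f x), mul_nonneg h.le (norm_nonneg (f x))]

theorem Decay.integrable_sq (hf : Decay f) : Integrable (fun x => ‖f x‖ ^ 2) halfLine := by
  refine Integrable.mono' hf.int (hf.aesm.norm.pow 2) (ae_of_all _ fun x => ?_)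
  rw [Real.norm_of_nonneg (by positivity)]
  nlinarith [mul_nonneg (sq_nonneg x) (sq_nonneg ‖f x‖)]

theorem Decay.integrable_sq_mul_sq (hf : Decay f) :
    Integrable (fun x => x ^ 2 * ‖f x‖ ^ 2) halfLine := by
  refine (hf.int.sub hf.integrable_sq).congr (ae_of_all _ fun x => ?_)
  simp only [Pi.sub_apply]; ring

theorem Decay.memLp (hf : Decay f) : MemLp f 2 halfLine :=
  (memLp_two_iff_integrable_sq_norm hf.aesm).2 hf.integrable_sq

theorem Decay.indicator (hf : Decay f) {s : Set ℝ} (hs : MeasurableSet s) :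
    Decay (s.indicator f) := by
  refine ⟨hf.aesm.indicator hs, ?_⟩
  refine (hf.int.indicator hs).congr (ae_of_all _ fun x => ?_)
  by_cases hx : x ∈ s <;> simp [hx]

/-- The integrals of the Schur weight of the kernel `1 / max x t`. -/
theorem schur_weight {x : ℝ} (hx : 0 < x) :
    IntegrableOn (fun t : ℝ => x ^ (1 / 2 : ℝ) * t ^ (-(1 / 2) : ℝ) / max x t) (Ioi 0) ∧
      ∫ t in Ioi (0 : ℝ), x ^ (1 / 2 : ℝ) * t ^ (-(1 / 2) : ℝ) / max x t = 4 := by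
  have i1 : IntegrableOn (fun t : ℝ => x ^ (1 / 2 : ℝ) / x * t ^ (-(1 / 2) : ℝ)) (Ioc 0 x) := by
    refine Integrable.const_mul ?_ _
    have := (intervalIntegral.intervalIntegrable_rpow' (a := 0) (b := x)
      (r := -(1 / 2)) (by norm_num))
    rwa [intervalIntegrable_iff_integrableOn_Ioc_of_le hx.le] at this
  have i2 : IntegrableOn (fun t : ℝ => x ^ (1 / 2 : ℝ) * t ^ (-(3 / 2) : ℝ)) (Ioi x) :=
    (integrableOn_Ioi_rpow_of_lt (by norm_num) hx).const_mul _
  have e1 : ∀ t ∈ Ioc 0 x, x ^ (1 / 2 : ℝ) / x * t ^ (-(1 / 2) : ℝ) =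
      x ^ (1 / 2 : ℝ) * t ^ (-(1 / 2) : ℝ) / max x t := by
    intro t ht
    rw [max_eq_left ht.2]; ring
  have e2 : ∀ t ∈ Ioi x, x ^ (1 / 2 : ℝ) * t ^ (-(3 / 2) : ℝ) =
      x ^ (1 / 2 : ℝ) * t ^ (-(1 / 2) : ℝ) / max x t := by
    intro t ht
    have ht0 : 0 < t := hx.trans ht
    have : t ^ (-(3 / 2) : ℝ) = t ^ (-(1 / 2) : ℝ) / t := by
      rw [show (-(3 / 2) : ℝ) = -(1 / 2) - 1 by norm_num, Real.rpow_sub_one ht0.ne']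
    rw [max_eq_right (le_of_lt ht), this]; ring
  have j1 := i1.congr_fun e1 measurableSet_Ioc
  have j2 := i2.congr_fun e2 measurableSet_Ioi
  rw [← Ioc_union_Ioi_eq_Ioi hx.le]
  refine ⟨j1.union j2, ?_⟩
  rw [setIntegral_union Ioc_disjoint_Ioi_same measurableSet_Ioi j1 j2,
    ← setIntegral_congr_fun measurableSet_Ioc e1, ← setIntegral_congr_fun measurableSet_Ioi e2,
    integral_const_mul, integral_const_mul, integral_Ioi_rpow_of_lt (by norm_num) hx,
    ← intervalIntegral.integral_of_le hx.le, integral_rpow (Or.inl (by norm_num))]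
  have h1 : x ^ (1 / 2 : ℝ) * x ^ (1 / 2 : ℝ) = x := by
    rw [← Real.rpow_add hx]; norm_num
  have h2 : x ^ (1 / 2 : ℝ) * x ^ (-(1 / 2) : ℝ) = 1 := by
    rw [← Real.rpow_add hx]; norm_num
  norm_num at h1 h2 ⊢
  calc _ = 2 * (x ^ (1 / 2 : ℝ) * x ^ (1 / 2 : ℝ)) / x + 2 * (x ^ (1 / 2 : ℝ) * x ^ (-(1 / 2) : ℝ)) := by
        norm_num; ring
    _ = 4 := by norm_num [h1, h2]; field_simp; norm_num

/-- Integrating the Schur weight over the second variable gives the constant `4`, and what is left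
is `x²‖f‖²`. -/
theorem Decay.integrable_schur (hf : Decay f) :
    Integrable (fun p : ℝ × ℝ => p.1 ^ 2 * ‖f p.1‖ ^ 2 *
      (p.1 ^ (1 / 2 : ℝ) * p.2 ^ (-(1 / 2) : ℝ) / max p.1 p.2)) (halfLine.prod halfLine) := by
  have hm : AEStronglyMeasurable (fun p : ℝ × ℝ => p.1 ^ 2 * ‖f p.1‖ ^ 2 *
      (p.1 ^ (1 / 2 : ℝ) * p.2 ^ (-(1 / 2) : ℝ) / max p.1 p.2)) (halfLine.prod halfLine) := by
    refine AEStronglyMeasurable.mul ?_ ?_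
    · exact hf.integrable_sq_mul_sq.aestronglyMeasurable.comp_fst
    · refine Measurable.aestronglyMeasurable ?_
      fun_prop
  rw [integrable_prod_iff hm]
  constructor
  · filter_upwards [ae_restrict_mem measurableSet_Ioi] with x hx
    exact (schur_weight hx).1.const_mul _
  · refine (hf.integrable_sq_mul_sq.mul_const 4).congr ?_
    filter_upwards [ae_restrict_mem measurableSet_Ioi] with x hx
    have hx' : 0 < x := hx
    rw [← (schur_weight hx).2, ← integral_const_mul]
    refine setIntegral_congr_fun measurableSet_Ioi fun t ht => ?_
    have ht' : 0 < t := ht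
    have hm : 0 < max x t := lt_max_of_lt_left hx'
    exact (Real.norm_of_nonneg (by positivity)).symm

theorem ae_prod_pos : ∀ᵐ p ∂((halfLine).prod halfLine), 0 < p.1 ∧ 0 < p.2 := by
  rw [Measure.prod_restrict]
  filter_upwards [ae_restrict_mem (measurableSet_Ioi.prod measurableSet_Ioi)] with p hp
  exact hp

/-- A Hardy type inequality: the form with the kernel `min x t` is finite. -/
theorem Decay.integrable_min_mul (hf : Decay f) (hg : Decay g) :
    Integrable (fun p : ℝ × ℝ => min p.1 p.2 * (‖f p.2‖ * ‖g p.1‖)) (halfLine.prod halfLine) := by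
  have h1 := hg.integrable_schur
  have h2 := hf.integrable_schur.swap
  refine Integrable.mono' (h1.add h2) ?_ ?_
  · refine AEStronglyMeasurable.mul (by fun_prop) ?_
    exact hf.aesm.norm.comp_snd.mul hg.aesm.norm.comp_fst
  · filter_upwards [ae_prod_pos] with p hp
    obtain ⟨hx, ht⟩ := hp
    simp only [Pi.add_apply, Function.comp, Prod.fst_swap, Prod.snd_swap]
    generalize p.1 = x at *
    generalize p.2 = t at *
    have hmax : 0 < max x t := lt_max_of_lt_left hx
    have hmm : min x t * max x t = x * t := min_mul_max x t
    have hmin : min x t = x * t / max x t := by rw [← hmm]; field_simp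
    have hmin0 : 0 < min x t := lt_min hx ht
    set a := x ^ (1 / 2 : ℝ) with ha
    set b := t ^ (1 / 2 : ℝ) with hb
    have hax : x = a ^ 2 := by
      rw [ha, ← Real.rpow_natCast, ← Real.rpow_mul hx.le]; norm_num
    have hbt : t = b ^ 2 := by
      rw [hb, ← Real.rpow_natCast, ← Real.rpow_mul ht.le]; norm_num
    have ha0 : 0 < a := by positivity
    have hb0 : 0 < b := by positivity
    have ha' : x ^ (-(1 / 2) : ℝ) = a⁻¹ := by rw [Real.rpow_neg hx.le]
    have hb' : t ^ (-(1 / 2) : ℝ) = b⁻¹ := by rw [Real.rpow_neg ht.le]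
    rw [Real.norm_of_nonneg (by positivity), ha', hb', hmin, max_comm t x]
    rw [div_mul_eq_mul_div, ← mul_div_assoc, ← mul_div_assoc, ← add_div]
    refine (div_le_div_iff_of_pos_right hmax).2 ?_
    set F := ‖f t‖
    set G := ‖g x‖
    -- Schur test: with `X = x G √x` and `Y = t F √t`, the claim multiplied by `√x √t` is `X Y ≤ X²
    -- + Y²`.
    rw [← mul_le_mul_iff_right₀ (mul_pos ha0 hb0)]
    have e : a * b * (x ^ 2 * G ^ 2 * (a * b⁻¹) + t ^ 2 * F ^ 2 * (b * a⁻¹)) =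
        (x * G * a) ^ 2 + (t * F * b) ^ 2 := by
      field_simp
    rw [e]
    have : a * b * (x * t * (F * G)) = (x * G * a) * (t * F * b) := by ring
    rw [this]
    nlinarith [sq_nonneg (x * G * a - t * F * b), sq_nonneg (x * G * a), sq_nonneg (t * F * b)]

theorem tail_integral_tendsto {F : ℝ → ℝ} (hF : Integrable F halfLine) :
    Tendsto (fun N : ℝ => ∫ x in Ioi N, F x) atTop (𝓝 0) := by
  have h := intervalIntegral_tendsto_integral_Ioi 0 hF tendsto_id
  have h2 : Tendsto (fun N : ℝ => (∫ x in Ioi (0 : ℝ), F x) - ∫ x in (0 : ℝ)..N, F x) atTop (𝓝 0) := by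
    simpa using h.const_sub (∫ x in Ioi (0 : ℝ), F x)
  refine h2.congr' ?_
  filter_upwards [eventually_ge_atTop (0 : ℝ)] with N hN
  have i1 : IntegrableOn F (Ioc 0 N) := hF.mono_measure (Measure.restrict_mono Ioc_subset_Ioi_self le_rfl)
  have i2 : IntegrableOn F (Ioi N) :=
    hF.mono_measure (Measure.restrict_mono (Ioi_subset_Ioi hN) le_rfl)
  rw [intervalIntegral.integral_of_le hN, ← Ioc_union_Ioi_eq_Ioi hN,
    setIntegral_union Ioc_disjoint_Ioi_same measurableSet_Ioi i1 i2]
  ring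

theorem Decay.integrable_min (hf : Decay f) (δ : ℝ) (hδ : 0 ≤ δ) :
    Integrable (fun x => min 2 (δ * x) * ‖f x‖) halfLine := by
  refine Integrable.mono' (hf.integrable.norm.const_mul 2) ?_ ?_
  · exact AEStronglyMeasurable.mul (by fun_prop) hf.aesm.norm
  · filter_upwards [ae_restrict_mem measurableSet_Ioi] with x hx
    have hx' : 0 < x := hx
    rw [Real.norm_of_nonneg (by positivity)]
    gcongr
    exact min_le_left _ _

/-- The modulus of continuity of order `1/2` (with small constant) of the Fourier transform. -/
theorem Decay.integral_min_le (hf : Decay f) {κ : ℝ} (hκ : 0 < κ) :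
    ∃ A : ℝ, 0 ≤ A ∧ ∀ δ : ℝ, 0 < δ →
      ∫ x in Ioi (0 : ℝ), min 2 (δ * x) * ‖f x‖ ≤ A * δ + κ * √δ := by
  -- With this weight the two terms of the arithmetic-geometric mean inequality, `2πτ√δ` and `(√δ /
  -- (2τ)) κτ`, are each `κ√δ / 2`.
  set τ : ℝ := κ / (4 * Real.pi) with hτ
  have hπ := Real.pi_pos
  have hτ0 : 0 < τ := by positivity
  -- Beyond `N` the weighted square integral is below `κτ`, which produces the small constant; on
  -- `(0, N]` the function `x‖f‖` is integrable and gives the linear term `A δ`.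
  have hev := (tail_integral_tendsto hf.integrable_sq_mul_sq).eventually
    (gt_mem_nhds (show (0 : ℝ) < κ * τ by positivity))
  obtain ⟨N, hN, hN0⟩ := (hev.and (eventually_ge_atTop 0)).exists
  have iN : IntegrableOn (fun x => x * ‖f x‖) (Ioc 0 N) := by
    refine Integrable.mono' (g := fun x => N * ‖f x‖) ?_ ?_ ?_
    · exact (hf.integrable.mono_measure
        (Measure.restrict_mono Ioc_subset_Ioi_self le_rfl)).norm.const_mul _
    · exact AEStronglyMeasurable.mul (by fun_prop)
        (hf.aesm.norm.mono_measure (Measure.restrict_mono Ioc_subset_Ioi_self le_rfl))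
    · filter_upwards [ae_restrict_mem measurableSet_Ioc] with x hx
      have := hx.1
      rw [Real.norm_of_nonneg (by positivity)]
      gcongr
      exact hx.2
  refine ⟨∫ x in Ioc 0 N, x * ‖f x‖, setIntegral_nonneg measurableSet_Ioc fun x hx =>
    mul_nonneg hx.1.le (norm_nonneg _), fun δ hδ => ?_⟩
  have hi := hf.integrable_min δ hδ.le
  have i1 : IntegrableOn (fun x => min 2 (δ * x) * ‖f x‖) (Ioc 0 N) :=
    hi.mono_measure (Measure.restrict_mono Ioc_subset_Ioi_self le_rfl)
  have i2 : IntegrableOn (fun x => min 2 (δ * x) * ‖f x‖) (Ioi N) :=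
    hi.mono_measure (Measure.restrict_mono (Ioi_subset_Ioi hN0) le_rfl)
  have hsplit : ∫ x in Ioi (0 : ℝ), min 2 (δ * x) * ‖f x‖ =
      (∫ x in Ioc 0 N, min 2 (δ * x) * ‖f x‖) + ∫ x in Ioi N, min 2 (δ * x) * ‖f x‖ := by
    rw [← Ioc_union_Ioi_eq_Ioi hN0, setIntegral_union Ioc_disjoint_Ioi_same measurableSet_Ioi i1 i2]
  rw [hsplit]
  refine add_le_add ?_ ?_
  · rw [mul_comm, ← integral_const_mul]
    refine setIntegral_mono_on i1 (iN.const_mul _) measurableSet_Ioc fun x hx => ?_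
    rw [← mul_assoc]
    gcongr
    exact min_le_right _ _
  · -- arithmetic-geometric mean inequality with weight `τ / √δ`
    have hs : 0 < √δ := Real.sqrt_pos.2 hδ
    have hss : √δ ^ 2 = δ := Real.sq_sqrt hδ.le
    have j1 : Integrable (fun x : ℝ => τ / √δ * (δ ^ 2 * (1 + (x / (2 / δ)) ^ 2)⁻¹)) := by
      refine Integrable.const_mul (Integrable.const_mul ?_ _) _
      exact integrable_inv_one_add_sq.comp_div (by positivity)
    have j2 : IntegrableOn (fun x : ℝ => √δ / (2 * τ) * (x ^ 2 * ‖f x‖ ^ 2)) (Ioi N) :=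
      (hf.integrable_sq_mul_sq.mono_measure
        (Measure.restrict_mono (Ioi_subset_Ioi hN0) le_rfl)).const_mul _
    have hle : ∫ x in Ioi N, min 2 (δ * x) * ‖f x‖ ≤
        ∫ x in Ioi N, (τ / √δ * (δ ^ 2 * (1 + (x / (2 / δ)) ^ 2)⁻¹) +
          √δ / (2 * τ) * (x ^ 2 * ‖f x‖ ^ 2)) := by
      refine setIntegral_mono_on i2 (j1.integrableOn.add j2) measurableSet_Ioi fun x hx => ?_
      have hx0 : 0 < x := lt_of_le_of_lt hN0 hx
      set q := min 2 (δ * x) with hq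
      have hq0 : 0 ≤ q := by positivity
      have hq2 : q ≤ 2 := min_le_left _ _
      have hq3 : q ≤ δ * x := min_le_right _ _
      have h1 : q ^ 2 / x ^ 2 ≤ 2 * (δ ^ 2 * (1 + (x / (2 / δ)) ^ 2)⁻¹) := by
        rw [← mul_assoc, ← div_eq_mul_inv, div_le_div_iff₀ (by positivity) (by positivity)]
        have e : x / (2 / δ) = δ * x / 2 := by field_simp
        rw [e]
        have h2 : q ^ 2 ≤ (δ * x) ^ 2 := by gcongr
        have h3 : q ^ 2 ≤ 2 ^ 2 := by gcongr
        nlinarith [mul_le_mul_of_nonneg_right h3 (sq_nonneg (δ * x))]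
      have h4 : q * ‖f x‖ ≤ τ / √δ / 2 * (q ^ 2 / x ^ 2) + √δ / (2 * τ) * (x ^ 2 * ‖f x‖ ^ 2) := by
        set u := q / x
        set y := x * ‖f x‖
        have e1 : q * ‖f x‖ = u * y := by simp only [u, y]; field_simp
        have e2 : q ^ 2 / x ^ 2 = u ^ 2 := by simp only [u]; ring
        have e3 : x ^ 2 * ‖f x‖ ^ 2 = y ^ 2 := by simp only [y]; ring
        rw [e1, e2, e3]
        have e4 : τ / √δ / 2 * u ^ 2 + √δ / (2 * τ) * y ^ 2 - u * y =
            τ / (2 * √δ) * (u - √δ / τ * y) ^ 2 := by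
          field_simp; ring
        have : 0 ≤ τ / (2 * √δ) * (u - √δ / τ * y) ^ 2 := by positivity
        linarith
      calc _ ≤ _ := h4
        _ ≤ τ / √δ / 2 * (2 * (δ ^ 2 * (1 + (x / (2 / δ)) ^ 2)⁻¹)) + √δ / (2 * τ) * (x ^ 2 * ‖f x‖ ^ 2) := by
            gcongr
        _ = _ := by ring
    refine hle.trans ?_
    rw [integral_add j1.integrableOn j2, integral_const_mul (τ / √δ), integral_const_mul (√δ / (2 * τ))]
    have k1 : ∫ x in Ioi N, δ ^ 2 * (1 + (x / (2 / δ)) ^ 2)⁻¹ ≤ 2 * δ * Real.pi := by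
      refine (setIntegral_le_integral ?_ (ae_of_all _ fun x => by positivity)).trans (le_of_eq ?_)
      · exact (integrable_inv_one_add_sq.comp_div (by positivity)).const_mul _
      · rw [integral_const_mul, Measure.integral_comp_div (fun t : ℝ => (1 + t ^ 2)⁻¹),
          integral_univ_inv_one_add_sq, smul_eq_mul, abs_of_pos (by positivity)]
        field_simp
    calc _ ≤ τ / √δ * (2 * δ * Real.pi) + √δ / (2 * τ) * (κ * τ) := by
          gcongr
      _ = κ * √δ := by
          rw [hτ]
          nth_rewrite 2 [← hss]
          field_simp
          ring

end DecayingFunctions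

/-! ### Green's function of the Dirichlet problem: bounds and symmetries -/

section GreenKernel

/-- The primitive `∫₀^y e^{iwr} dr`. -/
def expPrim (w : ℂ) (y : ℝ) : ℂ := ∫ r in (0 : ℝ)..y, Complex.exp (Complex.I * w * r)

/-- The kernel of `(L₀ - w²)⁻¹`, in the form `½ ∫_{|x-t|}^{x+t} e^{iwr} dr`, which is regular at
`w = 0`. -/
def green (w : ℂ) (x t : ℝ) : ℂ := (expPrim w (x + t) - expPrim w |x - t|) / 2

theorem continuous_expPrim (w : ℂ) : Continuous (expPrim w) :=
  intervalIntegral.continuous_primitive (fun _ _ => (by fun_prop : Continuous _).intervalIntegrable _ _) 0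

theorem continuous_expPrim_left (y : ℝ) : Continuous fun w => expPrim w y :=
  intervalIntegral.continuous_parametric_intervalIntegral_of_continuous' (by fun_prop) _ _

theorem expPrim_eq {w : ℂ} (hw : w ≠ 0) (y : ℝ) :
    expPrim w y = (Complex.exp (Complex.I * w * y) - 1) / (Complex.I * w) := by
  have := integral_exp_mul_complex (a := 0) (b := y) (c := Complex.I * w)
    (mul_ne_zero Complex.I_ne_zero hw)
  simpa [expPrim] using this

theorem continuous_green (w : ℂ) : Continuous fun p : ℝ × ℝ => green w p.1 p.2 := by
  have := continuous_expPrim w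
  unfold green
  fun_prop

theorem continuous_green_left (x t : ℝ) : Continuous fun w => green w x t := by
  have := continuous_expPrim_left
  unfold green
  fun_prop

theorem green_comm (w : ℂ) (x t : ℝ) : green w x t = green w t x := by
  rw [green, green, add_comm, abs_sub_comm]

theorem norm_exp_le_one {w : ℂ} (hw : 0 ≤ w.im) {r : ℝ} (hr : 0 ≤ r) :
    ‖Complex.exp (Complex.I * w * r)‖ ≤ 1 := by
  rw [Complex.norm_exp, Real.exp_le_one_iff]
  simp
  positivity

/-- The kernel is half the integral of an exponential of modulus at most one over an interval of
length `2 * min x t`. The bound is uniform in the closed half-plane, including `w = 0`, and serves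
as the dominating function. -/
theorem norm_green_le_min {w : ℂ} (hw : 0 ≤ w.im) {x t : ℝ} (hx : 0 ≤ x) (ht : 0 ≤ t) :
    ‖green w x t‖ ≤ min x t := by
  have hI : ∀ a b : ℝ, IntervalIntegrable (fun r : ℝ => Complex.exp (Complex.I * w * r)) volume a b :=
    fun a b => (by fun_prop : Continuous _).intervalIntegrable _ _
  have habs : |x - t| ≤ x + t := abs_le.2 ⟨by linarith, by linarith⟩
  rw [green, expPrim, expPrim, intervalIntegral.integral_interval_sub_left (hI _ _) (hI _ _), norm_div]
  have h := intervalIntegral.norm_integral_le_of_norm_le_const (a := |x - t|) (b := x + t)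
    (f := fun r : ℝ => Complex.exp (Complex.I * w * r)) (C := 1) (fun r hr => by
      rw [uIoc_of_le habs] at hr
      exact norm_exp_le_one hw ((abs_nonneg _).trans hr.1.le))
  rw [abs_of_nonneg (a := x + t - |x - t|) (by linarith)] at h
  have e : min x t = (1 * (x + t - |x - t|)) / 2 := by
    rcases le_total x t with hxt | hxt
    · rw [min_eq_left hxt, abs_of_nonpos (by linarith)]; ring
    · rw [min_eq_right hxt, abs_of_nonneg (by linarith)]; ring
  rw [e]
  simp only [Complex.norm_ofNat]
  gcongr

theorem green_eq {w : ℂ} (hw : w ≠ 0) (x t : ℝ) :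
    green w x t = (Complex.exp (Complex.I * w * (x + t : ℝ)) -
      Complex.exp (Complex.I * w * (|x - t| : ℝ))) / (2 * Complex.I * w) := by
  rw [green, expPrim_eq hw, expPrim_eq hw]
  have := Complex.I_ne_zero
  field_simp
  ring

theorem norm_green_le_inv {w : ℂ} (hw : 0 ≤ w.im) (h0 : w ≠ 0) {x t : ℝ} (hx : 0 ≤ x) (ht : 0 ≤ t) :
    ‖green w x t‖ ≤ ‖w‖⁻¹ := by
  rw [green_eq h0, norm_div]
  have h1 := norm_exp_le_one hw (add_nonneg hx ht)
  have h2 := norm_exp_le_one hw (abs_nonneg (x - t))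
  have h3 := norm_sub_le (Complex.exp (Complex.I * w * (x + t : ℝ)))
      (Complex.exp (Complex.I * w * (|x - t| : ℝ)))
  have h4 : ‖2 * Complex.I * w‖ = 2 * ‖w‖ := by simp
  have h5 : 0 < ‖w‖ := norm_pos_iff.2 h0
  rw [h4, div_le_iff₀ (by positivity)]
  field_simp
  linarith

theorem expPrim_conj (w : ℂ) (y : ℝ) :
    expPrim (-(starRingEnd ℂ) w) y = (starRingEnd ℂ) (expPrim w y) := by
  simp only [expPrim, intervalIntegral, map_sub, ← integral_conj, ← Complex.exp_conj, map_mul,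
    Complex.conj_I, Complex.conj_ofReal, neg_mul_comm]

theorem green_conj (w : ℂ) (x t : ℝ) :
    green (-(starRingEnd ℂ) w) x t = (starRingEnd ℂ) (green w x t) := by
  simp [green, expPrim_conj, map_ofNat (starRingEnd ℂ) 2]

/-- The imaginary part of the kernel on the real axis is a difference of cosines of `l (x ∓ t)`,
hence a product of sines: it separates the variables, which is what makes the imaginary part of the
form a square. -/
theorem green_sub_conj {l : ℝ} (hl : l ≠ 0) (x t : ℝ) :
    green l x t - (starRingEnd ℂ) (green l x t) =
      2 * Complex.I / l * (Real.sin (l * t) * Real.sin (l * x) : ℝ) := by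
  have hl' : (l : ℂ) ≠ 0 := by exact_mod_cast hl
  rw [Complex.sub_conj, green_eq hl']
  have e1 : ∀ y : ℝ, Complex.exp (Complex.I * l * y) = (Real.cos (l * y) : ℝ) + (Real.sin (l * y) : ℝ) * Complex.I := by
    intro y
    rw [mul_comm Complex.I, mul_right_comm, Complex.exp_mul_I]
    push_cast; ring
  rw [e1, e1]
  have e2 : (((Real.cos (l * (x + t)) : ℝ) + (Real.sin (l * (x + t)) : ℝ) * Complex.I -
      ((Real.cos (l * |x - t|) : ℝ) + (Real.sin (l * |x - t|) : ℝ) * Complex.I)) / (2 * Complex.I * l) : ℂ).im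
      = (Real.cos (l * |x - t|) - Real.cos (l * (x + t))) / (2 * l) := by
    have : (((Real.cos (l * (x + t)) : ℝ) + (Real.sin (l * (x + t)) : ℝ) * Complex.I -
      ((Real.cos (l * |x - t|) : ℝ) + (Real.sin (l * |x - t|) : ℝ) * Complex.I)) / (2 * Complex.I * l) : ℂ) =
      (((Real.sin (l * (x + t)) - Real.sin (l * |x - t|)) / (2 * l) : ℝ) : ℂ) +
      (((Real.cos (l * |x - t|) - Real.cos (l * (x + t))) / (2 * l) : ℝ) : ℂ) * Complex.I := by
      have := Complex.I_ne_zero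
      have h2 := Complex.I_sq
      push_cast
      field_simp
      linear_combination ((Complex.cos (l * (x + t)) - Complex.cos (l * (|x - t| : ℝ)))) * h2
    rw [this, Complex.add_im, Complex.ofReal_im, Complex.mul_I_im, Complex.ofReal_re, zero_add]
  rw [e2]
  have e3 : Real.cos (l * |x - t|) = Real.cos (l * x - l * t) := by
    rcases le_total 0 (x - t) with h | h
    · rw [abs_of_nonneg h, mul_sub]
    · rw [abs_of_nonpos h, mul_neg, Real.cos_neg, mul_sub]
  rw [e3, mul_add, Real.cos_add, Real.cos_sub]
  push_cast
  field_simp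
  ring

/-- Multiplication by `l` cancels the denominator of the kernel and leaves exponentials, each of
which is bounded and Lipschitz in `l`. For positive `l` the extra factor does not affect arguments,
which is why the estimate can be used for the phase. -/
theorem norm_mul_green_sub_le (l m x t : ℝ) (hx : 0 ≤ x) (ht : 0 ≤ t) (hl : l ≠ 0) (hm : m ≠ 0) :
    ‖(l : ℂ) * green l x t - m * green m x t‖ ≤ min 2 (|l - m| * x) + min 2 (|l - m| * t) := by
  have hl' : (l : ℂ) ≠ 0 := by exact_mod_cast hl
  have hm' : (m : ℂ) ≠ 0 := by exact_mod_cast hm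
  have key : ∀ y : ℝ, 0 ≤ y → ‖Complex.exp (Complex.I * l * y) - Complex.exp (Complex.I * m * y)‖ ≤
      min 2 (|l - m| * y) := by
    intro y hy
    refine le_min ?_ ?_
    · refine (norm_sub_le _ _).trans ?_
      have h1 := norm_exp_le_one (w := l) (by simp) hy
      have h2 := norm_exp_le_one (w := m) (by simp) hy
      linarith
    · have e : Complex.exp (Complex.I * l * y) - Complex.exp (Complex.I * m * y) =
          Complex.exp (Complex.I * m * y) * (Complex.exp (Complex.I * ((l - m) * y : ℝ)) - 1) := by
        rw [mul_sub, ← Complex.exp_add]; push_cast; ring_nf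
      rw [e, norm_mul]
      have h2 := norm_exp_le_one (w := m) (by simp) hy
      have h3 := Real.norm_exp_I_mul_ofReal_sub_one_le (x := (l - m) * y)
      calc _ ≤ 1 * ‖(l - m) * y‖ := by gcongr
        _ = _ := by rw [one_mul, Real.norm_eq_abs, abs_mul, abs_of_nonneg hy]
  have habs : |x - t| ≤ x + t := abs_le.2 ⟨by linarith, by linarith⟩
  have e : (l : ℂ) * green l x t - m * green m x t =
      ((Complex.exp (Complex.I * l * (x + t : ℝ)) - Complex.exp (Complex.I * m * (x + t : ℝ))) -
      (Complex.exp (Complex.I * l * (|x - t| : ℝ)) - Complex.exp (Complex.I * m * (|x - t| : ℝ)))) /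
      (2 * Complex.I) := by
    rw [green_eq hl', green_eq hm']
    have := Complex.I_ne_zero
    field_simp
    ring
  rw [e, norm_div, show ‖2 * Complex.I‖ = 2 by simp, div_le_iff₀ (by norm_num)]
  have h1 := key (x + t) (by positivity)
  have h2 := key |x - t| (abs_nonneg _)
  have h3 := norm_sub_le (Complex.exp (Complex.I * l * (x + t : ℝ)) - Complex.exp (Complex.I * m * (x + t : ℝ)))
      (Complex.exp (Complex.I * l * (|x - t| : ℝ)) - Complex.exp (Complex.I * m * (|x - t| : ℝ)))
  have h4 : min 2 (|l - m| * |x - t|) ≤ min 2 (|l - m| * (x + t)) := by gcongr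
  have h5 : min 2 (|l - m| * (x + t)) ≤ min 2 (|l - m| * x) + min 2 (|l - m| * t) := by
    have ha : 0 ≤ |l - m| * x := by positivity
    have hb : 0 ≤ |l - m| * t := by positivity
    rw [mul_add]
    generalize |l - m| * x = a at *
    generalize |l - m| * t = b at *
    simp only [min_def]
    split_ifs <;> linarith
  linarith

end GreenKernel

/-! ### The quadratic form of the free resolvent and the sine transform -/

section GreenForm

variable {f g : ℝ → ℂ}

/-- The form `⟨(L₀ - w²)⁻¹ f, g⟩`, continued to the closed upper half-plane. -/
def greenForm (f g : ℝ → ℂ) (w : ℂ) : ℂ :=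
  ∫ p : ℝ × ℝ, green w p.1 p.2 * (f p.2 * (starRingEnd ℂ) (g p.1)) ∂(halfLine.prod halfLine)

/-- The sine transform. -/
def sineTransform (f : ℝ → ℂ) (l : ℝ) : ℂ := ∫ x in Ioi (0 : ℝ), (Real.sin (l * x) : ℂ) * f x

theorem aesm_prod_conj (hf : Decay f) (hg : Decay g) :
    AEStronglyMeasurable (fun p : ℝ × ℝ => f p.2 * (starRingEnd ℂ) (g p.1))
      (halfLine.prod halfLine) :=
  hf.aesm.comp_snd.mul (Complex.continuous_conj.comp_aestronglyMeasurable hg.aesm.comp_fst)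

theorem integrable_prod_conj (hf : Decay f) (hg : Decay g) :
    Integrable (fun p : ℝ × ℝ => f p.2 * (starRingEnd ℂ) (g p.1)) (halfLine.prod halfLine) := by
  have h := (hg.integrable.norm.mul_prod hf.integrable.norm)
  refine h.mono' (aesm_prod_conj hf hg) (ae_of_all _ fun p => ?_)
  rw [norm_mul, RCLike.norm_conj, mul_comm]

theorem norm_greenForm_integrand_le {w : ℂ} (hw : 0 ≤ w.im) :
    ∀ᵐ p ∂((halfLine).prod halfLine), ‖green w p.1 p.2 * (f p.2 * (starRingEnd ℂ) (g p.1))‖ ≤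
      min p.1 p.2 * (‖f p.2‖ * ‖g p.1‖) := by
  filter_upwards [ae_prod_pos] with p hp
  rw [norm_mul, norm_mul, RCLike.norm_conj]
  gcongr
  exact norm_green_le_min hw hp.1.le hp.2.le

theorem aesm_greenForm (hf : Decay f) (hg : Decay g) (w : ℂ) :
    AEStronglyMeasurable (fun p : ℝ × ℝ => green w p.1 p.2 * (f p.2 * (starRingEnd ℂ) (g p.1)))
      (halfLine.prod halfLine) :=
  (continuous_green w).aestronglyMeasurable.mul (aesm_prod_conj hf hg)

theorem integrable_greenForm (hf : Decay f) (hg : Decay g) {w : ℂ} (hw : 0 ≤ w.im) :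
    Integrable (fun p : ℝ × ℝ => green w p.1 p.2 * (f p.2 * (starRingEnd ℂ) (g p.1)))
      (halfLine.prod halfLine) :=
  (hf.integrable_min_mul hg).mono' (aesm_greenForm hf hg w) (norm_greenForm_integrand_le hw)

/-- The Hardy-type bound with the kernel `min x t` dominates the integrand uniformly in `w`; this is
where the boundary values, including the one at `0`, come from. -/
theorem continuousOn_greenForm (hf : Decay f) (hg : Decay g) :
    ContinuousOn (greenForm f g) {w | 0 ≤ w.im} := by
  intro w _
  refine tendsto_integral_filter_of_dominated_convergence _ ?_ ?_ (hf.integrable_min_mul hg) ?_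
  · exact Eventually.of_forall fun w => aesm_greenForm hf hg w
  · filter_upwards [self_mem_nhdsWithin] with w hw
    exact norm_greenForm_integrand_le hw
  · refine ae_of_all _ fun p => ?_
    exact (((continuous_green_left p.1 p.2).mul continuous_const).tendsto w).mono_left
      nhdsWithin_le_nhds

theorem norm_greenForm_le (hf : Decay f) (hg : Decay g) {w : ℂ} (hw : 0 ≤ w.im) (h0 : w ≠ 0) :
    ‖greenForm f g w‖ ≤ ‖w‖⁻¹ * ∫ p : ℝ × ℝ, ‖f p.2 * (starRingEnd ℂ) (g p.1)‖ ∂(halfLine.prod halfLine) := by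
  rw [← integral_const_mul]
  refine norm_integral_le_of_norm_le ((integrable_prod_conj hf hg).norm.const_mul _) ?_
  filter_upwards [ae_prod_pos] with p hp
  rw [norm_mul]
  gcongr
  exact norm_green_le_inv hw h0 hp.1.le hp.2.le

theorem greenForm_conj (f : ℝ → ℂ) (w : ℂ) :
    greenForm f f (-(starRingEnd ℂ) w) = (starRingEnd ℂ) (greenForm f f w) := by
  rw [greenForm, greenForm, ← integral_conj, ← integral_prod_swap]
  congr 1; ext p
  simp only [Prod.fst_swap, Prod.snd_swap, map_mul, Complex.conj_conj]
  rw [green_conj, green_comm]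
  ring

theorem integral_sin_mul_conj (f : ℝ → ℂ) (l : ℝ) :
    ∫ x in Ioi (0 : ℝ), (Real.sin (l * x) : ℂ) * (starRingEnd ℂ) (f x) =
      (starRingEnd ℂ) (sineTransform f l) := by
  rw [sineTransform, ← integral_conj]
  congr 1; ext x
  simp [Complex.conj_ofReal, -Complex.ofReal_sin]

/-- The form at `-l` is the conjugate of the form at `l`, and the difference of the kernels is a
product of sines, so the double integral factors into the sine transform times its conjugate. -/
theorem greenForm_sub_conj (hf : Decay f) {l : ℝ} (hl : l ≠ 0) :
    greenForm f f l - (starRingEnd ℂ) (greenForm f f l) =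
      2 * Complex.I / l * (‖sineTransform f l‖ ^ 2 : ℝ) := by
  have i1 := integrable_greenForm hf hf (w := (l : ℂ)) (by simp)
  have i2 := integrable_greenForm hf hf (w := -(starRingEnd ℂ) (l : ℂ)) (by simp)
  rw [← greenForm_conj, greenForm, greenForm, ← integral_sub i1 i2]
  have e : ∀ p : ℝ × ℝ, green l p.1 p.2 * (f p.2 * (starRingEnd ℂ) (f p.1)) -
      green (-(starRingEnd ℂ) (l : ℂ)) p.1 p.2 * (f p.2 * (starRingEnd ℂ) (f p.1)) =
      2 * Complex.I / l * (((Real.sin (l * p.1) : ℂ) * (starRingEnd ℂ) (f p.1)) *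
        ((Real.sin (l * p.2) : ℂ) * f p.2)) := by
    intro p
    rw [green_conj, ← sub_mul, green_sub_conj hl]
    push_cast; ring
  simp_rw [e]
  rw [integral_const_mul, integral_prod_mul (fun x : ℝ => (Real.sin (l * x) : ℂ) * (starRingEnd ℂ) (f x))
    (fun t : ℝ => (Real.sin (l * t) : ℂ) * f t)]
  rw [integral_sin_mul_conj]
  congr 1
  have := Complex.conj_mul' (sineTransform f l)
  simp only [sineTransform] at this ⊢
  rw [this]; push_cast; rfl

theorem greenForm_im (hf : Decay f) {l : ℝ} (hl : l ≠ 0) :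
    (greenForm f f l).im = ‖sineTransform f l‖ ^ 2 / l := by
  have h := greenForm_sub_conj hf hl
  rw [Complex.sub_conj] at h
  have hl' : (l : ℂ) ≠ 0 := by exact_mod_cast hl
  have h2 : (((greenForm f f l).im : ℝ) : ℂ) = ((‖sineTransform f l‖ ^ 2 / l : ℝ) : ℂ) := by
    have := Complex.I_ne_zero
    push_cast at h ⊢
    field_simp at h ⊢
    linear_combination h
  exact_mod_cast h2

/-- `λ ↦ λ ⟨R₀(λ² + i0) f, f⟩` is Hölder continuous of order `1/2`. -/
theorem greenForm_holder (hf : Decay f) : ∃ C : ℝ, 0 ≤ C ∧ ∀ l m : ℝ, l ≠ 0 → m ≠ 0 → |l - m| ≤ 1 →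
    ‖(l : ℂ) * greenForm f f l - m * greenForm f f m‖ ≤ C * √|l - m| := by
  obtain ⟨A, hA, hmin⟩ := hf.integral_min_le (κ := 1) one_pos
  set N := ∫ x in Ioi (0 : ℝ), ‖f x‖ with hN
  have hN0 : 0 ≤ N := integral_nonneg fun _ => norm_nonneg _
  refine ⟨2 * (N * (A + 1)), by positivity, fun l m hl hm hlm => ?_⟩
  rcases eq_or_ne l m with rfl | hne
  · simp
  have hδ : 0 < |l - m| := abs_pos.2 (sub_ne_zero.2 hne)
  have i1 := integrable_greenForm hf hf (w := (l : ℂ)) (by simp)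
  have i2 := integrable_greenForm hf hf (w := (m : ℂ)) (by simp)
  rw [greenForm, greenForm, ← integral_const_mul, ← integral_const_mul,
    ← integral_sub (i1.const_mul _) (i2.const_mul _)]
  have j1 := hf.integrable_min _ hδ.le
  have j := (j1.mul_prod hf.integrable.norm).add (hf.integrable.norm.mul_prod j1)
  refine (norm_integral_le_of_norm_le j ?_).trans ?_
  · filter_upwards [ae_prod_pos] with p hp
    have e : (l : ℂ) * (green l p.1 p.2 * (f p.2 * (starRingEnd ℂ) (f p.1))) -
        m * (green m p.1 p.2 * (f p.2 * (starRingEnd ℂ) (f p.1))) =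
        (l * green l p.1 p.2 - m * green m p.1 p.2) * (f p.2 * (starRingEnd ℂ) (f p.1)) := by ring
    rw [e, norm_mul, norm_mul, RCLike.norm_conj]
    calc _ ≤ (min 2 (|l - m| * p.1) + min 2 (|l - m| * p.2)) * (‖f p.2‖ * ‖f p.1‖) := by
          gcongr
          exact norm_mul_green_sub_le l m p.1 p.2 hp.1.le hp.2.le hl hm
      _ = _ := by simp only [Pi.add_apply]; ring
  · simp only [Pi.add_apply]
    rw [integral_add (j1.mul_prod hf.integrable.norm) (hf.integrable.norm.mul_prod j1),
      integral_prod_mul (fun x => min 2 (|l - m| * x) * ‖f x‖) (fun x => ‖f x‖),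
      integral_prod_mul (fun x => ‖f x‖) (fun x => min 2 (|l - m| * x) * ‖f x‖)]
    have h1 := hmin _ hδ
    have h2 : |l - m| ≤ √|l - m| := by
      rw [Real.le_sqrt' hδ]
      nlinarith
    have h3 : ∫ x in Ioi (0 : ℝ), min 2 (|l - m| * x) * ‖f x‖ ≤ (A + 1) * √|l - m| := by
      nlinarith
    calc _ ≤ (A + 1) * √|l - m| * N + N * ((A + 1) * √|l - m|) := by gcongr
      _ = _ := by ring

theorem integrable_sin_mul (hf : Decay f) (l : ℝ) :
    Integrable (fun x : ℝ => (Real.sin (l * x) : ℂ) * f x) halfLine := by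
  refine hf.integrable.bdd_mul (c := 1) (by fun_prop) (ae_of_all _ fun x => ?_)
  rw [Complex.norm_real]
  exact Real.abs_sin_le_one _

theorem sineTransform_neg (f : ℝ → ℂ) (l : ℝ) : sineTransform f (-l) = -sineTransform f l := by
  rw [sineTransform, sineTransform, ← integral_neg]
  congr 1; ext x
  rw [neg_mul, Real.sin_neg]; push_cast; ring

theorem abs_sin_sub_le (l m x : ℝ) (hx : 0 ≤ x) :
    |Real.sin (l * x) - Real.sin (m * x)| ≤ min 2 (|l - m| * x) := by
  refine le_min ?_ ?_
  · have h1 := Real.abs_sin_le_one (l * x)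
    have h2 := Real.abs_sin_le_one (m * x)
    have := abs_sub (Real.sin (l * x)) (Real.sin (m * x))
    linarith
  · have := Convex.norm_image_sub_le_of_norm_deriv_le (f := Real.sin) (C := 1) (s := univ)
      (x := m * x) (y := l * x) (fun x _ => Real.differentiableAt_sin) (fun x _ => by
      rw [Real.deriv_sin]; exact Real.abs_cos_le_one _) convex_univ trivial trivial
    rw [← sub_mul] at this
    simpa [abs_mul, abs_of_nonneg hx] using this

theorem norm_sineTransform_sub_le (hf : Decay f) (l m : ℝ) :
    ‖sineTransform f l - sineTransform f m‖ ≤ ∫ x in Ioi (0 : ℝ), min 2 (|l - m| * x) * ‖f x‖ := by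
  rw [sineTransform, sineTransform, ← integral_sub (integrable_sin_mul hf l) (integrable_sin_mul hf m)]
  refine norm_integral_le_of_norm_le (hf.integrable_min _ (abs_nonneg _)) ?_
  filter_upwards [ae_restrict_mem measurableSet_Ioi] with x hx
  rw [← sub_mul, norm_mul, ← Complex.ofReal_sub, Complex.norm_real]
  gcongr
  exact abs_sin_sub_le l m x (le_of_lt hx)

theorem continuous_sineTransform (hf : Decay f) : Continuous (sineTransform f) := by
  refine continuous_of_dominated (bound := fun x => ‖f x‖) (fun l =>
    (integrable_sin_mul hf l).aestronglyMeasurable) (fun l => ae_of_all _ fun x => ?_)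
    hf.integrable.norm (ae_of_all _ fun x => by fun_prop)
  rw [norm_mul, Complex.norm_real]
  exact mul_le_of_le_one_left (norm_nonneg _) (Real.abs_sin_le_one _)

/-- The sine transform is little-o Hölder continuous of order `1/2`. -/
theorem sineTransform_modulus (hf : Decay f) {κ : ℝ} (hκ : 0 < κ) :
    ∃ δ₀ > 0, ∀ l m : ℝ, |l - m| ≤ δ₀ → ‖sineTransform f l - sineTransform f m‖ ≤ κ * √|l - m| := by
  obtain ⟨A, hA, hmin⟩ := hf.integral_min_le (κ := κ / 2) (by positivity)
  -- The radius is chosen so that `A * √δ ≤ κ / 2`, which absorbs the linear term `A * δ` into `κ /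
  -- 2 * √δ`.
  refine ⟨(κ / (2 * (A + 1))) ^ 2, by positivity, fun l m hlm => ?_⟩
  rcases eq_or_ne l m with rfl | hne
  · simp
  have hδ : 0 < |l - m| := abs_pos.2 (sub_ne_zero.2 hne)
  refine (norm_sineTransform_sub_le hf l m).trans ((hmin _ hδ).trans ?_)
  have h1 : √|l - m| ≤ κ / (2 * (A + 1)) := by
    rw [Real.sqrt_le_left (by positivity)]; exact hlm
  have h2 : |l - m| = √|l - m| * √|l - m| := (Real.mul_self_sqrt hδ.le).symm
  have h3 : A * √|l - m| ≤ κ / 2 := by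
    calc A * √|l - m| ≤ (A + 1) * (κ / (2 * (A + 1))) := by gcongr; linarith
      _ = κ / 2 := by field_simp
  have h4 : 0 ≤ √|l - m| := Real.sqrt_nonneg _
  calc A * |l - m| + κ / 2 * √|l - m| = (A * √|l - m|) * √|l - m| + κ / 2 * √|l - m| := by
        nth_rewrite 1 [h2]; ring
    _ ≤ κ / 2 * √|l - m| + κ / 2 * √|l - m| := by gcongr
    _ = _ := by ring

end GreenForm

/-! ### Spectral representation of the free resolvent -/

section Spectral

open FourierTransform

variable {f g : ℝ → ℂ}

theorem one_add_sq_le_norm_sub_sq {z : ℂ} (hz : z.im ≠ 0) (t : ℝ) :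
    1 + t ^ 2 ≤ (2 + (1 + 2 * z.re ^ 2) / z.im ^ 2) * ‖(t : ℂ) - z‖ ^ 2 := by
  have h0 : 0 < z.im ^ 2 := by positivity
  have e : ‖(t : ℂ) - z‖ ^ 2 = (t - z.re) ^ 2 + z.im ^ 2 := by
    rw [← Complex.normSq_eq_norm_sq, Complex.normSq_apply]
    simp; ring
  rw [e]
  have h1 : (1 + 2 * z.re ^ 2) / z.im ^ 2 * z.im ^ 2 = 1 + 2 * z.re ^ 2 := by field_simp
  have h2 : 0 ≤ (1 + 2 * z.re ^ 2) / z.im ^ 2 := by positivity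
  nlinarith [sq_nonneg (t - 2 * z.re), mul_nonneg h2 (sq_nonneg (t - z.re))]

theorem sq_sub_sq_ne_zero {w : ℂ} (hw : w.im ≠ 0) (s : ℝ) : (s : ℂ) ^ 2 - w ^ 2 ≠ 0 := by
  rw [sq_sub_sq]
  refine mul_ne_zero ?_ ?_ <;>
  · intro h
    have := congrArg Complex.im h
    simp at this
    exact hw this

theorem norm_inv_sq_sub_sq_le {w : ℂ} (hw : w.im ≠ 0) :
    ∃ C : ℝ, 0 ≤ C ∧ ∀ s : ℝ, ‖(s : ℂ) ^ 2 - w ^ 2‖⁻¹ ≤ C * (1 + s ^ 2)⁻¹ := by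
  set C := 2 + (1 + 2 * w.re ^ 2) / w.im ^ 2 with hC
  have hC0 : 0 ≤ C := by positivity
  refine ⟨C, hC0, fun s => ?_⟩
  have h1 := one_add_sq_le_norm_sub_sq hw s
  have h2 := one_add_sq_le_norm_sub_sq (z := -w) (by simpa using hw) s
  simp only [Complex.neg_re, Complex.neg_im, neg_sq, sub_neg_eq_add, ← hC] at h1 h2
  have hne := norm_pos_iff.2 (sq_sub_sq_ne_zero hw s)
  rw [← div_eq_mul_inv, inv_eq_one_div, div_le_div_iff₀ hne (by positivity), one_mul]
  have h3 : ((1 : ℝ) + s ^ 2) ^ 2 ≤ (C * ‖(s : ℂ) ^ 2 - w ^ 2‖) ^ 2 := by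
    rw [sq_sub_sq (s : ℂ), norm_mul]
    calc ((1 : ℝ) + s ^ 2) ^ 2 = (1 + s ^ 2) * (1 + s ^ 2) := by ring
      _ ≤ (C * ‖(s : ℂ) - w‖ ^ 2) * (C * ‖(s : ℂ) + w‖ ^ 2) := by gcongr
      _ = _ := by ring
  exact (sq_le_sq₀ (by positivity) (by positivity)).1 h3

theorem integrable_inv_sq_sub_sq {w : ℂ} (hw : w.im ≠ 0) :
    Integrable (fun s : ℝ => ((s : ℂ) ^ 2 - w ^ 2)⁻¹) := by
  obtain ⟨C, -, hC⟩ := norm_inv_sq_sub_sq_le hw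
  refine (integrable_inv_one_add_sq.const_mul C).mono' ?_ (ae_of_all _ fun s => ?_)
  · exact Continuous.aestronglyMeasurable
      (Continuous.inv₀ (by fun_prop) (fun s => sq_sub_sq_ne_zero hw s))
  · rw [norm_inv]; exact hC s

/-- The Fourier transform of `a ↦ e^{iw|a|}`. -/
theorem fourier_exp_abs {w : ℂ} (hw : 0 < w.im) :
    Integrable (fun a : ℝ => Complex.exp (Complex.I * w * (|a| : ℝ))) ∧
    ∀ ξ : ℝ, 𝓕 (fun a : ℝ => Complex.exp (Complex.I * w * (|a| : ℝ))) ξ =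
      -2 * Complex.I * w * (((2 * Real.pi * ξ : ℝ) : ℂ) ^ 2 - w ^ 2)⁻¹ := by
  have hpos : ∀ s : ℝ, ((Complex.I * (w - s)).re < 0) := by intro s; simp [hw]
  have i1 : ∀ s : ℝ, IntegrableOn (fun a : ℝ => Complex.exp (Complex.I * (w - s) * a)) (Ioi 0) :=
    fun s => integrableOn_exp_mul_complex_Ioi (hpos s) 0
  have v1 : ∀ s : ℝ, ∫ a in Ioi (0 : ℝ), Complex.exp (Complex.I * (w - s) * a) =
      -1 / (Complex.I * (w - s)) := fun s => by
    rw [integral_exp_mul_complex_Ioi (hpos s)]; simp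
  -- the integrand on the two half-lines
  have key : ∀ s : ℝ, Integrable (fun a : ℝ => Complex.exp (Complex.I * w * (|a| : ℝ)) *
      Complex.exp (-(Complex.I * s * a))) ∧
      ∫ a : ℝ, Complex.exp (Complex.I * w * (|a| : ℝ)) * Complex.exp (-(Complex.I * s * a)) =
      -1 / (Complex.I * (w - s)) + -1 / (Complex.I * (w + s)) := by
    intro s
    have e1 : ∀ a ∈ Ioi (0 : ℝ), Complex.exp (Complex.I * (w - s) * a) =
        Complex.exp (Complex.I * w * (|a| : ℝ)) * Complex.exp (-(Complex.I * s * a)) := by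
      intro a ha
      rw [abs_of_pos ha, ← Complex.exp_add]; ring_nf
    have e2 : ∀ a ∈ Ioi (0 : ℝ), Complex.exp (Complex.I * (w - (-s : ℝ)) * a) =
        Complex.exp (Complex.I * w * (|-a| : ℝ)) * Complex.exp (-(Complex.I * s * (-a : ℝ))) := by
      intro a ha
      rw [abs_neg, abs_of_pos ha, ← Complex.exp_add]; push_cast; ring_nf
    have j1 := (i1 s).congr_fun e1 measurableSet_Ioi
    have j2' := (i1 (-s)).congr_fun e2 measurableSet_Ioi
    have j2 : IntegrableOn (fun a : ℝ => Complex.exp (Complex.I * w * (|a| : ℝ)) *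
      Complex.exp (-(Complex.I * s * a))) (Iic 0) := by
      rw [← integrableOn_Ici_iff_integrableOn_Ioi] at j2'
      have h3 := (MeasurePreserving.integrableOn_comp_preimage (Measure.measurePreserving_neg volume)
        (MeasurableEquiv.neg ℝ).measurableEmbedding (f := fun a : ℝ => Complex.exp (Complex.I * w * (|a| : ℝ)) *
          Complex.exp (-(Complex.I * s * a))) (s := Iic 0)).1
      have h4 : IntegrableOn ((fun a : ℝ => Complex.exp (Complex.I * w * (|a| : ℝ)) *
          Complex.exp (-(Complex.I * s * a))) ∘ Neg.neg) (Neg.neg ⁻¹' Iic 0) := by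
        simpa [Function.comp_def] using j2'
      exact h3 h4
    refine ⟨?_, ?_⟩
    · rw [← integrableOn_univ, ← Iic_union_Ioi (a := (0 : ℝ))]
      exact j2.union j1
    · rw [← intervalIntegral.integral_Iic_add_Ioi j2 j1, ← setIntegral_congr_fun measurableSet_Ioi e1,
        v1 s, add_comm]
      congr 1
      have h5 := integral_comp_neg_Ioi (0 : ℝ) (fun a : ℝ => Complex.exp (Complex.I * w * (|a| : ℝ)) *
          Complex.exp (-(Complex.I * s * a)))
      rw [neg_zero] at h5
      rw [← h5, ← setIntegral_congr_fun measurableSet_Ioi e2, v1 (-s)]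
      push_cast; ring
  refine ⟨by simpa using (key 0).1, fun ξ => ?_⟩
  rw [Real.fourier_real_eq_integral_exp_smul]
  have h1 := (key (2 * Real.pi * ξ)).2
  have e : ∀ a : ℝ, Complex.exp ((-2 * Real.pi * a * ξ : ℝ) * Complex.I) • Complex.exp (Complex.I * w * (|a| : ℝ)) =
      Complex.exp (Complex.I * w * (|a| : ℝ)) * Complex.exp (-(Complex.I * ((2 * Real.pi * ξ : ℝ) : ℂ) * a)) := by
    intro a
    rw [smul_eq_mul, mul_comm]
    congr 2
    push_cast; ring
  simp_rw [e]
  rw [h1]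
  have hne := sq_sub_sq_ne_zero hw.ne' (2 * Real.pi * ξ)
  generalize ((2 * Real.pi * ξ : ℝ) : ℂ) = s at *
  have h2 : w - s ≠ 0 := by
    intro h; apply hne; rw [sub_eq_zero.1 h]; ring
  have h3 : w + s ≠ 0 := by
    intro h; apply hne; rw [eq_neg_of_add_eq_zero_left h]; ring
  have := Complex.I_ne_zero
  have hI := Complex.I_sq
  field_simp
  linear_combination (-2 * w * (s ^ 2 - w ^ 2)) * hI

/-- Fourier inversion for `a ↦ exp (I w |a|)`, whose transform is explicit; this takes the place of
a residue computation. -/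
theorem integral_exp_div_sq_sub_sq {w : ℂ} (hw : 0 < w.im) (a : ℝ) :
    ∫ s : ℝ, Complex.exp (Complex.I * s * a) * ((s : ℂ) ^ 2 - w ^ 2)⁻¹ =
      Real.pi * Complex.I / w * Complex.exp (Complex.I * w * (|a| : ℝ)) := by
  obtain ⟨hi, hF⟩ := fourier_exp_abs hw
  have hcont : Continuous (fun a : ℝ => Complex.exp (Complex.I * w * (|a| : ℝ))) := by fun_prop
  have hπ := Real.pi_pos
  have hFi : Integrable (𝓕 (fun a : ℝ => Complex.exp (Complex.I * w * (|a| : ℝ)))) := by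
    have := ((integrable_inv_sq_sub_sq hw.ne').comp_mul_left' (R := 2 * Real.pi) (by positivity)).const_mul
      (-2 * Complex.I * w)
    refine this.congr (ae_of_all _ fun ξ => ?_)
    simp only [hF]
  have h := congrFun (hcont.fourierInv_fourier_eq hi hFi) a
  rw [Real.fourierInv_eq_fourier_neg, Real.fourier_real_eq_integral_exp_smul] at h
  simp_rw [hF, smul_eq_mul] at h
  have e : ∀ ξ : ℝ, Complex.exp ((-2 * Real.pi * ξ * (-a) : ℝ) * Complex.I) *
      (-2 * Complex.I * w * (((2 * Real.pi * ξ : ℝ) : ℂ) ^ 2 - w ^ 2)⁻¹) =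
      (fun s : ℝ => (-2 * Complex.I * w) * (Complex.exp (Complex.I * s * a) * ((s : ℂ) ^ 2 - w ^ 2)⁻¹))
        (2 * Real.pi * ξ) := by
    intro ξ
    simp only
    rw [mul_left_comm]
    congr 3
    push_cast; ring
  simp_rw [e] at h
  rw [Measure.integral_comp_mul_left (fun s : ℝ => (-2 * Complex.I * w) *
    (Complex.exp (Complex.I * s * a) * ((s : ℂ) ^ 2 - w ^ 2)⁻¹)), integral_const_mul,
    abs_of_pos (by positivity)] at h
  rw [← h]
  have hw0 : w ≠ 0 := by rintro rfl; simp at hw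
  have hπ' : (Real.pi : ℂ) ≠ 0 := by exact_mod_cast hπ.ne'
  have hI := Complex.I_sq
  rw [Complex.real_smul]
  generalize ∫ s : ℝ, Complex.exp (Complex.I * s * a) * ((s : ℂ) ^ 2 - w ^ 2)⁻¹ = J
  push_cast
  field_simp
  linear_combination J * hI

/-- The product of sines is half the difference of the cosines of `s (x - t)` and `s (x + t)`, and
each cosine integrates to one of the exponentials of the kernel. -/
theorem green_eq_integral {w : ℂ} (hw : 0 < w.im) {x t : ℝ} (hx : 0 ≤ x) (ht : 0 ≤ t) :
    green w x t = (1 / Real.pi) * ∫ s : ℝ, (Real.sin (s * x) * Real.sin (s * t) : ℝ) * ((s : ℂ) ^ 2 - w ^ 2)⁻¹ := by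
  have hi : ∀ a : ℝ, Integrable fun s : ℝ => Complex.exp (Complex.I * s * a) * ((s : ℂ) ^ 2 - w ^ 2)⁻¹ := by
    intro a
    refine (integrable_inv_sq_sub_sq hw.ne').bdd_mul (c := 1) (by fun_prop) (ae_of_all _ fun s => ?_)
    rw [Complex.norm_exp]
    simp
  have e : ∀ s : ℝ, ((Real.sin (s * x) * Real.sin (s * t) : ℝ) : ℂ) * ((s : ℂ) ^ 2 - w ^ 2)⁻¹ =
      (1 / 4) * (Complex.exp (Complex.I * s * (x - t : ℝ)) * ((s : ℂ) ^ 2 - w ^ 2)⁻¹ +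
        Complex.exp (Complex.I * s * (-(x - t) : ℝ)) * ((s : ℂ) ^ 2 - w ^ 2)⁻¹ -
        (Complex.exp (Complex.I * s * (x + t : ℝ)) * ((s : ℂ) ^ 2 - w ^ 2)⁻¹ +
        Complex.exp (Complex.I * s * (-(x + t) : ℝ)) * ((s : ℂ) ^ 2 - w ^ 2)⁻¹)) := by
    intro s
    have e1 : ∀ y : ℝ, Complex.exp (Complex.I * s * y) + Complex.exp (Complex.I * s * (-y : ℝ)) =
        2 * (Real.cos (s * y) : ℝ) := by
      intro y
      push_cast
      rw [Complex.two_cos]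
      congr 2 <;> ring
    have e2 : (Real.sin (s * x) * Real.sin (s * t) : ℝ) = (Real.cos (s * (x - t)) - Real.cos (s * (x + t))) / 2 := by
      rw [mul_sub, mul_add, Real.cos_sub, Real.cos_add]; ring
    rw [← add_mul, ← add_mul, ← sub_mul, e1, e1, e2]
    push_cast; ring
  have hi₂ : ∀ a b : ℝ, Integrable fun s : ℝ => Complex.exp (Complex.I * s * a) * ((s : ℂ) ^ 2 - w ^ 2)⁻¹ +
      Complex.exp (Complex.I * s * b) * ((s : ℂ) ^ 2 - w ^ 2)⁻¹ := fun a b => (hi a).add (hi b)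
  simp_rw [e]
  rw [integral_const_mul, integral_sub (hi₂ _ _) (hi₂ _ _), integral_add (hi _) (hi _),
    integral_add (hi _) (hi _)]
  simp_rw [integral_exp_div_sq_sub_sq hw, abs_neg]
  have hw0 : w ≠ 0 := by rintro rfl; simp at hw
  rw [abs_of_nonneg (add_nonneg hx ht), green_eq hw0]
  have hπ' : (Real.pi : ℂ) ≠ 0 := by exact_mod_cast Real.pi_ne_zero
  have hI := Complex.I_sq
  have := Complex.I_ne_zero
  generalize Complex.exp (Complex.I * w * (x + t : ℝ)) = P
  generalize Complex.exp (Complex.I * w * (|x - t| : ℝ)) = Q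
  field_simp
  linear_combination (4 * (P - Q)) * hI

/-- The spectral representation of the quadratic form of the free resolvent. -/
theorem greenForm_eq_integral (hf : Decay f) {w : ℂ} (hw : 0 < w.im) :
    greenForm f f w = (1 / Real.pi) *
      ∫ s : ℝ, ((‖sineTransform f s‖ ^ 2 : ℝ) : ℂ) * ((s : ℂ) ^ 2 - w ^ 2)⁻¹ := by
  have hint : Integrable (Function.uncurry fun (p : ℝ × ℝ) (s : ℝ) =>
      ((Real.sin (s * p.1) * Real.sin (s * p.2) : ℝ) : ℂ) * ((f p.2 * (starRingEnd ℂ) (f p.1)) *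
        ((s : ℂ) ^ 2 - w ^ 2)⁻¹)) ((halfLine.prod halfLine).prod volume) := by
    refine ((integrable_prod_conj hf hf).mul_prod (integrable_inv_sq_sub_sq hw.ne')).bdd_mul
      (c := 1) ?_ (ae_of_all _ fun q => ?_)
    · refine Continuous.aestronglyMeasurable ?_
      fun_prop
    · rw [Complex.norm_real, norm_mul]
      exact mul_le_one₀ (Real.abs_sin_le_one _) (norm_nonneg _) (Real.abs_sin_le_one _)
  have e1 : greenForm f f w = (1 / Real.pi) * ∫ p : ℝ × ℝ, (∫ s : ℝ,
      ((Real.sin (s * p.1) * Real.sin (s * p.2) : ℝ) : ℂ) * ((f p.2 * (starRingEnd ℂ) (f p.1)) *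
        ((s : ℂ) ^ 2 - w ^ 2)⁻¹)) ∂(halfLine.prod halfLine) := by
    rw [greenForm, ← integral_const_mul]
    refine integral_congr_ae ?_
    filter_upwards [ae_prod_pos] with p hp
    rw [green_eq_integral hw hp.1.le hp.2.le, mul_assoc, ← integral_mul_const]
    congr 2; ext s
    ring
  rw [e1, integral_integral_swap hint]
  congr 2; ext s
  have e2 : ∀ p : ℝ × ℝ, ((Real.sin (s * p.1) * Real.sin (s * p.2) : ℝ) : ℂ) *
      ((f p.2 * (starRingEnd ℂ) (f p.1)) * ((s : ℂ) ^ 2 - w ^ 2)⁻¹) =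
      (((Real.sin (s * p.1) : ℂ) * (starRingEnd ℂ) (f p.1)) *
        ((Real.sin (s * p.2) : ℂ) * f p.2)) * ((s : ℂ) ^ 2 - w ^ 2)⁻¹ := by
    intro p; push_cast; ring
  simp_rw [e2]
  rw [integral_mul_const, integral_prod_mul (fun x : ℝ => (Real.sin (s * x) : ℂ) * (starRingEnd ℂ) (f x))
    (fun t : ℝ => (Real.sin (s * t) : ℂ) * f t), integral_sin_mul_conj]
  congr 1
  have := Complex.conj_mul' (sineTransform f s)
  simp only [sineTransform] at this ⊢
  rw [this]; push_cast; rfl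

end Spectral

/-! ### Plancherel for the half-line and sine transforms -/

section Hardy

open FourierTransform

variable {f g : ℝ → ℂ}

/-- The Fourier transform of a function on the half-axis. -/
def halfFourier (f : ℝ → ℂ) (l : ℝ) : ℂ :=
  ∫ x in Ioi (0 : ℝ), Complex.exp (-(Complex.I * l * x)) * f x

theorem integrable_exp_mul {μ : Measure ℝ} (hf : Integrable f μ) (l : ℝ) :
    Integrable (fun x : ℝ => Complex.exp (-(Complex.I * l * x)) * f x) μ := by
  refine hf.bdd_mul (c := 1) (by fun_prop) (ae_of_all _ fun x => ?_)
  rw [Complex.norm_exp]; simp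

theorem sineTransform_eq (hf : Integrable f halfLine) (l : ℝ) :
    sineTransform f l = (halfFourier f (-l) - halfFourier f l) / (2 * Complex.I) := by
  rw [halfFourier, halfFourier, ← integral_sub (integrable_exp_mul hf _) (integrable_exp_mul hf _),
    sineTransform, ← integral_div]
  congr 1; ext x
  rw [← sub_mul, mul_div_right_comm]
  congr 1
  rw [Complex.ofReal_sin, Complex.sin]
  have := Complex.I_ne_zero
  have hI := Complex.I_sq
  push_cast
  field_simp
  rw [hI]
  ring_nf

theorem fourier_indicator (f : ℝ → ℂ) (ξ : ℝ) :
    𝓕 ((Ioi (0 : ℝ)).indicator f) ξ = halfFourier f (2 * Real.pi * ξ) := by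
  rw [Real.fourier_real_eq_integral_exp_smul, halfFourier, ← integral_indicator measurableSet_Ioi]
  congr 1; ext x
  by_cases hx : x ∈ Ioi (0 : ℝ)
  · rw [indicator_of_mem hx, indicator_of_mem hx, smul_eq_mul]
    congr 2; push_cast; ring
  · rw [indicator_of_notMem hx, indicator_of_notMem hx, smul_zero]

/-- Plancherel's theorem on the half-axis. -/
theorem plancherel_halfFourier (h1 : Integrable f halfLine) (h2 : MemLp f 2 halfLine) :
    Integrable (fun s => ‖halfFourier f s‖ ^ 2) ∧
      ∫ s, ‖halfFourier f s‖ ^ 2 = 2 * Real.pi * ∫ x in Ioi (0 : ℝ), ‖f x‖ ^ 2 := by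
  have i1 : Integrable ((Ioi (0 : ℝ)).indicator f) := (integrable_indicator_iff measurableSet_Ioi).2 h1
  have i2 : MemLp ((Ioi (0 : ℝ)).indicator f) 2 := (memLp_indicator_iff_restrict measurableSet_Ioi).2 h2
  have hP := integral_norm_sq_fourier i1 i2
  have hI : Integrable (fun ξ => ‖𝓕 ((Ioi (0 : ℝ)).indicator f) ξ‖ ^ 2) :=
    (memLp_two_iff_integrable_sq_norm (memLp_fourier i1 i2).1).1 (memLp_fourier i1 i2)
  simp_rw [fourier_indicator] at hP hI
  have hπ := Real.pi_pos
  have hI' := (integrable_comp_mul_left_iff (fun s => ‖halfFourier f s‖ ^ 2)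
    (R := 2 * Real.pi) (by positivity)).1 hI
  refine ⟨hI', ?_⟩
  rw [Measure.integral_comp_mul_left (fun s => ‖halfFourier f s‖ ^ 2), smul_eq_mul,
    abs_of_pos (by positivity)] at hP
  have e : ∫ x, ‖(Ioi (0 : ℝ)).indicator f x‖ ^ 2 = ∫ x in Ioi (0 : ℝ), ‖f x‖ ^ 2 := by
    rw [← integral_indicator measurableSet_Ioi]
    congr 1; ext x
    by_cases hx : x ∈ Ioi (0 : ℝ) <;> simp [indicator, hx]
  rw [e] at hP
  rw [← hP]
  field_simp

/-- Plancherel's theorem for the sine transform. -/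
theorem plancherel_sineTransform (hf : Decay f) :
    Integrable (fun s => ‖sineTransform f s‖ ^ 2) ∧
      ∫ s, ‖sineTransform f s‖ ^ 2 = Real.pi * ∫ x in Ioi (0 : ℝ), ‖f x‖ ^ 2 := by
  set F : ℝ → ℂ := (Ioi (0 : ℝ)).indicator f with hF
  have i1 : Integrable F := (integrable_indicator_iff measurableSet_Ioi).2 hf.integrable
  have i2 : MemLp F 2 := (memLp_indicator_iff_restrict measurableSet_Ioi).2 hf.memLp
  have j1 : Integrable (fun x => F (-x)) := i1.comp_neg
  have j2 : MemLp (fun x => F (-x)) 2 := i2.comp_measurePreserving (Measure.measurePreserving_neg volume)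
  -- The sine transform of `f` is, up to a constant, the Fourier transform of its odd extension; the
  -- extension doubles the square norm and the constant accounts for the factor `4` in `hval`.
  have k1 := i1.sub j1
  have k2 := i2.sub j2
  have hP := integral_norm_sq_fourier k1 k2
  have hI : Integrable (fun ξ => ‖𝓕 (F - fun x => F (-x)) ξ‖ ^ 2) :=
    (memLp_two_iff_integrable_sq_norm (memLp_fourier k1 k2).1).1 (memLp_fourier k1 k2)
  have hval : ∀ ξ, ‖𝓕 (F - fun x => F (-x)) ξ‖ ^ 2 = 4 * ‖sineTransform f (2 * Real.pi * ξ)‖ ^ 2 := by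
    intro ξ
    have e1 : 𝓕 (F - fun x => F (-x)) ξ = 𝓕 F ξ - 𝓕 F (-ξ) := by
      rw [Real.fourier_real_eq_integral_exp_smul, Real.fourier_real_eq_integral_exp_smul,
        Real.fourier_real_eq_integral_exp_smul]
      have m1 : ∀ ζ : ℝ, Integrable (fun x : ℝ => Complex.exp ((-2 * Real.pi * x * ζ : ℝ) * Complex.I) • F x) := by
        intro ζ
        refine i1.bdd_mul (c := 1) (by fun_prop) (ae_of_all _ fun x => ?_)
        rw [Complex.norm_exp]; simp
      rw [← integral_neg_eq_self (fun x : ℝ => Complex.exp ((-2 * Real.pi * x * -ξ : ℝ) * Complex.I) • F x),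
        ← integral_sub (m1 ξ) ((m1 (-ξ)).comp_neg)]
      congr 1; ext x
      simp only [Pi.sub_apply, smul_sub]
      congr 3
      push_cast; ring
    rw [e1, hF, fourier_indicator, fourier_indicator, sineTransform_eq hf.integrable,
      norm_div, norm_sub_rev, mul_neg]
    simp
    ring
  simp_rw [hval] at hP hI
  have hπ := Real.pi_pos
  have hI' := (integrable_comp_mul_left_iff (fun s => 4 * ‖sineTransform f s‖ ^ 2)
    (R := 2 * Real.pi) (by positivity)).1 hI
  have hI2 : Integrable (fun s => ‖sineTransform f s‖ ^ 2) := by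
    simpa using hI'.const_mul (1 / 4)
  refine ⟨hI2, ?_⟩
  rw [Measure.integral_comp_mul_left (fun s => 4 * ‖sineTransform f s‖ ^ 2), smul_eq_mul,
    abs_of_pos (by positivity), integral_const_mul] at hP
  have hn : ∀ x, ‖(F - fun x => F (-x)) x‖ ^ 2 =
      (Ioi (0 : ℝ)).indicator (fun x => ‖f x‖ ^ 2) x + (Ioi (0 : ℝ)).indicator (fun x => ‖f x‖ ^ 2) (-x) := by
    intro x
    simp only [Pi.sub_apply, hF, indicator, mem_Ioi]
    rcases lt_trichotomy x 0 with h | h | h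
    · simp [h, h.le.not_gt]
    · simp [h]
    · simp [h, h.le.not_gt]
  have l1 : Integrable ((Ioi (0 : ℝ)).indicator (fun x => ‖f x‖ ^ 2)) :=
    (integrable_indicator_iff measurableSet_Ioi).2 hf.integrable_sq
  simp_rw [hn] at hP
  rw [integral_add l1 l1.comp_neg, integral_neg_eq_self, integral_indicator measurableSet_Ioi] at hP
  field_simp at hP
  linarith

/-- The square of the tail is a double integral over the pairs with both entries greater than `y`;
integrating over `y` first leaves the length `min p.1 p.2`. -/
theorem lintegral_tail_sq_le (hf : Decay f) :
    ∫⁻ y in Ioi (0 : ℝ), ENNReal.ofReal ((∫ x in Ioi y, ‖f x‖) ^ 2) ≤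
      ENNReal.ofReal (∫ p : ℝ × ℝ, min p.1 p.2 * (‖f p.2‖ * ‖f p.1‖) ∂(halfLine.prod halfLine)) := by
  have hU : ∀ y ∈ Ioi (0 : ℝ), ENNReal.ofReal ((∫ x in Ioi y, ‖f x‖) ^ 2) =
      ∫⁻ p : ℝ × ℝ, (if y < min p.1 p.2 then ENNReal.ofReal (‖f p.2‖ * ‖f p.1‖) else 0)
        ∂(halfLine.prod halfLine) := by
    intro y hy
    have hy' : (0 : ℝ) < y := hy
    have e1 : ∫ x in Ioi y, ‖f x‖ = ∫ x in Ioi (0 : ℝ), (Ioi y).indicator (fun x => ‖f x‖) x := by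
      rw [integral_indicator measurableSet_Ioi, Measure.restrict_restrict measurableSet_Ioi,
        Ioi_inter_Ioi, sup_of_le_left hy'.le]
    have iU : Integrable ((Ioi y).indicator (fun x => ‖f x‖)) halfLine :=
      hf.integrable.norm.indicator measurableSet_Ioi
    rw [e1, pow_two, ← integral_prod_mul, ofReal_integral_eq_lintegral_ofReal (iU.mul_prod iU)
      (ae_of_all _ fun p => mul_nonneg (indicator_nonneg (fun _ _ => norm_nonneg _) _)
        (indicator_nonneg (fun _ _ => norm_nonneg _) _))]
    congr 1; ext p
    by_cases h1 : y < p.1 <;> by_cases h2 : y < p.2 <;> simp [indicator, h1, h2, mul_comm]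
  rw [setLIntegral_congr_fun measurableSet_Ioi hU, lintegral_lintegral_swap]
  · rw [ofReal_integral_eq_lintegral_ofReal (hf.integrable_min_mul hf)]
    · refine lintegral_mono_ae ?_
      filter_upwards [ae_prod_pos] with p hp
      have e : ∀ y : ℝ, (if y < min p.1 p.2 then ENNReal.ofReal (‖f p.2‖ * ‖f p.1‖) else 0) =
          (Iio (min p.1 p.2)).indicator (fun _ => ENNReal.ofReal (‖f p.2‖ * ‖f p.1‖)) y := fun y => rfl
      simp_rw [e]
      rw [lintegral_indicator measurableSet_Iio, Measure.restrict_restrict measurableSet_Iio,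
        setLIntegral_const, inter_comm, Ioi_inter_Iio, Real.volume_Ioo, sub_zero,
        ← ENNReal.ofReal_mul (by positivity), mul_comm]
    · filter_upwards [ae_prod_pos] with p hp
      have := lt_min hp.1 hp.2
      simp only [Pi.zero_apply]
      positivity
  · have hm : AEMeasurable (fun q : ℝ × (ℝ × ℝ) => ENNReal.ofReal (‖f q.2.2‖ * ‖f q.2.1‖))
        (halfLine.prod (halfLine.prod halfLine)) :=
      ((hf.aesm.norm.comp_snd.mul hf.aesm.norm.comp_fst).comp_snd.aemeasurable).ennreal_ofReal
    have hs : MeasurableSet {q : ℝ × (ℝ × ℝ) | q.1 < min q.2.1 q.2.2} :=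
      measurableSet_lt (by fun_prop) (by fun_prop)
    refine (hm.indicator hs).congr (ae_of_all _ fun q => ?_)
    rfl

end Hardy

/-! ### Square-integrable difference quotients of the Fourier transform -/

section HardyInequality

variable {f g : ℝ → ℂ}

/-- Up to a unimodular constant, the difference quotient at `s₀` is the Fourier transform, taken at
`s - s₀`, of the tail `V y` formed by integrating `exp (-I s₀ x) f x` over `x > y`. Plancherel
reduces the claim to the square integral of `V`. The extra integrability of `x‖f‖` makes `V`
integrable and justifies Fubini. -/
theorem hardy_of_integrable (hf : Decay f) (hx : Integrable (fun x => x * ‖f x‖) halfLine) (s₀ : ℝ) :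
    ∫⁻ s, ENNReal.ofReal (‖halfFourier f s - halfFourier f s₀‖ ^ 2 / (s - s₀) ^ 2) ≤
      ENNReal.ofReal (2 * Real.pi *
        ∫ p : ℝ × ℝ, min p.1 p.2 * (‖f p.2‖ * ‖f p.1‖) ∂(halfLine.prod halfLine)) := by
  set M := ∫ p : ℝ × ℝ, min p.1 p.2 * (‖f p.2‖ * ‖f p.1‖) ∂(halfLine.prod halfLine) with hM
  set φ : ℝ → ℂ := fun x => Complex.exp (-(Complex.I * s₀ * x)) * f x with hφ
  have hφn : ∀ x, ‖φ x‖ = ‖f x‖ := by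
    intro x; rw [hφ, norm_mul, Complex.norm_exp]; simp
  have hφi : Integrable φ halfLine := integrable_exp_mul hf.integrable s₀
  set K : ℝ × ℝ → ℂ := fun q => {q : ℝ × ℝ | q.1 < q.2}.indicator (fun q => φ q.2) q with hK
  have hset : MeasurableSet {q : ℝ × ℝ | q.1 < q.2} := measurableSet_lt measurable_fst measurable_snd
  have hKm : AEStronglyMeasurable K (halfLine.prod halfLine) :=
    hφi.aestronglyMeasurable.comp_snd.indicator hset
  have hKx : ∀ x : ℝ, ∀ c : ℂ → ℝ → ℂ, (fun y => {q : ℝ × ℝ | q.1 < q.2}.indicator (fun q => c (φ q.2) q.1) (y, x)) =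
      (Iio x).indicator fun y => c (φ x) y := by
    intro x c; ext y; rfl
  have hKint : Integrable K (halfLine.prod halfLine) := by
    rw [integrable_prod_iff' hKm]
    constructor
    · filter_upwards [ae_restrict_mem measurableSet_Ioi] with x hx
      have e := hKx x (fun z _ => z)
      simp only [hK]
      rw [e, integrable_indicator_iff measurableSet_Iio]
      refine integrableOn_const ?_
      rw [Measure.restrict_apply measurableSet_Iio]
      have : Iio x ∩ Ioi 0 = Ioo 0 x := by rw [inter_comm]; rfl
      rw [this]; simp
    · refine hx.congr ?_
      filter_upwards [ae_restrict_mem measurableSet_Ioi] with x hx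
      have hx' : (0 : ℝ) < x := hx
      have e : ∀ y, ‖K (y, x)‖ = (Iio x).indicator (fun _ => ‖f x‖) y := by
        intro y
        simp only [hK]
        by_cases h : y < x
        · rw [indicator_of_mem (show (y, x) ∈ {q : ℝ × ℝ | q.1 < q.2} from h),
            indicator_of_mem (show y ∈ Iio x from h), hφn]
        · rw [indicator_of_notMem (show (y, x) ∉ {q : ℝ × ℝ | q.1 < q.2} from h),
            indicator_of_notMem (show y ∉ Iio x from h), norm_zero]
      simp_rw [e]
      rw [integral_indicator measurableSet_Iio, Measure.restrict_restrict measurableSet_Iio,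
        inter_comm, Ioi_inter_Iio, setIntegral_const, Measure.real, Real.volume_Ioo, sub_zero, smul_eq_mul,
        ENNReal.toReal_ofReal hx'.le]
  set V : ℝ → ℂ := fun y => ∫ x in Ioi (0 : ℝ), K (y, x) with hV
  have hVi : Integrable V halfLine := hKint.integral_prod_left
  have hVb : ∀ y ∈ Ioi (0 : ℝ), ‖V y‖ ≤ ∫ x in Ioi y, ‖f x‖ := by
    intro y hy
    have hy' : (0 : ℝ) < y := hy
    refine (norm_integral_le_integral_norm _).trans (le_of_eq ?_)
    have e : ∀ x, ‖K (y, x)‖ = (Ioi y).indicator (fun x => ‖f x‖) x := by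
      intro x
      simp only [hK]
      by_cases h : y < x
      · rw [indicator_of_mem (show (y, x) ∈ {q : ℝ × ℝ | q.1 < q.2} from h),
          indicator_of_mem (show x ∈ Ioi y from h), hφn]
      · rw [indicator_of_notMem (show (y, x) ∉ {q : ℝ × ℝ | q.1 < q.2} from h),
          indicator_of_notMem (show x ∉ Ioi y from h), norm_zero]
    simp_rw [e]
    rw [integral_indicator measurableSet_Ioi, Measure.restrict_restrict measurableSet_Ioi,
        Ioi_inter_Ioi, sup_of_le_left hy'.le]
  have hVN : ∀ y ∈ Ioi (0 : ℝ), ‖V y‖ ≤ ∫ x in Ioi (0 : ℝ), ‖f x‖ := fun y hy =>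
    (hVb y hy).trans (setIntegral_mono_set hf.integrable.norm (ae_of_all _ fun _ => norm_nonneg _)
      (Ioi_subset_Ioi (le_of_lt hy)).eventuallyLE)
  have hV2 : MemLp V 2 halfLine := by
    rw [memLp_two_iff_integrable_sq_norm hVi.aestronglyMeasurable]
    refine (hVi.norm.const_mul (∫ x in Ioi (0 : ℝ), ‖f x‖)).mono'
      (hVi.aestronglyMeasurable.norm.pow 2) ?_
    filter_upwards [ae_restrict_mem measurableSet_Ioi] with y hy
    rw [Real.norm_of_nonneg (by positivity), pow_two]
    exact mul_le_mul_of_nonneg_right (hVN y hy) (norm_nonneg _)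
  obtain ⟨p1, p2⟩ := plancherel_halfFourier hVi hV2
  have hM0 : 0 ≤ M := by
    refine integral_nonneg_of_ae ?_
    filter_upwards [ae_prod_pos] with p hp
    have := lt_min hp.1 hp.2
    simp only [Pi.zero_apply]
    positivity
  have hVM : ∫ y in Ioi (0 : ℝ), ‖V y‖ ^ 2 ≤ M := by
    rw [← ENNReal.ofReal_le_ofReal_iff hM0, ofReal_integral_eq_lintegral_ofReal
      ((memLp_two_iff_integrable_sq_norm hVi.aestronglyMeasurable).1 hV2)
      (ae_of_all _ fun _ => by positivity)]
    refine (setLIntegral_mono' measurableSet_Ioi fun y hy => ?_).trans (lintegral_tail_sq_le hf)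
    refine ENNReal.ofReal_le_ofReal ?_
    have := hVb y hy
    gcongr
  -- the Fourier transform of `V`
  have hFV : ∀ s, s ≠ s₀ → ‖halfFourier f s - halfFourier f s₀‖ ^ 2 / (s - s₀) ^ 2 =
      ‖halfFourier V (s - s₀)‖ ^ 2 := by
    intro s hs
    have hτ : ((s - s₀ : ℝ) : ℂ) ≠ 0 := by exact_mod_cast sub_ne_zero.2 hs
    have hI := Complex.I_ne_zero
    have e1 : halfFourier V (s - s₀) = ∫ y in Ioi (0 : ℝ), ∫ x in Ioi (0 : ℝ),
        Complex.exp (-(Complex.I * (s - s₀ : ℝ) * y)) * K (y, x) := by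
      rw [halfFourier]
      congr 1; ext y
      rw [hV, integral_const_mul]
    have hint : Integrable (Function.uncurry fun y x : ℝ =>
        Complex.exp (-(Complex.I * (s - s₀ : ℝ) * y)) * K (y, x)) (halfLine.prod halfLine) := by
      refine hKint.bdd_mul (c := 1) ?_ (ae_of_all _ fun q => ?_)
      · exact Continuous.aestronglyMeasurable (by fun_prop)
      · rw [Complex.norm_exp]; simp
    have e2 : ∀ x ∈ Ioi (0 : ℝ), ∫ y in Ioi (0 : ℝ), Complex.exp (-(Complex.I * (s - s₀ : ℝ) * y)) * K (y, x) =
        (-(Complex.I * (s - s₀ : ℝ)))⁻¹ * (Complex.exp (-(Complex.I * s * x)) * f x -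
          Complex.exp (-(Complex.I * s₀ * x)) * f x) := by
      intro x hx
      have hx' : (0 : ℝ) < x := hx
      have e3 : ∀ y : ℝ, Complex.exp (-(Complex.I * (s - s₀ : ℝ) * y)) * K (y, x) =
          (Iio x).indicator (fun y : ℝ => Complex.exp (-(Complex.I * (s - s₀ : ℝ)) * y) * φ x) y := by
        intro y
        simp only [hK]
        by_cases h : y < x
        · rw [indicator_of_mem (show (y, x) ∈ {q : ℝ × ℝ | q.1 < q.2} from h),
            indicator_of_mem (show y ∈ Iio x from h), neg_mul]
        · rw [indicator_of_notMem (show (y, x) ∉ {q : ℝ × ℝ | q.1 < q.2} from h),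
            indicator_of_notMem (show y ∉ Iio x from h), mul_zero]
      simp_rw [e3]
      rw [integral_indicator measurableSet_Iio, Measure.restrict_restrict measurableSet_Iio,
        inter_comm, Ioi_inter_Iio, integral_mul_const, ← integral_Ioc_eq_integral_Ioo,
        ← intervalIntegral.integral_of_le hx'.le,
        integral_exp_mul_complex (neg_ne_zero.2 (mul_ne_zero hI hτ)), div_eq_inv_mul, mul_assoc,
        sub_mul]
      congr 2
      · simp only [hφ]
        rw [← mul_assoc, ← Complex.exp_add]
        congr 2
        push_cast; ring
      · simp [hφ]
    rw [e1, integral_integral_swap hint, setIntegral_congr_fun measurableSet_Ioi e2,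
      integral_const_mul, integral_sub (integrable_exp_mul hf.integrable _)
      (integrable_exp_mul hf.integrable _), norm_mul, mul_pow, norm_inv, norm_neg, norm_mul,
      Complex.norm_I, one_mul, Complex.norm_real, Real.norm_eq_abs, inv_pow, sq_abs, div_eq_inv_mul]
    rfl
  have hae : ∀ᵐ s : ℝ, s ≠ s₀ := by simp [ae_iff, measure_singleton]
  have q1 : Integrable (fun s => ‖halfFourier V (s - s₀)‖ ^ 2) := p1.comp_sub_right s₀
  calc _ = ∫⁻ s, ENNReal.ofReal (‖halfFourier V (s - s₀)‖ ^ 2) := by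
        refine lintegral_congr_ae ?_
        filter_upwards [hae] with s hs
        rw [hFV s hs]
    _ = ENNReal.ofReal (2 * Real.pi * ∫ y in Ioi (0 : ℝ), ‖V y‖ ^ 2) := by
        rw [← ofReal_integral_eq_lintegral_ofReal q1 (ae_of_all _ fun _ => by positivity),
          integral_sub_right_eq_self (fun s => ‖halfFourier V s‖ ^ 2), p2]
    _ ≤ _ := by
        have := Real.pi_pos
        gcongr

/-- Hardy's inequality for the Fourier transform. -/
theorem integrable_hardy_halfFourier (hf : Decay f) (s₀ : ℝ) :
    Integrable (fun s => ‖halfFourier f s - halfFourier f s₀‖ ^ 2 / (s - s₀) ^ 2) := by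
  set M := ∫ p : ℝ × ℝ, min p.1 p.2 * (‖f p.2‖ * ‖f p.1‖) ∂(halfLine.prod halfLine) with hM
  have hcont : Continuous (halfFourier f) := by
    refine continuous_of_dominated (bound := fun x => ‖f x‖) (fun l =>
      (integrable_exp_mul hf.integrable l).aestronglyMeasurable) (fun l => ae_of_all _ fun x => ?_)
      hf.integrable.norm (ae_of_all _ fun x => by fun_prop)
    rw [norm_mul, Complex.norm_exp]; simp
  have hmeas : ∀ F : ℝ → ℂ, Continuous F → Measurable (fun s => ‖F s - F s₀‖ ^ 2 / (s - s₀) ^ 2) :=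
    fun F hF => by
      have := hF.measurable
      fun_prop
  -- Truncation to `x < N` supplies the integrability of `x‖f‖` with a bound independent of `N`, and
  -- Fatou's lemma removes it.
  let T : ℕ → ℝ → ℂ := fun N => (Iio (N : ℝ)).indicator f
  have hT : ∀ N, Decay (T N) := fun N => hf.indicator measurableSet_Iio
  have hTn : ∀ N x, ‖T N x‖ ≤ ‖f x‖ := fun N x => norm_indicator_le_norm_self _ _
  have hTx : ∀ N, Integrable (fun x => x * ‖T N x‖) halfLine := by
    intro N
    refine (hf.integrable.norm.const_mul (N : ℝ)).mono'
      (AEStronglyMeasurable.mul (by fun_prop) (hT N).aesm.norm) ?_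
    filter_upwards [ae_restrict_mem measurableSet_Ioi] with x hx
    have hx' : (0 : ℝ) < x := hx
    rw [Real.norm_of_nonneg (by positivity)]
    by_cases h : x < N
    · simp only [T, indicator_of_mem (show x ∈ Iio (N : ℝ) from h)]
      gcongr
    · simp only [T, indicator_of_notMem (show x ∉ Iio (N : ℝ) from h), norm_zero, mul_zero]
      positivity
  have hlim : ∀ l, Tendsto (fun N => halfFourier (T N) l) atTop (𝓝 (halfFourier f l)) := by
    intro l
    refine tendsto_integral_of_dominated_convergence (fun x => ‖f x‖)
      (fun N => (integrable_exp_mul (hT N).integrable l).aestronglyMeasurable) hf.integrable.norm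
      (fun N => ae_of_all _ fun x => ?_) (ae_of_all _ fun x => ?_)
    · rw [norm_mul, Complex.norm_exp]
      simpa using hTn N x
    · refine Tendsto.mul tendsto_const_nhds (tendsto_const_nhds.congr' ?_)
      filter_upwards [eventually_gt_atTop ⌈x⌉₊] with N hN
      have : x < N := (Nat.le_ceil x).trans_lt (by exact_mod_cast hN)
      simp only [T, indicator_of_mem (show x ∈ Iio (N : ℝ) from this)]
  have hbound : ∀ N, ∫⁻ s, ENNReal.ofReal (‖halfFourier (T N) s - halfFourier (T N) s₀‖ ^ 2 / (s - s₀) ^ 2) ≤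
      ENNReal.ofReal (2 * Real.pi * M) := by
    intro N
    refine (hardy_of_integrable (hT N) (hTx N) s₀).trans (ENNReal.ofReal_le_ofReal ?_)
    have := Real.pi_pos
    refine mul_le_mul_of_nonneg_left ?_ (by positivity)
    refine integral_mono_ae ((hT N).integrable_min_mul (hT N)) (hf.integrable_min_mul hf) ?_
    filter_upwards [ae_prod_pos] with p hp
    have := lt_min hp.1 hp.2
    have h1 := hTn N p.1
    have h2 := hTn N p.2
    gcongr
  refine ⟨(hmeas _ hcont).aestronglyMeasurable, ?_⟩
  rw [hasFiniteIntegral_iff_ofReal (ae_of_all _ fun s => by positivity)]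
  have hN : ∀ N, Continuous (halfFourier (T N)) := fun N => by
    refine continuous_of_dominated (bound := fun x => ‖f x‖) (fun l =>
      (integrable_exp_mul (hT N).integrable l).aestronglyMeasurable) (fun l => ae_of_all _ fun x => ?_)
      hf.integrable.norm (ae_of_all _ fun x => by fun_prop)
    rw [norm_mul, Complex.norm_exp]
    simpa using hTn N x
  calc _ = ∫⁻ s, liminf (fun N => ENNReal.ofReal
        (‖halfFourier (T N) s - halfFourier (T N) s₀‖ ^ 2 / (s - s₀) ^ 2)) atTop := by
        congr 1; ext s
        refine (Tendsto.liminf_eq ?_).symm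
        exact ENNReal.tendsto_ofReal (((((hlim s).sub (hlim s₀)).norm).pow 2).div_const _)
    _ ≤ liminf (fun N => ∫⁻ s, ENNReal.ofReal
        (‖halfFourier (T N) s - halfFourier (T N) s₀‖ ^ 2 / (s - s₀) ^ 2)) atTop :=
        lintegral_liminf_le fun N => (hmeas _ (hN N)).ennreal_ofReal
    _ ≤ ENNReal.ofReal (2 * Real.pi * M) := by
        refine liminf_le_of_le (by isBoundedDefault) fun b hb => ?_
        obtain ⟨N, hN⟩ := hb.exists
        exact hN.trans (hbound N)
    _ < ⊤ := ENNReal.ofReal_lt_top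

theorem integrable_hardy (hf : Decay f) (s₀ : ℝ) :
    Integrable (fun s => ‖sineTransform f s - sineTransform f s₀‖ ^ 2 / (s - s₀) ^ 2) := by
  have h1 := integrable_hardy_halfFourier hf s₀
  have h2 := (integrable_hardy_halfFourier hf (-s₀)).comp_neg
  have hm : Measurable (fun s => ‖sineTransform f s - sineTransform f s₀‖ ^ 2 / (s - s₀) ^ 2) := by
    have := (continuous_sineTransform hf).measurable
    fun_prop
  refine (h1.add h2).mono' hm.aestronglyMeasurable (ae_of_all _ fun s => ?_)
  rw [Real.norm_of_nonneg (by positivity), Pi.add_apply]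
  have e : (-s - -s₀) ^ 2 = (s - s₀) ^ 2 := by ring
  rw [e, ← add_div]
  gcongr
  rw [sineTransform_eq hf.integrable, sineTransform_eq hf.integrable, ← sub_div, norm_div]
  have e2 : halfFourier f (-s) - halfFourier f s - (halfFourier f (-s₀) - halfFourier f s₀) =
      (halfFourier f (-s) - halfFourier f (-s₀)) - (halfFourier f s - halfFourier f s₀) := by ring
  rw [e2, show ‖2 * Complex.I‖ = 2 by simp, div_pow]
  have h3 := norm_sub_le (halfFourier f (-s) - halfFourier f (-s₀)) (halfFourier f s - halfFourier f s₀)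
  set a := ‖halfFourier f (-s) - halfFourier f (-s₀)‖
  set b := ‖halfFourier f s - halfFourier f s₀‖
  set c := ‖(halfFourier f (-s) - halfFourier f (-s₀)) - (halfFourier f s - halfFourier f s₀)‖
  have hc : 0 ≤ c := norm_nonneg _
  have : c ^ 2 ≤ (a + b) ^ 2 := by gcongr
  nlinarith [sq_nonneg (a - b)]

end HardyInequality

/-! ### The spectral density and its behaviour at its zeros -/

section SimpleZero

variable {f : ℝ → ℂ}

theorem integrableOn_abs_rpow (x r : ℝ) (hr : 0 < r) :
    IntegrableOn (fun s => |s - x| ^ (-(1 / 2) : ℝ)) (Ioo (x - r) (x + r)) ∧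
      ∫ s in Ioo (x - r) (x + r), |s - x| ^ (-(1 / 2) : ℝ) = 4 * √r := by
  have hII : IntervalIntegrable (fun t : ℝ => t ^ (-(1 / 2) : ℝ)) volume 0 r :=
    intervalIntegral.intervalIntegrable_rpow' (by norm_num)
  have h1 : IntervalIntegrable (fun s => |s - x| ^ (-(1 / 2) : ℝ)) volume x (x + r) := by
    have h := (hII.comp_sub_right x)
    rw [zero_add, add_comm r] at h
    refine h.congr fun s hs => ?_
    rw [uIoc_of_le (by linarith)] at hs
    rw [abs_of_pos (by linarith [hs.1])]
  have h2 : IntervalIntegrable (fun s => |s - x| ^ (-(1 / 2) : ℝ)) volume (x - r) x := by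
    have h := (hII.comp_sub_left x).symm
    rw [sub_zero] at h
    refine h.congr fun s hs => ?_
    rw [uIoc_of_le (by linarith)] at hs
    rw [abs_of_nonpos (by linarith [hs.2]), neg_sub]
  have hle : x - r ≤ x + r := by linarith
  have h := h2.trans h1
  refine ⟨((intervalIntegrable_iff_integrableOn_Ioc_of_le hle).1 h).mono_set Ioo_subset_Ioc_self, ?_⟩
  rw [← integral_Ioc_eq_integral_Ioo, ← intervalIntegral.integral_of_le hle,
    ← intervalIntegral.integral_add_adjacent_intervals h2 h1]
  have e1 : ∫ s in x..(x + r), |s - x| ^ (-(1 / 2) : ℝ) = ∫ s in (0 : ℝ)..r, s ^ (-(1 / 2) : ℝ) := by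
    have h3 : ∫ s in x..(x + r), |s - x| ^ (-(1 / 2) : ℝ) = ∫ s in x..(x + r), (s - x) ^ (-(1 / 2) : ℝ) := by
      refine intervalIntegral.integral_congr fun s hs => ?_
      rw [uIcc_of_le (by linarith)] at hs
      rw [abs_of_nonneg (by linarith [hs.1])]
    rw [h3, intervalIntegral.integral_comp_sub_right (fun t : ℝ => t ^ (-(1 / 2) : ℝ)), sub_self, add_sub_cancel_left]
  have e2 : ∫ s in (x - r)..x, |s - x| ^ (-(1 / 2) : ℝ) = ∫ s in (0 : ℝ)..r, s ^ (-(1 / 2) : ℝ) := by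
    have h3 : ∫ s in (x - r)..x, |s - x| ^ (-(1 / 2) : ℝ) = ∫ s in (x - r)..x, (x - s) ^ (-(1 / 2) : ℝ) := by
      refine intervalIntegral.integral_congr fun s hs => ?_
      rw [uIcc_of_le (by linarith)] at hs
      rw [abs_of_nonpos (by linarith [hs.2]), neg_sub]
    rw [h3, intervalIntegral.integral_comp_sub_left (fun t : ℝ => t ^ (-(1 / 2) : ℝ)), sub_self, sub_sub_cancel]
  rw [e1, e2, integral_rpow (Or.inl (by norm_num)), Real.sqrt_eq_rpow]
  norm_num
  ring

/-- A Hölder bound of order `1/2` makes the difference quotient integrable. -/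
theorem integrable_div_of_holder {F : ℝ → ℝ} {x r C : ℝ} (hr : 0 < r) (hF : Measurable F)
    (hC : ∀ s ∈ Ioo (x - r) (x + r), |F s| ≤ C * √|s - x|) :
    IntegrableOn (fun s => F s / (s - x)) (Ioo (x - r) (x + r)) ∧
      ∫ s in Ioo (x - r) (x + r), |F s / (s - x)| ≤ 4 * C * √r := by
  obtain ⟨h1, h2⟩ := integrableOn_abs_rpow x r hr
  have hb : ∀ s ∈ Ioo (x - r) (x + r), |F s / (s - x)| ≤ C * |s - x| ^ (-(1 / 2) : ℝ) := by
    intro s hs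
    rcases eq_or_ne s x with rfl | hne
    · simp
    · have h0 : 0 < |s - x| := abs_pos.2 (sub_ne_zero.2 hne)
      rw [abs_div, div_le_iff₀ h0]
      refine (hC s hs).trans (le_of_eq ?_)
      rw [mul_assoc, Real.sqrt_eq_rpow]
      congr 1
      nth_rewrite 3 [← Real.rpow_one |s - x|]
      rw [← Real.rpow_add h0]; norm_num
  have hint : IntegrableOn (fun s => F s / (s - x)) (Ioo (x - r) (x + r)) := by
    refine (h1.const_mul C).mono' ?_ ((ae_restrict_iff' measurableSet_Ioo).2 (ae_of_all _ hb))
    exact (hF.div (by fun_prop)).aestronglyMeasurable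
  refine ⟨hint, (setIntegral_mono_on hint.abs (h1.const_mul C) measurableSet_Ioo hb).trans (le_of_eq ?_)⟩
  rw [integral_const_mul, h2]; ring

/-- The density of the spectral function in the variable `λ = √z`. -/
def specDensity (f : ℝ → ℂ) (s : ℝ) : ℝ := ‖sineTransform f s‖ ^ 2

theorem specDensity_neg (f : ℝ → ℂ) (s : ℝ) : specDensity f (-s) = specDensity f s := by
  rw [specDensity, specDensity, sineTransform_neg, norm_neg]

theorem specDensity_nonneg (f : ℝ → ℂ) (s : ℝ) : 0 ≤ specDensity f s := by
  rw [specDensity]; positivity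

theorem continuous_specDensity (hf : Decay f) : Continuous (specDensity f) :=
  (continuous_sineTransform hf).norm.pow 2

theorem integrable_specDensity (hf : Decay f) : Integrable (specDensity f) :=
  (plancherel_sineTransform hf).1

theorem integral_specDensity (hf : Decay f) :
    ∫ s, specDensity f s = Real.pi * ∫ x in Ioi (0 : ℝ), ‖f x‖ ^ 2 := (plancherel_sineTransform hf).2

/-- At a zero nothing is subtracted in Hardy's inequality. This is the integrability behind both the
simplicity of the zeros of the factor and the principal values there. -/
theorem integrable_specDensity_div (hf : Decay f) {l : ℝ} (hl : specDensity f l = 0) :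
    Integrable (fun s => specDensity f s / (s - l) ^ 2) := by
  have h0 : sineTransform f l = 0 := by simpa [specDensity] using hl
  simpa [h0, specDensity] using integrable_hardy hf l

theorem integrable_specDensity_div_sq_sub_sq (hf : Decay f) {l : ℝ} (hl : specDensity f l = 0) :
    Integrable (fun s => specDensity f s / (s ^ 2 - l ^ 2)) := by
  have h1 := integrable_specDensity_div hf hl
  have h2 := integrable_specDensity_div hf (l := -l) (by rw [specDensity_neg, hl])
  have hm := (continuous_specDensity hf).measurable
  refine (h1.add h2).mono' (Measurable.aestronglyMeasurable (by fun_prop)) (ae_of_all _ fun s => ?_)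
  have hρ := specDensity_nonneg f s
  simp only [Pi.add_apply, sub_neg_eq_add]
  rw [Real.norm_eq_abs, abs_div, abs_of_nonneg hρ, sq_sub_sq, abs_mul, ← sq_abs (s - l), ← sq_abs (s + l),
    div_eq_mul_inv, div_eq_mul_inv, div_eq_mul_inv, ← mul_add, mul_inv, ← inv_pow, ← inv_pow]
  refine mul_le_mul_of_nonneg_left ?_ hρ
  nlinarith [sq_nonneg (|s - l|⁻¹ - |s + l|⁻¹), sq_nonneg (|s - l|⁻¹), sq_nonneg (|s + l|⁻¹)]

theorem norm_sub_le_norm_sub_add_I (s x η : ℝ) : |s - x| ≤ ‖(s : ℂ) - (x + η * Complex.I)‖ := by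
  have := Complex.abs_re_le_norm ((s : ℂ) - (x + η * Complex.I))
  simpa using this

theorem tendsto_add_mul_I (x : ℝ) :
    Tendsto (fun η : ℝ => (x : ℂ) + η * Complex.I) (𝓝[>] 0) (𝓝[{w | 0 ≤ w.im}] (x : ℂ)) := by
  refine tendsto_nhdsWithin_iff.2 ⟨?_, ?_⟩
  · have : Continuous fun ε : ℝ => (x : ℂ) + ε * Complex.I := by fun_prop
    simpa using (this.tendsto 0).mono_left nhdsWithin_le_nhds
  · filter_upwards [self_mem_nhdsWithin] with η hη
    have : (0 : ℝ) < η := hη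
    simp [this.le]

theorem tendsto_greenForm_real (hf : Decay f) (x : ℝ) :
    Tendsto (fun η : ℝ => greenForm f f (x + η * Complex.I)) (𝓝[>] 0) (𝓝 (greenForm f f x)) :=
  ((continuousOn_greenForm hf hf) (x : ℂ) (by simp)).tendsto.comp (tendsto_add_mul_I x)

/-- Where the density vanishes the spectral integral converges absolutely on the real axis. Moving
`l` to `l + η * I` only increases the distances to `s` and to `-s`, so the limit integrand dominates
the others. -/
theorem greenForm_eq_integral_of_eq_zero (hf : Decay f) {l : ℝ} (hl : specDensity f l = 0) :
    greenForm f f l = ((1 / Real.pi * ∫ s, specDensity f s / (s ^ 2 - l ^ 2) : ℝ) : ℂ) := by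
  have hi := integrable_specDensity_div_sq_sub_sq hf hl
  refine tendsto_nhds_unique (tendsto_greenForm_real hf l) ?_
  have hc : (fun η : ℝ => greenForm f f (l + η * Complex.I)) =ᶠ[𝓝[>] 0] fun η : ℝ =>
      (1 / Real.pi) * ∫ s : ℝ, (specDensity f s : ℂ) * ((s : ℂ) ^ 2 - (l + η * Complex.I) ^ 2)⁻¹ := by
    filter_upwards [self_mem_nhdsWithin] with η hη
    exact greenForm_eq_integral hf (by simpa using hη)
  refine Tendsto.congr' hc.symm ?_
  push_cast
  refine Tendsto.const_mul _ ?_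
  rw [← integral_complex_ofReal]
  have hm := (continuous_specDensity hf).measurable
  refine tendsto_integral_filter_of_dominated_convergence (fun s => ‖specDensity f s / (s ^ 2 - l ^ 2)‖) ?_ ?_
    hi.norm ?_
  · exact Eventually.of_forall fun η => Measurable.aestronglyMeasurable (by fun_prop)
  · refine Eventually.of_forall fun η => ae_of_all _ fun s => ?_
    rw [norm_mul, norm_inv, sq_sub_sq, norm_mul, norm_div, Complex.norm_real, sq_sub_sq, norm_mul,
      div_eq_mul_inv]
    by_cases h1 : s + l = 0
    · have : specDensity f s = 0 := by
        rw [eq_neg_of_add_eq_zero_left h1, specDensity_neg, hl]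
      simp [this]
    by_cases h2 : s - l = 0
    · have : specDensity f s = 0 := by rw [sub_eq_zero.1 h2, hl]
      simp [this]
    have h3 := norm_sub_le_norm_sub_add_I s l η
    have h4 : |s + l| ≤ ‖(s : ℂ) + (l + η * Complex.I)‖ := by
      have := norm_sub_le_norm_sub_add_I s (-l) (-η)
      rw [sub_neg_eq_add] at this
      refine this.trans (le_of_eq ?_)
      congr 1; push_cast; ring
    have h1' := abs_pos.2 h1
    have h2' := abs_pos.2 h2
    rw [Real.norm_eq_abs (s + l), Real.norm_eq_abs (s - l)]
    gcongr
  · have hae1 : ∀ᵐ s : ℝ, s ≠ l := by simp [ae_iff, measure_singleton]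
    have hae2 : ∀ᵐ s : ℝ, s ≠ -l := by simp [ae_iff, measure_singleton]
    filter_upwards [hae1, hae2] with s h1 h2
    have hne : (s : ℂ) ^ 2 - l ^ 2 ≠ 0 := by
      rw [sq_sub_sq]
      refine mul_ne_zero ?_ ?_
      · intro h; apply h2; have : s + l = 0 := by exact_mod_cast h
        linarith
      · intro h; apply h1; have : s - l = 0 := by exact_mod_cast h
        linarith
    have h3 : Tendsto (fun η : ℝ => (l : ℂ) + η * Complex.I) (𝓝[>] 0) (𝓝 l) :=
      (tendsto_add_mul_I l).mono_right nhdsWithin_le_nhds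
    have h4 := ((tendsto_const_nhds (x := (s : ℂ) ^ 2)).sub (h3.pow 2)).inv₀ hne
    have := h4.const_mul (specDensity f s : ℂ)
    simpa [div_eq_mul_inv] using this

end SimpleZero

/-! ### Simplicity of the positive zeros -/

section SimpleZero

variable {f : ℝ → ℂ}

/-- `ρ(s) / (s² - l²)` for the spectral density `ρ`. -/
def specQuotient (f : ℝ → ℂ) (l s : ℝ) : ℝ := specDensity f s / (s ^ 2 - l ^ 2)

theorem measurable_specQuotient (hf : Decay f) (l : ℝ) : Measurable (specQuotient f l) := by
  have := (continuous_specDensity hf).measurable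
  unfold specQuotient
  fun_prop

theorem specQuotient_neg (f : ℝ → ℂ) (l s : ℝ) : specQuotient f l (-s) = specQuotient f l s := by
  rw [specQuotient, specQuotient, specDensity_neg, neg_sq]

/-- The local Hölder estimate for the quotient, with a constant that is small compared to the
distance to the zero. -/
theorem specQuotient_sub_le (hf : Decay f) {l : ℝ} (hl : 0 < l) (h0 : specDensity f l = 0) {κ : ℝ}
    (hκ : 0 < κ) : ∀ᶠ x in 𝓝[≠] l, ∀ s ∈ Ioo (x - |x - l| / 2) (x + |x - l| / 2),
      |specQuotient f l s - specQuotient f l x| ≤ 14 * κ ^ 2 / (√|x - l| * l) * √|s - x| := by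
  obtain ⟨δ₀, hδ₀, hmod⟩ := sineTransform_modulus hf hκ
  have hq0 : sineTransform f l = 0 := by simpa [specDensity] using h0
  have hball : Metric.ball l (min (δ₀ / 2) (l / 2)) ∈ 𝓝 l := Metric.ball_mem_nhds _ (by positivity)
  filter_upwards [nhdsWithin_le_nhds hball, self_mem_nhdsWithin] with x hx hxl s hs
  rw [Metric.mem_ball, Real.dist_eq, lt_min_iff] at hx
  set d := |x - l| with hd
  have hd0 : 0 < d := abs_pos.2 (sub_ne_zero.2 hxl)
  have hsx : |s - x| < d / 2 := abs_lt.2 ⟨by linarith [hs.1], by linarith [hs.2]⟩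
  have hsl1 : |s - l| ≤ 3 / 2 * d := by
    have := abs_add_le (s - x) (x - l)
    rw [sub_add_sub_cancel] at this
    linarith
  have hsl2 : d / 2 ≤ |s - l| := by
    have := abs_sub_abs_le_abs_sub (x - l) (-(s - x))
    rw [abs_neg, sub_neg_eq_add, show x - l + (s - x) = s - l by ring] at this
    linarith
  have hx1 := abs_lt.1 hx.2
  have hs1 := abs_le.1 hsl1
  have hxpos : 0 < x := by linarith [hx1.1]
  have hspos : 0 < s := by linarith [hs1.1, hx.2]
  set e := √d with he
  have he0 : 0 < e := Real.sqrt_pos.2 hd0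
  have hee : e ^ 2 = d := Real.sq_sqrt hd0.le
  set y := √|s - x| with hy
  have hy0 : 0 ≤ y := Real.sqrt_nonneg _
  have hyy : y ^ 2 = |s - x| := Real.sq_sqrt (abs_nonneg _)
  have hye : y ≤ e := Real.sqrt_le_sqrt (by linarith)
  have m1 : ‖sineTransform f s‖ ≤ κ * (2 * e) := by
    have h := hmod s l (by linarith [hx.1])
    rw [hq0, sub_zero] at h
    refine h.trans ?_
    gcongr
    rw [Real.sqrt_le_left (by positivity)]
    nlinarith
  have m2 : ‖sineTransform f x‖ ≤ κ * e := by
    have h := hmod x l (by linarith [hx.1])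
    rwa [hq0, sub_zero] at h
  have m3 : ‖sineTransform f s - sineTransform f x‖ ≤ κ * y := hmod s x (by linarith [hx.1])
  have r1 : |specDensity f s - specDensity f x| ≤ 3 * κ ^ 2 * e * y := by
    rw [specDensity, specDensity, sq_sub_sq, abs_mul]
    have h1 := (abs_norm_sub_norm_le (sineTransform f s) (sineTransform f x)).trans m3
    have h2 : |‖sineTransform f s‖ + ‖sineTransform f x‖| ≤ 3 * κ * e := by
      rw [abs_of_nonneg (by positivity)]; linarith
    calc _ ≤ (3 * κ * e) * (κ * y) := by gcongr
      _ = _ := by ring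
  have r2 : specDensity f x ≤ κ ^ 2 * d := by
    rw [specDensity, ← hee]
    calc _ ≤ (κ * e) ^ 2 := by gcongr
      _ = _ := by ring
  have hDs : d / 2 * l ≤ |s ^ 2 - l ^ 2| := by
    rw [sq_sub_sq, abs_mul, abs_of_pos (show 0 < s + l by linarith), mul_comm]
    gcongr
    linarith
  have hDx : d * l ≤ |x ^ 2 - l ^ 2| := by
    rw [sq_sub_sq, abs_mul, abs_of_pos (show 0 < x + l by linarith), mul_comm]
    gcongr
    linarith
  have hDsx : |x ^ 2 - l ^ 2 - (s ^ 2 - l ^ 2)| ≤ 4 * l * |s - x| := by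
    rw [show x ^ 2 - l ^ 2 - (s ^ 2 - l ^ 2) = (s + x) * -(s - x) by ring, abs_mul, abs_neg,
      abs_of_pos (by linarith)]
    gcongr
    linarith [hs1.2, hx1.2]
  have hDs0 : s ^ 2 - l ^ 2 ≠ 0 := abs_pos.1 (lt_of_lt_of_le (by positivity) hDs)
  have hDx0 : x ^ 2 - l ^ 2 ≠ 0 := abs_pos.1 (lt_of_lt_of_le (by positivity) hDx)
  -- Numerator and denominator are varied separately; the two terms give the constants 6 and 8 that
  -- add up to 14.
  have hsplit : specQuotient f l s - specQuotient f l x =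
      (specDensity f s - specDensity f x) / (s ^ 2 - l ^ 2) +
      specDensity f x * (x ^ 2 - l ^ 2 - (s ^ 2 - l ^ 2)) / ((s ^ 2 - l ^ 2) * (x ^ 2 - l ^ 2)) := by
    rw [specQuotient, specQuotient]
    field_simp
    ring
  rw [hsplit]
  refine (abs_add_le _ _).trans ?_
  rw [abs_div, abs_div, abs_mul, abs_mul, abs_of_nonneg (specDensity_nonneg f x)]
  have t1 : |specDensity f s - specDensity f x| / |s ^ 2 - l ^ 2| ≤ (3 * κ ^ 2 * e * y) / (d / 2 * l) := by
    gcongr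
  have t2 : specDensity f x * |x ^ 2 - l ^ 2 - (s ^ 2 - l ^ 2)| / (|s ^ 2 - l ^ 2| * |x ^ 2 - l ^ 2|) ≤
      κ ^ 2 * d * (4 * l * |s - x|) / (d / 2 * l * (d * l)) := by
    gcongr
  refine (add_le_add t1 t2).trans ?_
  have e1 : (3 * κ ^ 2 * e * y) / (d / 2 * l) = 6 * κ ^ 2 / (e * l) * y := by
    rw [← hee]; field_simp; ring
  have e2 : κ ^ 2 * d * (4 * l * |s - x|) / (d / 2 * l * (d * l)) = 8 * κ ^ 2 / (e * l) * (y * (y / e)) := by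
    rw [← hyy, ← hee]; field_simp; ring
  rw [e1, e2]
  have e3 : y / e ≤ 1 := (div_le_one he0).2 hye
  have e4 : 8 * κ ^ 2 / (e * l) * (y * (y / e)) ≤ 8 * κ ^ 2 / (e * l) * y := by
    gcongr
    exact mul_le_of_le_one_right hy0 e3
  have e5 : 14 * κ ^ 2 / (e * l) * y = 6 * κ ^ 2 / (e * l) * y + 8 * κ ^ 2 / (e * l) * y := by ring
  linarith

/-- One of `|s - l|`, `|s + l|` is at least `l`, so the cubic denominator is controlled by the two
squared ones at the price of the factor `1 / l`. -/
theorem integrable_specQuotient_div (hf : Decay f) {l : ℝ} (hl : 0 < l) (h0 : specDensity f l = 0) :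
    Integrable (fun s => specQuotient f l s / (s - l)) := by
  have h1 := integrable_specDensity_div hf h0
  have h2 := integrable_specDensity_div hf (l := -l) (by rw [specDensity_neg, h0])
  have hm := measurable_specQuotient hf l
  refine ((h1.add h2).const_mul (1 / l)).mono' (Measurable.aestronglyMeasurable (by fun_prop))
    (ae_of_all _ fun s => ?_)
  have hρ := specDensity_nonneg f s
  simp only [Pi.add_apply, sub_neg_eq_add, specQuotient]
  by_cases h1 : s = l
  · subst h1; simp [h0]
  by_cases h2 : s = -l
  · subst h2; simp [specDensity_neg, h0]
  have h1' : 0 < |s - l| := abs_pos.2 (sub_ne_zero.2 h1)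
  have h2' : 0 < |s + l| := abs_pos.2 (by intro h; apply h2; linarith)
  rw [Real.norm_eq_abs, abs_div, abs_div, abs_of_nonneg hρ, sq_sub_sq, abs_mul, ← sq_abs (s - l),
    ← sq_abs (s + l)]
  have hlle : l ≤ max |s - l| |s + l| := by
    by_contra hcon
    rw [not_le, max_lt_iff] at hcon
    have a1 := abs_lt.1 hcon.1
    have a2 := abs_lt.1 hcon.2
    linarith
  rw [div_add_div _ _ (by positivity) (by positivity), div_div, div_mul_div_comm, one_mul,
    div_le_div_iff₀ (by positivity) (by positivity)]
  set a := |s - l|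
  set b := |s + l|
  have key : l * b ≤ a ^ 2 + b ^ 2 := by
    rcases le_max_iff.1 hlle with h | h <;> nlinarith [sq_nonneg (a - b)]
  have : specDensity f s * (l * (a ^ 2 * b ^ 2)) = specDensity f s * (a ^ 2 * b) * (l * b) := by ring
  rw [this]
  calc _ ≤ specDensity f s * (a ^ 2 * b) * (a ^ 2 + b ^ 2) := by gcongr
    _ = _ := by ring

/-- Averaging over `s` and `-s` turns the integrand into a positive multiple of ρ(s)/(s² - l²)². Up
to normalization this is the formal derivative in `l` of the spectral integral, and its positivity
is the source of simplicity. -/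
theorem integral_specQuotient_div_pos (hf : Decay f) {l : ℝ} (hl : 0 < l) (h0 : specDensity f l = 0)
    (hne : ∃ s, specDensity f s ≠ 0) : 0 < ∫ s, specQuotient f l s / (s - l) := by
  have hi := integrable_specQuotient_div hf hl h0
  have e : ∀ s, specQuotient f l s / (s - l) + specQuotient f l (-s) / (-s - l) =
      2 * l * (specDensity f s / (s ^ 2 - l ^ 2) ^ 2) := by
    intro s
    rw [specQuotient_neg, specQuotient]
    by_cases h1 : s = l
    · subst h1; simp [h0]
    by_cases h2 : s = -l
    · subst h2; simp [specDensity_neg, h0]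
    have h1' : s - l ≠ 0 := sub_ne_zero.2 h1
    have h2' : s + l ≠ 0 := by intro h; apply h2; linarith
    have h3 : -s - l ≠ 0 := by intro h; apply h2; linarith
    have h4 : s ^ 2 - l ^ 2 ≠ 0 := by rw [sq_sub_sq]; exact mul_ne_zero h2' h1'
    field_simp
    ring
  have h2 : Integrable fun s => 2 * l * (specDensity f s / (s ^ 2 - l ^ 2) ^ 2) :=
    (hi.add hi.comp_neg).congr (ae_of_all _ e)
  have h3 : ∫ s, 2 * l * (specDensity f s / (s ^ 2 - l ^ 2) ^ 2) = 2 * ∫ s, specQuotient f l s / (s - l) := by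
    simp_rw [← e]
    rw [integral_add hi hi.comp_neg, integral_neg_eq_self (fun s => specQuotient f l s / (s - l)), two_mul]
  have h4 : 0 < ∫ s, 2 * l * (specDensity f s / (s ^ 2 - l ^ 2) ^ 2) := by
    rw [integral_pos_iff_support_of_nonneg (fun s => by have := specDensity_nonneg f s; positivity) h2]
    have hopen : IsOpen {s | specDensity f s ≠ 0} := isOpen_ne.preimage (continuous_specDensity hf)
    refine lt_of_lt_of_le (hopen.measure_pos volume hne) (measure_mono fun s hs => ?_)
    have hs' : specDensity f s ≠ 0 := hs
    have h5 : s ≠ l := by rintro rfl; exact hs' h0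
    have h6 : s ≠ -l := by rintro rfl; exact hs' (by rw [specDensity_neg, h0])
    have h7 : s ^ 2 - l ^ 2 ≠ 0 := by
      rw [sq_sub_sq]
      exact mul_ne_zero (by intro h; apply h6; linarith) (sub_ne_zero.2 h5)
    simp only [Function.mem_support]
    positivity
  linarith

/-- Split at distance `|x - l| / 2` from `x`. Outside, `|s - l| ≤ 3 |s - x|`, so dominated
convergence gives the positive limit `P`. Inside, the Hölder estimate with a small constant costs at
most `P / 2`, although the interval shrinks with `|x - l|`. -/
theorem specQuotient_pv_lower_bound (hf : Decay f) {l : ℝ} (hl : 0 < l) (h0 : specDensity f l = 0)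
    (hne : ∃ s, specDensity f s ≠ 0) : ∃ c > 0, ∀ᶠ x : ℝ in 𝓝[≠] l,
      Integrable (pvIntegrand (specQuotient f l) x (|x - l| / 2)) ∧
      c ≤ ∫ s, pvIntegrand (specQuotient f l) x (|x - l| / 2) s := by
  have hi := integrable_specQuotient_div hf hl h0
  have hm := measurable_specQuotient hf l
  set P := ∫ s, specQuotient f l s / (s - l) with hP
  have hP0 : 0 < P := integral_specQuotient_div_pos hf hl h0 hne
  set far : ℝ → ℝ → ℝ := fun x s =>
    (Ioo (x - |x - l| / 2) (x + |x - l| / 2))ᶜ.indicator (fun s => specQuotient f l s / (s - x)) s with hfar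
  have hbound : ∀ x, ∀ s, ‖far x s‖ ≤ 3 * ‖specQuotient f l s / (s - l)‖ := by
    intro x s
    simp only [hfar]
    by_cases hs : s ∈ Ioo (x - |x - l| / 2) (x + |x - l| / 2)
    · rw [indicator_of_notMem (by simpa using hs), norm_zero]; positivity
    · rw [indicator_of_mem (by simpa using hs), norm_div, norm_div, Real.norm_eq_abs (s - x),
        Real.norm_eq_abs (s - l), ← mul_div_assoc]
      have h1 : |x - l| / 2 ≤ |s - x| := by
        by_contra hcon
        have := abs_lt.1 (not_le.1 hcon)
        exact hs ⟨by linarith [this.1], by linarith [this.2]⟩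
      have h2 : |s - l| ≤ 3 * |s - x| := by
        have := abs_add_le (s - x) (x - l)
        rw [sub_add_sub_cancel] at this
        linarith
      by_cases h3 : s = l
      · subst h3
        simp [specQuotient]
      · have h4 : 0 < |s - l| := abs_pos.2 (sub_ne_zero.2 h3)
        have h5 : 0 < |s - x| := by linarith
        rw [div_le_div_iff₀ h5 h4]
        calc _ ≤ ‖specQuotient f l s‖ * (3 * |s - x|) := by gcongr
          _ = _ := by ring
  have hfm : ∀ x, Measurable (far x) := fun x =>
    Measurable.indicator (by fun_prop) measurableSet_Ioo.compl
  have hfi : ∀ x, Integrable (far x) := fun x =>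
    (hi.norm.const_mul 3).mono' (hfm x).aestronglyMeasurable (ae_of_all _ (hbound x))
  have hlim : Tendsto (fun x => ∫ s, far x s) (𝓝 l) (𝓝 P) := by
    refine tendsto_integral_filter_of_dominated_convergence _ (Eventually.of_forall fun x =>
      (hfm x).aestronglyMeasurable) (Eventually.of_forall fun x => ae_of_all _ (hbound x))
      (hi.norm.const_mul 3) ?_
    have hae : ∀ᵐ s : ℝ, s ≠ l := by simp [ae_iff, measure_singleton]
    filter_upwards [hae] with s hs
    have hcont : ContinuousAt (fun x => specQuotient f l s / (s - x)) l :=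
      ContinuousAt.div (by fun_prop) (by fun_prop) (sub_ne_zero.2 hs)
    refine hcont.tendsto.congr' ?_
    have h1 : ∀ᶠ x in 𝓝 l, |x - l| / 2 < |s - x| := by
      refine ContinuousAt.eventually_lt (by fun_prop) (by fun_prop) ?_
      simpa using sub_ne_zero.2 hs
    filter_upwards [h1] with x hx
    simp only [hfar]
    rw [indicator_of_mem]
    intro hmem
    exact absurd (abs_lt.2 ⟨by linarith [hmem.1], by linarith [hmem.2]⟩) hx.not_gt
  -- Chosen to turn the bound `4 * 14 * κ² / l` for the inner part into `P / 2`.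
  set κ := √(P * l / 112) with hκ
  have hκ0 : 0 < κ := Real.sqrt_pos.2 (by positivity)
  have hκ2 : κ ^ 2 = P * l / 112 := Real.sq_sqrt (by positivity)
  refine ⟨P / 4, by positivity, ?_⟩
  filter_upwards [specQuotient_sub_le hf hl h0 hκ0, nhdsWithin_le_nhds (hlim.eventually
    (lt_mem_nhds (show 3 / 4 * P < P by linarith))), self_mem_nhdsWithin] with x hx hxP hxl
  set r := |x - l| / 2 with hr
  have hd0 : 0 < |x - l| := abs_pos.2 (sub_ne_zero.2 hxl)
  have hr0 : 0 < r := by positivity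
  obtain ⟨n1, n2⟩ := integrable_div_of_holder (F := fun s => specQuotient f l s - specQuotient f l x)
    hr0 (hm.sub_const _) hx
  have hsplit : pvIntegrand (specQuotient f l) x r = fun s => far x s +
      (Ioo (x - r) (x + r)).indicator (fun s => (specQuotient f l s - specQuotient f l x) / (s - x)) s := by
    ext s
    simp only [hfar, pvIntegrand, ← hr]
    by_cases hs : s ∈ Ioo (x - r) (x + r)
    · rw [indicator_of_mem hs, indicator_of_mem hs, indicator_of_notMem (by simpa using hs), zero_add]
    · rw [indicator_of_notMem hs, indicator_of_notMem hs, indicator_of_mem (by simpa using hs), sub_zero,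
        add_zero]
  have n3 := n1.integrable_indicator measurableSet_Ioo
  rw [hsplit]
  refine ⟨(hfi x).add n3, ?_⟩
  rw [integral_add (hfi x) n3, integral_indicator measurableSet_Ioo]
  have n4 : |∫ s in Ioo (x - r) (x + r), (specQuotient f l s - specQuotient f l x) / (s - x)| ≤ P / 2 := by
    refine (abs_integral_le_integral_abs).trans (n2.trans ?_)
    have h1 : √r ≤ √|x - l| := Real.sqrt_le_sqrt (by linarith)
    have h2 : 0 < √|x - l| := Real.sqrt_pos.2 hd0
    calc _ ≤ 4 * (14 * κ ^ 2 / (√|x - l| * l)) * √|x - l| := by gcongr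
      _ = P / 2 := by rw [hκ2]; field_simp; norm_num
  have := (abs_le.1 n4).1
  linarith

/-- The zeros of `1 + α ⟨R₀(λ² + i0) f, f⟩` on the positive half-axis are simple. -/
theorem greenForm_simple_zero (hf : Decay f) {l : ℝ} (hl : 0 < l) (h0 : specDensity f l = 0)
    (hne : ∃ s, specDensity f s ≠ 0) : ∃ c > 0, ∀ᶠ x : ℝ in 𝓝[≠] l,
      c ≤ ((greenForm f f x).re - (greenForm f f l).re) / (x - l) := by
  obtain ⟨c, hc, hev⟩ := specQuotient_pv_lower_bound hf hl h0 hne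
  have hπ := Real.pi_pos
  refine ⟨c / (2 * Real.pi), by positivity, ?_⟩
  have hxp : ∀ᶠ x : ℝ in 𝓝[≠] l, 0 < x := nhdsWithin_le_nhds (lt_mem_nhds hl)
  filter_upwards [hev, hxp, self_mem_nhdsWithin] with x hx hx0 hxl
  obtain ⟨hint, hcx⟩ := hx
  have hi := integrable_specDensity_div_sq_sub_sq hf h0
  set q := specQuotient f l with hq
  have hqi : Integrable q := hi
  -- the resolvent identity
  have key : ∀ w : ℂ, 0 < w.im → ∫ s : ℝ, (q s : ℂ) / (s - w) =
      (greenForm f f w - greenForm f f l) * w * Real.pi / (w ^ 2 - l ^ 2) := by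
    intro w hw
    have hw0 : w ≠ 0 := by rintro rfl; simp at hw
    have hwl : w ^ 2 - (l : ℂ) ^ 2 ≠ 0 := by
      rw [← neg_ne_zero, neg_sub]; exact sq_sub_sq_ne_zero hw.ne' l
    have hsw : ∀ s : ℝ, (s : ℂ) - w ≠ 0 ∧ (s : ℂ) + w ≠ 0 := by
      intro s
      have := sq_sub_sq_ne_zero hw.ne' s
      rw [sq_sub_sq] at this
      exact ⟨right_ne_zero_of_mul this, left_ne_zero_of_mul this⟩
    have hb : ∀ s : ℝ, ‖((s : ℂ) - w)⁻¹‖ ≤ w.im⁻¹ := by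
      intro s
      rw [norm_inv]
      refine inv_anti₀ hw ?_
      have := Complex.abs_im_le_norm ((s : ℂ) - w)
      simp at this
      exact (le_abs_self _).trans this
    have i1 : Integrable fun s : ℝ => ((s : ℂ) - w)⁻¹ * (q s : ℂ) :=
      hqi.ofReal.bdd_mul (Continuous.aestronglyMeasurable
        (Continuous.inv₀ (by fun_prop) fun s => (hsw s).1)) (ae_of_all _ hb)
    have i2 : Integrable fun s : ℝ => (q s : ℂ) / (s - w) :=
      i1.congr (ae_of_all _ fun s => (div_eq_inv_mul _ _).symm)
    have i3 : Integrable fun s : ℝ => (specDensity f s : ℂ) * ((s : ℂ) ^ 2 - w ^ 2)⁻¹ := by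
      obtain ⟨C, -, hC⟩ := norm_inv_sq_sub_sq_le hw.ne'
      refine (integrable_inv_sq_sub_sq hw.ne').bdd_mul
        (c := (∫ x in Ioi (0 : ℝ), ‖f x‖) ^ 2) ?_ (ae_of_all _ fun s => ?_)
      · exact (Complex.continuous_ofReal.comp (continuous_specDensity hf)).aestronglyMeasurable
      · rw [Complex.norm_real, Real.norm_of_nonneg (specDensity_nonneg f s), specDensity]
        gcongr
        refine norm_integral_le_of_norm_le hf.integrable.norm (ae_of_all _ fun x => ?_)
        rw [norm_mul, Complex.norm_real]
        exact mul_le_of_le_one_left (norm_nonneg _) (Real.abs_sin_le_one _)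
    have e1 : ∀ᵐ s : ℝ, (specDensity f s : ℂ) * ((s : ℂ) ^ 2 - w ^ 2)⁻¹ - ((specQuotient f l s : ℝ) : ℂ) =
        (w ^ 2 - l ^ 2) / (2 * w) * ((q s : ℂ) / (s - w) + -((q (-s) : ℂ) / ((-s : ℝ) - w)) * (-1)) := by
      have hae1 : ∀ᵐ s : ℝ, s ≠ l := by simp [ae_iff, measure_singleton]
      have hae2 : ∀ᵐ s : ℝ, s ≠ -l := by simp [ae_iff, measure_singleton]
      filter_upwards [hae1, hae2] with s h1 h2
      have h1' : (s : ℂ) - l ≠ 0 := by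
        rw [← Complex.ofReal_sub]; exact_mod_cast sub_ne_zero.2 h1
      have h2' : (s : ℂ) + l ≠ 0 := by
        rw [← Complex.ofReal_add]
        exact_mod_cast fun h => h2 (by linarith)
      have h3 : (s : ℂ) ^ 2 - l ^ 2 ≠ 0 := by rw [sq_sub_sq]; exact mul_ne_zero h2' h1'
      have h4 := sq_sub_sq_ne_zero hw.ne' s
      obtain ⟨h5, h6⟩ := hsw s
      have h7 : -(s : ℂ) - w ≠ 0 := by
        intro h; apply h6; linear_combination -h
      rw [hq, specQuotient_neg, specQuotient]
      push_cast
      field_simp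
      ring
    have e2 : greenForm f f w - greenForm f f l = (w ^ 2 - l ^ 2) / (Real.pi * w) * ∫ s : ℝ, (q s : ℂ) / (s - w) := by
      rw [greenForm_eq_integral hf hw, greenForm_eq_integral_of_eq_zero hf h0]
      have e3 : ((1 / Real.pi * ∫ s, specDensity f s / (s ^ 2 - l ^ 2) : ℝ) : ℂ) =
          (1 / Real.pi) * ∫ s, ((specQuotient f l s : ℝ) : ℂ) := by
        rw [integral_complex_ofReal]; push_cast; rfl
      rw [e3, ← mul_sub]
      have e4 := integral_sub i3 (hqi.ofReal (𝕜 := ℂ))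
      have e5 : (∫ s : ℝ, (((‖sineTransform f s‖ ^ 2 : ℝ)) : ℂ) * ((s : ℂ) ^ 2 - w ^ 2)⁻¹) - (∫ s, ((specQuotient f l s : ℝ) : ℂ)) =
          ∫ s : ℝ, (w ^ 2 - l ^ 2) / (2 * w) * ((q s : ℂ) / (s - w) + -((q (-s) : ℂ) / ((-s : ℝ) - w)) * (-1)) := by
        rw [← integral_congr_ae e1]
        exact e4.symm
      rw [e5, integral_const_mul, integral_add i2 (by simpa using i2.comp_neg)]
      have e6 : ∫ s : ℝ, -((q (-s) : ℂ) / ((-s : ℝ) - w)) * (-1) = ∫ s : ℝ, (q s : ℂ) / (s - w) := by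
        rw [← integral_neg_eq_self (fun s : ℝ => (q s : ℂ) / (s - w))]
        congr 1; ext s; ring
      rw [e6]
      have hπ' : (Real.pi : ℂ) ≠ 0 := by exact_mod_cast hπ.ne'
      field_simp
      ring
    rw [e2]
    have hπ' : (Real.pi : ℂ) ≠ 0 := by exact_mod_cast hπ.ne'
    field_simp
  -- At `w = x + η * I` the left side of `key` tends in real part to the principal value just
  -- bounded below, and the right side to the difference of the forms over `x² - l²`, up to the
  -- factor `x * π`.
  have hlim1 := tendsto_re_cauchy_integral hint
  have hxl' : (x : ℂ) ^ 2 - (l : ℂ) ^ 2 ≠ 0 := by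
    have : x ^ 2 - l ^ 2 ≠ 0 := by
      rw [sq_sub_sq]
      exact mul_ne_zero (by linarith) (sub_ne_zero.2 hxl)
    exact_mod_cast this
  have hw : Tendsto (fun η : ℝ => (x : ℂ) + η * Complex.I) (𝓝[>] 0) (𝓝 x) :=
    (tendsto_add_mul_I x).mono_right nhdsWithin_le_nhds
  have hlim2 : Tendsto (fun η : ℝ => ((greenForm f f (x + η * Complex.I) - greenForm f f l) *
      (x + η * Complex.I) * Real.pi / ((x + η * Complex.I) ^ 2 - l ^ 2)).re) (𝓝[>] 0)
      (𝓝 (((greenForm f f x - greenForm f f l) * x * Real.pi / ((x : ℂ) ^ 2 - l ^ 2)).re)) :=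
    (Complex.continuous_re.tendsto _).comp ((((((tendsto_greenForm_real hf x).sub_const _).mul hw).mul_const _)).div
      ((hw.pow 2).sub_const _) hxl')
  have hval := tendsto_nhds_unique hlim1 (hlim2.congr' (by
    filter_upwards [self_mem_nhdsWithin] with η hη
    rw [key _ (by simpa using hη)]))
  have e7 : ((greenForm f f x - greenForm f f l) * x * Real.pi / ((x : ℂ) ^ 2 - l ^ 2)).re =
      ((greenForm f f x).re - (greenForm f f l).re) * (x * Real.pi / (x ^ 2 - l ^ 2)) := by
    have : (greenForm f f x - greenForm f f l) * x * Real.pi / ((x : ℂ) ^ 2 - l ^ 2) =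
        (greenForm f f x - greenForm f f l) * ((x * Real.pi / (x ^ 2 - l ^ 2) : ℝ) : ℂ) := by
      push_cast; ring
    rw [this, Complex.re_mul_ofReal, Complex.sub_re]
  rw [hval, e7] at hcx
  have hsub : x - l ≠ 0 := sub_ne_zero.2 hxl
  have hsum : 0 < x + l := by linarith
  set D := (greenForm f f x).re - (greenForm f f l).re with hD
  have e8 : D * (x * Real.pi / (x ^ 2 - l ^ 2)) = D / (x - l) * (x * Real.pi / (x + l)) := by
    rw [sq_sub_sq]; field_simp
  rw [e8] at hcx
  have h9 : 0 < x * Real.pi / (x + l) := by positivity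
  have h10 : x * Real.pi / (x + l) ≤ 2 * Real.pi := by
    rw [div_le_iff₀ hsum]; nlinarith
  rw [div_le_iff₀ (by positivity)]
  have h11 : 0 < D / (x - l) := by
    by_contra hcon
    have := mul_nonpos_of_nonpos_of_nonneg (not_lt.1 hcon) h9.le
    linarith
  exact hcx.trans (by gcongr)

end SimpleZero

/-! ### The resolvent of `L0` as an integral operator -/

section GreenOperator

/-- The derivative of `green w x t` in `x` (off the diagonal). -/
def greenDeriv (w : ℂ) (x t : ℝ) : ℂ :=
  (Complex.exp (Complex.I * w * (x + t : ℝ)) -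
    if t < x then Complex.exp (Complex.I * w * (x - t : ℝ))
    else -Complex.exp (Complex.I * w * (t - x : ℝ))) / 2

theorem hasDerivAt_expPrim (w : ℂ) (y : ℝ) :
    HasDerivAt (expPrim w) (Complex.exp (Complex.I * w * y)) y :=
  intervalIntegral.integral_hasDerivAt_right ((by fun_prop : Continuous _).intervalIntegrable _ _)
    (Continuous.stronglyMeasurableAtFilter (by fun_prop) _ _) (by fun_prop)

theorem hasDerivAt_green (w : ℂ) {y t : ℝ} (h : y ≠ t) :
    HasDerivAt (fun y => green w y t) (greenDeriv w y t) y := by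
  have h1 : HasDerivAt (fun y => expPrim w (y + t)) (Complex.exp (Complex.I * w * (y + t : ℝ))) y :=
    (hasDerivAt_expPrim w (y + t)).comp_add_const y t
  rcases lt_or_gt_of_ne h with h | h
  · have h2 : HasDerivAt (fun y => expPrim w (t - y)) (-Complex.exp (Complex.I * w * (t - y : ℝ))) y :=
      (hasDerivAt_expPrim w (t - y)).comp_const_sub t y
    have h3 : HasDerivAt (fun y => expPrim w |y - t|) (-Complex.exp (Complex.I * w * (t - y : ℝ))) y :=
      h2.congr_of_eventuallyEq (by
        filter_upwards [gt_mem_nhds h] with s hs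
        rw [abs_of_neg (sub_neg.2 hs), neg_sub])
    have := (h1.sub h3).div_const 2
    rw [greenDeriv, if_neg h.not_gt]
    exact this
  · have h2 : HasDerivAt (fun y => expPrim w (y - t)) (Complex.exp (Complex.I * w * (y - t : ℝ))) y :=
      (hasDerivAt_expPrim w (y - t)).comp_sub_const y t
    have h3 : HasDerivAt (fun y => expPrim w |y - t|) (Complex.exp (Complex.I * w * (y - t : ℝ))) y :=
      h2.congr_of_eventuallyEq (by
        filter_upwards [lt_mem_nhds h] with s hs
        rw [abs_of_pos (sub_pos.2 hs)])
    have := (h1.sub h3).div_const 2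
    rw [greenDeriv, if_pos h]
    exact this

theorem measurable_greenDeriv (w : ℂ) : Measurable fun p : ℝ × ℝ => greenDeriv w p.1 p.2 := by
  refine Measurable.div_const (Measurable.sub (by fun_prop) ?_) 2
  exact Measurable.ite (measurableSet_lt measurable_snd measurable_fst) (by fun_prop) (by fun_prop)

theorem intervalIntegrable_greenDeriv (w : ℂ) (t a b : ℝ) :
    IntervalIntegrable (fun y => greenDeriv w y t) volume a b := by
  have h2 : ∀ f g : ℝ → ℂ, Continuous f → Continuous g →
      IntervalIntegrable (fun y => if t < y then f y else g y) volume a b := by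
    intro f g hf hg
    have e : (fun y => if t < y then f y else g y) =
        fun y => (Ioi t).indicator f y + (Iic t).indicator g y := by
      ext y
      by_cases hy : t < y
      · simp [hy, hy.not_ge]
      · simp [hy, not_lt.1 hy]
    rw [e]
    have k1 := (intervalIntegrable_iff.1 (hf.intervalIntegrable (μ := volume) a b)).indicator (measurableSet_Ioi (a := t))
    have k2 := (intervalIntegrable_iff.1 (hg.intervalIntegrable (μ := volume) a b)).indicator (measurableSet_Iic (a := t))
    exact intervalIntegrable_iff.2 (k1.add k2)
  refine IntervalIntegrable.div_const (IntervalIntegrable.sub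
    ((by fun_prop : Continuous _).intervalIntegrable _ _) (h2 _ _ (by fun_prop) (by fun_prop))) 2

theorem integral_greenDeriv (w : ℂ) {x t : ℝ} (hx : 0 ≤ x) (ht : 0 ≤ t) :
    ∫ y in (0 : ℝ)..x, greenDeriv w y t = green w x t := by
  have h0 : green w 0 t = 0 := by
    rw [green]
    simp [abs_of_nonneg ht]
  have := integral_eq_of_hasDerivAt_off_countable_of_le (fun y => green w y t)
    (fun y => greenDeriv w y t) hx (countable_singleton t)
    ((continuous_green w).comp (continuous_id.prodMk continuous_const)).continuousOn
    (fun y hy => hasDerivAt_green w hy.2) (intervalIntegrable_greenDeriv w t 0 x)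
  rw [this, h0, sub_zero]

/-- The integrated form of -G'' = w²G + δ_t. Adding the unit jump back to the derivative gives a
continuous function `H` with derivative -w²G off the point `t`, to which the fundamental theorem of
calculus applies. -/
theorem greenDeriv_eq (w : ℂ) (hw : w ≠ 0) {x t : ℝ} (hx : 0 ≤ x) (ht : 0 < t) :
    greenDeriv w x t = greenDeriv w 0 t - (if t < x then 1 else 0) -
      ∫ y in (0 : ℝ)..x, w ^ 2 * green w y t := by
  set H : ℝ → ℂ := fun y => (Complex.exp (Complex.I * w * (y + t : ℝ)) +
    if y ≤ t then Complex.exp (Complex.I * w * (t - y : ℝ))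
    else 2 - Complex.exp (Complex.I * w * (y - t : ℝ))) / 2 with hH
  have hHg : ∀ y, greenDeriv w y t = H y - if t < y then 1 else 0 := by
    intro y
    simp only [hH, greenDeriv]
    by_cases hy : t < y
    · rw [if_pos hy, if_neg hy.not_ge, if_pos hy]; ring
    · rw [if_neg hy, if_pos (not_lt.1 hy), if_neg hy]; ring
  have hc : Continuous H := by
    refine Continuous.div_const (Continuous.add (by fun_prop) ?_) 2
    refine Continuous.if_le (by fun_prop) (by fun_prop) continuous_id continuous_const ?_
    rintro y rfl
    simp; norm_num
  have hexp : ∀ (φ : ℝ → ℝ) (c y : ℝ), HasDerivAt φ c y →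
      HasDerivAt (fun y => Complex.exp (Complex.I * w * (φ y : ℝ)))
        (Complex.exp (Complex.I * w * (φ y : ℝ)) * (Complex.I * w * c)) y := fun φ c y h =>
    (h.ofReal_comp.const_mul (Complex.I * w)).cexp
  have hd : ∀ y, y ≠ t → HasDerivAt H (-(w ^ 2 * green w y t)) y := by
    intro y hy
    have h1 := hexp (fun y => y + t) 1 y ((hasDerivAt_id y).add_const t)
    rw [green_eq hw]
    have hI := Complex.I_ne_zero
    rcases lt_or_gt_of_ne hy with h | h
    · have h2 := hexp (fun y => t - y) (-1) y ((hasDerivAt_id y).const_sub t)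
      have h3 := ((h1.add h2).div_const 2).congr_of_eventuallyEq (f₁ := H) (by
        filter_upwards [gt_mem_nhds h] with s hs
        simp only [hH]
        rw [if_pos hs.le]
        rfl)
      refine h3.congr_deriv ?_
      rw [abs_of_neg (sub_neg.2 h), neg_sub]
      field_simp
      push_cast
      linear_combination ((Complex.exp (Complex.I * w * (t - y))) - Complex.exp (Complex.I * w * (y + t))) * (-1) * (Complex.I_sq)
    · have h2 := (hexp (fun y => y - t) 1 y ((hasDerivAt_id y).sub_const t)).const_sub 2
      have h3 := ((h1.add h2).div_const 2).congr_of_eventuallyEq (f₁ := H) (by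
        filter_upwards [lt_mem_nhds h] with s hs
        simp only [hH]
        rw [if_neg hs.not_ge]
        rfl)
      refine h3.congr_deriv ?_
      rw [abs_of_pos (sub_pos.2 h)]
      field_simp
      push_cast
      linear_combination ((Complex.exp (Complex.I * w * (y - t))) - Complex.exp (Complex.I * w * (y + t))) * (-1) * (Complex.I_sq)
  have hg : Continuous fun y => -(w ^ 2 * green w y t) := by
    have := (continuous_green w).comp (continuous_id.prodMk (continuous_const (y := t)))
    exact (continuous_const.mul this).neg
  have := integral_eq_of_hasDerivAt_off_countable_of_le H _ hx (countable_singleton t)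
    hc.continuousOn (fun y hy => hd y hy.2) (hg.intervalIntegrable _ _)
  rw [intervalIntegral.integral_neg] at this
  rw [hHg, hHg, if_neg ht.not_gt]
  linear_combination -this

theorem norm_exp_mul_I (w : ℂ) (r : ℝ) :
    ‖Complex.exp (Complex.I * w * r)‖ = Real.exp (-(w.im * r)) := by
  rw [Complex.norm_exp]
  simp

theorem norm_green_le_exp {w : ℂ} (hw : 0 < w.im) {x t : ℝ} (hx : 0 ≤ x) (ht : 0 ≤ t) :
    ‖green w x t‖ ≤ ‖w‖⁻¹ * Real.exp (-(w.im * |x - t|)) := by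
  have h0 : w ≠ 0 := by rintro rfl; simp at hw
  rw [green_eq h0, norm_div]
  have h3 := norm_sub_le (Complex.exp (Complex.I * w * (x + t : ℝ)))
      (Complex.exp (Complex.I * w * (|x - t| : ℝ)))
  rw [norm_exp_mul_I, norm_exp_mul_I] at h3
  have h1 : Real.exp (-(w.im * (x + t))) ≤ Real.exp (-(w.im * |x - t|)) := by
    have : |x - t| ≤ x + t := abs_le.2 ⟨by linarith, by linarith⟩
    gcongr
  have h4 : ‖2 * Complex.I * w‖ = 2 * ‖w‖ := by simp
  have h5 : 0 < ‖w‖ := norm_pos_iff.2 h0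
  rw [h4, div_le_iff₀ (by positivity)]
  field_simp
  linarith

theorem norm_greenDeriv_le_exp {w : ℂ} (hw : 0 < w.im) {x t : ℝ} (hx : 0 ≤ x) (ht : 0 ≤ t) :
    ‖greenDeriv w x t‖ ≤ 1 * Real.exp (-(w.im * |x - t|)) := by
  have h1 : Real.exp (-(w.im * (x + t))) ≤ Real.exp (-(w.im * |x - t|)) := by
    have : |x - t| ≤ x + t := abs_le.2 ⟨by linarith, by linarith⟩
    gcongr
  have key : ∀ a b : ℂ, ‖a‖ ≤ Real.exp (-(w.im * |x - t|)) → ‖b‖ ≤ Real.exp (-(w.im * |x - t|)) →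
      ‖(a - b) / 2‖ ≤ 1 * Real.exp (-(w.im * |x - t|)) := by
    intro a b ha hb
    have := norm_sub_le a b
    rw [norm_div, Complex.norm_ofNat, div_le_iff₀ (by norm_num)]
    linarith
  refine key _ _ (by rw [norm_exp_mul_I]; exact h1) ?_
  split_ifs with h
  · rw [norm_exp_mul_I, abs_of_pos (sub_pos.2 h)]
  · rw [norm_neg, norm_exp_mul_I, abs_of_nonpos (by linarith [not_lt.1 h]), neg_sub]

theorem integrable_exp_neg_mul_abs {η : ℝ} (hη : 0 < η) :
    Integrable fun s : ℝ => Real.exp (-(η * |s|)) := by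
  have h1 : IntegrableOn (fun s : ℝ => Real.exp (-(η * |s|))) (Ioi 0) :=
    (integrableOn_exp_mul_Ioi (neg_lt_zero.2 hη) 0).congr_fun (fun s hs => by
      simp only; rw [abs_of_pos hs, neg_mul]) measurableSet_Ioi
  have h2 : IntegrableOn (fun s : ℝ => Real.exp (-(η * |s|))) (Iic 0) :=
    (integrableOn_exp_mul_Iic hη 0).congr_fun (fun s hs => by
      simp only; rw [abs_of_nonpos hs]; ring_nf) measurableSet_Iic
  rw [← integrableOn_univ, ← Iic_union_Ioi (a := (0 : ℝ))]
  exact h2.union h1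

variable {f g : ℝ → ℂ}

/-- For integrable `f` the image is bounded, because the kernel is, and integrable, because the
kernel is dominated by a convolution; the square is at most the supremum times the modulus. -/
theorem memLp_integral_kernel {K : ℝ → ℝ → ℂ} (hK : Measurable fun p : ℝ × ℝ => K p.1 p.2)
    {C η : ℝ} (hC : 0 ≤ C) (hη : 0 < η)
    (hb : ∀ x t, 0 ≤ x → 0 ≤ t → ‖K x t‖ ≤ C * Real.exp (-(η * |x - t|)))
    (hf : Integrable f halfLine) :
    MemLp (fun x => ∫ t in Ioi (0 : ℝ), K x t * f t) 2 halfLine := by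
  have hm : AEStronglyMeasurable (fun p : ℝ × ℝ => K p.1 p.2 * f p.2) (halfLine.prod halfLine) :=
    hK.aestronglyMeasurable.mul hf.1.comp_snd
  have hm1 : AEStronglyMeasurable (fun x => ∫ t in Ioi (0 : ℝ), K x t * f t) halfLine :=
    hm.integral_prod_right'
  have hconv : Integrable (fun p : ℝ × ℝ => ‖f p.2‖ * Real.exp (-(η * |p.1 - p.2|)))
      (halfLine.prod halfLine) := by
    have := hf.norm.convolution_integrand (ContinuousLinearMap.mul ℝ ℝ) (integrable_exp_neg_mul_abs hη)
    simp only [ContinuousLinearMap.mul_apply'] at this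
    refine this.mono_measure ?_
    rw [show (halfLine.prod halfLine) = (volume.prod halfLine).restrict (Ioi 0 ×ˢ univ) by
      rw [← Measure.prod_restrict, Measure.restrict_univ]]
    exact Measure.restrict_le_self
  have hint : Integrable (fun p : ℝ × ℝ => K p.1 p.2 * f p.2) (halfLine.prod halfLine) := by
    refine (hconv.const_mul C).mono' hm ?_
    filter_upwards [ae_prod_pos] with p hp
    rw [norm_mul]
    calc _ ≤ C * Real.exp (-(η * |p.1 - p.2|)) * ‖f p.2‖ := by
          gcongr; exact hb _ _ hp.1.le hp.2.le
      _ = _ := by ring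
  have hint1 := hint.integral_prod_left
  rw [memLp_two_iff_integrable_sq_norm hm1]
  refine (hint1.norm.const_mul (C * ∫ t in Ioi (0 : ℝ), ‖f t‖)).mono' (hm1.norm.pow 2) ?_
  filter_upwards [ae_restrict_mem measurableSet_Ioi] with x hx
  have h1 : ‖∫ t in Ioi (0 : ℝ), K x t * f t‖ ≤ C * ∫ t in Ioi (0 : ℝ), ‖f t‖ := by
    rw [← integral_const_mul]
    refine norm_integral_le_of_norm_le (hf.norm.const_mul C) ?_
    filter_upwards [ae_restrict_mem measurableSet_Ioi] with t ht
    rw [norm_mul]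
    gcongr
    refine (hb _ _ (le_of_lt hx) (le_of_lt ht)).trans (mul_le_of_le_one_right hC ?_)
    rw [Real.exp_le_one_iff]
    have := abs_nonneg (x - t)
    nlinarith
  rw [Real.norm_of_nonneg (by positivity), sq]
  gcongr

/-- The function `∫ G(x,t) f(t) dt`. -/
def greenOp (w : ℂ) (f : ℝ → ℂ) (x : ℝ) : ℂ := ∫ t in Ioi (0 : ℝ), green w x t * f t

theorem intervalIntegral_kernel_swap {K : ℝ → ℝ → ℂ} (hK : Measurable fun p : ℝ × ℝ => K p.1 p.2)
    {C : ℝ} (hb : ∀ x t, 0 ≤ x → 0 ≤ t → ‖K x t‖ ≤ C) (hf : Integrable f halfLine)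
    {x : ℝ} (hx : 0 ≤ x) :
    ∫ y in (0 : ℝ)..x, ∫ t in Ioi (0 : ℝ), K y t * f t =
      ∫ t in Ioi (0 : ℝ), (∫ y in (0 : ℝ)..x, K y t) * f t := by
  rw [intervalIntegral.integral_of_le hx, integral_integral_swap]
  · refine integral_congr_ae (ae_of_all _ fun t => ?_)
    beta_reduce
    rw [integral_mul_const, intervalIntegral.integral_of_le hx]
  · have h1 : Integrable (fun p : ℝ × ℝ => (1 : ℂ) * f p.2)
        ((volume.restrict (Ioc 0 x)).prod halfLine) := Integrable.mul_prod (integrable_const 1) hf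
    have h2 := h1.bdd_mul (f := fun p : ℝ × ℝ => K p.1 p.2) (c := C) hK.aestronglyMeasurable (by
      rw [Measure.prod_restrict]
      filter_upwards [ae_restrict_mem (measurableSet_Ioc.prod measurableSet_Ioi)] with p hp
      exact hb _ _ (le_of_lt hp.1.1) (le_of_lt hp.2))
    refine h2.congr (ae_of_all _ fun p => ?_)
    simp [Function.uncurry]

theorem integrable_kernel_mul {K : ℝ → ℝ → ℂ} (hK : Measurable fun p : ℝ × ℝ => K p.1 p.2)
    {C : ℝ} (hb : ∀ x t, 0 ≤ x → 0 ≤ t → ‖K x t‖ ≤ C) (hf : Integrable f halfLine)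
    {x : ℝ} (hx : 0 ≤ x) : Integrable (fun t => K x t * f t) halfLine :=
  hf.bdd_mul (c := C) (hK.comp (measurable_const.prodMk measurable_id)).aestronglyMeasurable (by
    filter_upwards [ae_restrict_mem measurableSet_Ioi] with t ht
    exact hb x t hx (le_of_lt ht))

theorem memLp_greenOp {w : ℂ} (hw : 0 < w.im) (hf : Integrable f halfLine) :
    MemLp (greenOp w f) 2 halfLine :=
  memLp_integral_kernel (continuous_green w).measurable (inv_nonneg.2 (norm_nonneg w)) hw
    (fun _ _ hx ht => norm_green_le_exp hw hx ht) hf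

/-- The resolvent of `L₀` is the integral operator with kernel `green`. -/
theorem isDirichletPair_greenOp {w : ℂ} (hw : 0 < w.im) {f : L2} (hf : Integrable f halfLine) :
    IsDirichletPair ((memLp_greenOp hw hf).toLp _) (w ^ 2 • (memLp_greenOp hw hf).toLp _ + f) := by
  have h0 : w ≠ 0 := by rintro rfl; simp at hw
  have hb1 : ∀ x t : ℝ, 0 ≤ x → 0 ≤ t → ‖greenDeriv w x t‖ ≤ 1 := by
    intro x t hx ht
    refine (norm_greenDeriv_le_exp hw hx ht).trans ?_
    rw [one_mul, Real.exp_le_one_iff]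
    have := abs_nonneg (x - t)
    nlinarith
  have hb2 : ∀ x t : ℝ, 0 ≤ x → 0 ≤ t → ‖green w x t‖ ≤ ‖w‖⁻¹ := fun x t hx ht =>
    norm_green_le_inv hw.le h0 hx ht
  have hmd := measurable_greenDeriv w
  have hmg := (continuous_green w).measurable
  refine ⟨greenOp w f, fun x => ∫ t in Ioi (0 : ℝ), greenDeriv w x t * f t, MemLp.coeFn_toLp _,
    memLp_integral_kernel hmd zero_le_one hw
      (fun _ _ hx ht => norm_greenDeriv_le_exp hw hx ht) hf, fun x hx => ?_, fun x hx => ?_⟩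
  · rw [intervalIntegral_kernel_swap hmd hb1 hf hx, greenOp]
    refine setIntegral_congr_fun measurableSet_Ioi fun t ht => ?_
    rw [integral_greenDeriv w hx (le_of_lt ht)]
  · have hae : ((w ^ 2 • (memLp_greenOp hw hf).toLp _ + f : L2) : ℝ → ℂ) =ᵐ[halfLine]
        fun t => w ^ 2 * greenOp w f t + f t := by
      filter_upwards [Lp.coeFn_add (w ^ 2 • (memLp_greenOp hw hf).toLp _) f,
        Lp.coeFn_smul (w ^ 2) ((memLp_greenOp hw hf).toLp _),
        (memLp_greenOp hw hf).coeFn_toLp] with t k1 k2 k3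
      rw [k1, Pi.add_apply, k2, Pi.smul_apply, k3, smul_eq_mul]
    rw [intervalIntegral_congr_half hae hx, intervalIntegral.integral_add
      ((intervalIntegrable_of_memLp (memLp_greenOp hw hf) hx).const_mul _)
      (intervalIntegrable_of_memLp (Lp.memLp f) hx), intervalIntegral.integral_const_mul]
    have e1 : ∫ t in (0 : ℝ)..x, f t = ∫ t in Ioi (0 : ℝ), (if t < x then 1 else 0) * f t := by
      rw [intervalIntegral.integral_of_le hx, integral_Ioc_eq_integral_Ioo,
        ← Ioi_inter_Iio, ← setIntegral_indicator measurableSet_Iio]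
      refine integral_congr_ae (ae_of_all _ fun t => ?_)
      by_cases ht : t < x <;> simp [ht]
    have e2 : ∫ y in (0 : ℝ)..x, greenOp w f y = ∫ t in Ioi (0 : ℝ), (∫ y in (0 : ℝ)..x, green w y t) * f t :=
      intervalIntegral_kernel_swap hmg hb2 hf hx
    have i1 := integrable_kernel_mul hmd hb1 hf (le_refl (0 : ℝ))
    have i2 : Integrable (fun t => (if t < x then 1 else 0) * f t) halfLine := by
      refine hf.bdd_mul (c := 1) (Measurable.aestronglyMeasurable
        (Measurable.ite measurableSet_Iio measurable_const measurable_const)) (ae_of_all _ fun t => ?_)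
      split_ifs <;> simp
    have i3 : Integrable (fun t => (∫ y in (0 : ℝ)..x, green w y t) * f t) halfLine := by
      refine hf.bdd_mul (c := ‖w‖⁻¹ * |x - 0|) ?_ ?_
      · refine Continuous.aestronglyMeasurable ?_
        exact intervalIntegral.continuous_parametric_intervalIntegral_of_continuous'
          (f := fun t y => green w y t) ((continuous_green w).comp continuous_swap) _ _
      · filter_upwards [ae_restrict_mem measurableSet_Ioi] with t ht
        refine intervalIntegral.norm_integral_le_of_norm_le_const fun y hy => ?_
        rw [uIoc_of_le hx] at hy
        exact hb2 _ _ hy.1.le (le_of_lt ht)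
    rw [e1, e2, ← integral_const_mul, ← integral_add (i3.const_mul _) i2]
    refine Eq.trans ?_ (integral_sub i1 ((i3.const_mul _).add i2))
    refine setIntegral_congr_fun measurableSet_Ioi fun t ht => ?_
    rw [greenDeriv_eq w h0 hx ht, intervalIntegral.integral_const_mul]
    ring

theorem inner_greenOp {w : ℂ} (hw : 0 < w.im) {f g : L2} (hf : Decay f) (hg : Decay g) :
    inner ℂ g ((memLp_greenOp hw hf.integrable).toLp _) = greenForm f g w := by
  rw [greenForm, integral_prod _ (integrable_greenForm hf hg hw.le), L2.inner_def]
  refine integral_congr_ae ?_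
  filter_upwards [(memLp_greenOp hw hf.integrable).coeFn_toLp] with x hx
  rw [hx, RCLike.inner_apply, greenOp, ← integral_mul_const]
  refine integral_congr_ae (ae_of_all _ fun t => ?_)
  simp only
  ring

theorem mem_graph_greenOp {w : ℂ} (hw : 0 < w.im) {f : L2} (hf : Integrable f halfLine) :
    ∃ u : L0.domain, (u : L2) = (memLp_greenOp hw hf).toLp _ ∧ L0 u - w ^ 2 • (u : L2) = f := by
  have h : ((memLp_greenOp hw hf).toLp _, w ^ 2 • (memLp_greenOp hw hf).toLp _ + f) ∈ L0.graph := by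
    rw [L0_graph]
    exact isDirichletPair_greenOp hw hf
  obtain ⟨u, h1, h2⟩ := (LinearPMap.mem_graph_iff _).1 h
  refine ⟨u, h1, ?_⟩
  simp only at h1 h2
  rw [h1, h2, add_sub_cancel_left]

end GreenOperator

/-! ### Reducing subspaces and resolvents of an operator with a resolution of identity -/

section Abstract

variable {H : Type*} [NormedAddCommGroup H] [InnerProductSpace ℂ H]

/-- A symmetric operator: its quadratic form is real. -/
def IsSymmetricForm (L : H →ₗ.[ℂ] H) : Prop := ∀ u : L.domain, (inner ℂ (u : H) (L u)).im = 0

theorem IsSymmetricForm.eq_zero {L : H →ₗ.[ℂ] H} (hL : IsSymmetricForm L) {z : ℂ} (hz : z.im ≠ 0)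
    {u : L.domain} (h : L u = z • (u : H)) : u = 0 := by
  have h1 := hL u
  rw [h, inner_smul_right, inner_self_eq_norm_sq_to_K] at h1
  rw [RCLike.ofReal_eq_complex_ofReal, ← Complex.ofReal_pow, Complex.mul_im, Complex.ofReal_im,
    Complex.ofReal_re, mul_zero, zero_add] at h1
  rcases mul_eq_zero.1 h1 with h3 | h3
  · exact absurd h3 hz
  · exact Subtype.ext (norm_eq_zero.1 (pow_eq_zero_iff two_ne_zero |>.1 h3))

/-- A real quadratic form excludes non-real eigenvalues, so one solution of the equation is the only
one and `resolventApply` takes its genuine branch. -/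
theorem IsSymmetricForm.resolventApply_eq [CompleteSpace H] {L : H →ₗ.[ℂ] H} (hL : IsSymmetricForm L) {z : ℂ}
    (hz : z.im ≠ 0) {u : L.domain} {f : H} (h : L u - z • (u : H) = f) :
    resolventApply L z f = u := by
  have hex : ∃! u : L.domain, L u - z • (u : H) = f := by
    refine ⟨u, h, fun y hy => ?_⟩
    rw [← sub_eq_zero]
    refine hL.eq_zero hz ?_
    rw [LinearPMap.map_sub, Submodule.coe_sub, smul_sub]
    have := hy.trans h.symm
    rw [sub_eq_sub_iff_add_eq_add] at this ⊢
    rw [add_comm (z • (y : H))]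
    simpa [add_comm] using this
  rw [resolventApply, dif_pos hex]
  exact congrArg _ (hex.unique hex.choose_spec.1 h)

theorem apply_mem_cyclicSpan (E : ℝ → H →L[ℂ] H) (g : H) (t : ℝ) : E t g ∈ cyclicSpan E g :=
  Submodule.subset_span ⟨t, rfl⟩

variable [CompleteSpace H]

theorem IsResolutionOfIdentity.isSymmetricForm {L : H →ₗ.[ℂ] H} {E : ℝ → H →L[ℂ] H}
    (hE : IsResolutionOfIdentity L E) : IsSymmetricForm L := by
  obtain ⟨μ, -, -, h⟩ := hE.generates
  intro u
  rw [h u]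
  exact Complex.ofReal_im _

theorem IsResolutionOfIdentity.inner_apply_comm {L : H →ₗ.[ℂ] H} {E : ℝ → H →L[ℂ] H}
    (hE : IsResolutionOfIdentity L E) (t : ℝ) (x y : H) : inner ℂ (E t x) y = inner ℂ x (E t y) := by
  have h := (hE.isStarProjection t).isSelfAdjoint
  rw [← ContinuousLinearMap.adjoint_inner_left, ← ContinuousLinearMap.star_eq_adjoint, h.star_eq]

/-- A closed subspace invariant under the resolution of identity of `L` reduces `L`. -/
theorem IsResolutionOfIdentity.inner_eq_zero_of_reducing {L : H →ₗ.[ℂ] H} {E : ℝ → H →L[ℂ] H}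
    (hE : IsResolutionOfIdentity L E) {K : Submodule ℂ H} (hK : ∀ t, ∀ x ∈ K, E t x ∈ K)
    {a b : H} (ha : a ∈ K) (hb : b ∈ Kᗮ) (hab : a + b ∈ L.domain) :
    ∃ ha' : a ∈ L.domain, b ∈ L.domain ∧ inner ℂ b (L ⟨a, ha'⟩) = 0 := by
  obtain ⟨μ, h1, h2, h3⟩ := hE.generates
  have hfin : ∀ y, IsFiniteMeasure (μ y) := by
    intro y
    refine ⟨?_⟩
    have hu : (univ : Set ℝ) = ⋃ n : ℕ, Iic (n : ℝ) := by
      ext x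
      obtain ⟨n, hn⟩ := exists_nat_ge x
      simpa using ⟨n, hn⟩
    have hle : μ y univ ≤ ENNReal.ofReal (‖y‖ ^ 2) := by
      rw [hu, Monotone.measure_iUnion (fun m n hmn => Iic_subset_Iic.2 (by exact_mod_cast hmn))]
      refine iSup_le fun n => ?_
      rw [h1]
      have : ‖E n y‖ ≤ ‖y‖ := by
        have h4 : ‖E n y‖ ^ 2 = (inner ℂ y (E n y)).re := by
          rw [← hE.inner_apply_comm, ← @inner_self_eq_norm_sq ℂ]
          rw [hE.inner_apply_comm, hE.inner_apply_comm, ← mul_apply_eq_comp, hE.mul_eq, min_self]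
          rfl
        have h5 := (Complex.re_le_norm _).trans (norm_inner_le_norm (𝕜 := ℂ) y (E n y))
        rcases (norm_nonneg (E n y)).eq_or_lt with h6 | h6
        · rw [← h6]; exact norm_nonneg y
        · nlinarith
      gcongr
    exact hle.trans_lt ENNReal.ofReal_lt_top
  have hK' : ∀ t, ∀ x ∈ Kᗮ, E t x ∈ Kᗮ := by
    intro t x hx
    rw [Submodule.mem_orthogonal] at hx ⊢
    intro y hy
    rw [← hE.inner_apply_comm]
    exact hx _ (hK t y hy)
  -- The spectral family preserves `K` and its orthogonal complement, so by Pythagoras the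
  -- distribution functions add. Consequently both the domain condition and the quadratic form split
  -- along the decomposition.
  have hsplit : ∀ c d : H, c ∈ K → d ∈ Kᗮ → μ (c + d) = μ c + μ d := by
    intro c d hc hd
    have := hfin
    refine Measure.ext_of_Iic _ _ fun t => ?_
    rw [Measure.add_apply, h1, h1, h1, ← ENNReal.ofReal_add (by positivity) (by positivity), map_add,
      sq, sq, sq, norm_add_sq_eq_norm_sq_add_norm_sq_of_inner_eq_zero (𝕜 := ℂ)]
    exact Submodule.inner_right_of_mem_orthogonal (hK t c hc) (hK' t d hd)
  have hdom : a ∈ L.domain ∧ b ∈ L.domain := by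
    have := (h2 _).1 hab
    rw [hsplit a b ha hb, integrable_add_measure] at this
    exact ⟨(h2 a).2 this.1, (h2 b).2 this.2⟩
  refine ⟨hdom.1, hdom.2, ?_⟩
  have hform : ∀ c d : L.domain, (c : H) ∈ K → (d : H) ∈ Kᗮ →
      inner ℂ (c : H) (L d) + inner ℂ (d : H) (L c) = 0 := by
    intro c d hc hd
    have k0 := h3 (c + d)
    have k1 := h3 c
    have k2 := h3 d
    rw [Submodule.coe_add, hsplit _ _ hc hd] at k0
    have i0 : ∀ e : L.domain, Integrable (fun t : ℝ => t) (μ e) := by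
      intro e
      have := hfin e
      refine (((h2 e).1 e.2).add (integrable_const 1)).mono' measurable_id.aestronglyMeasurable
        (ae_of_all _ fun t => ?_)
      simp only [Pi.add_apply, Real.norm_eq_abs]
      nlinarith [sq_abs t, sq_nonneg (|t| - 1), abs_nonneg t]
    rw [integral_add_measure (i0 c) (i0 d), Complex.ofReal_add, ← k1, ← k2, LinearPMap.map_add, inner_add_left,
      inner_add_right, inner_add_right] at k0
    linear_combination k0
  have e1 := hform ⟨a, hdom.1⟩ ⟨b, hdom.2⟩ ha hb
  -- Only the quadratic form of `L` is known; replacing `b` by `I • b` separates the two cross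
  -- terms, as in polarization.
  have e2 := hform ⟨a, hdom.1⟩ (Complex.I • ⟨b, hdom.2⟩) ha (Submodule.smul_mem _ _ hb)
  rw [LinearPMap.map_smul, Submodule.coe_smul, inner_smul_left, inner_smul_right, Complex.conj_I] at e2
  have hI := Complex.I_sq
  simp only at e1 e2
  linear_combination (1 / 2) * e1 + (Complex.I / 2) * e2 + (-1/2 * inner ℂ a (L ⟨b, hdom.2⟩) + 1 / 2 * inner ℂ b (L ⟨a, hdom.1⟩)) * hI

/-- Let `b` be the component of `u` orthogonal to `K`. Pairing the equation with `b` gives ⟨b, Lb⟩ =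
z‖b‖², whose left side is real while `z` is not; hence `b = 0`. -/
theorem IsResolutionOfIdentity.mem_of_resolvent_eq {L : H →ₗ.[ℂ] H} {E : ℝ → H →L[ℂ] H}
    (hE : IsResolutionOfIdentity L E) {K : Submodule ℂ H} [K.HasOrthogonalProjection]
    (hK : ∀ t, ∀ x ∈ K, E t x ∈ K) {z : ℂ} (hz : z.im ≠ 0) {u : L.domain} {f : H} (hf : f ∈ K)
    (h : L u - z • (u : H) = f) : (u : H) ∈ K := by
  obtain ⟨a, ha, b, hb, hab⟩ := Submodule.exists_add_mem_mem_orthogonal (K := K) (u : H)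
  obtain ⟨ha', hb', h0⟩ := hE.inner_eq_zero_of_reducing hK ha hb (hab ▸ u.2)
  have hu : u = ⟨a, ha'⟩ + ⟨b, hb'⟩ := Subtype.ext hab
  have h1 : inner ℂ b (L u - z • (u : H)) = 0 := by
    rw [h]; exact Submodule.inner_left_of_mem_orthogonal hf hb
  have h2 : inner ℂ b a = 0 := Submodule.inner_left_of_mem_orthogonal ha hb
  rw [inner_sub_right, hu, LinearPMap.map_add, inner_add_right, h0, zero_add, Submodule.coe_add,
    inner_smul_right, inner_add_right] at h1
  simp only [h2, zero_add] at h1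
  have h3 := hE.isSymmetricForm ⟨b, hb'⟩
  simp only at h3
  rw [sub_eq_zero.1 h1, inner_self_eq_norm_sq_to_K, RCLike.ofReal_eq_complex_ofReal,
    ← Complex.ofReal_pow, Complex.mul_im, Complex.ofReal_im, Complex.ofReal_re, mul_zero, zero_add] at h3
  have h4 : b = 0 := by
    rcases mul_eq_zero.1 h3 with h5 | h5
    · exact absurd h5 hz
    · exact norm_eq_zero.1 (pow_eq_zero_iff two_ne_zero |>.1 h5)
  rw [hab, h4, add_zero]
  exact ha

/-- If `g` is orthogonal to all `E_t f`, it is orthogonal to the resolvent of `f`. -/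
theorem IsResolutionOfIdentity.inner_resolvent_eq_zero {L : H →ₗ.[ℂ] H} {E : ℝ → H →L[ℂ] H}
    (hE : IsResolutionOfIdentity L E) {f g : H} (hfg : ∀ t, inner ℂ g (E t f) = 0)
    {z : ℂ} (hz : z.im ≠ 0) {u : L.domain} (h : L u - z • (u : H) = f) : inner ℂ g (u : H) = 0 := by
  have hcl : ∀ s, ∀ x ∈ cyclicSpan E g, E s x ∈ cyclicSpan E g := by
    intro s x hx
    rw [cyclicSpan] at hx ⊢
    refine Submodule.span_induction (p := fun x _ => E s x ∈ Submodule.span ℂ (Set.range fun t => E t g))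
      ?_ (by simp) ?_ ?_ hx
    · rintro _ ⟨t, rfl⟩
      refine Submodule.subset_span ⟨min s t, ?_⟩
      simp only
      rw [← hE.mul_eq]; rfl
    · intro x y _ _ hx hy
      rw [map_add]; exact add_mem hx hy
    · intro c x _ hx
      rw [map_smul]; exact Submodule.smul_mem _ c hx
  have hinv : ∀ t, ∀ x ∈ (cyclicSpan E g)ᗮ, E t x ∈ (cyclicSpan E g)ᗮ := by
    intro t x hx
    rw [Submodule.mem_orthogonal] at hx ⊢
    intro y hy
    rw [← hE.inner_apply_comm]
    exact hx _ (hcl t y hy)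
  have hmem : ∀ x : H, x ∈ (cyclicSpan E g)ᗮ ↔ ∀ t, inner ℂ (E t g) x = 0 := by
    intro x
    constructor
    · intro hx t
      exact Submodule.inner_right_of_mem_orthogonal (apply_mem_cyclicSpan _ _ t) hx
    · intro hx
      rw [Submodule.mem_orthogonal]
      intro y hy
      rw [cyclicSpan] at hy
      refine Submodule.span_induction (p := fun y _ => inner ℂ y x = 0) ?_ (by simp) ?_ ?_ hy
      · rintro _ ⟨t, rfl⟩; exact hx t
      · intro a b _ _ ha hb; rw [inner_add_left, ha, hb, add_zero]
      · intro c a _ ha; rw [inner_smul_left, ha, mul_zero]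
  -- The orthogonal complement of the cyclic span of `g` is invariant and contains `f`, so it
  -- contains `u`. Since `g` is only a limit of the `E t g`, the conclusion is reached as `t` tends
  -- to infinity.
  have hu := (hmem _).1 (hE.mem_of_resolvent_eq hinv hz
    ((hmem f).2 fun t => by rw [hE.inner_apply_comm]; exact hfg t) h)
  have hlim : Tendsto (fun t => inner ℂ (E t g) (u : H)) atTop (𝓝 (inner ℂ g (u : H))) :=
    (hE.tendsto_atTop g).inner tendsto_const_nhds
  exact tendsto_nhds_unique (hlim.congr hu) tendsto_const_nhds

end Abstract

/-! ### Orthogonal families: reduction of the factors to the free resolvent -/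

section Factors

variable {n : ℕ} {α : Fin n → ℝ} {v : Fin n → L2} {E : ℝ → L2 →L[ℂ] L2}

theorem IsAdmissible.decay' (h : IsAdmissible α v) (k : Fin n) : Decay (v k) :=
  ⟨Lp.aestronglyMeasurable _, h.decay k⟩

/-- Self-adjointness of `E t` makes the one-sided hypothesis symmetric in the two indices. -/
theorem IsOrthogonalFamily.inner_eq_zero (hE : IsResolutionOfIdentity L0 E)
    (hO : IsOrthogonalFamily E v) {k s : Fin n} (hks : k ≠ s) (t : ℝ) :
    inner ℂ (v k) (E t (v s)) = 0 := by
  rcases lt_or_gt_of_ne hks with h | h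
  · rw [← hE.inner_apply_comm]
    exact Submodule.inner_right_of_mem_orthogonal (apply_mem_cyclicSpan _ _ t) (hO s k h)
  · exact Submodule.inner_left_of_mem_orthogonal (apply_mem_cyclicSpan _ _ t) (hO k s h)

theorem partialOp_isSymmetricForm (hE : IsResolutionOfIdentity L0 E) (k : ℕ) :
    IsSymmetricForm (partialOp α v k) := by
  intro u
  have h0 := hE.isSymmetricForm ⟨(u : L2), u.2⟩
  have h1 : partialOp α v k u = (∑ s : Fin n, if (s : ℕ) < k then
      (α s : ℂ) • InnerProductSpace.rankOne ℂ (v s) (v s) else 0 : L2 →L[ℂ] L2) (u : L2) +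
      L0 ⟨(u : L2), u.2⟩ := rfl
  rw [h1, inner_add_right, Complex.add_im, h0, add_zero, _root_.sum_apply, inner_sum, Complex.im_sum]
  refine Finset.sum_eq_zero fun s _ => ?_
  split_ifs
  · rw [_root_.smul_apply, InnerProductSpace.rankOne_apply, inner_smul_right, inner_smul_right,
      Complex.im_ofReal_mul, ← inner_conj_symm (u : L2), Complex.mul_conj, Complex.ofReal_im, mul_zero]
  · simp

theorem exists_resolvent (hE : IsResolutionOfIdentity L0 E) {w : ℂ} (hw : 0 < w.im) (hw2 : (w ^ 2).im ≠ 0)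
    {f : L2} (hf : Integrable f halfLine) :
    ∃ u : L0.domain, L0 u - w ^ 2 • (u : L2) = f ∧
      (u : L2) = (memLp_greenOp hw hf).toLp _ ∧ resolventApply L0 (w ^ 2) f = u := by
  obtain ⟨u, h1, h2⟩ := mem_graph_greenOp hw hf
  exact ⟨u, h2, h1, hE.isSymmetricForm.resolventApply_eq hw2 h2⟩

theorem exists_sq_eq {z : ℂ} (hz : z.im ≠ 0) : ∃ w : ℂ, 0 < w.im ∧ w ^ 2 = z := by
  obtain ⟨w, hw⟩ := IsAlgClosed.exists_pow_nat_eq z (n := 2) (by norm_num)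
  have h0 : w.im ≠ 0 := by
    intro h
    apply hz
    rw [← hw, sq, Complex.mul_im, h]
    ring
  rcases lt_or_gt_of_ne h0 with h | h
  · exact ⟨-w, by simpa using h, by rw [neg_sq, hw]⟩
  · exact ⟨w, h, hw⟩

theorem inner_resolventApply (hE : IsResolutionOfIdentity L0 E) {f g : L2} (hf : Decay f) (hg : Decay g)
    {w : ℂ} (hw : 0 < w.im) (hw2 : (w ^ 2).im ≠ 0) :
    inner ℂ g (resolventApply L0 (w ^ 2) f) = greenForm f g w := by
  obtain ⟨u, -, h2, h3⟩ := exists_resolvent hE hw hw2 hf.integrable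
  rw [h3, h2, inner_greenOp hw hf hg]

theorem greenForm_eq_zero (hE : IsResolutionOfIdentity L0 E) (hK : IsAdmissible α v)
    (hO : IsOrthogonalFamily E v) {k s : Fin n} (hks : k ≠ s) {w : ℂ} (hw : 0 < w.im)
    (hw2 : (w ^ 2).im ≠ 0) : greenForm (v s) (v k) w = 0 := by
  obtain ⟨u, h1, h2, h3⟩ := exists_resolvent hE hw hw2 (hK.decay' s).integrable
  rw [← inner_greenOp hw (hK.decay' s) (hK.decay' k), ← h2]
  exact hE.inner_resolvent_eq_zero (fun t => hO.inner_eq_zero hE hks t) hw2 h1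

/-- The free resolvent of `v k` is orthogonal to every earlier `v s`, so the finite-rank part of the
operator annihilates it and it solves the perturbed equation as well. -/
theorem resolventApply_partialOp (hE : IsResolutionOfIdentity L0 E) (hK : IsAdmissible α v)
    (hO : IsOrthogonalFamily E v) (k : Fin n) {z : ℂ} (hz : z.im ≠ 0) :
    resolventApply (partialOp α v k) z (v k) = resolventApply L0 z (v k) := by
  obtain ⟨w, hw, rfl⟩ := exists_sq_eq hz
  obtain ⟨u, h1, h2, h3⟩ := exists_resolvent hE hw hz (hK.decay' k).integrable
  rw [h3]
  refine (partialOp_isSymmetricForm hE k).resolventApply_eq hz (u := ⟨(u : L2), u.2⟩) ?_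
  have h4 : partialOp α v k ⟨(u : L2), u.2⟩ = (∑ s : Fin n, if (s : ℕ) < k then
      (α s : ℂ) • InnerProductSpace.rankOne ℂ (v s) (v s) else 0 : L2 →L[ℂ] L2) (u : L2) +
      L0 u := rfl
  have h5 : (∑ s : Fin n, if (s : ℕ) < k then
      (α s : ℂ) • InnerProductSpace.rankOne ℂ (v s) (v s) else 0 : L2 →L[ℂ] L2) (u : L2) = 0 := by
    rw [_root_.sum_apply]
    refine Finset.sum_eq_zero fun s _ => ?_
    split_ifs with hs
    · rw [_root_.smul_apply, InnerProductSpace.rankOne_apply,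
        hE.inner_resolvent_eq_zero (fun t => hO.inner_eq_zero hE (Fin.ne_of_lt hs) t) hz h1, zero_smul,
        smul_zero]
    · simp
  rw [h4, h5, zero_add]
  exact h1

theorem bFactor_eq (hE : IsResolutionOfIdentity L0 E) (hK : IsAdmissible α v)
    (hO : IsOrthogonalFamily E v) (k : Fin n) {w : ℂ} (hw : 0 < w.im) (hw2 : (w ^ 2).im ≠ 0) :
    bFactor α v k (w ^ 2) = 1 + α k * greenForm (v k) (v k) w := by
  rw [bFactor, resolventApply_partialOp hE hK hO k hw2,
    inner_resolventApply hE (hK.decay' k) (hK.decay' k) hw hw2]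

end Factors

/-! ### Determinant of a rank-one update -/

section RankOneDeterminant

variable {m : Type*} [Fintype m] [DecidableEq m]

open Matrix in
theorem det_sub_rankOne_of_isUnit {A : Matrix m m ℂ} (hA : IsUnit A.det) (u r : m → ℂ) :
    (A - Matrix.of fun i j => u i * r j).det = A.det - ∑ j, r j * (A.updateCol j u).det := by
  have h1 := Matrix.det_add_replicateCol_mul_replicateRow (ι := Unit) hA u (-r)
  have e1 : A - (Matrix.of fun i j => u i * r j) = A + replicateCol Unit u * replicateRow Unit (-r) := by
    ext i j
    simp [Matrix.mul_apply, replicateCol, replicateRow, sub_eq_add_neg]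
  have e2 : ∀ j, (A.updateCol j u).det = (A.adjugate *ᵥ u) j := fun j => by
    rw [← Matrix.cramer_eq_adjugate_mulVec, Matrix.cramer_apply]
  have h0 : A.det ≠ 0 := hA.ne_zero
  have e3 : (1 + replicateRow Unit (-r) * A⁻¹ * replicateCol Unit u : Matrix Unit Unit ℂ) default default =
      1 + -(r ⬝ᵥ (A⁻¹ *ᵥ u)) := by
    rw [Matrix.add_apply, Matrix.one_apply_eq, Matrix.mul_assoc, ← neg_dotProduct]
    rfl
  rw [e1, h1, Matrix.det_unique (_ : Matrix Unit Unit ℂ), e3, Matrix.inv_def, Ring.inverse_eq_inv', Matrix.smul_mulVec, dotProduct_smul, smul_eq_mul, dotProduct]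
  simp_rw [e2]
  field_simp
  ring

/-- For invertible matrices this is the matrix determinant lemma; the general case follows by
continuity, since adding a small non-zero scalar matrix makes `A` invertible. It collapses the
Cramer sum in the Jost solution to a single determinant, also where the Jost matrix is singular. -/
theorem det_sub_rankOne (A : Matrix m m ℂ) (u r : m → ℂ) :
    (A - Matrix.of fun i j => u i * r j).det = A.det - ∑ j, r j * (A.updateCol j u).det := by
  set B : ℂ → Matrix m m ℂ := fun t => Matrix.scalar m t + A with hB
  have hBc : Continuous B := by
    refine Continuous.add ?_ continuous_const
    refine continuous_matrix fun i j => ?_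
    simp only [Matrix.scalar_apply, Matrix.diagonal_apply]
    split_ifs <;> fun_prop
  have h0 : B 0 = A := by simp [hB]
  have hne : ∀ᶠ t in 𝓝[≠] (0 : ℂ), IsUnit (B t).det := by
    have hp : (-A).charpoly ≠ 0 := (Matrix.charpoly_monic _).ne_zero
    have hfin : ((-A).charpoly.roots.toFinset : Set ℂ).Finite := Finset.finite_toSet _
    have : ∀ᶠ t in 𝓝[≠] (0 : ℂ), t ∉ ((-A).charpoly.roots.toFinset : Set ℂ) := by
      have := hfin.sdiff (t := {0})
      refine mem_nhdsWithin.2 ⟨_, this.isClosed.isOpen_compl, by simp, ?_⟩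
      rintro t ⟨ht1, ht2⟩ ht3
      exact ht1 ⟨ht3, ht2⟩
    filter_upwards [this] with t ht
    rw [isUnit_iff_ne_zero]
    intro h
    refine ht ?_
    simp only [Finset.mem_coe, Multiset.mem_toFinset]
    rw [Polynomial.mem_roots hp, Polynomial.IsRoot, Matrix.eval_charpoly, sub_neg_eq_add]
    exact h
  have k1 : Tendsto (fun t => (B t - Matrix.of fun i j => u i * r j).det) (𝓝[≠] 0)
      (𝓝 ((B 0 - Matrix.of fun i j => u i * r j).det)) :=
    ((hBc.sub continuous_const).matrix_det.tendsto 0).mono_left nhdsWithin_le_nhds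
  have k2 : Tendsto (fun t => (B t).det - ∑ j, r j * ((B t).updateCol j u).det) (𝓝[≠] 0)
      (𝓝 ((B 0).det - ∑ j, r j * ((B 0).updateCol j u).det)) := by
    have : Continuous fun t => (B t).det - ∑ j, r j * ((B t).updateCol j u).det :=
      hBc.matrix_det.sub (continuous_finsetSum _ fun j _ =>
        continuous_const.mul (hBc.matrix_updateCol j continuous_const).matrix_det)
    exact (this.tendsto 0).mono_left nhdsWithin_le_nhds
  have k3 := tendsto_nhds_unique (k1.congr' (by
    filter_upwards [hne] with t ht using det_sub_rankOne_of_isUnit ht u r)) k2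
  rwa [h0] at k3

end RankOneDeterminant

/-! ### Boundary values of the factors -/

section BoundaryValues

variable {n : ℕ} {α β : Fin n → ℝ} {v u : Fin n → L2} {E : ℝ → L2 →L[ℂ] L2}

/-- The function `1 + a ⟨(L₀ - w²)⁻¹ f, f⟩` on the closed upper half-plane. -/
def bVal (a : ℝ) (f : ℝ → ℂ) (w : ℂ) : ℂ := 1 + a * greenForm f f w

theorem upperSet_subset : upperSet ⊆ {w : ℂ | 0 ≤ w.im} := fun _ hw => le_of_lt hw.1

/-- The direction is `1 + I` or `-1 + I` according to the sign of the real part, so that the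
approach avoids the imaginary axis, where the square is real. Without this the limits defining the
boundary values would be void. -/
theorem upperSet_neBot {w : ℂ} (hw : 0 ≤ w.im) : (𝓝[upperSet] w).NeBot := by
  rw [← mem_closure_iff_nhdsWithin_neBot]
  set d : ℂ := if 0 ≤ w.re then 1 + Complex.I else -1 + Complex.I with hd
  have hlim : Tendsto (fun t : ℝ => w + t * d) (𝓝[>] 0) (𝓝 w) := by
    have : Continuous fun t : ℝ => w + t * d := by fun_prop
    simpa using (this.tendsto 0).mono_left nhdsWithin_le_nhds
  refine mem_closure_of_tendsto hlim ?_
  filter_upwards [self_mem_nhdsWithin] with t ht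
  have ht' : 0 < t := ht
  have him : d.im = 1 := by rw [hd]; split_ifs <;> simp
  have h1 : 0 < (w + t * d).im := by simp [him]; linarith
  refine ⟨h1, ?_⟩
  have h2 : (w + t * d).re ≠ 0 := by
    rw [hd]
    split_ifs with h
    · simp; linarith
    · simp; linarith
  rw [sq, Complex.mul_im]
  intro h3
  have : (w + t * d).re * (w + t * d).im = 0 := by linarith
  rcases mul_eq_zero.1 this with h | h
  · exact h2 h
  · exact h1.ne' h

theorem continuousOn_bVal {a : ℝ} {f : ℝ → ℂ} (hf : Decay f) :
    ContinuousOn (bVal a f) {w | 0 ≤ w.im} :=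
  continuousOn_const.add (continuousOn_const.mul (continuousOn_greenForm hf hf))

theorem tendsto_bFactor_upper (hE : IsResolutionOfIdentity L0 E) (hK : IsAdmissible α v)
    (hO : IsOrthogonalFamily E v) (k : Fin n) {w : ℂ} (hw : 0 ≤ w.im) :
    Tendsto (fun w : ℂ => bFactor α v k (w ^ 2)) (𝓝[upperSet] w) (𝓝 (bVal (α k) (v k) w)) := by
  refine (((continuousOn_bVal (hK.decay' k)) w hw).mono upperSet_subset).tendsto.congr' ?_
  filter_upwards [self_mem_nhdsWithin] with z hz
  rw [bFactor_eq hE hK hO k hz.1 hz.2, bVal]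

theorem bUpper_eq (hE : IsResolutionOfIdentity L0 E) (hK : IsAdmissible α v)
    (hO : IsOrthogonalFamily E v) (k : Fin n) {w : ℂ} (hw : 0 ≤ w.im) :
    bUpper α v k w = bVal (α k) (v k) w :=
  have := upperSet_neBot hw
  (tendsto_bFactor_upper hE hK hO k hw).limUnder_eq

theorem tendsto_neg_lowerSet (w : ℂ) : Tendsto (fun z : ℂ => -z) (𝓝[lowerSet] w) (𝓝[upperSet] (-w)) := by
  refine tendsto_nhdsWithin_of_tendsto_nhds_of_eventually_within _
    ((continuous_neg.tendsto w).mono_left nhdsWithin_le_nhds) ?_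
  filter_upwards [self_mem_nhdsWithin] with z hz
  exact ⟨by simpa using hz.1, by simpa using hz.2⟩

theorem lowerSet_neBot {w : ℂ} (hw : w.im ≤ 0) : (𝓝[lowerSet] w).NeBot := by
  have h := upperSet_neBot (w := -w) (by simpa using hw)
  have : Tendsto (fun z : ℂ => -z) (𝓝[upperSet] (-w)) (𝓝[lowerSet] w) := by
    refine tendsto_nhdsWithin_of_tendsto_nhds_of_eventually_within _ ?_ ?_
    · have := ((continuous_neg (G := ℂ)).tendsto (-w)).mono_left (nhdsWithin_le_nhds (s := upperSet))
      rwa [neg_neg] at this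
    · filter_upwards [self_mem_nhdsWithin] with z hz
      exact ⟨by simpa using hz.1, by simpa using hz.2⟩
  exact this.neBot

theorem tendsto_bFactor_lower (hE : IsResolutionOfIdentity L0 E) (hK : IsAdmissible α v)
    (hO : IsOrthogonalFamily E v) (k : Fin n) {w : ℂ} (hw : w.im ≤ 0) :
    Tendsto (fun w : ℂ => bFactor α v k (w ^ 2)) (𝓝[lowerSet] w) (𝓝 (bVal (α k) (v k) (-w))) := by
  have := (tendsto_bFactor_upper hE hK hO k (w := -w) (by simpa using hw)).comp (tendsto_neg_lowerSet w)
  refine this.congr fun z => ?_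
  simp

/-- Since `w` and `-w` have the same square, the limit from below is the limit from above at the
reflected point. -/
theorem bLower_eq (hE : IsResolutionOfIdentity L0 E) (hK : IsAdmissible α v)
    (hO : IsOrthogonalFamily E v) (k : Fin n) {w : ℂ} (hw : w.im ≤ 0) :
    bLower α v k w = bVal (α k) (v k) (-w) :=
  have := lowerSet_neBot hw
  (tendsto_bFactor_lower hE hK hO k hw).limUnder_eq

theorem bVal_neg (a : ℝ) (f : ℝ → ℂ) (l : ℝ) : bVal a f (-l) = (starRingEnd ℂ) (bVal a f l) := by
  have := greenForm_conj f l
  rw [Complex.conj_ofReal] at this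
  simp [bVal, this]

theorem sFactor_eq (hE : IsResolutionOfIdentity L0 E) (hK : IsAdmissible α v)
    (hO : IsOrthogonalFamily E v) (k : Fin n) {l : ℝ} (hl : l ≠ 0) :
    sFactor α v k l = bVal (α k) (v k) (-l) / bVal (α k) (v k) l := by
  have h1 : (α k : ℂ) ≠ 0 := by exact_mod_cast hK.ne_zero k
  have h2 : (l : ℂ) ≠ 0 := by exact_mod_cast hl
  have hI := Complex.I_ne_zero
  rw [sFactor, rFactor, rFactor, bUpper_eq hE hK hO k (by simp), bUpper_eq hE hK hO k (by simp)]
  have e : -(-(2 * Complex.I * -(l : ℂ) / (α k)) * bVal (α k) (v k) (-l)) =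
      -(2 * Complex.I * l / α k) * bVal (α k) (v k) (-l) := by ring
  rw [e, mul_div_mul_left]
  exact neg_ne_zero.2 (div_ne_zero (mul_ne_zero (mul_ne_zero two_ne_zero hI) h2) h1)

theorem rFactor_eq_zero_iff (hE : IsResolutionOfIdentity L0 E) (hK : IsAdmissible α v)
    (hO : IsOrthogonalFamily E v) (k : Fin n) {w : ℂ} (hw0 : w ≠ 0) (hw : 0 ≤ w.im) :
    rFactor α v k w = 0 ↔ bVal (α k) (v k) w = 0 := by
  have h1 : (α k : ℂ) ≠ 0 := by exact_mod_cast hK.ne_zero k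
  rw [rFactor, bUpper_eq hE hK hO k hw, mul_eq_zero, neg_eq_zero, div_eq_zero_iff]
  simp [h1, hw0]

theorem sFactor_mul_bUpper (hE : IsResolutionOfIdentity L0 E) (hK : IsAdmissible α v)
    (hO : IsOrthogonalFamily E v) (k : Fin n) {l : ℝ} (hl : l ≠ 0) :
    sFactor α v k l * bUpper α v k l = bLower α v k l := by
  rw [sFactor_eq hE hK hO k hl, bUpper_eq hE hK hO k (by simp), bLower_eq hE hK hO k (by simp)]
  -- The two boundary values are conjugate, so they vanish together and the convention for a zero
  -- denominator does no harm.
  by_cases h : bVal (α k) (v k) l = 0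
  · rw [bVal_neg, h]; simp
  · rw [div_mul_cancel₀ _ h]

end BoundaryValues

/-! ### The Jost solution at the origin and the product formula -/

section Scattering

variable {n : ℕ} {α : Fin n → ℝ} {v : Fin n → L2} {E : ℝ → L2 →L[ℂ] L2}

theorem integrable_sin_sub_mul {f : ℝ → ℂ} (hf : Integrable f halfLine) (l : ℝ) (x : ℝ) :
    Integrable (fun t => (Ioi x).indicator (fun t => ((Real.sin (l * (t - x)) / l : ℝ) : ℂ)) t * f t) halfLine := by
  refine hf.bdd_mul (c := 1 / |l|) ?_ (ae_of_all _ fun t => ?_)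
  · exact ((by fun_prop : Measurable _).indicator measurableSet_Ioi).aestronglyMeasurable
  · by_cases h : t ∈ Ioi x
    · rw [indicator_of_mem h, Complex.norm_real, norm_div, Real.norm_eq_abs, Real.norm_eq_abs]
      gcongr
      exact Real.abs_sin_le_one _
    · rw [indicator_of_notMem h, norm_zero]; positivity

theorem psiTail_eq (f : L2) (l : ℝ) {x : ℝ} (hx : 0 ≤ x) :
    psiTail f l x = ∫ t in Ioi (0 : ℝ),
      (Ioi x).indicator (fun t => ((Real.sin (l * (t - x)) / l : ℝ) : ℂ)) t * f t := by
  have e : ∀ t, (Ioi x).indicator (fun t => ((Real.sin (l * (t - x)) / l : ℝ) : ℂ)) t * f t =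
      (Ioi x).indicator (fun t => ((Real.sin (l * (t - x)) / l : ℝ) : ℂ) * f t) t := by
    intro t
    by_cases h : t ∈ Ioi x <;> simp [h]
  simp_rw [e]
  rw [setIntegral_indicator measurableSet_Ioi, inter_eq_right.2 (Ioi_subset_Ioi hx), psiTail]

/-- Variation of constants: the resolvent kernel is a separated kernel minus the Volterra kernel
from which `psiTail` is built. -/
theorem green_eq_sin {l : ℝ} (hl : l ≠ 0) {x t : ℝ} :
    green l x t = Complex.exp (Complex.I * l * x) * ((Real.sin (l * t) / l : ℝ) : ℂ) -
      (Ioi x).indicator (fun t => ((Real.sin (l * (t - x)) / l : ℝ) : ℂ)) t := by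
  have hl' : (l : ℂ) ≠ 0 := by exact_mod_cast hl
  have hI := Complex.I_ne_zero
  have hs : ∀ r : ℝ, ((Real.sin (l * r) / l : ℝ) : ℂ) =
      (Complex.exp (Complex.I * l * r) - Complex.exp (-(Complex.I * l * r))) / (2 * Complex.I * l) := by
    intro r
    rw [Complex.ofReal_div, Complex.ofReal_sin, Complex.sin, Complex.ofReal_mul]
    rw [show -((l : ℂ) * r) * Complex.I = -(Complex.I * l * r) by ring,
      show ((l : ℂ) * r) * Complex.I = (Complex.I * l * r) by ring]
    field_simp
    linear_combination (Complex.exp (-(Complex.I * l * r)) - Complex.exp ((Complex.I * l * r))) * Complex.I_sq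
  have h1 : Complex.exp (Complex.I * l * (x + t : ℝ)) =
      Complex.exp (Complex.I * l * x) * Complex.exp (Complex.I * l * t) := by
    rw [← Complex.exp_add]; push_cast; ring_nf
  rw [green_eq hl', h1, hs t]
  by_cases h : t ∈ Ioi x
  · rw [indicator_of_mem h, abs_of_neg (sub_neg.2 h), neg_sub, hs (t - x)]
    have h2 : Complex.exp (-(Complex.I * l * (t - x : ℝ))) =
        Complex.exp (Complex.I * l * x) * Complex.exp (-(Complex.I * l * t)) := by
      rw [← Complex.exp_add]; push_cast; ring_nf
    rw [h2]
    ring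
  · rw [indicator_of_notMem h, abs_of_nonneg (sub_nonneg.2 (not_lt.1 h))]
    have h2 : Complex.exp (Complex.I * l * (x - t : ℝ)) =
        Complex.exp (Complex.I * l * x) * Complex.exp (-(Complex.I * l * t)) := by
      rw [← Complex.exp_add]; push_cast; ring_nf
    rw [h2]
    ring

/-- Pairing that decomposition of the kernel with `f` and `g` expresses the resolvent form through
exactly the two quantities that enter the Jost solution at the origin. -/
theorem conj_fourier_mul_psiTail_sub (f g : L2) (hf : Decay f) (hg : Decay g) {l : ℝ} (hl : l ≠ 0) :
    (starRingEnd ℂ) (fourier g l) * psiTail f l 0 -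
      ∫ x in Ioi (0 : ℝ), psiTail f l x * (starRingEnd ℂ) (g x) = greenForm f g l := by
  have hint := integrable_greenForm hf hg (w := l) (by simp)
  have hprod : greenForm f g l = ∫ x in Ioi (0 : ℝ), greenOp l f x * (starRingEnd ℂ) (g x) := by
    rw [greenForm, integral_prod _ hint]
    refine integral_congr_ae (ae_of_all _ fun x => ?_)
    simp only [greenOp]
    rw [← integral_mul_const]
    refine integral_congr_ae (ae_of_all _ fun t => ?_)
    ring
  have hop : ∀ x ∈ Ioi (0 : ℝ), psiTail f l x =
      Complex.exp (Complex.I * l * x) * psiTail f l 0 - greenOp l f x := by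
    intro x hx
    have i1 := (integrable_sin_sub_mul hf.integrable l 0).const_mul (Complex.exp (Complex.I * l * x))
    have i2 := integrable_sin_sub_mul hf.integrable l x
    rw [psiTail_eq f l (le_of_lt hx), psiTail_eq f l le_rfl, greenOp, eq_sub_iff_add_eq', ← eq_sub_iff_add_eq,
      ← integral_const_mul, ← integral_sub i1 i2]
    refine setIntegral_congr_fun measurableSet_Ioi fun t ht => ?_
    rw [green_eq_sin hl, indicator_of_mem ht, sub_zero]
    ring
  have hc : (starRingEnd ℂ) (fourier g l) =
      ∫ x in Ioi (0 : ℝ), Complex.exp (Complex.I * l * x) * (starRingEnd ℂ) (g x) := by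
    rw [fourier, ← integral_conj]
    refine integral_congr_ae (ae_of_all _ fun x => ?_)
    simp only [map_mul, ← Complex.exp_conj, map_neg, Complex.conj_I, Complex.conj_ofReal]
    ring_nf
  have i3 : Integrable (fun x => greenOp l f x * (starRingEnd ℂ) (g x)) halfLine := by
    refine hint.integral_prod_left.congr (ae_of_all _ fun x => ?_)
    simp only [greenOp]
    rw [← integral_mul_const]
    refine integral_congr_ae (ae_of_all _ fun t => ?_)
    ring
  have i4 : Integrable (fun x : ℝ => Complex.exp (Complex.I * l * x) * (starRingEnd ℂ) (g x)) halfLine := by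
    refine (Complex.conjLIE.toContinuousLinearEquiv.integrable_comp_iff.2 hg.integrable).bdd_mul (c := 1)
      (by fun_prop : Continuous _).aestronglyMeasurable ?_
    filter_upwards [ae_restrict_mem measurableSet_Ioi] with x hx
    exact norm_exp_le_one (by simp) (le_of_lt hx)
  have hphi : ∫ x in Ioi (0 : ℝ), psiTail f l x * (starRingEnd ℂ) (g x) =
      ∫ x in Ioi (0 : ℝ), (psiTail f l 0 * (Complex.exp (Complex.I * l * x) * (starRingEnd ℂ) (g x)) -
        greenOp l f x * (starRingEnd ℂ) (g x)) := by
    refine setIntegral_congr_fun measurableSet_Ioi fun x hx => ?_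
    rw [hop x hx]; ring
  rw [hphi, integral_sub (i4.const_mul _) i3, integral_const_mul, ← hc, hprod]
  ring

theorem greenForm_eq_zero_real (hE : IsResolutionOfIdentity L0 E) (hK : IsAdmissible α v)
    (hO : IsOrthogonalFamily E v) {k s : Fin n} (hks : k ≠ s) (l : ℝ) :
    greenForm (v s) (v k) l = 0 := by
  have := upperSet_neBot (w := l) (by simp)
  have h1 := (((continuousOn_greenForm (hK.decay' s) (hK.decay' k)) l (by simp)).mono upperSet_subset).tendsto
  refine tendsto_nhds_unique (h1.congr' ?_) tendsto_const_nhds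
  filter_upwards [self_mem_nhdsWithin] with w hw
  exact greenForm_eq_zero hE hK hO hks hw.1 hw.2

/-- At `x = 0` the Jost solution is the determinant of the Jost matrix minus a rank-one matrix.
Entry by entry this difference is minus the identity minus a coupling times a resolvent form, and
the forms off the diagonal vanish by orthogonality. -/
theorem jost_zero (hE : IsResolutionOfIdentity L0 E) (hK : IsAdmissible α v)
    (hO : IsOrthogonalFamily E v) {l : ℝ} (hl : l ≠ 0) :
    jost α v l 0 = (-1) ^ n * ∏ k, bVal (α k) (v k) l := by
  have h1 : jost α v l 0 = (jostMatrix α v l -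
      Matrix.of fun k s => (starRingEnd ℂ) (fourier (v k) l) * (α s * psiTail (v s) l 0)).det := by
    rw [det_sub_rankOne, jost, jostDet]
    simp only [jostCoeff, Complex.ofReal_zero, mul_zero, Complex.exp_zero, one_mul, sub_eq_add_neg,
      ← Finset.sum_neg_distrib]
    congr 1
    refine Finset.sum_congr rfl fun s _ => ?_
    ring
  have h2 : jostMatrix α v l -
      Matrix.of (fun k s => (starRingEnd ℂ) (fourier (v k) l) * (α s * psiTail (v s) l 0)) =
      Matrix.diagonal fun k => -bVal (α k) (v k) l := by
    ext k s
    have h3 := conj_fourier_mul_psiTail_sub (v s) (v k) (hK.decay' s) (hK.decay' k) hl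
    have h4 : phiEntry v s k l = ∫ x in Ioi (0 : ℝ), psiTail (v s) l x * (starRingEnd ℂ) (v k x) := rfl
    rw [← h4] at h3
    simp only [Matrix.sub_apply, jostMatrix, Matrix.of_apply, Matrix.diagonal_apply]
    by_cases hks : k = s
    · subst hks
      simp only [if_true, bVal]
      linear_combination (-(α k : ℂ)) * h3
    · rw [if_neg hks, if_neg (Ne.symm hks)]
      rw [greenForm_eq_zero_real hE hK hO hks l] at h3
      linear_combination (-(α s : ℂ)) * h3
  rw [h1, h2, Matrix.det_diagonal, Finset.prod_neg]
  simp

theorem scattering_eq_prod (hE : IsResolutionOfIdentity L0 E) (hK : IsAdmissible α v)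
    (hO : IsOrthogonalFamily E v) {l : ℝ} (hl : l ≠ 0) :
    scattering α v l = ∏ k, sFactor α v k l := by
  have h1 := jost_zero hE hK hO (neg_ne_zero.2 hl)
  rw [scattering, h1, jost_zero hE hK hO hl, mul_div_mul_left _ _ (by simp), ← Finset.prod_div_distrib]
  refine Finset.prod_congr rfl fun k _ => ?_
  rw [sFactor_eq hE hK hO k hl]
  simp

end Scattering

/-! ### Continuity of the argument on the closed upper half-plane -/

section Argument

theorem two_div_pi_mul_le_norm_exp_sub {A B : ℝ} (h : |A - B| ≤ Real.pi) :
    2 / Real.pi * |A - B| ≤ ‖Complex.exp (A * Complex.I) - Complex.exp (B * Complex.I)‖ := by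
  have e : Complex.exp (A * Complex.I) - Complex.exp (B * Complex.I) =
      Complex.exp (B * Complex.I) * (Complex.exp (Complex.I * (A - B : ℝ)) - 1) := by
    rw [mul_sub, ← Complex.exp_add, mul_one]
    push_cast
    ring_nf
  rw [e, norm_mul, Complex.norm_exp_ofReal_mul_I, one_mul, Complex.norm_exp_I_mul_ofReal_sub_one, norm_mul,
    Real.norm_ofNat, Real.norm_eq_abs]
  have := Real.mul_abs_le_abs_sin (x := (A - B) / 2) (by rw [abs_div, abs_two]; linarith)
  rw [abs_div, abs_two] at this
  linarith

theorem norm_div_norm_sub_le {u v : ℂ} (hu : u ≠ 0) (hv : v ≠ 0) :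
    ‖u / ‖u‖ - v / ‖v‖‖ ≤ 2 * ‖u - v‖ / ‖v‖ := by
  have hu' : 0 < ‖u‖ := norm_pos_iff.2 hu
  have hv' : 0 < ‖v‖ := norm_pos_iff.2 hv
  have hu2 : (‖u‖ : ℂ) ≠ 0 := by exact_mod_cast hu'.ne'
  have hv2 : (‖v‖ : ℂ) ≠ 0 := by exact_mod_cast hv'.ne'
  have e : u / ‖u‖ - v / ‖v‖ = (u - v) / ‖v‖ + u / ‖u‖ * (((‖v‖ - ‖u‖ : ℝ) : ℂ) / ‖v‖) := by
    push_cast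
    field_simp
    ring
  rw [e]
  refine (norm_add_le _ _).trans ?_
  rw [norm_mul, norm_div, norm_div, norm_div, Complex.norm_real, Complex.norm_real, Complex.norm_real,
    norm_norm, norm_norm, div_self hu'.ne', one_mul, ← add_div]
  have := abs_norm_sub_norm_le v u
  rw [norm_sub_rev v u] at this
  gcongr
  rw [Real.norm_eq_abs]
  linarith

/-- Both arguments lie in `[0, π]`, where an arc is at most `π / 2` times its chord; the chord
between the normalized vectors is at most `2 * ‖u - v‖ / ‖v‖`. The branch cut is harmless because it
is approached from above only. -/
theorem abs_arg_sub_le {u v : ℂ} (hu : u ≠ 0) (hv : v ≠ 0) (hui : 0 ≤ u.im) (hvi : 0 ≤ v.im) :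
    |u.arg - v.arg| ≤ Real.pi * ‖u - v‖ / ‖v‖ := by
  have h0 : ∀ {z : ℂ}, z ≠ 0 → Complex.exp (z.arg * Complex.I) = z / ‖z‖ := by
    intro z hz
    have h1 : (‖z‖ : ℂ) ≠ 0 := by exact_mod_cast (norm_pos_iff.2 hz).ne'
    rw [eq_div_iff h1, mul_comm, Complex.norm_mul_exp_arg_mul_I]
  have h1 : |u.arg - v.arg| ≤ Real.pi := by
    have a1 := Complex.arg_nonneg_iff.2 hui
    have a2 := Complex.arg_nonneg_iff.2 hvi
    have a3 := Complex.arg_le_pi u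
    have a4 := Complex.arg_le_pi v
    exact abs_le.2 ⟨by linarith, by linarith⟩
  have h2 := two_div_pi_mul_le_norm_exp_sub h1
  rw [h0 hu, h0 hv] at h2
  have h3 := h2.trans (norm_div_norm_sub_le hu hv)
  have hπ := Real.pi_pos
  have h4 : |u.arg - v.arg| = Real.pi / 2 * (2 / Real.pi * |u.arg - v.arg|) := by field_simp
  rw [h4]
  calc _ ≤ Real.pi / 2 * (2 * ‖u - v‖ / ‖v‖) := by gcongr
    _ = _ := by ring

end Argument

/-! ### The factor on the real axis -/

section BoundaryFunction

/-- The sign of a non-zero real number. -/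
def unitSign (a : ℝ) : ℝ := if a < 0 then -1 else 1

theorem unitSign_mul_self (a : ℝ) : unitSign a * unitSign a = 1 := by
  rw [unitSign]; split_ifs <;> norm_num

theorem unitSign_mul (a : ℝ) : unitSign a * a = |a| := by
  rw [unitSign]
  split_ifs with h
  · rw [abs_of_neg h]; ring
  · rw [abs_of_nonneg (not_lt.1 h)]; ring

theorem unitSign_ne_zero (a : ℝ) : unitSign a ≠ 0 := by
  rw [unitSign]; split_ifs <;> norm_num

theorem abs_unitSign (a : ℝ) : |unitSign a| = 1 := by
  rw [unitSign]; split_ifs <;> norm_num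

/-- The function `bVal`, multiplied by the sign of `a`; it maps the positive half-axis to the closed upper
half-plane. -/
def signedB (a : ℝ) (f : ℝ → ℂ) (w : ℂ) : ℂ := unitSign a * bVal a f w

variable {a : ℝ} {f : ℝ → ℂ}

theorem signedB_eq_zero_iff {w : ℂ} : signedB a f w = 0 ↔ bVal a f w = 0 := by
  have : (unitSign a : ℂ) ≠ 0 := by exact_mod_cast unitSign_ne_zero a
  simp [signedB, this]

theorem norm_signedB (w : ℂ) : ‖signedB a f w‖ = ‖bVal a f w‖ := by
  rw [signedB, norm_mul, Complex.norm_real, Real.norm_eq_abs, abs_unitSign, one_mul]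

theorem bVal_im (hf : Decay f) {l : ℝ} (hl : l ≠ 0) : (bVal a f l).im = a * specDensity f l / l := by
  rw [bVal, Complex.add_im, Complex.one_im, zero_add, Complex.im_ofReal_mul, greenForm_im hf hl, specDensity]
  ring

theorem signedB_im (hf : Decay f) {l : ℝ} (hl : l ≠ 0) :
    (signedB a f l).im = |a| * specDensity f l / l := by
  rw [signedB, Complex.im_ofReal_mul, bVal_im hf hl, ← unitSign_mul]
  ring

theorem signedB_im_nonneg (hf : Decay f) {l : ℝ} (hl : 0 < l) : 0 ≤ (signedB a f l).im := by
  rw [signedB_im hf hl.ne']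
  have := specDensity_nonneg f l
  positivity

theorem specDensity_eq_zero_of_bVal (hf : Decay f) (ha : a ≠ 0) {l : ℝ} (hl : 0 < l) (h : bVal a f l = 0) :
    specDensity f l = 0 := by
  have := bVal_im (a := a) hf hl.ne'
  rw [h, Complex.zero_im, eq_comm, div_eq_zero_iff, mul_eq_zero] at this
  rcases this with (h1 | h1) | h1
  · exact absurd h1 ha
  · exact h1
  · exact absurd h1 hl.ne'

theorem norm_bVal_sub_one_le (hf : Decay f) (a : ℝ) :
    ∃ C, 0 ≤ C ∧ ∀ w : ℂ, 0 ≤ w.im → w ≠ 0 → ‖bVal a f w - 1‖ ≤ C / ‖w‖ := by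
  refine ⟨|a| * ∫ p : ℝ × ℝ, ‖f p.2 * (starRingEnd ℂ) (f p.1)‖ ∂(halfLine.prod halfLine),
    mul_nonneg (abs_nonneg a) (integral_nonneg fun _ => norm_nonneg _), fun w hw h0 => ?_⟩
  rw [bVal, add_sub_cancel_left, norm_mul, Complex.norm_real, Real.norm_eq_abs, mul_div_assoc, div_eq_inv_mul]
  gcongr
  exact norm_greenForm_le hf hf hw h0

theorem continuous_bVal (hf : Decay f) (a : ℝ) : Continuous fun l : ℝ => bVal a f l :=
  (continuousOn_bVal hf).comp_continuous Complex.continuous_ofReal fun l => by simp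

theorem continuous_signedB (hf : Decay f) (a : ℝ) : Continuous fun l : ℝ => signedB a f l :=
  continuous_const.mul (continuous_bVal hf a)

theorem signedB_holder (hf : Decay f) (a : ℝ) : ∃ C : ℝ, 0 ≤ C ∧ ∀ l m : ℝ, l ≠ 0 → m ≠ 0 → |l - m| ≤ 1 →
    ‖(l : ℂ) * signedB a f l - m * signedB a f m‖ ≤ C * √|l - m| := by
  obtain ⟨C, hC, h⟩ := greenForm_holder hf
  refine ⟨1 + |a| * C, by positivity, fun l m hl hm hlm => ?_⟩
  have e : (l : ℂ) * signedB a f l - m * signedB a f m =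
      unitSign a * (((l - m : ℝ) : ℂ) + a * (l * greenForm f f l - m * greenForm f f m)) := by
    simp only [signedB, bVal]; push_cast; ring
  rw [e, norm_mul, Complex.norm_real, Real.norm_eq_abs, abs_unitSign, one_mul]
  refine (norm_add_le _ _).trans ?_
  rw [norm_mul, Complex.norm_real, Complex.norm_real, Real.norm_eq_abs, Real.norm_eq_abs, add_mul, mul_assoc, one_mul]
  have h1 : |l - m| ≤ √|l - m| := by
    have h2 : √|l - m| ≤ 1 := Real.sqrt_le_one.2 hlm
    have h3 := Real.sq_sqrt (abs_nonneg (l - m))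
    nlinarith [Real.sqrt_nonneg |l - m|]
  gcongr
  exact h l m hl hm hlm

/-- At a zero the real part equals `|a|` times the increment of the resolvent form; the
normalization of the sign makes it cross zero upwards for either sign of `a`. -/
theorem signedB_simple_zero (hf : Decay f) (ha : a ≠ 0) (hne : ∃ s, specDensity f s ≠ 0) {l : ℝ} (hl : 0 < l)
    (h0 : bVal a f l = 0) : ∃ c > 0, ∀ᶠ x : ℝ in 𝓝[≠] l, c ≤ (signedB a f x).re / (x - l) := by
  obtain ⟨c, hc, h⟩ := greenForm_simple_zero hf hl (specDensity_eq_zero_of_bVal hf ha hl h0) hne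
  refine ⟨|a| * c, by positivity, ?_⟩
  filter_upwards [h] with x hx
  have h1 : 1 + a * (greenForm f f l).re = 0 := by
    have := congrArg Complex.re h0
    rwa [bVal, Complex.add_re, Complex.one_re, Complex.re_ofReal_mul, Complex.zero_re] at this
  have e : (signedB a f x).re = |a| * ((greenForm f f x).re - (greenForm f f l).re) := by
    rw [signedB, bVal, Complex.re_ofReal_mul, Complex.add_re, Complex.one_re, Complex.re_ofReal_mul,
      ← unitSign_mul]
    linear_combination unitSign a * h1
  rw [e, mul_div_assoc]
  gcongr

end BoundaryFunction

/-! ### Construction of the phase -/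

section Phase

/-- The shift which makes the phase vanish at infinity. -/
def signShift (a : ℝ) : ℝ := if a < 0 then Real.pi else 0

/-- The number of points of `Z` to the right of `t`. -/
def zeroCount (Z : Finset ℝ) (t : ℝ) : ℝ := ∑ p ∈ Z, if t < p then 1 else 0

/-- The phase on the positive half-axis. -/
def posPhase (a : ℝ) (f : ℝ → ℂ) (Z : Finset ℝ) (t : ℝ) : ℝ :=
  (signedB a f t).arg - signShift a - Real.pi * zeroCount Z t

/-- The phase: the odd extension of `posPhase`. -/
def oddPhase (a : ℝ) (f : ℝ → ℂ) (Z : Finset ℝ) (t : ℝ) : ℝ :=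
  if 0 < t then posPhase a f Z t else if t < 0 then -posPhase a f Z (-t) else 0

variable {a : ℝ} {f : ℝ → ℂ} {Z : Finset ℝ}

theorem oddPhase_of_pos {t : ℝ} (ht : 0 < t) : oddPhase a f Z t = posPhase a f Z t := if_pos ht

theorem oddPhase_neg (t : ℝ) : oddPhase a f Z (-t) = -oddPhase a f Z t := by
  rcases lt_trichotomy t 0 with h | rfl | h
  · simp [oddPhase, h, h.not_gt]
  · simp [oddPhase]
  · simp [oddPhase, h, h.not_gt]

theorem zeroCount_eventually (Z : Finset ℝ) (x : ℝ) :
    ∀ᶠ s in 𝓝 x, (x ≤ s → zeroCount Z s = zeroCount Z x) ∧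
      (s < x → zeroCount Z s = zeroCount Z x + if x ∈ Z then 1 else 0) := by
  have h : ∀ᶠ s in 𝓝 x, ∀ p ∈ Z, p ≠ x → (s < p ↔ x < p) := by
    rw [Finset.eventually_all]
    intro p _
    rcases lt_trichotomy p x with h | h | h
    · filter_upwards [lt_mem_nhds h] with s hs _
      exact ⟨fun h2 => absurd h2 hs.not_gt, fun h2 => absurd h2 h.not_gt⟩
    · exact Eventually.of_forall fun s hs => absurd h hs
    · filter_upwards [gt_mem_nhds h] with s hs _
      exact ⟨fun _ => h, fun _ => hs⟩
  filter_upwards [h] with s hs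
  constructor
  · intro hxs
    refine Finset.sum_congr rfl fun p hp => ?_
    by_cases hpx : p = x
    · subst hpx; simp [hxs.not_gt]
    · simp only [hs p hp hpx]
  · intro hsx
    have e : (if x ∈ Z then (1 : ℝ) else 0) = ∑ p ∈ Z, if p = x then 1 else 0 := by
      rw [Finset.sum_ite_eq' Z x (fun _ => (1 : ℝ))]
    rw [e, zeroCount, zeroCount, ← Finset.sum_add_distrib]
    refine Finset.sum_congr rfl fun p hp => ?_
    by_cases hpx : p = x
    · subst hpx; simp [hsx]
    · simp only [hs p hp hpx, hpx, if_false, add_zero]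

theorem measurable_zeroCount (Z : Finset ℝ) : Measurable (zeroCount Z) :=
  Finset.measurable_sum _ fun _ _ => Measurable.ite measurableSet_Iio measurable_const measurable_const

theorem measurable_posPhase (hf : Decay f) : Measurable (posPhase a f Z) :=
  ((Complex.measurable_arg.comp (continuous_signedB hf a).measurable).sub_const _).sub
    ((measurable_zeroCount Z).const_mul _)

theorem measurable_oddPhase (hf : Decay f) : Measurable (oddPhase a f Z) :=
  Measurable.ite measurableSet_Ioi (measurable_posPhase hf)
    (Measurable.ite measurableSet_Iio ((measurable_posPhase hf).comp measurable_neg).neg measurable_const)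

/-- A positive factor does not change the argument, so the Hölder estimate for `s * signedB` can be
used; the zero count is constant near a point outside `Z`. -/
theorem abs_posPhase_sub_le_holder (hf : Decay f) {x : ℝ} (hx : 0 < x) (hxZ : x ∉ Z)
    (h0 : bVal a f x ≠ 0) : ∃ C, ∀ᶠ s in 𝓝 x, |posPhase a f Z s - posPhase a f Z x| ≤ C * √|s - x| := by
  obtain ⟨C, hC, h⟩ := signedB_holder hf a
  have hv : signedB a f x ≠ 0 := fun h => h0 (signedB_eq_zero_iff.1 h)
  refine ⟨Real.pi * C / ‖(x : ℂ) * signedB a f x‖, ?_⟩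
  have h1 : ∀ᶠ s : ℝ in 𝓝 x, signedB a f s ≠ 0 := (continuous_signedB hf a).continuousAt.eventually_ne hv
  have h2 : ∀ᶠ s : ℝ in 𝓝 x, |s - x| ≤ 1 := by
    filter_upwards [Metric.closedBall_mem_nhds x one_pos] with s hs
    rwa [Metric.mem_closedBall, Real.dist_eq] at hs
  filter_upwards [h1, h2, lt_mem_nhds hx, zeroCount_eventually Z x] with s hs1 hs2 hs3 hs4
  have hN : zeroCount Z s = zeroCount Z x := by
    rcases le_or_gt x s with h5 | h5
    · exact hs4.1 h5
    · rw [hs4.2 h5, if_neg hxZ, add_zero]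
  have e : posPhase a f Z s - posPhase a f Z x = (signedB a f s).arg - (signedB a f x).arg := by
    rw [posPhase, posPhase, hN]; ring
  have hx' : (x : ℂ) ≠ 0 := by exact_mod_cast hx.ne'
  have hs' : (s : ℂ) ≠ 0 := by exact_mod_cast hs3.ne'
  rw [e, ← Complex.arg_real_mul (signedB a f s) hs3, ← Complex.arg_real_mul (signedB a f x) hx]
  refine (abs_arg_sub_le (mul_ne_zero hs' hs1) (mul_ne_zero hx' hv) ?_ ?_).trans ?_
  · rw [Complex.im_ofReal_mul]; exact mul_nonneg hs3.le (signedB_im_nonneg hf hs3)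
  · rw [Complex.im_ofReal_mul]; exact mul_nonneg hx.le (signedB_im_nonneg hf hx)
  · rw [div_mul_eq_mul_div, mul_assoc]
    gcongr
    exact h s x hs3.ne' hx.ne' hs2

/-- At a simple zero the real part of `signedB` passes from negative to positive while the imaginary
part stays non-negative. The argument drops from near `π` to near `0`, and the drop of `zeroCount`
compensates. What remains is the angle between the value and its real part, of order |Im| / |Re|,
where the imaginary part is comparable to the density and the real part is at least a multiple of
`|s - x|`. -/
theorem abs_posPhase_sub_le_of_zero (hf : Decay f) (ha : a ≠ 0) (hne : ∃ s, specDensity f s ≠ 0) {x : ℝ}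
    (hx : 0 < x) (hxZ : x ∈ Z) (h0 : bVal a f x = 0) :
    ∃ C, 0 ≤ C ∧ ∀ᶠ s in 𝓝 x, |posPhase a f Z s - posPhase a f Z x| ≤ C * (specDensity f s / |s - x|) := by
  obtain ⟨c, hc, h⟩ := signedB_simple_zero hf ha hne hx h0
  have hpi := Real.pi_pos
  refine ⟨Real.pi * (|a| * (2 / x)) / c, by positivity, ?_⟩
  -- The convention `arg 0 = 0` agrees with the limit from the right, and the strict inequality in
  -- `zeroCount` leaves `x` itself uncounted at `x`.
  have hA0 : (signedB a f x).arg = 0 := by rw [signedB_eq_zero_iff.2 h0, Complex.arg_zero]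
  filter_upwards [eventually_nhdsWithin_iff.1 h, lt_mem_nhds (show x / 2 < x by linarith),
    zeroCount_eventually Z x] with s hs1 hs2 hs3
  rcases eq_or_ne s x with rfl | hsx
  · simp
  have hs0 : 0 < s := by linarith
  have h1 := hs1 hsx
  have hd : 0 < |s - x| := abs_pos.2 (sub_ne_zero.2 hsx)
  set u := signedB a f s with hu
  have hrabs : c * |s - x| ≤ |u.re| := by
    have h2 : c ≤ |u.re| / |s - x| := by rw [← abs_div]; exact h1.trans (le_abs_self _)
    rwa [le_div_iff₀ hd] at h2
  have hre : u.re ≠ 0 := abs_pos.1 (lt_of_lt_of_le (by positivity) hrabs)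
  have hu0 : u ≠ 0 := by intro h; exact hre (by rw [h]; rfl)
  have hv0 : (u.re : ℂ) ≠ 0 := by exact_mod_cast hre
  have e : posPhase a f Z s - posPhase a f Z x = u.arg - (u.re : ℂ).arg := by
    rcases lt_or_gt_of_ne hsx with h2 | h2
    · have h3 : u.re < 0 := by
        by_contra hcon
        have : u.re / (s - x) ≤ 0 := div_nonpos_of_nonneg_of_nonpos (not_lt.1 hcon) (by linarith)
        linarith
      rw [Complex.arg_ofReal_of_neg h3, posPhase, posPhase, hs3.2 h2, if_pos hxZ, hA0]
      ring
    · have h3 : 0 < u.re := by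
        by_contra hcon
        have : u.re / (s - x) ≤ 0 := div_nonpos_of_nonpos_of_nonneg (not_lt.1 hcon) (by linarith)
        linarith
      rw [Complex.arg_ofReal_of_nonneg h3.le, posPhase, posPhase, hs3.1 h2.le, hA0]
      ring
  rw [e]
  refine (abs_arg_sub_le hu0 hv0 (signedB_im_nonneg hf hs0) (by simp)).trans ?_
  have e2 : u - u.re = u.im * Complex.I := by
    rw [sub_eq_iff_eq_add', Complex.re_add_im]
  have hρ := specDensity_nonneg f s
  have him : |u.im| ≤ |a| * (2 / x) * specDensity f s := by
    rw [abs_of_nonneg (signedB_im_nonneg hf hs0), signedB_im hf hs0.ne']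
    have : 1 / s ≤ 2 / x := by rw [div_le_div_iff₀ hs0 hx]; linarith
    calc |a| * specDensity f s / s = |a| * (1 / s) * specDensity f s := by ring
      _ ≤ _ := by gcongr
  rw [e2, norm_mul, Complex.norm_I, mul_one, Complex.norm_real, Complex.norm_real, Real.norm_eq_abs,
    Real.norm_eq_abs]
  calc _ ≤ Real.pi * (|a| * (2 / x) * specDensity f s) / (c * |s - x|) := by gcongr
    _ = _ := by field_simp

theorem specDensity_le_of_zero (hf : Decay f) {x : ℝ} (h0 : specDensity f x = 0) {κ : ℝ} (hκ : 0 < κ) :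
    ∀ᶠ s in 𝓝 x, specDensity f s ≤ κ * |s - x| := by
  obtain ⟨δ, hδ, h⟩ := sineTransform_modulus hf (Real.sqrt_pos.2 hκ)
  have h1 : sineTransform f x = 0 := by simpa [specDensity] using h0
  filter_upwards [Metric.closedBall_mem_nhds x hδ] with s hs
  rw [Metric.mem_closedBall, Real.dist_eq] at hs
  have h2 := h s x hs
  rw [h1, sub_zero] at h2
  calc specDensity f s ≤ (√κ * √|s - x|) ^ 2 := by rw [specDensity]; gcongr
    _ = _ := by rw [mul_pow, Real.sq_sqrt hκ.le, Real.sq_sqrt (abs_nonneg _)]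

/-- At a zero the bound ρ(s)/|s - x| tends to `0` because the Hölder constant of the sine transform
is arbitrarily small; plain Hölder continuity of order 1/2 would only bound it. -/
theorem continuousAt_posPhase (hf : Decay f) (ha : a ≠ 0) (hne : ∃ s, specDensity f s ≠ 0)
    (hZ : ∀ l, l ∈ Z ↔ 0 < l ∧ bVal a f l = 0) {x : ℝ} (hx : 0 < x) :
    ContinuousAt (posPhase a f Z) x := by
  rw [ContinuousAt, tendsto_iff_norm_sub_tendsto_zero]
  by_cases hxZ : x ∈ Z
  · have h0 := ((hZ x).1 hxZ).2
    obtain ⟨C, hC, h⟩ := abs_posPhase_sub_le_of_zero hf ha hne hx hxZ h0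
    rw [Metric.tendsto_nhds]
    intro ε hε
    filter_upwards [h, specDensity_le_of_zero hf (specDensity_eq_zero_of_bVal hf ha hx h0)
      (show 0 < ε / (C + 1) by positivity)] with s hs1 hs2
    rw [Real.dist_eq, sub_zero, abs_norm, Real.norm_eq_abs]
    refine hs1.trans_lt ?_
    have h3 : specDensity f s / |s - x| ≤ ε / (C + 1) := by
      refine div_le_of_le_mul₀ (abs_nonneg _) (by positivity) hs2
    calc _ ≤ C * (ε / (C + 1)) := by gcongr
      _ < ε := by rw [mul_div_assoc', div_lt_iff₀ (by positivity)]; nlinarith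
  · obtain ⟨C, h⟩ := abs_posPhase_sub_le_holder hf hx hxZ (fun h => hxZ ((hZ x).2 ⟨hx, h⟩))
    refine squeeze_zero' (Eventually.of_forall fun _ => norm_nonneg _) h ?_
    have : ContinuousAt (fun s => C * √|s - x|) x := by fun_prop
    simpa using this.tendsto

theorem continuousOn_oddPhase (hf : Decay f) (ha : a ≠ 0) (hne : ∃ s, specDensity f s ≠ 0)
    (hZ : ∀ l, l ∈ Z ↔ 0 < l ∧ bVal a f l = 0) : ContinuousOn (oddPhase a f Z) (Ioi 0) := by
  intro x hx
  refine ((continuousAt_posPhase hf ha hne hZ hx).congr ?_).continuousWithinAt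
  filter_upwards [lt_mem_nhds hx] with s hs
  exact (oddPhase_of_pos hs).symm

/-- Boundedness is immediate. Beyond `K + 1` there are no zeros because the factor is `1 + O(1/s)`,
and the argument of `signedB` differs from that of its limit, which is `signShift a`, by `O(1/s)`.
-/
theorem abs_posPhase_le (hf : Decay f) (hZ : ∀ l, l ∈ Z ↔ 0 < l ∧ bVal a f l = 0) :
    ∃ C D, ∀ s, 0 < s → |posPhase a f Z s| ≤ C ∧ |posPhase a f Z s| * s ≤ D := by
  have hpi := Real.pi_pos
  have hN : ∀ s, |zeroCount Z s| ≤ Z.card := by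
    intro s
    rw [zeroCount]
    refine (Finset.abs_sum_le_sum_abs _ _).trans ?_
    rw [Finset.card_eq_sum_ones, Nat.cast_sum]
    refine Finset.sum_le_sum fun p _ => ?_
    split_ifs <;> simp
  have hC : ∀ s, |posPhase a f Z s| ≤ Real.pi + Real.pi + Real.pi * Z.card := by
    intro s
    rw [posPhase]
    refine (abs_sub _ _).trans (add_le_add ((abs_sub _ _).trans (add_le_add (Complex.abs_arg_le_pi _) ?_)) ?_)
    · rw [signShift]; split_ifs <;> simp [abs_of_pos, hpi, hpi.le]
    · rw [abs_mul, abs_of_pos hpi]; gcongr; exact hN s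
  set C₀ := Real.pi + Real.pi + Real.pi * Z.card with hC₀
  have hC0 : 0 ≤ C₀ := by positivity
  obtain ⟨K, hK, hb⟩ := norm_bVal_sub_one_le hf a
  refine ⟨C₀, C₀ * (K + 1) + Real.pi * K, fun s hs => ⟨hC s, ?_⟩⟩
  rcases le_or_gt s (K + 1) with h | h
  · have : |posPhase a f Z s| * s ≤ C₀ * (K + 1) := mul_le_mul (hC s) h hs.le hC0
    have : 0 ≤ Real.pi * K := by positivity
    linarith
  · have hnear : ∀ t : ℝ, K + 1 < t → ‖bVal a f t - 1‖ ≤ K / t ∧ bVal a f t ≠ 0 := by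
      intro t ht
      have ht0 : 0 < t := by linarith
      have h1 := hb t (by simp) (by exact_mod_cast ht0.ne')
      rw [Complex.norm_real, Real.norm_of_nonneg ht0.le] at h1
      refine ⟨h1, fun h2 => ?_⟩
      rw [h2, zero_sub, norm_neg, norm_one, le_div_iff₀ ht0] at h1
      linarith
    have hN0 : zeroCount Z s = 0 := by
      refine Finset.sum_eq_zero fun p hp => ?_
      rw [if_neg]
      intro hsp
      exact (hnear p (h.trans hsp)).2 ((hZ p).1 hp).2
    have harg : signShift a = ((unitSign a : ℝ) : ℂ).arg := by
      rw [signShift, unitSign]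
      split_ifs
      · rw [Complex.arg_ofReal_of_neg (by norm_num)]
      · rw [Complex.arg_ofReal_of_nonneg (by norm_num)]
    have hu : signedB a f s ≠ 0 := fun h2 => (hnear s h).2 (signedB_eq_zero_iff.1 h2)
    have h1 := abs_arg_sub_le hu (v := (unitSign a : ℂ)) (by exact_mod_cast unitSign_ne_zero a)
      (signedB_im_nonneg hf hs) (by simp)
    have e : signedB a f s - unitSign a = unitSign a * (bVal a f s - 1) := by rw [signedB]; ring
    rw [e, norm_mul, Complex.norm_real, Real.norm_eq_abs, abs_unitSign, one_mul, div_one] at h1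
    rw [posPhase, hN0, mul_zero, sub_zero, harg]
    have h2 : Real.pi * ‖bVal a f s - 1‖ * s ≤ Real.pi * K := by
      have := (hnear s h).1
      rw [le_div_iff₀ hs] at this
      rw [mul_assoc]
      gcongr
    have h3 : 0 ≤ C₀ * (K + 1) := by positivity
    have h4 := mul_le_mul_of_nonneg_right h1 hs.le
    linarith

theorem abs_oddPhase_le (hf : Decay f) (hZ : ∀ l, l ∈ Z ↔ 0 < l ∧ bVal a f l = 0) :
    ∃ C D, ∀ s, |oddPhase a f Z s| ≤ C ∧ |oddPhase a f Z s| * |s| ≤ D := by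
  obtain ⟨C, D, h⟩ := abs_posPhase_le hf hZ
  have hC := (abs_nonneg _).trans (h 1 one_pos).1
  have hD := (mul_nonneg (abs_nonneg _) zero_le_one).trans (h 1 one_pos).2
  refine ⟨C, D, fun s => ?_⟩
  rcases lt_trichotomy s 0 with hs | rfl | hs
  · have h1 := h (-s) (by linarith)
    rw [← neg_neg s, oddPhase_neg, abs_neg, abs_neg, oddPhase_of_pos (neg_pos.2 hs), abs_of_pos (neg_pos.2 hs)]
    exact h1
  · simpa [oddPhase] using ⟨hC, hD⟩
  · rw [oddPhase_of_pos hs, abs_of_pos hs]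
    exact h s hs

theorem tendsto_oddPhase (hf : Decay f) (hZ : ∀ l, l ∈ Z ↔ 0 < l ∧ bVal a f l = 0) :
    Tendsto (oddPhase a f Z) atTop (𝓝 0) := by
  obtain ⟨C, D, h⟩ := abs_oddPhase_le hf hZ
  rw [tendsto_zero_iff_abs_tendsto_zero]
  refine squeeze_zero' (Eventually.of_forall fun _ => abs_nonneg _) (g := fun s => D / s) ?_
    (tendsto_const_nhds.div_atTop tendsto_id)
  filter_upwards [eventually_gt_atTop 0] with s hs
  rw [le_div_iff₀ hs]
  have := (h s).2
  rwa [abs_of_pos hs] at this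

theorem signedB_eq_exp {l : ℝ} : signedB a f l = ‖bVal a f l‖ * Complex.exp ((signedB a f l).arg * Complex.I) := by
  rw [← norm_signedB, Complex.norm_mul_exp_arg_mul_I]

/-- The factor at `-l` is the conjugate of the one at `l`, so the quotient is exp(-2i arg); the
shift and the zero count change the argument by integer multiples of `π`, which the doubled exponent
does not see. -/
theorem exp_posPhase {l : ℝ} (h0 : bVal a f l ≠ 0) :
    bVal a f (-l) / bVal a f l = Complex.exp (-2 * Complex.I * posPhase a f Z l) := by
  have hs : (unitSign a : ℂ) ≠ 0 := by exact_mod_cast unitSign_ne_zero a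
  have hn : (‖bVal a f l‖ : ℂ) ≠ 0 := by exact_mod_cast (norm_pos_iff.2 h0).ne'
  set A := (signedB a f l).arg with hA
  have h1 : bVal a f (-l) / bVal a f l = (starRingEnd ℂ) (signedB a f l) / signedB a f l := by
    rw [bVal_neg, signedB, map_mul, Complex.conj_ofReal, mul_div_mul_left _ _ hs]
  have h2 : (starRingEnd ℂ) (signedB a f l) = ‖bVal a f l‖ * Complex.exp (-(A * Complex.I)) := by
    rw [signedB_eq_exp, map_mul, Complex.conj_ofReal, ← Complex.exp_conj, map_mul, Complex.conj_ofReal,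
      Complex.conj_I, mul_neg]
  rw [h1, h2, signedB_eq_exp, mul_div_mul_left _ _ hn, ← Complex.exp_sub]
  have h3 : ∃ m : ℕ, zeroCount Z l = m := by
    refine ⟨(Z.filter fun p => l < p).card, ?_⟩
    rw [zeroCount, Finset.sum_ite, Finset.sum_const_zero, add_zero, Finset.sum_const, nsmul_eq_mul, mul_one]
  obtain ⟨m, hm⟩ := h3
  have h4 : ∃ j : ℕ, signShift a = Real.pi * j := by
    rw [signShift]
    split_ifs
    · exact ⟨1, by simp⟩
    · exact ⟨0, by simp⟩
  obtain ⟨j, hj⟩ := h4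
  rw [Complex.exp_eq_exp_iff_exists_int]
  refine ⟨-(j + m), ?_⟩
  rw [posPhase, hm, hj]
  push_cast
  ring

theorem exp_oddPhase {l : ℝ} (hl : l ≠ 0) (h0 : bVal a f l ≠ 0) :
    bVal a f (-l) / bVal a f l = Complex.exp (-2 * Complex.I * oddPhase a f Z l) := by
  rcases lt_or_gt_of_ne hl with h | h
  · have h1 : bVal a f ((-l : ℝ) : ℂ) ≠ 0 := by
      rw [Complex.ofReal_neg, bVal_neg]
      exact (map_ne_zero _).2 h0
    have h2 := exp_posPhase (Z := Z) h1
    have h3 : oddPhase a f Z l = -posPhase a f Z (-l) := by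
      rw [← oddPhase_of_pos (neg_pos.2 h), oddPhase_neg, neg_neg]
    rw [Complex.ofReal_neg, neg_neg] at h2
    rw [h3, ← inv_div, h2, ← Complex.exp_neg]
    push_cast
    ring_nf
  · rw [oddPhase_of_pos h]
    exact exp_posPhase h0

end Phase

/-! ### Existence of the principal values of the phase -/

section PrincipalValue

theorem pvIntegrand_neg {ζ : ℝ → ℝ} (hodd : ∀ t, ζ (-t) = -ζ t) (x r s : ℝ) :
    pvIntegrand ζ (-x) r s = pvIntegrand ζ x r (-s) := by
  have h : s ∈ Ioo (-x - r) (-x + r) ↔ -s ∈ Ioo (x - r) (x + r) := by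
    simp only [mem_Ioo]
    constructor <;> rintro ⟨h1, h2⟩ <;> constructor <;> linarith
  have e : (-s - x) = -(s - -x) := by ring
  simp only [pvIntegrand]
  by_cases hs : s ∈ Ioo (-x - r) (-x + r)
  · rw [indicator_of_mem hs, indicator_of_mem (h.1 hs), hodd, hodd, e, div_neg, ← neg_div]
    ring
  · rw [indicator_of_notMem hs, indicator_of_notMem (fun h2 => hs (h.2 h2)), hodd, e, div_neg, ← neg_div]
    ring

theorem integrable_pvIntegrand_neg {ζ : ℝ → ℝ} (hodd : ∀ t, ζ (-t) = -ζ t) {x r : ℝ}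
    (h : Integrable (pvIntegrand ζ x r)) : Integrable (pvIntegrand ζ (-x) r) :=
  h.comp_neg.congr (ae_of_all _ fun s => (pvIntegrand_neg hodd x r s).symm)

theorem pv_neg {ζ : ℝ → ℝ} (hodd : ∀ t, ζ (-t) = -ζ t) {x r : ℝ} (h : Integrable (pvIntegrand ζ x r)) :
    pv ζ (-x) = pv ζ x := by
  rw [(hasPV_of_integrable h).pv_eq, (hasPV_of_integrable (integrable_pvIntegrand_neg hodd h)).pv_eq]
  simp_rw [pvIntegrand_neg hodd]
  exact integral_neg_eq_self (pvIntegrand ζ x r) volume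

variable {a : ℝ} {f : ℝ → ℂ} {Z : Finset ℝ}

/-- Away from the zeros the difference quotient is bounded by the integrable `|s - x| ^ (-1/2)`; at
a zero it is bounded by a multiple of ρ(s)/(s - x)², which is integrable by Hardy's inequality. -/
theorem exists_integrable_pvIntegrand_of_pos (hf : Decay f) (ha : a ≠ 0) (hne : ∃ s, specDensity f s ≠ 0)
    (hZ : ∀ l, l ∈ Z ↔ 0 < l ∧ bVal a f l = 0) {x : ℝ} (hx : 0 < x) :
    ∃ r, Integrable (pvIntegrand (oddPhase a f Z) x r) := by
  obtain ⟨C, D, hCD⟩ := abs_oddPhase_le hf hZ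
  have hm := measurable_oddPhase (a := a) (Z := Z) hf
  suffices h : ∃ r > 0, IntegrableOn (fun s => (oddPhase a f Z s - oddPhase a f Z x) / (s - x))
      (Ioo (x - r) (x + r)) by
    obtain ⟨r, hr, h⟩ := h
    exact ⟨r, integrable_pvIntegrand hr hm.aestronglyMeasurable (fun s => (hCD s).1) (fun s => (hCD s).2) h⟩
  by_cases hxZ : x ∈ Z
  · have h0 := ((hZ x).1 hxZ).2
    obtain ⟨K, hK, h⟩ := abs_posPhase_sub_le_of_zero hf ha hne hx hxZ h0
    obtain ⟨r, hr, hball⟩ := Metric.eventually_nhds_iff_ball.1 (h.and (lt_mem_nhds hx))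
    rw [Real.ball_eq_Ioo] at hball
    refine ⟨r, hr, ?_⟩
    refine ((integrable_specDensity_div hf (specDensity_eq_zero_of_bVal hf ha hx h0)).const_mul K).integrableOn.mono'
      (Measurable.aestronglyMeasurable (by fun_prop)) ?_
    filter_upwards [ae_restrict_mem measurableSet_Ioo] with s hs
    obtain ⟨h1, h2⟩ := hball s hs
    rw [oddPhase_of_pos h2, oddPhase_of_pos hx, norm_div, Real.norm_eq_abs, Real.norm_eq_abs]
    calc _ ≤ K * (specDensity f s / |s - x|) / |s - x| := by gcongr
      _ = _ := by rw [← sq_abs (s - x), mul_div_assoc, div_div, ← sq]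
  · obtain ⟨K, h⟩ := abs_posPhase_sub_le_holder hf hx hxZ (fun h => hxZ ((hZ x).2 ⟨hx, h⟩))
    obtain ⟨r, hr, hball⟩ := Metric.eventually_nhds_iff_ball.1 (h.and (lt_mem_nhds hx))
    rw [Real.ball_eq_Ioo] at hball
    refine ⟨r, hr, (integrable_div_of_holder hr (hm.sub_const _) (C := K) fun s hs => ?_).1⟩
    obtain ⟨h1, h2⟩ := hball s hs
    rwa [oddPhase_of_pos h2, oddPhase_of_pos hx]

theorem exists_integrable_pvIntegrand (hf : Decay f) (ha : a ≠ 0) (hne : ∃ s, specDensity f s ≠ 0)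
    (hZ : ∀ l, l ∈ Z ↔ 0 < l ∧ bVal a f l = 0) {x : ℝ} (hx : x ≠ 0) :
    ∃ r, Integrable (pvIntegrand (oddPhase a f Z) x r) := by
  rcases lt_or_gt_of_ne hx with h | h
  · obtain ⟨r, hr⟩ := exists_integrable_pvIntegrand_of_pos hf ha hne hZ (neg_pos.2 h)
    refine ⟨r, ?_⟩
    have := integrable_pvIntegrand_neg oddPhase_neg hr
    rwa [neg_neg] at this
  · exact exists_integrable_pvIntegrand_of_pos hf ha hne hZ h

end PrincipalValue

/-! ### Bound states and finiteness of the zero set -/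

section ImaginaryAxis

variable {a : ℝ} {f : ℝ → ℂ}

/-- The integral `∫ ρ(s) / (s² + κ²) ds` of the spectral density. -/
def stieltjes (f : ℝ → ℂ) (κ : ℝ) : ℝ := ∫ s, specDensity f s / (s ^ 2 + κ ^ 2)

theorem integrable_stieltjes (hf : Decay f) {κ : ℝ} (hκ : 0 < κ) :
    Integrable fun s => specDensity f s / (s ^ 2 + κ ^ 2) := by
  refine ((integrable_specDensity hf).div_const (κ ^ 2)).mono' ?_ (ae_of_all _ fun s => ?_)
  · exact (continuous_specDensity hf |>.div (by fun_prop) fun s => by positivity).aestronglyMeasurable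
  · have := specDensity_nonneg f s
    rw [Real.norm_of_nonneg (by positivity)]
    gcongr
    nlinarith

theorem stieltjes_nonneg (f : ℝ → ℂ) (κ : ℝ) : 0 ≤ stieltjes f κ :=
  integral_nonneg fun s => div_nonneg (specDensity_nonneg f s) (by positivity)

theorem stieltjes_strictAnti (hf : Decay f) (hne : ∃ s, specDensity f s ≠ 0) {κ κ' : ℝ} (hκ : 0 < κ)
    (h : κ < κ') : stieltjes f κ' < stieltjes f κ := by
  have hκ' : 0 < κ' := hκ.trans h
  rw [← sub_pos, stieltjes, stieltjes, ← integral_sub (integrable_stieltjes hf hκ) (integrable_stieltjes hf hκ')]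
  obtain ⟨s, hs⟩ := hne
  have hlt : ∀ s : ℝ, 1 / (s ^ 2 + κ' ^ 2) < 1 / (s ^ 2 + κ ^ 2) := fun s => by
    apply one_div_lt_one_div_of_lt (by positivity)
    gcongr
  have e : ∀ s, specDensity f s / (s ^ 2 + κ ^ 2) - specDensity f s / (s ^ 2 + κ' ^ 2) =
      specDensity f s * (1 / (s ^ 2 + κ ^ 2) - 1 / (s ^ 2 + κ' ^ 2)) := fun s => by ring
  refine integral_pos_of_integrable_nonneg_nonzero (x := s) ?_
    ((integrable_stieltjes hf hκ).sub (integrable_stieltjes hf hκ')) ?_ ?_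
  · exact (continuous_specDensity hf |>.div (by fun_prop) fun s => by positivity).sub
      (continuous_specDensity hf |>.div (by fun_prop) fun s => by positivity)
  · intro s
    simp only [Pi.zero_apply]
    rw [e]
    exact mul_nonneg (specDensity_nonneg f s) (sub_pos.2 (hlt s)).le
  · rw [e]
    exact mul_ne_zero hs (sub_pos.2 (hlt s)).ne'

theorem bVal_I (hf : Decay f) {κ : ℝ} (hκ : 0 < κ) :
    bVal a f (Complex.I * κ) = ((1 + a / Real.pi * stieltjes f κ : ℝ) : ℂ) := by
  have e : ∀ s : ℝ, ((‖sineTransform f s‖ ^ 2 : ℝ) : ℂ) * ((s : ℂ) ^ 2 - (Complex.I * κ) ^ 2)⁻¹ =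
      ((specDensity f s / (s ^ 2 + κ ^ 2) : ℝ) : ℂ) := by
    intro s
    rw [mul_pow, Complex.I_sq, specDensity]
    push_cast
    rw [div_eq_mul_inv]
    ring_nf
  rw [bVal, greenForm_eq_integral hf (by simpa using hκ)]
  simp_rw [e]
  rw [integral_complex_ofReal, ← stieltjes]
  push_cast
  ring

theorem bVal_I_eq_zero_iff (hf : Decay f) {κ : ℝ} (hκ : 0 < κ) :
    bVal a f (Complex.I * κ) = 0 ↔ 1 + a / Real.pi * stieltjes f κ = 0 := by
  rw [bVal_I hf hκ, Complex.ofReal_eq_zero]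

theorem bVal_I_ne_zero_of_pos (hf : Decay f) (ha : 0 < a) {κ : ℝ} (hκ : 0 < κ) :
    bVal a f (Complex.I * κ) ≠ 0 := by
  rw [Ne, bVal_I_eq_zero_iff hf hκ]
  have := stieltjes_nonneg f κ
  have := Real.pi_pos
  positivity

/-- On the imaginary axis the factor is real and strictly monotone in `κ`, since a rank-one
perturbation enters through a Stieltjes integral. -/
theorem bVal_I_zero_unique (hf : Decay f) (ha : a ≠ 0) (hne : ∃ s, specDensity f s ≠ 0) {κ κ' : ℝ} (hκ : 0 < κ)
    (hκ' : 0 < κ') (h : bVal a f (Complex.I * κ) = 0) (h' : bVal a f (Complex.I * κ') = 0) : κ = κ' := by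
  rw [bVal_I_eq_zero_iff hf hκ] at h
  rw [bVal_I_eq_zero_iff hf hκ'] at h'
  have h1 : a / Real.pi * (stieltjes f κ - stieltjes f κ') = 0 := by linarith
  have h2 := (mul_eq_zero.1 h1).resolve_left (div_ne_zero ha Real.pi_ne_zero)
  rcases lt_trichotomy κ κ' with h3 | h3 | h3
  · linarith [stieltjes_strictAnti hf hne hκ h3]
  · exact h3
  · linarith [stieltjes_strictAnti hf hne hκ' h3]

/-- The values on the positive imaginary axis are at least `1`, and so is the real part of their
limit. -/
theorem bVal_zero_ne_zero_of_pos (hf : Decay f) (ha : 0 < a) : bVal a f 0 ≠ 0 := by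
  have h1 : Tendsto (fun η : ℝ => (bVal a f (Complex.I * η)).re) (𝓝[>] 0) (𝓝 (bVal a f 0).re) := by
    have h2 := ((continuousOn_bVal (a := a) hf) ((0 : ℝ) : ℂ) (by simp)).tendsto.comp (tendsto_add_mul_I 0)
    have h3 := (Complex.continuous_re.tendsto _).comp h2
    rw [Complex.ofReal_zero] at h3
    refine h3.congr fun η => ?_
    simp [mul_comm]
  have h4 : 1 ≤ (bVal a f 0).re := by
    refine ge_of_tendsto h1 ?_
    filter_upwards [self_mem_nhdsWithin] with η hη
    rw [bVal_I hf hη, Complex.ofReal_re]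
    have := stieltjes_nonneg f η
    have := Real.pi_pos
    have : 0 ≤ a / Real.pi * stieltjes f η := by positivity
    linarith
  intro h
  rw [h] at h4
  norm_num at h4

/-- The zeros lie in a compact interval because the factor tends to `1`. An accumulation point would
itself be a zero, hence positive by `h0`, but simple zeros are isolated. -/
theorem finite_zeros (hf : Decay f) (ha : a ≠ 0) (hne : ∃ s, specDensity f s ≠ 0) (h0 : bVal a f 0 ≠ 0) :
    {l : ℝ | 0 < l ∧ bVal a f l = 0}.Finite := by
  by_contra hinf
  obtain ⟨C, hC, hb⟩ := norm_bVal_sub_one_le hf a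
  have hsub : {l : ℝ | 0 < l ∧ bVal a f l = 0} ⊆ Icc 0 C := by
    rintro l ⟨hl, hl0⟩
    have h1 := hb l (by simp) (by exact_mod_cast hl.ne')
    rw [hl0, zero_sub, norm_neg, norm_one, Complex.norm_real, Real.norm_of_nonneg hl.le, le_div_iff₀ hl] at h1
    exact ⟨hl.le, by linarith⟩
  obtain ⟨x, hx, hacc⟩ := Set.Infinite.exists_accPt_of_subset_isCompact hinf isCompact_Icc hsub
  rw [accPt_iff_frequently] at hacc
  by_cases hxz : bVal a f x = 0
  · have hx0 : 0 < x := by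
      rcases hx.1.eq_or_lt with h | h
      · rw [← h, Complex.ofReal_zero] at hxz; exact absurd hxz h0
      · exact h
    obtain ⟨c, hc, h⟩ := signedB_simple_zero hf ha hne hx0 hxz
    refine hacc ?_
    filter_upwards [eventually_nhdsWithin_iff.1 h] with y hy
    rintro ⟨hyx, -, hy0⟩
    have := hy hyx
    rw [signedB_eq_zero_iff.2 hy0, Complex.zero_re, zero_div] at this
    linarith
  · refine hacc ?_
    filter_upwards [(continuous_bVal hf a).continuousAt.eventually_ne hxz] with y hy h
    exact hy h.2.2

end ImaginaryAxis

/-! ### Uniqueness of a continuous phase -/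

section Uniqueness

/-- Off the finite set, and then everywhere by continuity, the difference is a multiple of `π`. It
tends to `0`, so a non-zero value would force the modulus to pass through `π / 2`. -/
theorem eqOn_of_exp_eq {ζ₁ ζ₂ : ℝ → ℝ} (h₁ : ContinuousOn ζ₁ (Ioi 0)) (h₂ : ContinuousOn ζ₂ (Ioi 0))
    (l₁ : Tendsto ζ₁ atTop (𝓝 0)) (l₂ : Tendsto ζ₂ atTop (𝓝 0)) (Z : Finset ℝ)
    (h : ∀ l : ℝ, 0 < l → l ∉ Z →
      Complex.exp (-2 * Complex.I * ζ₁ l) = Complex.exp (-2 * Complex.I * ζ₂ l)) :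
    EqOn ζ₁ ζ₂ (Ioi 0) := by
  have hc : ContinuousOn (fun l => ζ₁ l - ζ₂ l) (Ioi 0) := h₁.sub h₂
  have hsin0 : ∀ l : ℝ, 0 < l → l ∉ Z → Real.sin (ζ₁ l - ζ₂ l) = 0 := by
    intro l hl hlZ
    obtain ⟨m, hm⟩ := Complex.exp_eq_exp_iff_exists_int.1 (h l hl hlZ)
    rw [Real.sin_eq_zero_iff]
    refine ⟨-m, ?_⟩
    have h1 : ((-m * Real.pi : ℝ) : ℂ) = ((ζ₁ l - ζ₂ l : ℝ) : ℂ) := by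
      have hI : (2 * Complex.I) ≠ 0 := by simp
      apply mul_left_cancel₀ hI
      push_cast
      linear_combination hm
    have h2 := Complex.ofReal_injective h1
    push_cast
    exact h2
  have hsin : ∀ l : ℝ, 0 < l → Real.sin (ζ₁ l - ζ₂ l) = 0 := by
    intro l hl
    have hca : ContinuousAt (fun l => Real.sin (ζ₁ l - ζ₂ l)) l :=
      (Real.continuous_sin.continuousAt).comp (hc.continuousAt (Ioi_mem_nhds hl))
    have hev : ∀ᶠ s in 𝓝[≠] l, s ∉ Z := by
      have := (Finset.finite_toSet Z).sdiff (t := {l})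
      refine mem_nhdsWithin.2 ⟨_, this.isClosed.isOpen_compl, by simp, ?_⟩
      rintro t ⟨ht1, ht2⟩ ht3
      exact ht1 ⟨ht3, ht2⟩
    refine tendsto_nhds_unique ((hca.tendsto.mono_left nhdsWithin_le_nhds).congr' ?_)
      (tendsto_const_nhds (f := 𝓝[≠] l))
    filter_upwards [hev, nhdsWithin_le_nhds (lt_mem_nhds hl)] with s hs1 hs2 using hsin0 s hs2 hs1
  intro t ht
  by_contra hne
  have hpi := Real.pi_pos
  have h1 : Real.pi ≤ |ζ₁ t - ζ₂ t| := by
    by_contra hcon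
    have h2 := abs_lt.1 (not_le.1 hcon)
    exact hne (sub_eq_zero.1 ((Real.sin_eq_zero_iff_of_lt_of_lt h2.1 h2.2).1 (hsin t ht)))
  have h2 : ∀ᶠ T in atTop, |ζ₁ T - ζ₂ T| < Real.pi / 2 := by
    have := (l₁.sub l₂).abs
    rw [sub_zero, abs_zero] at this
    exact this.eventually (gt_mem_nhds (by positivity))
  obtain ⟨T, hT1, hT2⟩ := (h2.and (eventually_ge_atTop t)).exists
  have hcabs : ContinuousOn (fun l => |ζ₁ l - ζ₂ l|) (Icc t T) :=
    (hc.mono fun s hs => lt_of_lt_of_le ht hs.1).abs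
  obtain ⟨s, hs, hs2⟩ := intermediate_value_Icc' hT2 hcabs
    (show Real.pi / 2 ∈ Icc |ζ₁ T - ζ₂ T| |ζ₁ t - ζ₂ t| from ⟨hT1.le, by linarith⟩)
  have hs3 := hsin s (lt_of_lt_of_le ht hs.1)
  rcases abs_eq (by positivity) |>.1 hs2 with h3 | h3
  · rw [h3, Real.sin_pi_div_two] at hs3; norm_num at hs3
  · rw [h3, Real.sin_neg, Real.sin_pi_div_two] at hs3; norm_num at hs3

end Uniqueness

/-! ### Existence and uniqueness of the scattering data -/

section ScatteringData

variable {n : ℕ} {α : Fin n → ℝ} {v : Fin n → L2} {E : ℝ → L2 →L[ℂ] L2}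

theorem integral_norm_sq_eq (f : L2) : ∫ x in Ioi (0 : ℝ), ‖f x‖ ^ 2 = ‖f‖ ^ 2 := by
  rw [← norm_sq_toLp (Lp.memLp f), Lp.toLp_coeFn]

theorem exists_specDensity_ne_zero (hK : IsAdmissible α v) (k : Fin n) : ∃ s, specDensity (v k) s ≠ 0 := by
  by_contra! hcon
  have h1 := integral_specDensity (hK.decay' k)
  simp only [hcon, integral_zero] at h1
  rw [integral_norm_sq_eq] at h1
  have h2 := (mul_eq_zero.1 h1.symm).resolve_left Real.pi_ne_zero
  exact hK.linearIndependent.ne_zero k (norm_eq_zero.1 (pow_eq_zero_iff two_ne_zero |>.1 h2))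

theorem IsScatteringData.mem_realZeros' (hE : IsResolutionOfIdentity L0 E) (hK : IsAdmissible α v)
    (hO : IsOrthogonalFamily E v) {k : Fin n} {d : ScatteringData} (hd : IsScatteringData α v k d) (l : ℝ) :
    l ∈ d.realZeros ↔ 0 < l ∧ bVal (α k) (v k) l = 0 := by
  rw [hd.mem_realZeros]
  refine and_congr_right fun hl => ?_
  exact rFactor_eq_zero_iff hE hK hO k (by exact_mod_cast hl.ne') (by simp)

theorem IsScatteringData.mem_boundStates' (hE : IsResolutionOfIdentity L0 E) (hK : IsAdmissible α v)
    (hO : IsOrthogonalFamily E v) {k : Fin n} {d : ScatteringData} (hd : IsScatteringData α v k d) (κ : ℝ) :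
    κ ∈ d.boundStates ↔ 0 < κ ∧ bVal (α k) (v k) (Complex.I * κ) = 0 := by
  rw [hd.mem_boundStates]
  refine and_congr_right fun hl => ?_
  exact rFactor_eq_zero_iff hE hK hO k (mul_ne_zero Complex.I_ne_zero (by exact_mod_cast hl.ne'))
    (by simpa using hl.le)

theorem isScatteringData_oddPhase (hE : IsResolutionOfIdentity L0 E) (hK : IsAdmissible α v)
    (hO : IsOrthogonalFamily E v) (k : Fin n) {Z K : Finset ℝ}
    (hZ : ∀ l, l ∈ Z ↔ 0 < l ∧ bVal (α k) (v k) l = 0)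
    (hKs : ∀ κ, κ ∈ K ↔ 0 < κ ∧ bVal (α k) (v k) (Complex.I * κ) = 0) :
    IsScatteringData α v k ⟨oddPhase (α k) (v k) Z, Z, K⟩ where
  odd := oddPhase_neg
  continuousOn := continuousOn_oddPhase (hK.decay' k) (hK.ne_zero k) (exists_specDensity_ne_zero hK k) hZ
  tendsto := tendsto_oddPhase (hK.decay' k) hZ
  factor_eq := by
    intro l hl
    -- The factor `w` in `rFactor` makes it vanish at the origin, so no condition on the phase
    -- arises there.
    have hl0 : l ≠ 0 := by
      rintro rfl
      exact hl (by simp [rFactor])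
    have hB : bVal (α k) (v k) l ≠ 0 := fun h =>
      hl ((rFactor_eq_zero_iff hE hK hO k (by exact_mod_cast hl0) (by simp)).2 h)
    rw [sFactor_eq hE hK hO k hl0, exp_oddPhase hl0 hB]
  mem_realZeros := by
    intro l
    rw [hZ]
    refine and_congr_right fun hl => ?_
    exact (rFactor_eq_zero_iff hE hK hO k (by exact_mod_cast hl.ne') (by simp)).symm
  mem_boundStates := by
    intro κ
    rw [hKs]
    refine and_congr_right fun hl => ?_
    exact (rFactor_eq_zero_iff hE hK hO k (mul_ne_zero Complex.I_ne_zero (by exact_mod_cast hl.ne'))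
      (by simpa using hl.le)).symm

theorem IsScatteringData.unique {k : Fin n} {d d' : ScatteringData} (hd : IsScatteringData α v k d)
    (hd' : IsScatteringData α v k d') : d = d' := by
  have hZ : d.realZeros = d'.realZeros := Finset.ext fun l => by
    rw [hd.mem_realZeros, hd'.mem_realZeros]
  have hKs : d.boundStates = d'.boundStates := Finset.ext fun l => by
    rw [hd.mem_boundStates, hd'.mem_boundStates]
  have heq := eqOn_of_exp_eq hd.continuousOn hd'.continuousOn hd.tendsto hd'.tendsto d.realZeros (by
    intro l hl hlZ
    have hr : rFactor α v k l ≠ 0 := fun h => hlZ ((hd.mem_realZeros l).2 ⟨hl, h⟩)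
    rw [← hd.factor_eq l hr, ← hd'.factor_eq l hr])
  have hph : d.phase = d'.phase := by
    ext l
    rcases lt_trichotomy l 0 with h | rfl | h
    · rw [← neg_neg l, hd.odd, hd'.odd, heq (neg_pos.2 h)]
    · have h1 := hd.odd 0
      have h2 := hd'.odd 0
      rw [neg_zero] at h1 h2
      linarith
    · exact heq h
  cases d
  cases d'
  simp_all

/-- Reduces every statement about given scattering data to the explicit phase; finiteness of the
zero set is built into the data, so no condition at the origin is needed. -/
theorem IsScatteringData.phase_eq (hE : IsResolutionOfIdentity L0 E) (hK : IsAdmissible α v)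
    (hO : IsOrthogonalFamily E v) {k : Fin n} {d : ScatteringData} (hd : IsScatteringData α v k d) :
    d.phase = oddPhase (α k) (v k) d.realZeros :=
  congrArg ScatteringData.phase (hd.unique (isScatteringData_oddPhase hE hK hO k
    (hd.mem_realZeros' hE hK hO) (hd.mem_boundStates' hE hK hO)))

theorem existsUnique_isScatteringData (hE : IsResolutionOfIdentity L0 E) (hK : IsAdmissible α v)
    (hO : IsOrthogonalFamily E v) (k : Fin n) (h0 : 0 < α k ∨ bUpper α v k 0 ≠ 0) :
    ∃! d, IsScatteringData α v k d := by
  have hf := hK.decay' k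
  have hne := exists_specDensity_ne_zero hK k
  have h1 : bVal (α k) (v k) 0 ≠ 0 := by
    rcases h0 with h | h
    · exact bVal_zero_ne_zero_of_pos hf h
    · rwa [bUpper_eq hE hK hO k (by simp)] at h
  have hZ := finite_zeros hf (hK.ne_zero k) hne h1
  have hB : {κ : ℝ | 0 < κ ∧ bVal (α k) (v k) (Complex.I * κ) = 0}.Finite :=
    Set.Subsingleton.finite fun κ hκ κ' hκ' =>
      bVal_I_zero_unique hf (hK.ne_zero k) hne hκ.1 hκ'.1 hκ.2 hκ'.2
  exact ⟨_, isScatteringData_oddPhase hE hK hO k (Z := hZ.toFinset) (K := hB.toFinset)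
    (fun l => by simp) (fun l => by simp), fun d hd => hd.unique (isScatteringData_oddPhase hE hK hO k
    (fun l => by simp) (fun l => by simp))⟩

end ScatteringData

/-! ### The logarithm of the factor and its boundary argument -/

section SpectralFunction

variable {a : ℝ} {f : ℝ → ℂ} {Z K : Finset ℝ}

/-- The function `1 + a ⟨(L₀ - z)⁻¹ f, f⟩` of the spectral parameter `z`. -/
def bSpec (a : ℝ) (f : ℝ → ℂ) (z : ℂ) : ℂ :=
  1 + a * ((1 / Real.pi) * ∫ s : ℝ, ((specDensity f s : ℝ) : ℂ) * ((s : ℂ) ^ 2 - z)⁻¹)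

theorem bSpec_sq (hf : Decay f) {w : ℂ} (hw : 0 < w.im) : bSpec a f (w ^ 2) = bVal a f w := by
  rw [bVal, greenForm_eq_integral hf hw]
  rfl

theorem im_le_norm_sq_sub (z : ℂ) (s : ℝ) : z.im ≤ ‖(s : ℂ) ^ 2 - z‖ := by
  have h := Complex.abs_im_le_norm ((s : ℂ) ^ 2 - z)
  rw [Complex.sub_im, ← Complex.ofReal_pow, Complex.ofReal_im, zero_sub, abs_neg] at h
  rw [← Complex.ofReal_pow]
  exact (le_abs_self _).trans h

theorem sq_sub_ne_zero {z : ℂ} (hz : 0 < z.im) (s : ℝ) : (s : ℂ) ^ 2 - z ≠ 0 :=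
  norm_pos_iff.1 (hz.trans_le (im_le_norm_sq_sub z s))

theorem integrable_specDensity_mul_inv (hf : Decay f) {z : ℂ} (hz : 0 < z.im) :
    Integrable fun s : ℝ => ((specDensity f s : ℝ) : ℂ) * ((s : ℂ) ^ 2 - z)⁻¹ := by
  refine ((integrable_specDensity hf).mul_const z.im⁻¹).mono' ?_ (ae_of_all _ fun s => ?_)
  · have := continuous_specDensity hf
    exact (Continuous.mul (by fun_prop) (Continuous.inv₀ (by fun_prop)
      (sq_sub_ne_zero hz))).aestronglyMeasurable
  · have := specDensity_nonneg f s
    rw [norm_mul, Complex.norm_real, Real.norm_of_nonneg this, norm_inv]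
    gcongr
    exact im_le_norm_sq_sub z s

theorem differentiableAt_bSpec (hf : Decay f) {z : ℂ} (hz : 0 < z.im) :
    DifferentiableAt ℂ (bSpec a f) z := by
  have him : ∀ y ∈ Metric.ball z (z.im / 2), z.im / 2 < y.im := by
    intro y hy
    rw [Metric.mem_ball, dist_eq_norm] at hy
    have h := (Complex.abs_im_le_norm (y - z)).trans_lt hy
    rw [Complex.sub_im] at h
    linarith [(abs_lt.1 h).1]
  have hρ := continuous_specDensity hf
  have h := hasDerivAt_integral_of_dominated_loc_of_deriv_le (μ := volume) (x₀ := z)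
    (F := fun z (s : ℝ) => ((specDensity f s : ℝ) : ℂ) * ((s : ℂ) ^ 2 - z)⁻¹)
    (F' := fun z (s : ℝ) => ((specDensity f s : ℝ) : ℂ) * (((s : ℂ) ^ 2 - z) ^ 2)⁻¹)
    (s := Metric.ball z (z.im / 2)) (bound := fun s => specDensity f s * ((z.im / 2) ^ 2)⁻¹)
    (Metric.ball_mem_nhds _ (by positivity)) ?_ (integrable_specDensity_mul_inv hf hz) ?_ ?_
    ((integrable_specDensity hf).mul_const _) ?_
  · exact ((h.2.differentiableAt.const_mul _).const_mul _).const_add _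
  · filter_upwards [Metric.ball_mem_nhds z (show 0 < z.im / 2 by positivity)] with y hy
    have hy0 : 0 < y.im := lt_trans (by positivity) (him y hy)
    exact (integrable_specDensity_mul_inv hf hy0).aestronglyMeasurable
  · exact (Continuous.mul (by fun_prop) (Continuous.inv₀ (by fun_prop)
      fun s => pow_ne_zero 2 (sq_sub_ne_zero hz s))).aestronglyMeasurable
  · refine ae_of_all _ fun s y hy => ?_
    rw [norm_mul, Complex.norm_real, Real.norm_of_nonneg (specDensity_nonneg f s), norm_inv, norm_pow]
    have := specDensity_nonneg f s
    gcongr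
    exact (him y hy).le.trans (im_le_norm_sq_sub y s)
  · refine ae_of_all _ fun s y hy => ?_
    have hy0 : 0 < y.im := lt_trans (by positivity) (him y hy)
    have h1 := ((hasDerivAt_id y).const_sub ((s : ℂ) ^ 2)).inv (sq_sub_ne_zero hy0 s)
    refine (h1.const_mul _).congr_deriv ?_
    simp [div_eq_mul_inv]

theorem bSpec_im (hf : Decay f) {z : ℂ} (hz : 0 < z.im) :
    (bSpec a f z).im = a * (1 / Real.pi * ∫ s, specDensity f s * (z.im / ‖(s : ℂ) ^ 2 - z‖ ^ 2)) := by
  have h1 : ((∫ s : ℝ, ((specDensity f s : ℝ) : ℂ) * ((s : ℂ) ^ 2 - z)⁻¹) : ℂ).im =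
      ∫ s, specDensity f s * (z.im / ‖(s : ℂ) ^ 2 - z‖ ^ 2) := by
    rw [← Complex.imCLM_apply, ← Complex.imCLM.integral_comp_comm (integrable_specDensity_mul_inv hf hz)]
    refine integral_congr_ae (ae_of_all _ fun s => ?_)
    simp only [Complex.imCLM_apply]
    rw [Complex.im_ofReal_mul, Complex.inv_im, Complex.normSq_eq_norm_sq, Complex.sub_im, ← Complex.ofReal_pow,
      Complex.ofReal_im, zero_sub, neg_neg]
  rw [bSpec, Complex.add_im, Complex.one_im, zero_add, Complex.im_ofReal_mul, ← h1,
    show (1 / (Real.pi : ℂ)) = ((1 / Real.pi : ℝ) : ℂ) by push_cast; rfl, Complex.im_ofReal_mul]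

/-- With the sign of `a` factored out, this is a Herglotz function of `z`. It therefore has no zeros
in the upper half-plane and its argument lies strictly between `0` and `π`. -/
theorem signed_bSpec_im_pos (hf : Decay f) (ha : a ≠ 0) (hne : ∃ s, specDensity f s ≠ 0) {z : ℂ}
    (hz : 0 < z.im) : 0 < (unitSign a * bSpec a f z).im := by
  rw [Complex.im_ofReal_mul, bSpec_im hf hz, ← mul_assoc, unitSign_mul]
  have hpos : 0 < ∫ s, specDensity f s * (z.im / ‖(s : ℂ) ^ 2 - z‖ ^ 2) := by
    obtain ⟨s, hs⟩ := hne
    have hn : ∀ s : ℝ, 0 < ‖(s : ℂ) ^ 2 - z‖ := fun s => norm_pos_iff.2 (sq_sub_ne_zero hz s)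
    have hρ := continuous_specDensity hf
    refine integral_pos_of_integrable_nonneg_nonzero (x := s) ?_ ?_ ?_ ?_
    · exact Continuous.mul hρ (Continuous.div continuous_const (by fun_prop) fun s => (pow_pos (hn s) 2).ne')
    · refine ((integrable_specDensity hf).mul_const z.im⁻¹).mono' ?_ (ae_of_all _ fun s => ?_)
      · exact (Continuous.mul hρ (Continuous.div continuous_const (by fun_prop)
          fun s => (pow_pos (hn s) 2).ne')).aestronglyMeasurable
      · have h0 := specDensity_nonneg f s
        rw [Real.norm_of_nonneg (by positivity)]
        gcongr
        rw [div_le_iff₀ (pow_pos (hn s) 2)]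
        have := im_le_norm_sq_sub z s
        calc z.im = z.im⁻¹ * z.im ^ 2 := by field_simp
          _ ≤ _ := by gcongr
    · intro s
      have h0 := specDensity_nonneg f s
      simp only [Pi.zero_apply]
      positivity
    · exact mul_ne_zero hs (div_pos hz (pow_pos (hn s) 2)).ne'
  have := Real.pi_pos
  positivity

/-- The logarithm of `bSpec` in the upper half-plane. -/
def logB (a : ℝ) (f : ℝ → ℂ) (z : ℂ) : ℂ :=
  Complex.log (unitSign a * bSpec a f z) - Complex.I * signShift a

theorem exp_signShift (a : ℝ) : Complex.exp (-(Complex.I * signShift a)) = unitSign a := by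
  rw [signShift, unitSign]
  split_ifs
  · rw [Complex.exp_neg, mul_comm, Complex.exp_pi_mul_I]
    norm_num
  · simp

theorem logB_im (a : ℝ) (f : ℝ → ℂ) (z : ℂ) :
    (logB a f z).im = (unitSign a * bSpec a f z).arg - signShift a := by
  simp [logB, Complex.log_im]

theorem exp_logB (hf : Decay f) (ha : a ≠ 0) (hne : ∃ s, specDensity f s ≠ 0) {z : ℂ} (hz : 0 < z.im) :
    Complex.exp (logB a f z) = bSpec a f z := by
  have h0 : (unitSign a : ℂ) * bSpec a f z ≠ 0 := by
    intro h
    have := signed_bSpec_im_pos hf ha hne hz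
    rw [h] at this
    simp at this
  rw [logB, sub_eq_add_neg, Complex.exp_add, Complex.exp_log h0, exp_signShift, mul_right_comm,
    ← Complex.ofReal_mul, unitSign_mul_self, Complex.ofReal_one, one_mul]

/-- The imaginary part lies in `(0, π)` or, after the shift for negative `a`, in `(-π, 0)`; either
way the branch is principal, so `log (1 + small)` controls it at infinity. -/
theorem logB_eq_log (hf : Decay f) (ha : a ≠ 0) (hne : ∃ s, specDensity f s ≠ 0) {z : ℂ} (hz : 0 < z.im) :
    logB a f z = Complex.log (bSpec a f z) := by
  have h1 := signed_bSpec_im_pos hf ha hne hz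
  have h2 : 0 < (unitSign a * bSpec a f z).arg := by
    refine lt_of_le_of_ne (Complex.arg_nonneg_iff.2 h1.le) fun h => ?_
    exact h1.ne' (Complex.arg_eq_zero_iff.1 h.symm).2
  have h3 := Complex.arg_le_pi (unitSign a * bSpec a f z)
  have hpi := Real.pi_pos
  have hs : signShift a = 0 ∨ signShift a = Real.pi := by
    rw [signShift]; split_ifs <;> simp
  rw [← exp_logB hf ha hne hz, Complex.log_exp]
  · rw [logB_im]; rcases hs with h | h <;> rw [h] <;> linarith
  · rw [logB_im]; rcases hs with h | h <;> rw [h] <;> linarith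

theorem differentiableAt_logB (hf : Decay f) (ha : a ≠ 0) (hne : ∃ s, specDensity f s ≠ 0) {z : ℂ}
    (hz : 0 < z.im) : DifferentiableAt ℂ (logB a f) z :=
  (((differentiableAt_bSpec hf hz).const_mul _).clog
    (Or.inr (signed_bSpec_im_pos hf ha hne hz).ne')).sub_const _

theorem abs_logB_im_le (a : ℝ) (f : ℝ → ℂ) (z : ℂ) : |(logB a f z).im| ≤ 2 * Real.pi := by
  have hpi := Real.pi_pos
  have hs : |signShift a| ≤ Real.pi := by
    rw [signShift]; split_ifs <;> simp [abs_of_pos, hpi, hpi.le]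
  rw [logB_im]
  have := abs_sub (unitSign a * bSpec a f z).arg (signShift a)
  linarith [Complex.abs_arg_le_pi (unitSign a * bSpec a f z)]

theorem norm_logB_le (hf : Decay f) (ha : a ≠ 0) (hne : ∃ s, specDensity f s ≠ 0) :
    ∃ M R : ℝ, ∀ z : ℂ, 0 < z.im → R ≤ ‖z‖ → ‖logB a f z‖ ≤ M * ‖z‖ ^ (-(1 / 2) : ℝ) := by
  obtain ⟨C, hC, hb⟩ := norm_bVal_sub_one_le hf a
  refine ⟨3 / 2 * C, (2 * C) ^ 2, fun z hz hR => ?_⟩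
  obtain ⟨w, hw, rfl⟩ := exists_sq_eq hz.ne'
  have hw0 : w ≠ 0 := by rintro rfl; simp at hw
  have hwp : 0 < ‖w‖ := norm_pos_iff.2 hw0
  rw [norm_pow] at hR ⊢
  have h1 : 2 * C ≤ ‖w‖ := le_of_sq_le_sq hR hwp.le
  have h2 := hb w hw.le hw0
  have h3 : ‖bVal a f w - 1‖ ≤ 1 / 2 := h2.trans (by rw [div_le_iff₀ hwp]; linarith)
  have h4 := Complex.norm_log_one_add_half_le_self h3
  rw [add_sub_cancel] at h4
  have h5 : (‖w‖ ^ 2) ^ (-(1 / 2) : ℝ) = ‖w‖⁻¹ := by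
    rw [← Real.rpow_natCast, ← Real.rpow_mul hwp.le, ← Real.rpow_neg_one]
    norm_num
  rw [logB_eq_log hf ha hne hz, bSpec_sq hf hw, h5]
  calc _ ≤ 3 / 2 * ‖bVal a f w - 1‖ := h4
    _ ≤ 3 / 2 * (C / ‖w‖) := by gcongr
    _ = _ := by ring

/-- Continuity of `bVal` along a square root `w ε` of the spectral parameter. The argument converges
even if the limit is a negative real number, because all values stay in the closed upper half-plane.
-/
theorem tendsto_logB_im (hf : Decay f) (ha : a ≠ 0) (hne : ∃ s, specDensity f s ≠ 0) {w₀ : ℂ} (hw₀ : 0 ≤ w₀.im)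
    (h0 : bVal a f w₀ ≠ 0) (him : 0 ≤ (signedB a f w₀).im) {t : ℝ} {w : ℝ → ℂ}
    (hw : ∀ ε : ℝ, 0 < ε → 0 < (w ε).im ∧ w ε ^ 2 = t + ε * Complex.I)
    (hlim : Tendsto w (𝓝[>] 0) (𝓝 w₀)) :
    Tendsto (fun ε : ℝ => (logB a f (t + ε * Complex.I)).im) (𝓝[>] 0)
      (𝓝 ((signedB a f w₀).arg - signShift a)) := by
  have hne0 : signedB a f w₀ ≠ 0 := fun h => h0 (signedB_eq_zero_iff.1 h)
  have hlim' : Tendsto w (𝓝[>] 0) (𝓝[{w | 0 ≤ w.im}] w₀) := by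
    refine tendsto_nhdsWithin_iff.2 ⟨hlim, ?_⟩
    filter_upwards [self_mem_nhdsWithin] with ε hε using (hw ε hε).1.le
  have hB : Tendsto (fun ε => signedB a f (w ε)) (𝓝[>] 0) (𝓝 (signedB a f w₀)) :=
    ((continuousOn_bVal hf w₀ hw₀).tendsto.comp hlim').const_mul _
  have hz : ∀ ε : ℝ, 0 < ε → 0 < ((t : ℂ) + ε * Complex.I).im := fun ε hε => by simpa using hε
  have harg : Tendsto (fun ε => (signedB a f (w ε)).arg) (𝓝[>] 0) (𝓝 (signedB a f w₀).arg) := by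
    rw [tendsto_iff_norm_sub_tendsto_zero]
    have h1 : Tendsto (fun ε => Real.pi * ‖signedB a f (w ε) - signedB a f w₀‖ / ‖signedB a f w₀‖) (𝓝[>] 0)
        (𝓝 0) := by
      have := ((tendsto_iff_norm_sub_tendsto_zero.1 hB).const_mul Real.pi).div_const ‖signedB a f w₀‖
      simpa using this
    refine squeeze_zero' (Eventually.of_forall fun _ => norm_nonneg _) ?_ h1
    filter_upwards [self_mem_nhdsWithin] with ε hε
    obtain ⟨k1, k2⟩ := hw ε hε
    have k3 := signed_bSpec_im_pos hf ha hne (hz ε hε)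
    rw [← k2, bSpec_sq hf k1] at k3
    refine abs_arg_sub_le ?_ hne0 k3.le him
    intro h
    rw [← signedB, h] at k3
    simp at k3
  refine (harg.sub_const (signShift a)).congr' ?_
  filter_upwards [self_mem_nhdsWithin] with ε hε
  obtain ⟨k1, k2⟩ := hw ε hε
  rw [logB_im, ← k2, bSpec_sq hf k1, signedB]

/-- The boundary values of the argument of `bSpec`. -/
def argBoundary (a : ℝ) (f : ℝ → ℂ) (Z K : Finset ℝ) (t : ℝ) : ℝ :=
  (Ioi 0).indicator (fun t => oddPhase a f Z √t) t +
    ∑ p ∈ Z, Real.pi * (Ioo 0 (p ^ 2)).indicator 1 t - ∑ κ ∈ K, Real.pi * (Ioo (-κ ^ 2) 0).indicator 1 t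

theorem argBoundary_of_pos (hZ : ∀ l, l ∈ Z ↔ 0 < l ∧ bVal a f l = 0) {t : ℝ} (ht : 0 < t) :
    argBoundary a f Z K t = (signedB a f (√t : ℝ)).arg - signShift a := by
  have h1 : ∑ κ ∈ K, Real.pi * (Ioo (-κ ^ 2) 0).indicator (1 : ℝ → ℝ) t = 0 :=
    Finset.sum_eq_zero fun κ _ => by
      rw [indicator_of_notMem (fun h => ht.not_gt h.2), mul_zero]
  have h2 : ∑ p ∈ Z, Real.pi * (Ioo 0 (p ^ 2)).indicator (1 : ℝ → ℝ) t = Real.pi * zeroCount Z √t := by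
    rw [zeroCount, Finset.mul_sum]
    refine Finset.sum_congr rfl fun p hp => ?_
    have hp0 := ((hZ p).1 hp).1
    by_cases h : √t < p
    · rw [if_pos h, indicator_of_mem (show t ∈ Ioo 0 (p ^ 2) from ⟨ht, (Real.sqrt_lt' hp0).1 h⟩), Pi.one_apply]
    · rw [if_neg h, indicator_of_notMem (fun h3 => h ((Real.sqrt_lt' hp0).2 h3.2))]
  rw [argBoundary, h1, h2, indicator_of_mem (show t ∈ Ioi (0 : ℝ) from ht), oddPhase_of_pos (Real.sqrt_pos.2 ht),
    posPhase]
  ring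

/-- For negative spectral parameter the factor is real. If `a < 0` it increases in `κ` towards `1`,
so it is negative exactly below the bound state, where the shifted argument is `-π`; elsewhere that
argument is `0`. If `a > 0` the factor is positive and there is no bound state. -/
theorem argBoundary_of_neg (hf : Decay f) (ha : a ≠ 0) (hne : ∃ s, specDensity f s ≠ 0)
    (hK : ∀ κ, κ ∈ K ↔ 0 < κ ∧ bVal a f (Complex.I * κ) = 0) {t : ℝ} (ht : t < 0)
    (h0 : bVal a f (Complex.I * (√(-t) : ℝ)) ≠ 0) :
    argBoundary a f Z K t = (signedB a f (Complex.I * (√(-t) : ℝ))).arg - signShift a := by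
  have hpi := Real.pi_pos
  have h2 : ∑ p ∈ Z, Real.pi * (Ioo 0 (p ^ 2)).indicator (1 : ℝ → ℝ) t = 0 :=
    Finset.sum_eq_zero fun p _ => by
      rw [indicator_of_notMem (fun h => ht.not_gt h.1), mul_zero]
  have ht' : 0 < -t := by linarith
  set κ₀ := √(-t) with hκ₀
  have hκ₀p : 0 < κ₀ := Real.sqrt_pos.2 ht'
  have hiff : ∀ κ, 0 < κ → (t ∈ Ioo (-κ ^ 2) 0 ↔ κ₀ < κ) := by
    intro κ hκ
    rw [hκ₀, Real.sqrt_lt' hκ]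
    constructor
    · intro h; linarith [h.1]
    · intro h; exact ⟨by linarith, ht⟩
  rw [argBoundary, h2, indicator_of_notMem (show t ∉ Ioi (0 : ℝ) from ht.not_gt), add_zero, zero_sub,
    signedB, bVal_I hf hκ₀p, ← Complex.ofReal_mul]
  rw [Ne, bVal_I_eq_zero_iff hf hκ₀p] at h0
  rcases lt_or_gt_of_ne ha with ha' | ha'
  · have hinc : ∀ κ κ', 0 < κ → κ < κ' → 1 + a / Real.pi * stieltjes f κ < 1 + a / Real.pi * stieltjes f κ' := by
      intro κ κ' h1 h3
      have := stieltjes_strictAnti hf hne h1 h3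
      have h4 : a / Real.pi < 0 := div_neg_of_neg_of_pos ha' hpi
      nlinarith
    simp only [unitSign, signShift, if_pos ha']
    rcases lt_or_gt_of_ne h0 with h3 | h3
    · rw [Complex.arg_ofReal_of_nonneg (by linarith)]
      -- there is a zero to the right of `κ₀`
      have hlim : Tendsto (fun κ : ℝ => 1 + a / Real.pi * stieltjes f κ) atTop (𝓝 1) := by
        obtain ⟨C, hC, hb⟩ := norm_bVal_sub_one_le hf a
        rw [tendsto_iff_norm_sub_tendsto_zero]
        refine squeeze_zero' (Eventually.of_forall fun _ => norm_nonneg _) (g := fun κ : ℝ => C / κ) ?_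
          (tendsto_const_nhds.div_atTop tendsto_id)
        filter_upwards [eventually_gt_atTop 0] with κ hκ
        have := hb (Complex.I * κ) (by simpa using hκ.le)
          (mul_ne_zero Complex.I_ne_zero (by exact_mod_cast hκ.ne'))
        rw [bVal_I hf hκ, ← Complex.ofReal_one, ← Complex.ofReal_sub, Complex.norm_real, norm_mul, Complex.norm_I, one_mul,
          Complex.norm_real, Real.norm_of_nonneg hκ.le] at this
        exact this
      obtain ⟨T, hT1, hT2⟩ := ((hlim.eventually (lt_mem_nhds zero_lt_one)).and (eventually_ge_atTop κ₀)).exists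
      have hcont : ContinuousOn (fun κ : ℝ => 1 + a / Real.pi * stieltjes f κ) (Icc κ₀ T) := by
        have h4 : ContinuousOn (fun κ : ℝ => (bVal a f (Complex.I * κ)).re) (Icc κ₀ T) := by
          refine Complex.continuous_re.comp_continuousOn ((continuousOn_bVal hf).comp (by fun_prop) ?_)
          intro κ hκ
          simpa using hκ₀p.le.trans hκ.1
        refine h4.congr fun κ hκ => ?_
        simp only
        rw [bVal_I hf (hκ₀p.trans_le hκ.1), Complex.ofReal_re]
      obtain ⟨κ₁, hκ₁, hκ₁0⟩ := intermediate_value_Icc hT2 hcont (show (0 : ℝ) ∈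
        Icc (1 + a / Real.pi * stieltjes f κ₀) (1 + a / Real.pi * stieltjes f T) from ⟨h3.le, hT1.le⟩)
      simp only at hκ₁0
      have hκ₁p : 0 < κ₁ := hκ₀p.trans_le hκ₁.1
      have hκ₁m : κ₁ ∈ K := (hK κ₁).2 ⟨hκ₁p, (bVal_I_eq_zero_iff hf hκ₁p).2 hκ₁0⟩
      have hlt : κ₀ < κ₁ := lt_of_le_of_ne hκ₁.1 (by rintro h; rw [h, hκ₁0] at h3; exact lt_irrefl _ h3)
      rw [Finset.sum_eq_single_of_mem κ₁ hκ₁m]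
      · rw [indicator_of_mem ((hiff κ₁ hκ₁p).2 hlt), Pi.one_apply]; ring
      · intro κ hκ hne'
        obtain ⟨k1, k2⟩ := (hK κ).1 hκ
        exact absurd (bVal_I_zero_unique hf ha hne k1 hκ₁p k2 ((hK κ₁).1 hκ₁m).2) hne'
    · rw [Complex.arg_ofReal_of_neg (by linarith), sub_self, neg_eq_zero]
      refine Finset.sum_eq_zero fun κ hκ => ?_
      obtain ⟨k1, k2⟩ := (hK κ).1 hκ
      rw [bVal_I_eq_zero_iff hf k1] at k2
      rw [indicator_of_notMem, mul_zero]
      rw [hiff κ k1]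
      intro hlt
      linarith [hinc κ₀ κ hκ₀p hlt]
  · have h3 : 0 ≤ a / Real.pi * stieltjes f κ₀ := mul_nonneg (by positivity) (stieltjes_nonneg f κ₀)
    simp only [unitSign, signShift, if_neg ha'.not_gt]
    rw [Complex.arg_ofReal_of_nonneg (by linarith), sub_zero, neg_eq_zero]
    refine Finset.sum_eq_zero fun κ hκ => ?_
    obtain ⟨k1, k2⟩ := (hK κ).1 hκ
    exact absurd k2 (bVal_I_ne_zero_of_pos hf ha' k1)

theorem tendsto_argBoundary (hf : Decay f) (ha : a ≠ 0) (hne : ∃ s, specDensity f s ≠ 0)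
    (hZ : ∀ l, l ∈ Z ↔ 0 < l ∧ bVal a f l = 0)
    (hK : ∀ κ, κ ∈ K ↔ 0 < κ ∧ bVal a f (Complex.I * κ) = 0) :
    ∀ᵐ t : ℝ, Tendsto (fun ε : ℝ => (logB a f (t + ε * Complex.I)).im) (𝓝[>] 0)
      (𝓝 (argBoundary a f Z K t)) := by
  have hfin : (insert (0 : ℝ) ((Z.image fun p => p ^ 2) ∪ K.image fun κ => -κ ^ 2 : Finset ℝ) : Set ℝ).Finite :=
    (Finset.finite_toSet _).insert _
  filter_upwards [hfin.countable.ae_notMem volume] with t ht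
  have ht0 : t ≠ 0 := fun h => ht (Or.inl h)
  have hline : Tendsto (fun ε : ℝ => (t : ℂ) + ε * Complex.I) (𝓝[>] 0) (𝓝 t) :=
    (tendsto_nhdsWithin_iff.1 (tendsto_add_mul_I t)).1
  rcases lt_or_gt_of_ne ht0 with h | h
  · have hκ : 0 < √(-t) := Real.sqrt_pos.2 (by linarith)
    have hB : bVal a f (Complex.I * (√(-t) : ℝ)) ≠ 0 := by
      intro hB
      refine ht (Or.inr ?_)
      simp only [Finset.coe_union, Finset.coe_image, mem_union, mem_image, Finset.mem_coe]
      exact Or.inr ⟨√(-t), (hK _).2 ⟨hκ, hB⟩, by rw [Real.sq_sqrt (by linarith)]; ring⟩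
    rw [argBoundary_of_neg hf ha hne hK h hB]
    -- The square root used is `I * (-z) ^ (1/2)`, which is continuous across the negative axis and
    -- lies in the upper half-plane.
    refine tendsto_logB_im hf ha hne (by simp) hB ?_
      (w := fun ε : ℝ => Complex.I * (-((t : ℂ) + ε * Complex.I)) ^ (2⁻¹ : ℂ)) ?_ ?_
    · rw [signedB, bVal_I hf hκ, ← Complex.ofReal_mul, Complex.ofReal_im]
    · intro ε hε
      constructor
      · rw [Complex.I_mul_im, Complex.cpow_inv_two_re]
        have h1 := Complex.abs_re_le_norm (-((t : ℂ) + ε * Complex.I))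
        have h2 : (-((t : ℂ) + ε * Complex.I)).re = -t := by simp
        rw [h2] at h1 ⊢
        have := le_abs_self (-t)
        exact Real.sqrt_pos.2 (by linarith)
      · rw [mul_pow, Complex.I_sq, Complex.cpow_ofNat_inv_pow]
        ring
    · have h1 : ContinuousAt (fun z : ℂ => Complex.I * (-z) ^ (2⁻¹ : ℂ)) (t : ℂ) := by
        refine continuousAt_const.mul (ContinuousAt.cpow (by fun_prop) continuousAt_const (Or.inl ?_))
        simpa using h
      have h2 : Complex.I * (-(t : ℂ)) ^ (2⁻¹ : ℂ) = Complex.I * (√(-t) : ℝ) := by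
        rw [Real.sqrt_eq_rpow, Complex.ofReal_cpow (by linarith)]
        norm_num
      rw [← h2]
      exact h1.tendsto.comp hline
  · have hp : 0 < √t := Real.sqrt_pos.2 h
    have hB : bVal a f (√t : ℝ) ≠ 0 := by
      intro hB
      refine ht (Or.inr ?_)
      simp only [Finset.coe_union, Finset.coe_image, mem_union, mem_image, Finset.mem_coe]
      exact Or.inl ⟨√t, (hZ _).2 ⟨hp, hB⟩, Real.sq_sqrt h.le⟩
    rw [argBoundary_of_pos hZ h]
    refine tendsto_logB_im hf ha hne (by simp) hB (signedB_im_nonneg hf hp)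
      (w := fun ε : ℝ => ((t : ℂ) + ε * Complex.I) ^ (2⁻¹ : ℂ)) ?_ ?_
    · intro ε hε
      constructor
      · have h4 : ((t : ℂ) + ε * Complex.I).im = ε := by simp
        have h2 : ((t : ℂ) + ε * Complex.I).re = t := by simp
        rw [Complex.cpow_inv_two_im_eq_sqrt (by rw [h4]; exact hε.le)]
        refine Real.sqrt_pos.2 ?_
        have h5 := Complex.abs_re_lt_norm (z := (t : ℂ) + ε * Complex.I) |>.2 (by rw [h4]; exact hε.ne')
        have := le_abs_self ((t : ℂ) + ε * Complex.I).re
        linarith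
      · rw [Complex.cpow_ofNat_inv_pow]
    · have h1 : ContinuousAt (fun z : ℂ => z ^ (2⁻¹ : ℂ)) (t : ℂ) :=
        ContinuousAt.cpow (by fun_prop) continuousAt_const (Or.inl (by simpa using h))
      have h2 : (t : ℂ) ^ (2⁻¹ : ℂ) = (√t : ℝ) := by
        rw [Real.sqrt_eq_rpow, Complex.ofReal_cpow h.le]
        norm_num
      rw [← h2]
      exact h1.tendsto.comp hline

end SpectralFunction

/-! ### The modulus of the factor and the reconstruction identity -/

section ModulusFormula

variable {a : ℝ} {f : ℝ → ℂ} {Z K : Finset ℝ}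

/-- The logarithm of `t - z` is an antiderivative, since `t - z` never meets the real axis. These
integrals turn the `π`-steps of the argument into the products over zeros and bound states. -/
theorem integrable_integral_indicator_cauchy {z : ℂ} (hz : 0 < z.im) {b c : ℝ} (hbc : b ≤ c) :
    Integrable (fun t : ℝ => (((Ioo b c).indicator 1 t : ℝ) : ℂ) / (t - z)) ∧
      (∫ t : ℝ, (((Ioo b c).indicator 1 t : ℝ) : ℂ) / (t - z)).re =
        Real.log ‖(c : ℂ) - z‖ - Real.log ‖(b : ℂ) - z‖ := by
  have him : ∀ t : ℝ, ((t : ℂ) - z).im ≠ 0 := fun t => by simpa using hz.ne'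
  have hne : ∀ t : ℝ, (t : ℂ) - z ≠ 0 := fun t h => him t (by rw [h]; rfl)
  have hc : Continuous fun t : ℝ => ((t : ℂ) - z)⁻¹ := Continuous.inv₀ (by fun_prop) hne
  have e : (fun t : ℝ => (((Ioo b c).indicator 1 t : ℝ) : ℂ) / (t - z)) =
      (Ioo b c).indicator fun t : ℝ => ((t : ℂ) - z)⁻¹ := by
    ext t
    by_cases h : t ∈ Ioo b c
    · rw [indicator_of_mem h, indicator_of_mem h]; simp
    · rw [indicator_of_notMem h, indicator_of_notMem h]; simp
  have hint : IntegrableOn (fun t : ℝ => ((t : ℂ) - z)⁻¹) (Ioo b c) :=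
    (hc.continuousOn.integrableOn_Icc (a := b) (b := c)).mono_set Ioo_subset_Icc_self
  have hd : ∀ t ∈ uIcc b c, HasDerivAt (fun t : ℝ => Complex.log ((t : ℂ) - z)) ((t : ℂ) - z)⁻¹ t := by
    intro t _
    have h1 : HasDerivAt (fun t : ℝ => (t : ℂ) - z) 1 t := (Complex.ofRealCLM.hasDerivAt (x := t)).sub_const z
    have h2 := h1.clog_real (Or.inr (him t))
    rwa [one_div] at h2
  rw [e]
  refine ⟨hint.integrable_indicator measurableSet_Ioo, ?_⟩
  rw [integral_indicator measurableSet_Ioo, ← integral_Ioc_eq_integral_Ioo, ← intervalIntegral.integral_of_le hbc,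
    intervalIntegral.integral_eq_sub_of_hasDerivAt hd (hc.intervalIntegrable _ _), Complex.sub_re,
    Complex.log_re, Complex.log_re]

/-- Substitute `t = s ^ 2` and use 2s/(s² - w²) = 1/(s - w) + 1/(s + w); oddness folds the second
term onto the negative half-axis. -/
theorem integral_odd_cauchy {ζ : ℝ → ℝ} (hodd : ∀ t, ζ (-t) = -ζ t) {w : ℂ} (hw : 0 < w.im)
    (hint : Integrable fun s : ℝ => (ζ s : ℂ) / (s - w)) :
    Integrable (fun t : ℝ => (((Ioi 0).indicator (fun t => ζ √t) t : ℝ) : ℂ) / (t - w ^ 2)) ∧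
      ∫ t : ℝ, (((Ioi 0).indicator (fun t => ζ √t) t : ℝ) : ℂ) / (t - w ^ 2) =
        ∫ s : ℝ, (ζ s : ℂ) / (s - w) := by
  have e : (fun t : ℝ => (((Ioi 0).indicator (fun t => ζ √t) t : ℝ) : ℂ) / (t - w ^ 2)) =
      (Ioi 0).indicator fun t : ℝ => (ζ √t : ℂ) / (t - w ^ 2) := by
    ext t
    by_cases h : t ∈ Ioi (0 : ℝ)
    · rw [indicator_of_mem h, indicator_of_mem h]
    · rw [indicator_of_notMem h, indicator_of_notMem h]; simp
  have hneg : Integrable fun s : ℝ => (ζ s : ℂ) / (s + w) := by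
    refine hint.comp_neg.congr (ae_of_all _ fun s => ?_)
    simp only [hodd]
    push_cast
    rw [← neg_add', neg_div_neg_eq]
  have hk : ∀ s ∈ Ioi (0 : ℝ), ((2 : ℝ) * s ^ ((2 : ℝ) - 1)) • ((ζ √(s ^ (2 : ℝ)) : ℂ) / ((s ^ (2 : ℝ) : ℝ) - w ^ 2)) =
      (ζ s : ℂ) / (s - w) + (ζ s : ℂ) / (s + w) := by
    intro s hs
    have hs' : (0 : ℝ) < s := hs
    have h1 : (s : ℂ) - w ≠ 0 := by
      intro h
      have := congrArg Complex.im h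
      simp at this
      linarith
    have h2 : (s : ℂ) + w ≠ 0 := by
      intro h
      have := congrArg Complex.im h
      simp at this
      linarith
    have h3 : (s : ℂ) ^ 2 - w ^ 2 ≠ 0 := by rw [sq_sub_sq]; exact mul_ne_zero h2 h1
    rw [Real.rpow_two, Real.sqrt_sq hs'.le, show (2 : ℝ) - 1 = 1 by norm_num, Real.rpow_one, Complex.real_smul]
    push_cast
    rw [div_add_div _ _ h1 h2, ← mul_div_assoc, div_eq_div_iff h3 (mul_ne_zero h1 h2)]
    ring
  have hI : IntegrableOn (fun s : ℝ => (ζ s : ℂ) / (s - w) + (ζ s : ℂ) / (s + w)) (Ioi 0) :=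
    (hint.add hneg).integrableOn
  rw [e]
  constructor
  · refine IntegrableOn.integrable_indicator ?_ measurableSet_Ioi
    rw [← integrableOn_Ioi_comp_rpow_iff _ (show (2 : ℝ) ≠ 0 by norm_num)]
    refine hI.congr_fun (fun s hs => ?_) measurableSet_Ioi
    simp only [abs_two]
    exact (hk s hs).symm
  · rw [integral_indicator measurableSet_Ioi, ← integral_comp_rpow_Ioi_of_pos (show (0 : ℝ) < 2 by norm_num),
      setIntegral_congr_fun measurableSet_Ioi hk, integral_add hint.integrableOn hneg.integrableOn,
      ← integral_add_compl measurableSet_Ioi hint, compl_Ioi]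
    congr 1
    rw [← neg_zero, ← integral_comp_neg_Ioi, neg_zero]
    refine integral_congr_ae (ae_of_all _ fun s => ?_)
    simp only [hodd]
    push_cast
    rw [← neg_add', neg_div_neg_eq]

/-- The real part of the Cauchy representation of `logB` is the logarithm of the modulus. The
condition on `w ^ 2` places the spectral parameter in the upper half-plane, that is, `w` in the open
first quadrant. -/
theorem norm_bVal_eq_of_im_pos (hf : Decay f) (ha : a ≠ 0) (hne : ∃ s, specDensity f s ≠ 0)
    (hZ : ∀ l, l ∈ Z ↔ 0 < l ∧ bVal a f l = 0)
    (hK : ∀ κ, κ ∈ K ↔ 0 < κ ∧ bVal a f (Complex.I * κ) = 0) {w : ℂ} (hw : 0 < w.im) (hw2 : 0 < (w ^ 2).im)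
    (hint : Integrable fun s : ℝ => (oddPhase a f Z s : ℂ) / (s - w)) :
    ‖bVal a f w‖ = (∏ p ∈ Z, ‖(p : ℂ) ^ 2 - w ^ 2‖ / ‖w ^ 2‖) * (∏ κ ∈ K, ‖(κ : ℂ) ^ 2 + w ^ 2‖ / ‖w ^ 2‖) *
      Real.exp (1 / Real.pi * (∫ s : ℝ, (oddPhase a f Z s : ℂ) / (s - w)).re) := by
  have hpi := Real.pi_pos
  obtain ⟨M, R, hMR⟩ := norm_logB_le hf ha hne
  have hmain := cauchy_integral_boundary (fun z hz => differentiableAt_logB (a := a) hf ha hne hz)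
    hMR (fun z _ => abs_logB_im_le a f z) (tendsto_argBoundary hf ha hne hZ hK) hw2
  obtain ⟨i1, e1⟩ := integral_odd_cauchy oddPhase_neg hw hint
  have hcz := fun (b c : ℝ) (hbc : b ≤ c) => integrable_integral_indicator_cauchy hw2 hbc
  have hsplit : ∀ t : ℝ, (argBoundary a f Z K t : ℂ) / (t - w ^ 2) =
      (((Ioi 0).indicator (fun t => oddPhase a f Z √t) t : ℝ) : ℂ) / (t - w ^ 2) +
      ∑ p ∈ Z, (Real.pi : ℂ) * ((((Ioo 0 (p ^ 2)).indicator 1 t : ℝ) : ℂ) / (t - w ^ 2)) -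
      ∑ κ ∈ K, (Real.pi : ℂ) * ((((Ioo (-κ ^ 2) 0).indicator 1 t : ℝ) : ℂ) / (t - w ^ 2)) := by
    intro t
    rw [argBoundary]
    push_cast
    rw [sub_div, add_div, Finset.sum_div, Finset.sum_div]
    simp only [mul_div_assoc]
  have i2 : Integrable fun t : ℝ =>
      ∑ p ∈ Z, (Real.pi : ℂ) * ((((Ioo 0 (p ^ 2)).indicator 1 t : ℝ) : ℂ) / (t - w ^ 2)) :=
    integrable_finsetSum _ fun p _ => ((hcz 0 (p ^ 2) (sq_nonneg p)).1).const_mul _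
  have i3 : Integrable fun t : ℝ =>
      ∑ κ ∈ K, (Real.pi : ℂ) * ((((Ioo (-κ ^ 2) 0).indicator 1 t : ℝ) : ℂ) / (t - w ^ 2)) :=
    integrable_finsetSum _ fun κ _ => ((hcz (-κ ^ 2) 0 (by nlinarith)).1).const_mul _
  have i12 : Integrable fun t : ℝ =>
      (((Ioi 0).indicator (fun t => oddPhase a f Z √t) t : ℝ) : ℂ) / (t - w ^ 2) +
      ∑ p ∈ Z, (Real.pi : ℂ) * ((((Ioo 0 (p ^ 2)).indicator 1 t : ℝ) : ℂ) / (t - w ^ 2)) := i1.add i2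
  simp_rw [hsplit] at hmain
  rw [integral_sub i12 i3, integral_add i1 i2, e1,
    integral_finsetSum _ (fun p _ => ((hcz 0 (p ^ 2) (sq_nonneg p)).1).const_mul _),
    integral_finsetSum _ (fun κ _ => ((hcz (-κ ^ 2) 0 (by nlinarith)).1).const_mul _)] at hmain
  simp only [integral_const_mul] at hmain
  have hre := congrArg Complex.re hmain
  rw [Complex.sub_re, Complex.add_re, Complex.re_sum, Complex.re_sum, Complex.re_ofReal_mul] at hre
  simp only [Complex.re_ofReal_mul] at hre
  have hz0 : 0 < ‖w ^ 2‖ := norm_pos_iff.2 fun h => by rw [h] at hw2; simp at hw2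
  have hp0 : ∀ p : ℝ, 0 < ‖(p : ℂ) ^ 2 - w ^ 2‖ := fun p => norm_pos_iff.2 fun h => by
    have := congrArg Complex.im h
    rw [Complex.sub_im, ← Complex.ofReal_pow, Complex.ofReal_im, Complex.zero_im] at this
    linarith
  have hκ0 : ∀ κ : ℝ, 0 < ‖(κ : ℂ) ^ 2 + w ^ 2‖ := fun p => norm_pos_iff.2 fun h => by
    have := congrArg Complex.im h
    rw [Complex.add_im, ← Complex.ofReal_pow, Complex.ofReal_im, Complex.zero_im] at this
    linarith
  have r1 : ∀ p ∈ Z, Real.pi * (∫ t : ℝ, (((Ioo 0 (p ^ 2)).indicator 1 t : ℝ) : ℂ) / (t - w ^ 2)).re =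
      Real.pi * Real.log (‖(p : ℂ) ^ 2 - w ^ 2‖ / ‖w ^ 2‖) := by
    intro p _
    rw [(hcz 0 (p ^ 2) (sq_nonneg p)).2, Real.log_div (hp0 p).ne' hz0.ne']
    push_cast
    rw [zero_sub, norm_neg]
  have r2 : ∀ κ ∈ K, Real.pi * (∫ t : ℝ, (((Ioo (-κ ^ 2) 0).indicator 1 t : ℝ) : ℂ) / (t - w ^ 2)).re =
      -(Real.pi * Real.log (‖(κ : ℂ) ^ 2 + w ^ 2‖ / ‖w ^ 2‖)) := by
    intro κ _
    rw [(hcz (-κ ^ 2) 0 (by nlinarith)).2, Real.log_div (hκ0 κ).ne' hz0.ne']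
    push_cast
    rw [zero_sub, norm_neg, ← neg_add', norm_neg]
    ring
  rw [Finset.sum_congr rfl r1, Finset.sum_congr rfl r2, Finset.sum_neg_distrib, ← Finset.mul_sum, ← Finset.mul_sum] at hre
  have hlog : (logB a f (w ^ 2)).re = 1 / Real.pi * (∫ s : ℝ, (oddPhase a f Z s : ℂ) / (s - w)).re +
      ∑ p ∈ Z, Real.log (‖(p : ℂ) ^ 2 - w ^ 2‖ / ‖w ^ 2‖) +
      ∑ κ ∈ K, Real.log (‖(κ : ℂ) ^ 2 + w ^ 2‖ / ‖w ^ 2‖) := by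
    field_simp
    linarith
  rw [← bSpec_sq hf hw, ← exp_logB hf ha hne hw2, Complex.norm_exp, hlog, Real.exp_add, Real.exp_add,
    Real.exp_sum, Real.exp_sum,
    Finset.prod_congr rfl fun p _ => Real.exp_log (div_pos (hp0 p) hz0),
    Finset.prod_congr rfl fun κ _ => Real.exp_log (div_pos (hκ0 κ) hz0)]
  ring

theorem norm_bVal_eq (hf : Decay f) (ha : a ≠ 0) (hne : ∃ s, specDensity f s ≠ 0)
    (hZ : ∀ l, l ∈ Z ↔ 0 < l ∧ bVal a f l = 0)
    (hK : ∀ κ, κ ∈ K ↔ 0 < κ ∧ bVal a f (Complex.I * κ) = 0) {l : ℝ} (hl : 0 < l) :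
    ‖bVal a f l‖ = (∏ p ∈ Z, |l ^ 2 - p ^ 2| / l ^ 2) * (∏ κ ∈ K, (l ^ 2 + κ ^ 2) / l ^ 2) *
      Real.exp (1 / Real.pi * pv (oddPhase a f Z) l) := by
  obtain ⟨r, hr⟩ := exists_integrable_pvIntegrand hf ha hne hZ hl.ne'
  have hline : Tendsto (fun η : ℝ => (l : ℂ) + η * Complex.I) (𝓝[>] 0) (𝓝 l) :=
    (tendsto_nhdsWithin_iff.1 (tendsto_add_mul_I l)).1
  have t1 : Tendsto (fun η : ℝ => ‖bVal a f (l + η * Complex.I)‖) (𝓝[>] 0) (𝓝 ‖bVal a f l‖) :=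
    ((continuousOn_bVal hf (l : ℂ) (by simp)).tendsto.comp (tendsto_add_mul_I l)).norm
  have hl0 : ‖(l : ℂ) ^ 2‖ ≠ 0 := by
    rw [norm_ne_zero_iff]; exact pow_ne_zero 2 (by exact_mod_cast hl.ne')
  have t2 : Tendsto (fun η : ℝ => ∏ p ∈ Z, ‖(p : ℂ) ^ 2 - (l + η * Complex.I) ^ 2‖ / ‖((l : ℂ) + η * Complex.I) ^ 2‖)
      (𝓝[>] 0) (𝓝 (∏ p ∈ Z, ‖(p : ℂ) ^ 2 - (l : ℂ) ^ 2‖ / ‖(l : ℂ) ^ 2‖)) :=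
    tendsto_finsetProd _ fun p _ => Tendsto.div (tendsto_const_nhds.sub (hline.pow 2)).norm (hline.pow 2).norm hl0
  have t3 : Tendsto (fun η : ℝ => ∏ κ ∈ K, ‖(κ : ℂ) ^ 2 + (l + η * Complex.I) ^ 2‖ / ‖((l : ℂ) + η * Complex.I) ^ 2‖)
      (𝓝[>] 0) (𝓝 (∏ κ ∈ K, ‖(κ : ℂ) ^ 2 + (l : ℂ) ^ 2‖ / ‖(l : ℂ) ^ 2‖)) :=
    tendsto_finsetProd _ fun p _ => Tendsto.div (tendsto_const_nhds.add (hline.pow 2)).norm (hline.pow 2).norm hl0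
  have t4 := (Real.continuous_exp.tendsto _).comp ((tendsto_re_cauchy_integral hr).const_mul (1 / Real.pi))
  have hnorm : ‖(l : ℂ) ^ 2‖ = l ^ 2 := by
    rw [← Complex.ofReal_pow, Complex.norm_real, Real.norm_of_nonneg (by positivity)]
  have hp : ∀ p ∈ Z, ‖(p : ℂ) ^ 2 - (l : ℂ) ^ 2‖ / ‖(l : ℂ) ^ 2‖ = |l ^ 2 - p ^ 2| / l ^ 2 := fun p _ => by
    rw [hnorm, ← Complex.ofReal_pow, ← Complex.ofReal_pow, ← Complex.ofReal_sub, Complex.norm_real,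
      Real.norm_eq_abs, abs_sub_comm]
  have hκ : ∀ κ ∈ K, ‖(κ : ℂ) ^ 2 + (l : ℂ) ^ 2‖ / ‖(l : ℂ) ^ 2‖ = (l ^ 2 + κ ^ 2) / l ^ 2 := fun κ _ => by
    rw [hnorm, ← Complex.ofReal_pow, ← Complex.ofReal_pow, ← Complex.ofReal_add, Complex.norm_real,
      Real.norm_of_nonneg (by positivity), add_comm]
  rw [(hasPV_of_integrable hr).pv_eq, ← Finset.prod_congr rfl hp, ← Finset.prod_congr rfl hκ]
  refine tendsto_nhds_unique (t1.congr' ?_) ((t2.mul t3).mul t4)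
  filter_upwards [self_mem_nhdsWithin] with η hη
  have hη' : 0 < η := hη
  refine norm_bVal_eq_of_im_pos hf ha hne hZ hK (by simpa using hη') ?_ (integrable_cauchy_kernel hr hη')
  rw [sq, Complex.mul_im]
  simp only [Complex.add_re, Complex.add_im, Complex.ofReal_re, Complex.ofReal_im, Complex.mul_re, Complex.mul_im,
    Complex.I_re, Complex.I_im]
  nlinarith [mul_pos hl hη']

/-- The sine of the uncorrected argument times the modulus is the imaginary part of the factor. The
zero count changes the sine by a sign, one for each zero to the right of `l`, and the product of the
differences `l ^ 2 - p ^ 2` carries the same sign. -/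
theorem sin_posPhase_mul (hf : Decay f) (hZ : ∀ l, l ∈ Z ↔ 0 < l ∧ bVal a f l = 0) {l : ℝ} (hl : 0 < l) :
    (∏ p ∈ Z, (l ^ 2 - p ^ 2)) * Real.sin (posPhase a f Z l) * ‖bVal a f l‖ =
      (∏ p ∈ Z, |l ^ 2 - p ^ 2|) * (a * specDensity f l / l) := by
  have h1 : ‖bVal a f l‖ * Real.sin ((signedB a f l).arg - signShift a) = a * specDensity f l / l := by
    rw [← bVal_im hf hl.ne', Real.sin_sub, ← norm_signedB]
    have h2 : ‖signedB a f l‖ * Real.sin (signedB a f l).arg = (signedB a f l).im := Complex.norm_mul_sin_arg _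
    have h3 : Real.sin (signShift a) = 0 := by rw [signShift]; split_ifs <;> simp
    have h4 : Real.cos (signShift a) = unitSign a := by rw [signShift, unitSign]; split_ifs <;> simp
    rw [h3, h4, mul_zero, sub_zero, ← mul_assoc, h2, signedB, Complex.im_ofReal_mul, mul_right_comm,
      unitSign_mul_self, one_mul]
  have h2 : (∏ p ∈ Z, (l ^ 2 - p ^ 2)) = (∏ p ∈ Z, (if l < p then (-1 : ℝ) else 1)) * ∏ p ∈ Z, |l ^ 2 - p ^ 2| := by
    rw [← Finset.prod_mul_distrib]
    refine Finset.prod_congr rfl fun p hp => ?_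
    have hp0 := ((hZ p).1 hp).1
    split_ifs with h
    · rw [abs_of_neg (by nlinarith)]; ring
    · rw [abs_of_nonneg (by nlinarith [not_lt.1 h]), one_mul]
  have h3 : (∏ p ∈ Z, (if l < p then (-1 : ℝ) else 1)) = (-1) ^ (Z.filter fun p => l < p).card := by
    rw [Finset.prod_ite, Finset.prod_const, Finset.prod_const_one, mul_one]
  have h4 : zeroCount Z l = (Z.filter fun p => l < p).card := by
    rw [zeroCount, Finset.sum_ite, Finset.sum_const_zero, add_zero, Finset.sum_const, nsmul_eq_mul, mul_one]
  have h5 : Real.sin (posPhase a f Z l) =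
      (-1) ^ (Z.filter fun p => l < p).card * Real.sin ((signedB a f l).arg - signShift a) := by
    rw [posPhase, h4, mul_comm Real.pi, Real.sin_sub_nat_mul_pi]
  have h6 : ((-1 : ℝ) ^ (Z.filter fun p => l < p).card) * (-1) ^ (Z.filter fun p => l < p).card = 1 := by
    rw [← mul_pow]; norm_num
  rw [h2, h3, h5, ← h1]
  linear_combination ((∏ p ∈ Z, |l ^ 2 - p ^ 2|) * Real.sin ((signedB a f l).arg - signShift a) * ‖bVal a f l‖) * h6

theorem dataDensity_oddPhase (hf : Decay f) (ha : a ≠ 0) (hne : ∃ s, specDensity f s ≠ 0)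
    (hZ : ∀ l, l ∈ Z ↔ 0 < l ∧ bVal a f l = 0)
    (hK : ∀ κ, κ ∈ K ↔ 0 < κ ∧ bVal a f (Complex.I * κ) = 0) {l : ℝ} (hl : 0 < l) :
    l * dataDensity ⟨oddPhase a f Z, Z, K⟩ l = a * specDensity f l := by
  have h1 := norm_bVal_eq hf ha hne hZ hK hl
  have h2 := sin_posPhase_mul (a := a) (Z := Z) hf hZ hl
  rw [Finset.prod_div_distrib, Finset.prod_div_distrib, Finset.prod_const, Finset.prod_const] at h1
  simp only [dataDensity]
  rw [psi_eq hl.ne', oddPhase_of_pos hl]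
  set P := ∏ p ∈ Z, |l ^ 2 - p ^ 2| with hP
  set Q := ∏ p ∈ Z, (l ^ 2 - p ^ 2) with hQ
  set κs := ∏ κ ∈ K, (l ^ 2 + κ ^ 2) with hκs
  set X := Real.exp (1 / Real.pi * pv (oddPhase a f Z) l) with hX
  -- At a zero the argument carries no information, but there both sides vanish; elsewhere the
  -- common factor `P` can be cancelled.
  by_cases hB : l ∈ Z
  · have hQ0 : Q = 0 := Finset.prod_eq_zero hB (sub_self _)
    rw [hQ0, specDensity_eq_zero_of_bVal hf ha hl ((hZ l).1 hB).2]
    ring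
  · have hP0 : P ≠ 0 := by
      refine Finset.prod_ne_zero_iff.2 fun p hp => abs_ne_zero.2 fun h => hB ?_
      have hp0 := ((hZ p).1 hp).1
      have : l = p := by
        have h3 : (l - p) * (l + p) = 0 := by linarith
        rcases mul_eq_zero.1 h3 with h4 | h4 <;> linarith
      rwa [this]
    rw [h1] at h2
    have h3 : P * (a * specDensity f l) = P * (l * ((1 / l ^ 2) ^ (Z.card + K.card) * κs * Q *
        Real.sin (posPhase a f Z l) * X)) := by
      have h4 : a * specDensity f l = l * (a * specDensity f l / l) := by field_simp
      rw [h4, mul_left_comm, ← h2, one_div, inv_pow, pow_add]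
      field_simp
    exact (mul_left_cancel₀ hP0 h3).symm

theorem dataDensity_neg {d : ScatteringData} (hodd : ∀ t, d.phase (-t) = -d.phase t) {x r : ℝ} (hx : x ≠ 0)
    (h : Integrable (pvIntegrand d.phase x r)) : dataDensity d (-x) = -dataDensity d x := by
  rw [dataDensity, dataDensity, pv_neg hodd h, hodd, psi_eq hx, psi_eq (neg_ne_zero.2 hx), Real.sin_neg, neg_sq]
  ring

end ModulusFormula

/-! ### Recovery of the coupling and of the density from the data -/

section InverseProblem

variable {n : ℕ} {α β : Fin n → ℝ} {v u : Fin n → L2} {E : ℝ → L2 →L[ℂ] L2}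

theorem norm_W_sq {f : L2} (hf : Decay f) (l : ℝ) : ‖W f l‖ ^ 2 = 4 * specDensity f l := by
  have h : W f l = -(2 * Complex.I * sineTransform f l) := by
    rw [sineTransform_eq hf.integrable]
    have h1 : fourier f l = halfFourier f l := rfl
    have h2 : fourier f (-l) = halfFourier f (-l) := rfl
    have hI := Complex.I_ne_zero
    rw [W, h1, h2]
    field_simp
    ring
  rw [h, norm_neg, norm_mul, norm_mul, Complex.norm_I, Complex.norm_ofNat, specDensity]
  ring

theorem IsScatteringData.mul_dataDensity (hE : IsResolutionOfIdentity L0 E) (hK : IsAdmissible α v)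
    (hO : IsOrthogonalFamily E v) {k : Fin n} {d : ScatteringData} (hd : IsScatteringData α v k d) {l : ℝ}
    (hl : 0 < l) : l * dataDensity d l = α k * specDensity (v k) l := by
  have h := dataDensity_oddPhase (hK.decay' k) (hK.ne_zero k) (exists_specDensity_ne_zero hK k)
    (hd.mem_realZeros' hE hK hO) (hd.mem_boundStates' hE hK hO) hl
  rwa [← hd.phase_eq hE hK hO] at h

theorem IsScatteringData.exists_integrable_pvIntegrand (hE : IsResolutionOfIdentity L0 E) (hK : IsAdmissible α v)
    (hO : IsOrthogonalFamily E v) {k : Fin n} {d : ScatteringData} (hd : IsScatteringData α v k d) {l : ℝ}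
    (hl : l ≠ 0) : ∃ r, Integrable (pvIntegrand d.phase l r) := by
  rw [hd.phase_eq hE hK hO]
  exact NonlocalScattering.exists_integrable_pvIntegrand (hK.decay' k) (hK.ne_zero k)
    (exists_specDensity_ne_zero hK k) (hd.mem_realZeros' hE hK hO) hl

theorem IsScatteringData.norm_W_sq_eq (hE : IsResolutionOfIdentity L0 E) (hK : IsAdmissible α v)
    (hO : IsOrthogonalFamily E v) {k : Fin n} {d : ScatteringData} (hd : IsScatteringData α v k d) {l : ℝ}
    (hl : l ≠ 0) : ‖W (v k) l‖ ^ 2 = 4 * l / α k * dataDensity d l := by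
  have hα := hK.ne_zero k
  have key : ∀ x : ℝ, 0 < x → 4 * specDensity (v k) x = 4 * x / α k * dataDensity d x := by
    intro x hx
    have h := hd.mul_dataDensity hE hK hO hx
    field_simp
    linarith
  rw [norm_W_sq (hK.decay' k)]
  rcases lt_or_gt_of_ne hl with h | h
  · obtain ⟨r, hr⟩ := hd.exists_integrable_pvIntegrand hE hK hO (neg_ne_zero.2 hl)
    have h1 := dataDensity_neg hd.odd (neg_ne_zero.2 hl) hr
    rw [neg_neg] at h1
    rw [h1, ← specDensity_neg, key (-l) (neg_pos.2 h)]
    ring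
  · exact key l h

theorem IsScatteringData.integrableOn (hE : IsResolutionOfIdentity L0 E) (hK : IsAdmissible α v)
    (hO : IsOrthogonalFamily E v) {k : Fin n} {d : ScatteringData} (hd : IsScatteringData α v k d) :
    IntegrableOn (fun l : ℝ => l * dataDensity d l) (Ioi 0) :=
  ((integrable_specDensity (hK.decay' k)).const_mul (α k)).integrableOn.congr_fun
    (fun _ hl => (hd.mul_dataDensity hE hK hO hl).symm) measurableSet_Ioi

/-- By Plancherel a normalized vector has a density of total mass `π`, and by evenness `π / 2` on
the half-line; the data give the coupling times the density. -/
theorem IsScatteringData.coupling_eq (hE : IsResolutionOfIdentity L0 E) (hK : IsAdmissible α v)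
    (hO : IsOrthogonalFamily E v) {k : Fin n} {d : ScatteringData} (hd : IsScatteringData α v k d)
    (hv : ‖v k‖ = 1) : α k = 2 / Real.pi * ∫ l in Ioi (0 : ℝ), l * dataDensity d l := by
  have h1 := integral_specDensity (hK.decay' k)
  have h2 : ∀ s, specDensity (v k) |s| = specDensity (v k) s := by
    intro s
    rcases abs_choice s with h | h <;> rw [h]
    exact specDensity_neg _ s
  have h3 := integral_comp_abs (f := specDensity (v k))
  simp_rw [h2] at h3
  rw [integral_norm_sq_eq, hv, h3] at h1
  rw [setIntegral_congr_fun measurableSet_Ioi fun l hl => hd.mul_dataDensity hE hK hO hl, integral_const_mul]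
  have hpi := Real.pi_pos
  have h4 : ∫ s in Ioi (0 : ℝ), specDensity (v k) s = Real.pi / 2 := by linarith
  rw [h4]
  field_simp

theorem bVal_eq_of_specDensity_eq {f g : ℝ → ℂ} (hf : Decay f) (hg : Decay g)
    (h : specDensity f = specDensity g) (a : ℝ) {w : ℂ} (hw : 0 ≤ w.im) : bVal a f w = bVal a g w := by
  have hpos : ∀ w : ℂ, 0 < w.im → bVal a f w = bVal a g w := by
    intro w hw
    rw [← bSpec_sq hf hw, ← bSpec_sq hg hw, bSpec, bSpec, h]
  rcases hw.eq_or_lt with h0 | h0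
  · have := upperSet_neBot hw
    have h1 := ((continuousOn_bVal (a := a) hf w hw).mono upperSet_subset).tendsto
    have h2 := ((continuousOn_bVal (a := a) hg w hw).mono upperSet_subset).tendsto
    refine tendsto_nhds_unique h1 (h2.congr' ?_)
    filter_upwards [self_mem_nhdsWithin] with z hz using (hpos z hz.1).symm
  · exact hpos w h0

/-- Scattering data only involve `rFactor` on the closed upper half-plane, and by the spectral
representation this is determined by the coupling and the density, the latter being a quarter of
`‖W‖ ^ 2`. -/
theorem IsScatteringData.congr (hE : IsResolutionOfIdentity L0 E) (hK : IsAdmissible α v)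
    (hO : IsOrthogonalFamily E v) (hK' : IsAdmissible β u) (hO' : IsOrthogonalFamily E u) {k : Fin n}
    {d : ScatteringData} (hd : IsScatteringData α v k d) (hβ : β k = α k)
    (hW : ∀ l : ℝ, ‖W (u k) l‖ = ‖W (v k) l‖) : IsScatteringData β u k d := by
  have hρ : specDensity (u k) = specDensity (v k) := by
    ext l
    have h1 := norm_W_sq (hK.decay' k) l
    rw [← hW l, norm_W_sq (hK'.decay' k)] at h1
    linarith
  have hr : ∀ w : ℂ, 0 ≤ w.im → rFactor β u k w = rFactor α v k w := by
    intro w hw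
    rw [rFactor, rFactor, bUpper_eq hE hK' hO' k hw, bUpper_eq hE hK hO k hw, hβ,
      bVal_eq_of_specDensity_eq (hK'.decay' k) (hK.decay' k) hρ _ hw]
  have hrl : ∀ l : ℝ, rFactor β u k l = rFactor α v k l := fun l => hr l (by simp)
  refine ⟨hd.odd, hd.continuousOn, hd.tendsto, fun l hl => ?_, fun l => ?_, fun κ => ?_⟩
  · rw [hrl] at hl
    have h1 := hrl (-l)
    rw [Complex.ofReal_neg] at h1
    rw [sFactor, h1, hrl, ← hd.factor_eq l hl, sFactor]
  · rw [hd.mem_realZeros, hrl]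
  · rw [hd.mem_boundStates]
    refine and_congr_right fun hκ => ?_
    rw [hr _ (by simpa using hκ.le)]

end InverseProblem

end NonlocalScattering

end

/-! ### The main theorem -/

open NonlocalScattering
theorem theorem5p2 (n : ℕ) (E : ℝ → L2 →L[ℂ] L2) (hE : IsResolutionOfIdentity L0 E)
    (α : Fin n → ℝ) (v : Fin n → L2) (hK : IsAdmissible α v) (hO : IsOrthogonalFamily E v) :
    -- the factors: reduction to the free resolvent, boundary values, Riemann problems, product
    (∀ (k : Fin n) (z : ℂ), z.im ≠ 0 →
      bFactor α v k z = 1 + (α k : ℂ) * inner ℂ (v k) (resolventApply L0 z (v k))) ∧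
    (∀ (k : Fin n) (l : ℝ),
      Tendsto (fun w : ℂ => bFactor α v k (w ^ 2)) (𝓝[upperSet] (l : ℂ)) (𝓝 (bUpper α v k l)) ∧
      Tendsto (fun w : ℂ => bFactor α v k (w ^ 2)) (𝓝[lowerSet] (l : ℂ)) (𝓝 (bLower α v k l))) ∧
    (∀ (k : Fin n) (l : ℝ), l ≠ 0 → sFactor α v k l * bUpper α v k l = bLower α v k l) ∧
    (∀ l : ℝ, l ≠ 0 → scattering α v l = ∏ k, sFactor α v k l) ∧
    -- the scattering data of a factor exist and are unique
    (∀ k : Fin n, (0 < α k ∨ bUpper α v k 0 ≠ 0) → ∃! d, IsScatteringData α v k d) ∧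
    -- the scattering data determine `|W_k|²` and `α_k`
    (∀ l : ℝ, l ≠ 0 → ∃ L, HasPV (fun t => Real.arctan (1 / t)) l L) ∧
    (∀ (k : Fin n) (d : ScatteringData), IsScatteringData α v k d →
      d.boundStates.card ≤ 1 ∧ (0 < α k → d.boundStates = ∅) ∧
      (∀ l : ℝ, l ≠ 0 → ∃ L, HasPV d.phase l L) ∧
      (∀ l : ℝ, l ≠ 0 → ‖W (v k) l‖ ^ 2 = 4 * l / α k * dataDensity d l) ∧
      IntegrableOn (fun l : ℝ => l * dataDensity d l) (Ioi 0) ∧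
      (‖v k‖ = 1 → α k = 2 / Real.pi * ∫ l in Ioi (0 : ℝ), l * dataDensity d l)) ∧
    -- all normalized solutions of the inverse problem
    (∀ d : Fin n → ScatteringData, (∀ k, IsScatteringData α v k (d k)) → (∀ k, ‖v k‖ = 1) →
      ∀ (β : Fin n → ℝ) (u : Fin n → L2), IsAdmissible β u → IsOrthogonalFamily E u →
        (∀ k, ‖u k‖ = 1) →
        ((∀ k, IsScatteringData β u k (d k)) ↔
          ∀ k, β k = α k ∧ ∀ l : ℝ, ‖W (u k) l‖ = ‖W (v k) l‖)) := by
  have hf := hK.decay'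
  have hne := exists_specDensity_ne_zero hK
  refine ⟨fun k z hz => ?_, fun k l => ⟨?_, ?_⟩, fun k l hl => sFactor_mul_bUpper hE hK hO k hl,
    fun l hl => scattering_eq_prod hE hK hO hl, fun k h => existsUnique_isScatteringData hE hK hO k h,
    fun l hl => ⟨_, hasPV_arctan hl⟩, fun k d hd => ⟨?_, fun hα => ?_, fun l hl => ?_,
      fun l hl => hd.norm_W_sq_eq hE hK hO hl, hd.integrableOn hE hK hO, hd.coupling_eq hE hK hO⟩,
    fun d hd hv β u hK' hO' hu => ⟨fun hd' k => ?_, fun h k => ?_⟩⟩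
  · rw [bFactor, resolventApply_partialOp hE hK hO k hz]
  · rw [bUpper_eq hE hK hO k (by simp)]
    exact tendsto_bFactor_upper hE hK hO k (by simp)
  · rw [bLower_eq hE hK hO k (by simp)]
    exact tendsto_bFactor_lower hE hK hO k (by simp)
  · refine Finset.card_le_one.2 fun κ hκ κ' hκ' => ?_
    rw [hd.mem_boundStates' hE hK hO] at hκ hκ'
    exact bVal_I_zero_unique (hf k) (hK.ne_zero k) (hne k) hκ.1 hκ'.1 hκ.2 hκ'.2
  · refine Finset.eq_empty_of_forall_notMem fun κ hκ => ?_
    rw [hd.mem_boundStates' hE hK hO] at hκ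
    exact bVal_I_ne_zero_of_pos (hf k) hα hκ.1 hκ.2
  · obtain ⟨r, hr⟩ := hd.exists_integrable_pvIntegrand hE hK hO hl
    exact ⟨_, hasPV_of_integrable hr⟩
  -- Both couplings equal the same integral of the common data; once they agree, the density formula
  -- identifies the two moduli.
  · have hβ : β k = α k := by
      rw [(hd' k).coupling_eq hE hK' hO' (hu k), (hd k).coupling_eq hE hK hO (hv k)]
    refine ⟨hβ, fun l => ?_⟩
    rcases eq_or_ne l 0 with rfl | hl
    · simp [W]
    · have h1 := (hd' k).norm_W_sq_eq hE hK' hO' hl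
      rw [hβ, ← (hd k).norm_W_sq_eq hE hK hO hl] at h1
      exact (sq_eq_sq₀ (norm_nonneg _) (norm_nonneg _)).1 h1
  · exact (hd k).congr hE hK hO hK' hO' (h k).1 (h k).2
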